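/- Let $G$ be a finite simple graph with vertex set $V(G)$ and edge set $E(G)$, and let $\mathcal G$ be a finite abelian group. For an edge labelling $f:E(G)\to\mathcal G$ define the weighted degree of a vertex $v$ by $w(v)=\sum_{e\ni v}f(e)$; $f$ is called $\mathcal G$-irregular if $w(u)\neq w(v)$ for all $u\neq v$ in $V(G)$. The problem Irregular Labeling is the following. An instance consists of a connected simple graph $G$ with vertices $0,\dots,n-1$ $(n\ge 1)$, given by $n$ and a list of its edges (each edge once, in any order, as a pair of its ends in either order), and a finite list of prime powers $d_1,\dots,d_k\ge 2$ (possibly empty, not necessarily distinct), which describes the abelian group $\mathcal G=\mathbb Z_{d_1}\times\dots\times\mathbb Z_{d_k}$. The task is to output a $\mathcal G$-irregular labelling of $G$, or to report correctly that none exists. An output labelling lists the labels of the edges in the order of the input, a group element $(g_1,\dots,g_k)$ with $0\le g_j<d_j$ being written as the single number $\sum_{j=1}^{k} g_j\,d_1\cdots d_{j-1}\in\{0,\dots,|\mathcal G|-1\}$. The machine is a word RAM whose cells are initially $0$ except for the input. In unit time it reads a constant, a register or an array cell at a computed index, writes a word, carries out an addition, a truncated subtraction, a multiplication, an integer division with quotient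 or remainder, or a comparison of two words, or branches on whether a word is zero. All constants, indices and computed values must be smaller than the word bound $W$. **Corollary 4.2.** Irregular Labeling can be solved in time $O(|E(G)|+|\mathcal G|)$. That is, there are a single word RAM program $P$ and constants $C,c\in\mathbb N$ such that, for every instance $(G;d_1,\dots,d_k)$ and every word bound $W\ge C\,(|E(G)|+|\mathcal G|)^c$, the program $P$ halts on this instance after at most $C\,(|E(G)|+|\mathcal G|)$ steps, computes no value that is not less than $W$, and solves the instance. -/

import Mathlib

namespace IrregularLabeling

/-! ### Labellings -/

open Classical in
/-- The weighted degree `w(v)`: the sum of the labels of the edges that contain `v`. -/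
noncomputable def weight {V A : Type*} [Fintype V] [AddCommGroup A] (G : SimpleGraph V)
    (f : G.edgeSet → A) (v : V) : A :=
  ∑ e : G.edgeSet, if v ∈ (e : Sym2 V) then f e else 0

/-- An edge labelling is irregular if the weighted degrees of distinct vertices are distinct. -/
def IsIrregular {V A : Type*} [Fintype V] [AddCommGroup A] (G : SimpleGraph V)
    (f : G.edgeSet → A) : Prop :=
  Function.Injective (weight G f)

/-- The abelian group `ℤ/d₁ × ⋯ × ℤ/dₖ` given by the list `[d₁, …, dₖ]`. -/
abbrev CyclicProduct (ds : List ℕ) : Type :=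
  ∀ i : Fin ds.length, ZMod (ds.get i)

/-- The one-word name of a group element `(g₁, …, gₖ)`, `0 ≤ gⱼ < dⱼ`: its position in mixed radix,
`g₁ + g₂ d₁ + g₃ d₁ d₂ + ⋯`, a number below `d₁ ⋯ dₖ`. -/
def code (ds : List ℕ) (g : CyclicProduct ds) : ℕ :=
  ∑ i : Fin ds.length, (g i).val * (ds.take i).prod

/-- `edges` lists every edge of `G` exactly once, in any order, each by its two ends in either
order. -/
def IsEdgeList {n : ℕ} (G : SimpleGraph (Fin n)) (edges : List (Fin n × Fin n)) : Prop :=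
  (edges.map fun p => s(p.1, p.2)).Nodup ∧
    ∀ e : Sym2 (Fin n), e ∈ edges.map (fun p => s(p.1, p.2)) ↔ e ∈ G.edgeSet

/-! ### A word RAM, programmed in structured form -/

/-- The memory: numbered registers and numbered arrays of cells. A program mentions finitely many of
them. -/
structure Store where
  reg : ℕ → ℕ
  arr : ℕ → ℕ → ℕ

/-- The store after writing `z` to register `x`. -/
def Store.setReg (s : Store) (x z : ℕ) : Store :=
  { s with reg := Function.update s.reg x z }

/-- The store after writing `z` to cell `i` of array `a`. -/
def Store.setCell (s : Store) (a i z : ℕ) : Store :=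
  { s with arr := Function.update s.arr a (Function.update (s.arr a) i z) }

/-- The arithmetic and comparison instructions of the machine. -/
inductive Op where
  | add | sub | mul | div | mod | lt | eq

/-- Subtraction is cut off at `0`, `x / 0 = 0`, `x % 0 = x`; comparisons return `1` or `0`. -/
def Op.val : Op → ℕ → ℕ → ℕ
  | .add, x, y => x + y
  | .sub, x, y => x - y
  | .mul, x, y => x * y
  | .div, x, y => x / y
  | .mod, x, y => x % y
  | .lt, x, y => if x < y then 1 else 0
  | .eq, x, y => if x = y then 1 else 0

/-- Expressions: constants, registers, array cells at a computed index, and operations. -/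
inductive Expr where
  | const (z : ℕ)
  | reg (x : ℕ)
  | cell (a : ℕ) (i : Expr)
  | op (o : Op) (e₁ e₂ : Expr)

/-- The value of an expression. -/
def Expr.val (s : Store) : Expr → ℕ
  | .const z => z
  | .reg x => s.reg x
  | .cell a i => s.arr a (i.val s)
  | .op o e₁ e₂ => o.val (e₁.val s) (e₂.val s)

/-- Every value that occurs while the expression is evaluated fits into a machine word, that is, is
less than `W`. -/
def Expr.Fits (W : ℕ) (s : Store) : Expr → Prop
  | .const z => z < W
  | .reg x => s.reg x < W
  | .cell a i => i.Fits W s ∧ s.arr a (i.val s) < W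
  | .op o e₁ e₂ => e₁.Fits W s ∧ e₂.Fits W s ∧ o.val (e₁.val s) (e₂.val s) < W

/-- The number of unit-time instructions spent on evaluating an expression. -/
def Expr.cost : Expr → ℕ
  | .const _ => 1
  | .reg _ => 1
  | .cell _ i => i.cost + 1
  | .op _ e₁ e₂ => e₁.cost + e₂.cost + 1

/-- Programs. A condition holds if its value is not `0`. -/
inductive Prog where
  | skip
  | assign (x : ℕ) (e : Expr)
  | store (a : ℕ) (i e : Expr)
  | seq (p q : Prog)
  | ite (e : Expr) (p q : Prog)
  | while (e : Expr) (p : Prog)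

/-- `Run W p s t s'`: on a machine whose words hold the numbers below `W`, the program `p` started
in store `s` halts after exactly `t` unit-time steps, in store `s'`. A program that would produce
a value not less than `W` has no run. -/
inductive Run (W : ℕ) : Prog → Store → ℕ → Store → Prop
  | skip (s : Store) : Run W .skip s 1 s
  | assign (x : ℕ) (e : Expr) (s : Store) (he : e.Fits W s) :
      Run W (.assign x e) s (e.cost + 1) (s.setReg x (e.val s))
  | store (a : ℕ) (i e : Expr) (s : Store) (hi : i.Fits W s) (he : e.Fits W s) :
      Run W (.store a i e) s (i.cost + e.cost + 1) (s.setCell a (i.val s) (e.val s))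
  | seq (p q : Prog) (s s' s'' : Store) (t t' : ℕ)
      (hp : Run W p s t s') (hq : Run W q s' t' s'') :
      Run W (.seq p q) s (t + t') s''
  | ite_true (e : Expr) (p q : Prog) (s s' : Store) (t : ℕ) (he : e.Fits W s)
      (h : e.val s ≠ 0) (hp : Run W p s t s') :
      Run W (.ite e p q) s (e.cost + 1 + t) s'
  | ite_false (e : Expr) (p q : Prog) (s s' : Store) (t : ℕ) (he : e.Fits W s)
      (h : e.val s = 0) (hq : Run W q s t s') :
      Run W (.ite e p q) s (e.cost + 1 + t) s'
  | while_true (e : Expr) (p : Prog) (s s' s'' : Store) (t t' : ℕ) (he : e.Fits W s)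
      (h : e.val s ≠ 0) (hp : Run W p s t s') (hw : Run W (.while e p) s' t' s'') :
      Run W (.while e p) s (e.cost + 1 + t + t') s''
  | while_false (e : Expr) (p : Prog) (s : Store) (he : e.Fits W s) (h : e.val s = 0) :
      Run W (.while e p) s (e.cost + 1) s

/-! ### The problem -/

/-- The input. Registers `0`, `1`, `2` hold the numbers of vertices, of edges and of cyclic factors;
arrays `0` and `1` hold the two ends of each edge and array `2` the orders of the cyclic factors.
The rest of the memory is `0`. -/
def input (n : ℕ) (edges : List (Fin n × Fin n)) (orders : List ℕ) : Store where
  reg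
    | 0 => n
    | 1 => edges.length
    | 2 => orders.length
    | _ => 0
  arr
    | 0 => fun i => (edges.map fun p => (p.1 : ℕ)).getD i 0
    | 1 => fun i => (edges.map fun p => (p.2 : ℕ)).getD i 0
    | 2 => fun i => orders.getD i 0
    | _ => fun _ => 0

/-- The final store `s` solves the instance: either register `0` holds `1` and array `3` holds, edge
by edge in the order of the input, the labels of an irregular labelling; or register `0` holds `0`
and there is no irregular labelling. -/
def IsAnswer {n : ℕ} (G : SimpleGraph (Fin n)) (edges : List (Fin n × Fin n)) (orders : List ℕ)
    (s : Store) : Prop :=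
  (s.reg 0 = 1 ∧ ∃ f : G.edgeSet → CyclicProduct orders, IsIrregular G f ∧
      ∀ (i : Fin edges.length) (e : G.edgeSet),
        (e : Sym2 (Fin n)) = s((edges.get i).1, (edges.get i).2) →
          s.arr 3 i = code orders (f e)) ∨
    (s.reg 0 = 0 ∧ ¬ ∃ f : G.edgeSet → CyclicProduct orders, IsIrregular G f)

end IrregularLabeling

/-! Fix a spanning tree of the graph, label all other edges by 0, and prescribe distinct weights for
the vertices. From the leaves to the root, the label of each tree edge is forced: it is what the
weight of its lower end still lacks. Only the condition at the root remains. As child and parent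
have opposite colours in the two-colouring of the tree, this condition says that the prescribed
weights of the two colour classes have equal sums (`sum_label`). So it suffices to choose distinct
group elements, a of them for one class and b for the other, with equal sums, where a + b = n.

Obstructions. The weights of any labelling add up to F + F, where F is the sum of the labels. If n
is the order N of the group and N is 2 mod 4, this sum is the only involution, which is not a double
(`not_irregular_full`). In an elementary 2-group with n = N - 2 ≥ 3, the two unused elements would
have sum 0 and coincide (`not_irregular_twos`). In an elementary 3-group with n = N - 1, the centre
of a star would get the one unused element as its weight (`not_irregular_star`). The cases n > N and
n = 2 are immediate. All other instances have a solution.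

Choice of the weights. A few elements are chosen by hand so that the sums agree and each class
misses an even number of elements. Then pairs x, -x are put into one class or the other, which
changes no sum (`Sel.complete_pairs`). Elements with x = -x form no such pair. At most one of them
besides 0 is easily handled; if there are more, two involutions α, β generate a Klein four-group,
and cosets of it are used first: a coset of self-inverse elements splits into two pairs of sum α
each, and α = -α, so the equality survives whichever classes receive the pairs
(`Sel.complete_cosets`). Greedy choice succeeds by counting: it fails only if more elements are
wasted than the N - n that can be spared. The initial choices (`Sel.odd_one` to `Sel.many_six_odd`)
are designed to waste few enough elements in every remaining case. One case depends on the tree: for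
elementary 3-groups with n = N - 1 both classes need two vertices. If the spanning tree is a star
but the graph is not, an edge between two leaves allows one leaf to be hung below the other
(`Tree.reparent`).

Time. Breadth-first search yields the tree in time O(n + m), where m is the number of edges, and n ≤
m + 1. The choice of the weights runs through the group a bounded number of times, so subtraction of
codes must take constant time although the number of factors is unbounded. For this the list of
orders is cut into an initial part, one factor and a final part such that both parts have product at
most √N; then subtraction tables for the two parts have at most N entries, and the single factor is
handled by arithmetic (`tables_does`, `EvalTo.subE`). -/

namespace IrregularLabeling

/-! ### Symbolic execution with time bounds -/

/-- All memory contents are machine words. -/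
structure Store.Bounded (W : ℕ) (s : Store) : Prop where
  reg : ∀ x, s.reg x < W
  arr : ∀ a i, s.arr a i < W

/-- The part of `Expr.Fits` that is not automatic in a bounded store. -/
def Op.Safe (W : ℕ) : Op → ℕ → ℕ → Prop
  | .add, x, y => x + y < W
  | .mul, x, y => x * y < W
  | _, _, _ => True

/-- The part of `Expr.Fits` that is not automatic in a bounded store. -/
def Expr.Safe (W : ℕ) (s : Store) : Expr → Prop
  | .const z => z < W
  | .reg _ => True
  | .cell _ i => i.Safe W s
  | .op o e₁ e₂ => e₁.Safe W s ∧ e₂.Safe W s ∧ o.Safe W (e₁.val s) (e₂.val s)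

instance : Add Expr := ⟨Expr.op .add⟩
instance : Sub Expr := ⟨Expr.op .sub⟩
instance : Mul Expr := ⟨Expr.op .mul⟩
instance : Div Expr := ⟨Expr.op .div⟩
instance : Mod Expr := ⟨Expr.op .mod⟩
instance (k : ℕ) : OfNat Expr k := ⟨Expr.const k⟩

infix:50 " <ₑ " => Expr.op Op.lt
infix:50 " =ₑ " => Expr.op Op.eq
prefix:max "#" => Expr.reg
infixr:40 " ;; " => Prog.seq

/-! ### Evaluation and safety of expressions -/

section simpLemmas
variable (W : ℕ) (s : Store) (e₁ e₂ : Expr) (k : ℕ)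

@[simp] theorem Expr.val_add : (e₁ + e₂).val s = e₁.val s + e₂.val s := rfl
@[simp] theorem Expr.val_sub : (e₁ - e₂).val s = e₁.val s - e₂.val s := rfl
@[simp] theorem Expr.val_mul : (e₁ * e₂).val s = e₁.val s * e₂.val s := rfl
@[simp] theorem Expr.val_div : (e₁ / e₂).val s = e₁.val s / e₂.val s := rfl
@[simp] theorem Expr.val_mod : (e₁ % e₂).val s = e₁.val s % e₂.val s := rfl
@[simp] theorem Expr.val_lt :
    (e₁ <ₑ e₂).val s = if e₁.val s < e₂.val s then 1 else 0 := rfl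
@[simp] theorem Expr.val_eq :
    (e₁ =ₑ e₂).val s = if e₁.val s = e₂.val s then 1 else 0 := rfl
@[simp] theorem Expr.val_zero : (0 : Expr).val s = 0 := rfl
@[simp] theorem Expr.val_one : (1 : Expr).val s = 1 := rfl
@[simp] theorem Expr.val_ofNat : (ofNat(k) : Expr).val s = OfNat.ofNat k := rfl
@[simp] theorem Expr.val_reg (x : ℕ) : (#x).val s = s.reg x := rfl
@[simp] theorem Expr.val_cell (a : ℕ) (i : Expr) : (Expr.cell a i).val s = s.arr a (i.val s) := rfl

@[simp] theorem Expr.safe_add : (e₁ + e₂).Safe W s ↔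
    e₁.Safe W s ∧ e₂.Safe W s ∧ e₁.val s + e₂.val s < W := Iff.rfl
@[simp] theorem Expr.safe_mul : (e₁ * e₂).Safe W s ↔
    e₁.Safe W s ∧ e₂.Safe W s ∧ e₁.val s * e₂.val s < W := Iff.rfl
@[simp] theorem Expr.safe_sub : (e₁ - e₂).Safe W s ↔ e₁.Safe W s ∧ e₂.Safe W s := by
  change (_ ∧ _ ∧ True) ↔ _; simp
@[simp] theorem Expr.safe_div : (e₁ / e₂).Safe W s ↔ e₁.Safe W s ∧ e₂.Safe W s := by
  change (_ ∧ _ ∧ True) ↔ _; simp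
@[simp] theorem Expr.safe_mod : (e₁ % e₂).Safe W s ↔ e₁.Safe W s ∧ e₂.Safe W s := by
  change (_ ∧ _ ∧ True) ↔ _; simp
@[simp] theorem Expr.safe_lt : (e₁ <ₑ e₂).Safe W s ↔ e₁.Safe W s ∧ e₂.Safe W s := by
  change (_ ∧ _ ∧ True) ↔ _; simp
@[simp] theorem Expr.safe_eq : (e₁ =ₑ e₂).Safe W s ↔ e₁.Safe W s ∧ e₂.Safe W s := by
  change (_ ∧ _ ∧ True) ↔ _; simp
@[simp] theorem Expr.safe_zero : (0 : Expr).Safe W s ↔ 0 < W := Iff.rfl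
@[simp] theorem Expr.safe_one : (1 : Expr).Safe W s ↔ 1 < W := Iff.rfl
@[simp] theorem Expr.safe_ofNat : (ofNat(k) : Expr).Safe W s ↔ OfNat.ofNat k < W := Iff.rfl
@[simp] theorem Expr.safe_reg (x : ℕ) : (#x).Safe W s := trivial
@[simp] theorem Expr.safe_cell (a : ℕ) (i : Expr) :
    (Expr.cell a i).Safe W s ↔ i.Safe W s := Iff.rfl

end simpLemmas

section store
variable (s : Store) (x y z a b i : ℕ)

@[simp] theorem Store.setReg_reg : (s.setReg x z).reg y = if y = x then z else s.reg y := by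
  simp [Store.setReg, Function.update_apply]
@[simp] theorem Store.setReg_arr : (s.setReg x z).arr = s.arr := rfl
@[simp] theorem Store.setCell_reg : (s.setCell a i z).reg = s.reg := rfl
@[simp] theorem Store.setCell_arr : (s.setCell a i z).arr b =
    if b = a then Function.update (s.arr a) i z else s.arr b := by
  simp only [Store.setCell, Function.update_apply]

end store

theorem Op.val_lt_of_safe {W : ℕ} (o : Op) {x y : ℕ} (hW : 1 < W) (hx : x < W)
    (h : o.Safe W x y) : o.val x y < W := by
  cases o
  · exact h
  · exact lt_of_le_of_lt (Nat.sub_le _ _) hx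
  · exact h
  · exact lt_of_le_of_lt (Nat.div_le_self _ _) hx
  · exact lt_of_le_of_lt (Nat.mod_le _ _) hx
  · simp only [Op.val]; split <;> omega
  · simp only [Op.val]; split <;> omega

/-- Differences, quotients and remainders never exceed their first operand and comparisons are at
most 1, so in a bounded store only constants, sums and products need a check. -/
theorem Expr.fits_of_safe {W : ℕ} {s : Store} (hW : 1 < W) (hs : s.Bounded W) (e : Expr)
    (h : e.Safe W s) : e.Fits W s ∧ e.val s < W := by
  induction e with
  | const z => exact ⟨h, h⟩
  | reg x => exact ⟨hs.reg x, hs.reg x⟩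
  | cell a i ih => exact ⟨⟨(ih h).1, hs.arr _ _⟩, hs.arr _ _⟩
  | op o e₁ e₂ ih₁ ih₂ =>
    have h₁ := ih₁ h.1
    have h₂ := ih₂ h.2.1
    have h₃ := o.val_lt_of_safe hW h₁.2 h.2.2
    exact ⟨⟨h₁.1, h₂.1, h₃⟩, h₃⟩

theorem Store.Bounded.setReg {W : ℕ} {s : Store} (hs : s.Bounded W) {x z : ℕ} (hz : z < W) :
    (s.setReg x z).Bounded W := by
  refine ⟨fun y => ?_, hs.arr⟩
  rw [Store.setReg_reg]; split
  · exact hz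
  · exact hs.reg y

theorem Store.Bounded.setCell {W : ℕ} {s : Store} (hs : s.Bounded W) {a i z : ℕ} (hz : z < W) :
    (s.setCell a i z).Bounded W := by
  refine ⟨hs.reg, fun b j => ?_⟩
  rw [Store.setCell_arr]; split
  · rw [Function.update_apply]; split
    · exact hz
    · exact hs.arr _ _
  · exact hs.arr _ _

/-- The effect of a program without loops. -/
def Prog.exec : Prog → Store → Store
  | .skip, s => s
  | .assign x e, s => s.setReg x (e.val s)
  | .store a i e, s => s.setCell a (i.val s) (e.val s)
  | .seq p q, s => q.exec (p.exec s)
  | .ite e p q, s => if e.val s = 0 then q.exec s else p.exec s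
  | .while _ _, s => s

/-- The program has no loop, and no sum or product that it forms is too large. -/
def Prog.Ok (W : ℕ) : Prog → Store → Prop
  | .skip, _ => True
  | .assign _ e, s => e.Safe W s
  | .store _ i e, s => i.Safe W s ∧ e.Safe W s
  | .seq p q, s => p.Ok W s ∧ q.Ok W (p.exec s)
  | .ite e p q, s => e.Safe W s ∧ if e.val s = 0 then q.Ok W s else p.Ok W s
  | .while _ _, _ => False

/-- A bound for the running time of a program without loops. -/
def Prog.time : Prog → ℕ
  | .skip => 1
  | .assign _ e => e.cost + 1
  | .store _ i e => i.cost + e.cost + 1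
  | .seq p q => p.time + q.time
  | .ite e p q => e.cost + 1 + (p.time + q.time)
  | .while _ _ => 0

/-- The registers that a program may change. -/
def Prog.wregs : Prog → List ℕ
  | .skip => []
  | .assign x _ => [x]
  | .store _ _ _ => []
  | .seq p q => p.wregs ++ q.wregs
  | .ite _ p q => p.wregs ++ q.wregs
  | .while _ p => p.wregs

/-- The arrays that a program may change. -/
def Prog.warrs : Prog → List ℕ
  | .skip => []
  | .assign _ _ => []
  | .store a _ _ => [a]
  | .seq p q => p.warrs ++ q.warrs
  | .ite _ p q => p.warrs ++ q.warrs
  | .while _ p => p.warrs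

/-- The stores agree on everything that the program does not change. -/
structure Agree (p : Prog) (s s' : Store) : Prop where
  reg : ∀ x, x ∉ p.wregs → s'.reg x = s.reg x
  arr : ∀ a, a ∉ p.warrs → s'.arr a = s.arr a

theorem Agree.refl (p : Prog) (s : Store) : Agree p s s := ⟨fun _ _ => rfl, fun _ _ => rfl⟩

theorem Agree.trans {p : Prog} {s s' s'' : Store} (h : Agree p s s') (h' : Agree p s' s'') :
    Agree p s s'' :=
  ⟨fun x hx => (h'.reg x hx).trans (h.reg x hx), fun a ha => (h'.arr a ha).trans (h.arr a ha)⟩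

theorem Agree.mono {p q : Prog} {s s' : Store} (h : Agree p s s')
    (hr : ∀ x ∈ p.wregs, x ∈ q.wregs) (ha : ∀ x ∈ p.warrs, x ∈ q.warrs) : Agree q s s' :=
  ⟨fun x hx => h.reg x fun h => hx (hr x h), fun a h' => h.arr a fun h => h' (ha a h)⟩

/-- Frame property. The lists `wregs` and `warrs` are computed from the program text, so that later
proofs transport the untouched part of the memory by `decide`. -/
theorem Run.agree {W : ℕ} {p : Prog} {s s' : Store} {t : ℕ} (h : Run W p s t s') :
    Agree p s s' := by
  induction h with
  | skip s => exact Agree.refl _ _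
  | assign x e s he =>
    refine ⟨fun y hy => ?_, fun a _ => rfl⟩
    rw [Store.setReg_reg, if_neg]; simpa [Prog.wregs] using hy
  | store a i e s hi he =>
    refine ⟨fun y hy => rfl, fun b hb => ?_⟩
    rw [Store.setCell_arr, if_neg]; simpa [Prog.warrs] using hb
  | seq p q s s' s'' t t' hp hq ihp ihq =>
    exact (ihp.mono (fun x hx => List.mem_append_left _ hx)
      (fun x hx => List.mem_append_left _ hx)).trans
      (ihq.mono (fun x hx => List.mem_append_right _ hx) (fun x hx => List.mem_append_right _ hx))
  | ite_true e p q s s' t he h hp ih =>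
    exact ih.mono (fun x hx => List.mem_append_left _ hx) (fun x hx => List.mem_append_left _ hx)
  | ite_false e p q s s' t he h hp ih =>
    exact ih.mono (fun x hx => List.mem_append_right _ hx) (fun x hx => List.mem_append_right _ hx)
  | while_true e p s s' s'' t t' he h hp hw ihp ihw =>
    exact (ihp.mono (q := .while e p) (fun x hx => hx) (fun x hx => hx)).trans ihw
  | while_false e p s he h => exact Agree.refl _ _

/-- From the store `s`, the program halts within `T` steps in a bounded store with property `Q`. -/
def Does (W : ℕ) (p : Prog) (T : ℕ) (s : Store) (Q : Store → Prop) : Prop :=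
  ∃ t s', Run W p s t s' ∧ t ≤ T ∧ s'.Bounded W ∧ Agree p s s' ∧ Q s'

theorem Does.mono {W : ℕ} {p : Prog} {T T' : ℕ} {s : Store} {Q Q' : Store → Prop}
    (h : Does W p T s Q) (hT : T ≤ T') (hQ : ∀ s', s'.Bounded W → Agree p s s' → Q s' → Q' s') :
    Does W p T' s Q' := by
  obtain ⟨t, s', h₁, h₂, h₃, h₄, h₅⟩ := h
  exact ⟨t, s', h₁, h₂.trans hT, h₃, h₄, hQ s' h₃ h₄ h₅⟩

theorem Does.seq {W : ℕ} {p q : Prog} {T T' : ℕ} {s : Store} {Q Q' : Store → Prop}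
    (h : Does W p T s Q)
    (h' : ∀ s', s'.Bounded W → Agree p s s' → Q s' → Does W q T' s' Q') :
    Does W (p ;; q) (T + T') s Q' := by
  obtain ⟨t, s', h₁, h₂, h₃, h₄, h₅⟩ := h
  obtain ⟨t', s'', h₁', h₂', h₃', h₄', h₅'⟩ := h' s' h₃ h₄ h₅
  have hr := Run.seq _ _ _ _ _ _ _ h₁ h₁'
  exact ⟨t + t', s'', hr, by omega, h₃', hr.agree, h₅'⟩

theorem Does.ite {W : ℕ} {e : Expr} {p q : Prog} {T : ℕ} {s : Store} {Q : Store → Prop}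
    (hW : 1 < W) (hs : s.Bounded W) (he : e.Safe W s)
    (hp : e.val s ≠ 0 → Does W p T s Q) (hq : e.val s = 0 → Does W q T s Q) :
    Does W (.ite e p q) (e.cost + 1 + T) s Q := by
  have hf := (e.fits_of_safe hW hs he).1
  by_cases h : e.val s = 0
  · obtain ⟨t, s', h₁, h₂, h₃, h₄, h₅⟩ := hq h
    have hr := Run.ite_false e p q s s' t hf h h₁
    exact ⟨_, s', hr, by omega, h₃, hr.agree, h₅⟩
  · obtain ⟨t, s', h₁, h₂, h₃, h₄, h₅⟩ := hp h
    have hr := Run.ite_true e p q s s' t hf h h₁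
    exact ⟨_, s', hr, by omega, h₃, hr.agree, h₅⟩

theorem Does.exec {W : ℕ} (hW : 1 < W) (p : Prog) {s : Store} (hs : s.Bounded W)
    (h : p.Ok W s) : Does W p p.time s (fun s' => s' = p.exec s) := by
  induction p generalizing s with
  | skip => exact ⟨_, _, .skip s, le_rfl, hs, Agree.refl _ _, rfl⟩
  | assign x e =>
    have hf := e.fits_of_safe hW hs h
    have hr := Run.assign x e s hf.1
    exact ⟨_, _, hr, le_rfl, hs.setReg hf.2, hr.agree, rfl⟩
  | store a i e =>
    have hi := i.fits_of_safe hW hs h.1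
    have hf := e.fits_of_safe hW hs h.2
    have hr := Run.store a i e s hi.1 hf.1
    exact ⟨_, _, hr, le_rfl, hs.setCell hf.2, hr.agree, rfl⟩
  | seq p q ihp ihq =>
    refine (ihp hs h.1).seq fun _ hs' _ e => ?_
    subst e
    exact ihq hs' h.2
  | ite e p q ihp ihq =>
    refine Does.ite hW hs h.1 (fun he => ?_) (fun he => ?_)
    · have h2 := h.2; rw [if_neg he] at h2
      refine (ihp hs h2).mono (by omega) fun s' _ _ e => ?_
      rw [e, Prog.exec, if_neg he]
    · have h2 := h.2; rw [if_pos he] at h2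
      refine (ihq hs h2).mono (by omega) fun s' _ _ e => ?_
      rw [e, Prog.exec, if_pos he]
  | _ => exact h.elim

theorem Does.of_exec {W : ℕ} (hW : 1 < W) {p : Prog} {s : Store} (hs : s.Bounded W)
    {Q : Store → Prop} (h : p.Ok W s) (hQ : Q (p.exec s)) : Does W p p.time s Q :=
  (Does.exec hW p hs h).mono le_rfl fun _ _ _ e => e ▸ hQ

/-- The function Φ is a potential: the cost of the test and the body of each round is paid by the
decrease of Φ. This gives amortized bounds for loops whose rounds differ much in cost, such as the
growth of the tables, or whose number of rounds is not known in advance, such as the search. -/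
theorem Does.while {W : ℕ} (hW : 1 < W) {e : Expr} {p : Prog} (I : Store → Prop) (Φ : Store → ℕ)
    {s : Store} (hs : s.Bounded W) (h0 : I s)
    (step : ∀ s', s'.Bounded W → Agree p s s' → I s' → e.Safe W s' ∧ (e.val s' ≠ 0 →
      ∃ T, Does W p T s' (fun s'' => I s'' ∧ T + e.cost + 1 + Φ s'' ≤ Φ s'))) :
    Does W (.while e p) (Φ s + e.cost + 1) s (fun s' => I s' ∧ e.val s' = 0) := by
  suffices H : ∀ k, ∀ s', Φ s' ≤ k → s'.Bounded W → Agree p s s' → I s' →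
      Does W (.while e p) (Φ s' + e.cost + 1) s' (fun s' => I s' ∧ e.val s' = 0) from
    H _ s le_rfl hs (Agree.refl _ _) h0
  intro k
  induction k with
  | zero =>
    intro s' hk hs' ha hI
    obtain ⟨h1, h2⟩ := step s' hs' ha hI
    have hf := (e.fits_of_safe hW hs' h1).1
    by_cases h : e.val s' = 0
    · have hr := Run.while_false e p s' hf h
      exact ⟨_, _, hr, by omega, hs', hr.agree, hI, h⟩
    · obtain ⟨T, t, s'', _, _, _, _, _, h6⟩ := h2 h
      omega
  | succ k ih =>
    intro s' hk hs' ha hI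
    obtain ⟨h1, h2⟩ := step s' hs' ha hI
    have hf := (e.fits_of_safe hW hs' h1).1
    by_cases h : e.val s' = 0
    · have hr := Run.while_false e p s' hf h
      exact ⟨_, _, hr, by omega, hs', hr.agree, hI, h⟩
    · obtain ⟨T, t, s'', r1, r2, r3, r4, r5, r6⟩ := h2 h
      obtain ⟨t', s3, q1, q2, q3, q4, q5⟩ := ih s'' (by omega) r3 (ha.trans r4) r5
      have hr := Run.while_true e p s' s'' s3 t t' hf h r1 q1
      exact ⟨_, _, hr, by omega, q3, hr.agree, q5⟩

/-- The loop in which register `i` runs from `0` to the content of register `b`. -/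
def forUp (i b : ℕ) (p : Prog) : Prog :=
  .assign i 0 ;; .while (#i <ₑ #b) (p ;; .assign i (#i + 1))

/-- A round costs 4 for the test and 4 for the increment besides its body; the remaining 6 steps are
the initialization and the last, failing test. -/
theorem Does.forUp {W : ℕ} {i b : ℕ} {p : Prog} {s : Store} (J : ℕ → Store → Prop) {N c : ℕ}
    (hW : 1 < W) (hs : s.Bounded W) (hb : s.reg b = N) (hib : i ≠ b) (hi : i ∉ p.wregs)
    (hbp : b ∉ p.wregs) (h0 : J 0 (s.setReg i 0))
    (step : ∀ k s', k < N → s'.Bounded W → Agree (forUp i b p) s s' → s'.reg i = k → J k s' →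
      Does W p c s' (fun s'' => J (k + 1) (s''.setReg i (k + 1)))) :
    Does W (IrregularLabeling.forUp i b p) (N * (c + 8) + 6) s (J N) := by
  have h1 : Does W (.assign i 0) 2 s (fun s' => s' = s.setReg i 0) :=
    Does.exec (p := .assign i 0) hW hs (by simp [Prog.Ok]; omega)
  refine Does.mono (h1.seq (T' := N * (c + 8) + 4) (Q' := J N) ?_) (by omega) fun _ _ _ h => h
  intro s1 hs1 ha1 e1
  subst e1
  set s1 := s.setReg i 0
  have key := Does.while (W := W) hW (e := #i <ₑ #b) (p := p ;; .assign i (#i + 1))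
    (fun s' => s'.reg i ≤ N ∧ J (s'.reg i) s') (fun s' => (N - s'.reg i) * (c + 8)) (s := s1) hs1
    (by simp [s1]; exact h0) ?_
  · refine key.mono ?_ ?_
    · simp [s1, Expr.cost]
    · intro s' hs' ha ⟨⟨hle, hJ⟩, hv⟩
      have hb' : s'.reg b = N := by
        rw [ha.reg b]
        · simp [s1, hib.symm, hb]
        · simp [Prog.wregs, hbp, hib.symm]
      simp [hb'] at hv
      have : s'.reg i = N := le_antisymm hle hv
      rwa [this] at hJ
  · intro s' hs' ha ⟨hle, hJ⟩
    have hb' : s'.reg b = N := by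
      rw [ha.reg b]
      · simp [s1, hib.symm, hb]
      · simp [Prog.wregs, hbp, hib.symm]
    refine ⟨by simp, fun hv => ?_⟩
    simp [hb'] at hv
    have hag : Agree (IrregularLabeling.forUp i b p) s s' := by
      refine (ha1.mono ?_ ?_).trans (ha.mono ?_ ?_) <;>
        simp [IrregularLabeling.forUp, Prog.wregs, Prog.warrs] <;> tauto
    have hstep := step _ s' hv hs' hag rfl hJ
    refine ⟨c + 4, Does.seq hstep (T' := 4) ?_⟩
    intro s2 hs2 ha2 h2
    have hi2 : s2.reg i = s'.reg i := ha2.reg i hi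
    have hbW : N < W := by rw [← hb]; exact hs.reg b
    refine (Does.exec (p := .assign i (#i + 1)) hW hs2 ?_).mono
      (le_rfl) ?_
    · simp [Prog.Ok, hi2]; omega
    · intro s3 hs3 ha3 e3
      rw [e3]
      simp only [Prog.exec, Expr.val_add, Expr.val_reg, Expr.val_one, hi2, Store.setReg_reg, if_true]
      refine ⟨⟨by omega, h2⟩, ?_⟩
      have : N - s'.reg i = (N - (s'.reg i + 1)) + 1 := by omega
      rw [this, Nat.add_mul, Nat.one_mul]
      have : (#i <ₑ #b).cost = 3 := rfl
      omega

/-- Evaluating an expression depends only on what it reads. -/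
def Expr.rregs : Expr → List ℕ
  | .const _ => []
  | .reg x => [x]
  | .cell _ i => i.rregs
  | .op _ e₁ e₂ => e₁.rregs ++ e₂.rregs

/-- The arrays that an expression reads. -/
def Expr.rarrs : Expr → List ℕ
  | .const _ => []
  | .reg _ => []
  | .cell a i => a :: i.rarrs
  | .op _ e₁ e₂ => e₁.rarrs ++ e₂.rarrs

theorem Expr.congr {W : ℕ} {s s' : Store} (e : Expr) (hr : ∀ x ∈ e.rregs, s'.reg x = s.reg x)
    (ha : ∀ a ∈ e.rarrs, s'.arr a = s.arr a) :
    e.val s' = e.val s ∧ (e.Safe W s → e.Safe W s') := by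
  induction e with
  | const z => exact ⟨rfl, id⟩
  | reg x => exact ⟨hr x (by simp [rregs]), id⟩
  | cell a i ih =>
    obtain ⟨h1, h2⟩ := ih hr fun b hb => ha b (List.mem_cons_of_mem _ hb)
    refine ⟨?_, h2⟩
    simp only [Expr.val_cell, h1, ha a (by simp [rarrs])]
  | op o e₁ e₂ ih₁ ih₂ =>
    obtain ⟨h1, h2⟩ := ih₁ (fun x hx => hr x (List.mem_append_left _ hx))
      (fun x hx => ha x (List.mem_append_left _ hx))
    obtain ⟨h3, h4⟩ := ih₂ (fun x hx => hr x (List.mem_append_right _ hx))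
      (fun x hx => ha x (List.mem_append_right _ hx))
    refine ⟨?_, fun ⟨q1, q2, q3⟩ => ⟨h2 q1, h4 q2, ?_⟩⟩
    · simp only [Expr.val, h1, h3]
    · rwa [h1, h3]

end IrregularLabeling

namespace IrregularLabeling

/-! ### Arithmetic of codes -/

/-- Digitwise subtraction of numbers in mixed radix. -/
def subc : List ℕ → ℕ → ℕ → ℕ
  | [], _, _ => 0
  | d :: ds, x, y => (x % d + (d - y % d)) % d + d * subc ds (x / d) (y / d)

/-- There are no carries between digits, so subtraction can be done separately on the parts of a
split list of orders. The tables rest on this. -/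
theorem subc_append (l₁ l₂ : List ℕ) (x y : ℕ) : subc (l₁ ++ l₂) x y =
    subc l₁ x y + l₁.prod * subc l₂ (x / l₁.prod) (y / l₁.prod) := by
  induction l₁ generalizing x y with
  | nil => simp [subc]
  | cons d ds ih =>
    simp only [List.cons_append, subc, ih, List.prod_cons, Nat.div_div_eq_div_mul]
    ring

theorem subc_mod (l : List ℕ) (x y : ℕ) : subc l (x % l.prod) (y % l.prod) = subc l x y := by
  induction l generalizing x y with
  | nil => simp [subc]
  | cons d ds ih =>
    simp only [subc, List.prod_cons, Nat.mod_mul_right_div_self, ih, Nat.mod_mul_right_mod]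

theorem subc_lt {l : List ℕ} (hl : ∀ d ∈ l, 2 ≤ d) (x y : ℕ) : subc l x y < l.prod := by
  induction l generalizing x y with
  | nil => simp [subc]
  | cons d ds ih =>
    have hd : 2 ≤ d := hl d (by simp)
    have h1 : (x % d + (d - y % d)) % d < d := Nat.mod_lt _ (by omega)
    have h2 := ih (fun e he => hl e (by simp [he])) (x / d) (y / d)
    simp only [subc, List.prod_cons]
    calc _ < d + d * subc ds (x / d) (y / d) := by omega
      _ = d * (subc ds (x / d) (y / d) + 1) := by ring
      _ ≤ _ := Nat.mul_le_mul_left _ h2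

/-- The first coordinate. -/
def headC {d : ℕ} {ds : List ℕ} (g : CyclicProduct (d :: ds)) : ZMod d :=
  g (0 : Fin (ds.length + 1))

/-- The other coordinates. -/
def tailC {d : ℕ} {ds : List ℕ} (g : CyclicProduct (d :: ds)) : CyclicProduct ds :=
  fun i : Fin ds.length => g (i.succ : Fin (ds.length + 1))

theorem code_cons (d : ℕ) (ds : List ℕ) (g : CyclicProduct (d :: ds)) :
    code (d :: ds) g = (headC g).val + d * code ds (tailC g) := by
  unfold code
  refine (Fin.sum_univ_succ (n := ds.length) _).trans ?_
  congr 1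
  · simp [headC]
  · rw [Finset.mul_sum]
    refine Finset.sum_congr rfl fun i _ => ?_
    simp only [Fin.val_succ, List.take_succ_cons, List.prod_cons]
    rw [mul_left_comm]
    rfl

theorem ext_headC_tailC {d : ℕ} {ds : List ℕ} {g h : CyclicProduct (d :: ds)}
    (h₁ : headC g = headC h) (h₂ : tailC g = tailC h) : g = h := by
  funext i
  refine Fin.cases (n := ds.length) (motive := fun i => g i = h i) h₁ (fun i => ?_) i
  exact congrFun h₂ i

theorem list_prod_pos {l : List ℕ} (hl : ∀ d ∈ l, 2 ≤ d) : 0 < l.prod :=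
  List.prod_pos fun d hd => by have := hl d hd; omega

theorem code_lt {ds : List ℕ} (hds : ∀ d ∈ ds, 2 ≤ d) (g : CyclicProduct ds) :
    code ds g < ds.prod := by
  induction ds with
  | nil => simp [code]
  | cons d ds ih =>
    have hd : 2 ≤ d := hds d (by simp)
    have : NeZero d := ⟨by omega⟩
    have h1 := ZMod.val_lt (headC g)
    have h2 := ih (fun e he => hds e (by simp [he])) (tailC g)
    rw [code_cons, List.prod_cons]
    calc _ < d + d * code ds (tailC g) := by omega
      _ = d * (code ds (tailC g) + 1) := by ring
      _ ≤ _ := Nat.mul_le_mul_left _ h2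

theorem code_injective {ds : List ℕ} (hds : ∀ d ∈ ds, 2 ≤ d) :
    Function.Injective (code ds) := by
  induction ds with
  | nil => intro g h _; funext i; exact i.elim0
  | cons d ds ih =>
    intro g h e
    have hd : 2 ≤ d := hds d (by simp)
    have : NeZero d := ⟨by omega⟩
    have h1 := ZMod.val_lt (headC g)
    have h2 := ZMod.val_lt (headC h)
    rw [code_cons, code_cons] at e
    have e1 := congrArg (· % d) e
    have e2 := congrArg (· / d) e
    simp only [Nat.add_mul_mod_self_left, Nat.mod_eq_of_lt h1, Nat.mod_eq_of_lt h2] at e1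
    simp only [Nat.add_mul_div_left _ _ (by omega : 0 < d), Nat.div_eq_of_lt h1,
      Nat.div_eq_of_lt h2, zero_add] at e2
    have e3 := ih (fun e he => hds e (by simp [he])) e2
    exact ext_headC_tailC (ZMod.val_injective d e1) e3

theorem exists_code {ds : List ℕ} (hds : ∀ d ∈ ds, 2 ≤ d) {x : ℕ} (hx : x < ds.prod) :
    ∃ g, code ds g = x := by
  induction ds generalizing x with
  | nil => exact ⟨fun i => i.elim0, by simp at hx; simp [code, hx]⟩
  | cons d ds ih =>
    have hd : 2 ≤ d := hds d (by simp)
    have : NeZero d := ⟨by omega⟩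
    rw [List.prod_cons] at hx
    obtain ⟨g, hg⟩ := ih (fun e he => hds e (by simp [he])) (x := x / d)
      (Nat.div_lt_of_lt_mul hx)
    let g' : CyclicProduct (d :: ds) := fun i : Fin (ds.length + 1) =>
      Fin.cases (motive := fun i => ZMod ((d :: ds).get i)) (x : ZMod d) g i
    refine ⟨g', ?_⟩
    have h1 : headC g' = (x : ZMod d) := rfl
    have h2 : tailC g' = g := rfl
    rw [code_cons, h1, h2, hg, ZMod.val_natCast]
    exact Nat.mod_add_div x d

theorem code_sub {ds : List ℕ} (hds : ∀ d ∈ ds, 2 ≤ d) (g h : CyclicProduct ds) :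
    code ds (g - h) = subc ds (code ds g) (code ds h) := by
  induction ds with
  | nil => simp [code, subc]
  | cons d ds ih =>
    have hd : 2 ≤ d := hds d (by simp)
    have : NeZero d := ⟨by omega⟩
    have h1 := ZMod.val_lt (headC g)
    have h2 := ZMod.val_lt (headC h)
    rw [code_cons, code_cons, code_cons, subc]
    simp only [Nat.add_mul_mod_self_left, Nat.mod_eq_of_lt h1, Nat.mod_eq_of_lt h2,
      Nat.add_mul_div_left _ _ (by omega : 0 < d), Nat.div_eq_of_lt h1,
      Nat.div_eq_of_lt h2, zero_add]
    rw [← ih (fun e he => hds e (by simp [he])) (tailC g) (tailC h)]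
    have h3 : tailC (g - h) = tailC g - tailC h := rfl
    rw [h3]
    congr 1
    -- Adding d before subtracting avoids truncated subtraction of naturals; in `ZMod d` the summand
    -- vanishes.
    have : headC (g - h) =
        (((headC g).val + (d - (headC h).val) : ℕ) : ZMod d) := by
      have h4 : headC (g - h) = headC g - headC h := rfl
      rw [h4, Nat.cast_add, Nat.cast_sub h2.le]
      simp [sub_eq_add_neg]
    rw [this, ZMod.val_natCast]

@[simp] theorem code_zero (ds : List ℕ) : code ds 0 = 0 := by simp [code]

theorem code_single {ds : List ℕ} (i : Fin ds.length) {c : ℕ}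
    (hc : c < ds.get i) : code ds (Pi.single i (c : ZMod (ds.get i))) =
      (ds.take i).prod * c := by
  have : NeZero (ds.get i) := ⟨by omega⟩
  unfold code
  rw [Finset.sum_eq_single i]
  · rw [Pi.single_eq_same, ZMod.val_natCast, Nat.mod_eq_of_lt hc, mul_comm]
  · intro j _ hj
    rw [Pi.single_eq_of_ne hj]; simp
  · simp

theorem card_cyclicProduct (ds : List ℕ) : Nat.card (CyclicProduct ds) = ds.prod := by
  rw [Nat.card_pi]
  simp only [Nat.card_zmod]
  rw [← List.prod_ofFn, List.ofFn_get]

/-- The tables that make subtraction of codes a constant-time expression. The list of orders is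
cut into an initial part, a single factor, and a final part; arrays `17` and `18` tabulate the
subtraction in the first and the last. -/
def Tab (ds : List ℕ) (s : Store) : Prop :=
  ∃ l₁ d l₂, ds = l₁ ++ d :: l₂ ∧ s.reg 3 = ds.prod ∧ s.reg 15 = l₁.prod ∧ s.reg 16 = d ∧
    s.reg 17 = l₁.prod * d ∧
    (∀ x < l₁.prod, ∀ y < l₁.prod, s.arr 17 (x * ds.prod + y) = subc l₁ x y) ∧
    (∀ x < l₂.prod, ∀ y < l₂.prod, s.arr 18 (x * ds.prod + y) = subc l₂ x y)

theorem Tab.congr {ds : List ℕ} {s s' : Store} (h : Tab ds s)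
    (hr : ∀ x ∈ [3, 15, 16, 17], s'.reg x = s.reg x)
    (ha : ∀ a ∈ [17, 18], s'.arr a = s.arr a) : Tab ds s' := by
  obtain ⟨l₁, d, l₂, h1, h2, h3, h4, h5, h6, h7⟩ := h
  refine ⟨l₁, d, l₂, h1, ?_, ?_, ?_, ?_, ?_, ?_⟩
  · rw [hr 3 (by simp), h2]
  · rw [hr 15 (by simp), h3]
  · rw [hr 16 (by simp), h4]
  · rw [hr 17 (by simp), h5]
  · rw [ha 17 (by simp)]; exact h6
  · rw [ha 18 (by simp)]; exact h7

/-- Subtraction of codes. -/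
def subE (x y : Expr) : Expr :=
  .cell 17 (x % #15 * #3 + y % #15) + #15 * ((x / #15 % #16 + (#16 - y / #15 % #16)) % #16) +
    #17 * .cell 18 (x / #17 * #3 + y / #17)

/-- In the store `s`, the expression computes the code of `g`. -/
def EvalTo (W : ℕ) (ds : List ℕ) (s : Store) (e : Expr) (g : CyclicProduct ds) : Prop :=
  e.val s = code ds g ∧ e.Safe W s

theorem mul_add_lt_mul {a b x y : ℕ} (hx : x < a) (hy : y < b) : x * b + y < a * b := by
  calc x * b + y < x * b + b := by omega
    _ = (x + 1) * b := by ring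
    _ ≤ a * b := Nat.mul_le_mul_right _ hx

theorem EvalTo.subE {W : ℕ} {ds : List ℕ} (hds : ∀ d ∈ ds, 2 ≤ d)
    (hW : ds.prod * ds.prod + 2 * ds.prod < W) {s : Store} (ht : Tab ds s) {e₁ e₂ : Expr}
    {g h : CyclicProduct ds} (h₁ : EvalTo W ds s e₁ g) (h₂ : EvalTo W ds s e₂ h) :
    EvalTo W ds s (IrregularLabeling.subE e₁ e₂) (g - h) := by
  obtain ⟨l₁, d, l₂, q1, q2, q3, q4, q5, q6, q7⟩ := ht
  have hx := code_lt hds g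
  have hy := code_lt hds h
  obtain ⟨v1, s1⟩ := h₁
  obtain ⟨v2, s2⟩ := h₂
  set x := code ds g with hxdef
  set y := code ds h with hydef
  set N := ds.prod with hN
  have hl1 : ∀ e ∈ l₁, 2 ≤ e := fun e he => hds e (by simp [q1, he])
  have hl2 : ∀ e ∈ l₂, 2 ≤ e := fun e he => hds e (by simp [q1, he])
  have hd : 2 ≤ d := hds d (by simp [q1])
  have hNe : N = l₁.prod * d * l₂.prod := by rw [hN, q1]; simp [mul_assoc]
  have p1 := list_prod_pos hl1
  have p2 := list_prod_pos hl2
  have hL1 : l₁.prod * d ≤ N := by rw [hNe]; exact Nat.le_mul_of_pos_right _ p2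
  have hL1' : l₁.prod ≤ N := le_trans (Nat.le_mul_of_pos_right _ (by omega)) hL1
  have hL2 : l₂.prod ≤ N := by
    rw [hNe]; exact Nat.le_mul_of_pos_left _ (Nat.mul_pos p1 (by omega))
  have hdN : d ≤ N := le_trans (Nat.le_mul_of_pos_left _ p1) hL1
  have c1 : s.arr 17 (x % l₁.prod * N + y % l₁.prod) = subc l₁ x y := by
    rw [q6 _ (Nat.mod_lt _ p1) _ (Nat.mod_lt _ p1), subc_mod]
  have hx2 : x / (l₁.prod * d) < l₂.prod := Nat.div_lt_of_lt_mul (by rwa [← hNe])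
  have hy2 : y / (l₁.prod * d) < l₂.prod := Nat.div_lt_of_lt_mul (by rwa [← hNe])
  have c2 := q7 _ hx2 _ hy2
  -- The digits below the single factor, the digit of this factor, and the digits above it.
  have hsub : code ds (g - h) = subc l₁ x y +
      l₁.prod * ((x / l₁.prod % d + (d - y / l₁.prod % d)) % d) +
      l₁.prod * d * subc l₂ (x / (l₁.prod * d)) (y / (l₁.prod * d)) := by
    rw [code_sub hds, ← hxdef, ← hydef]
    conv_lhs => rw [q1, subc_append]
    simp only [subc, Nat.div_div_eq_div_mul]
    ring
  have hlt := code_lt hds (g - h)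
  rw [← hN] at hlt
  rw [hsub] at hlt
  have hval : (IrregularLabeling.subE e₁ e₂).val s = code ds (g - h) := by
    rw [hsub]
    simp only [IrregularLabeling.subE, Expr.val_add, Expr.val_cell, Expr.val_mul, Expr.val_mod,
      Expr.val_reg, Expr.val_div, Expr.val_sub, v1, v2, q2, q3, q4, q5, c1, c2]
  refine ⟨hval, ?_⟩
  -- Table indices stay below N * N. The partial sums of the result are bounded by the final code,
  -- which is below N.
  have hm1 := mul_add_lt_mul (b := N) (lt_of_lt_of_le (Nat.mod_lt x p1) hL1')
    (lt_of_lt_of_le (Nat.mod_lt y p1) hL1')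
  have hm2 := mul_add_lt_mul (b := N) (lt_of_lt_of_le hx2 hL2) (lt_of_lt_of_le hy2 hL2)
  have z1 := Nat.zero_le (y / (l₁.prod * d))
  have z2 := Nat.zero_le (y % l₁.prod)
  have hm3 := Nat.mod_lt (x / l₁.prod) (by omega : 0 < d)
  simp only [IrregularLabeling.subE, Expr.safe_add, Expr.safe_cell, Expr.safe_mul, Expr.safe_mod,
    Expr.safe_reg, Expr.safe_div, Expr.safe_sub, s1, s2, v1, v2, q2, q3, q4, q5,
    Expr.val_add, Expr.val_cell, Expr.val_mul, Expr.val_mod,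
      Expr.val_reg, Expr.val_div, Expr.val_sub, c1, c2, true_and, and_true]
  refine ⟨⟨⟨?_, ?_⟩, ⟨?_, ?_⟩, ?_⟩, ⟨⟨?_, ?_⟩, ?_⟩, ?_⟩ <;> omega

theorem EvalTo.zero {W : ℕ} {ds : List ℕ} {s : Store} (hW : 0 < W) : EvalTo W ds s 0 0 :=
  ⟨by simp, hW⟩

theorem EvalTo.reg {W : ℕ} {ds : List ℕ} {s : Store} {x : ℕ} {g : CyclicProduct ds}
    (h : s.reg x = code ds g) : EvalTo W ds s #x g :=
  ⟨h, trivial⟩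

end IrregularLabeling

namespace IrregularLabeling

/-! ### Scanning the orders -/

/-- The positions `< j` of even orders, the last one first. -/
def evens (ds : List ℕ) : ℕ → List ℕ
  | 0 => []
  | j + 1 => if ds.getD j 0 % 2 = 0 then j :: evens ds j else evens ds j

/-- Code of the element `c` of the `i`-th factor. -/
def unitCode (ds : List ℕ) (i c : ℕ) : ℕ := (ds.take i).prod * c

/-- Run through the orders, with the current order in register `19` and the product of the previous
ones in register `3`. -/
def overOrders (p : Prog) : Prog :=
  .assign 3 1 ;; forUp 4 2 (.assign 19 (.cell 2 #4) ;; p ;; .assign 3 (#3 * #19))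

def countOrders : Prog :=
  .assign 5 (#5 + (#19 % 2 =ₑ 0)) ;; .assign 6 (#6 + (#19 =ₑ 2)) ;; .assign 7 (#7 + (#19 =ₑ 3))

def recordHalves : Prog :=
  .ite (#19 % 2 =ₑ 0)
    (.assign 13 #12 ;; .assign 12 #11 ;; .assign 11 #10 ;;
      .assign 10 (#3 * (#19 / 2)) ;; .assign 14 (#3 * (#19 / 4)))
    .skip

def recordNotThree : Prog := .ite (#19 =ₑ 3) .skip (.assign 8 #3)

def recordNotTwoFour : Prog := .ite (#19 =ₑ 2) .skip (.ite (#19 =ₑ 4) .skip (.assign 9 #3))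

/-- Compute the order of the group, the numbers of orders that are even, `2` and `3`, and the codes
of some useful elements. -/
def scan : Prog :=
  overOrders countOrders ;; overOrders recordHalves ;; overOrders recordNotThree ;;
    overOrders recordNotTwoFour

theorem take_prod_le {ds : List ℕ} (hds : ∀ d ∈ ds, 2 ≤ d) (j : ℕ) :
    (ds.take j).prod ≤ ds.prod := by
  conv_rhs => rw [← List.take_append_drop j ds, List.prod_append]
  exact Nat.le_mul_of_pos_right _ (list_prod_pos fun d hd => hds d (List.mem_of_mem_drop hd))

theorem take_succ_eq {ds : List ℕ} {j : ℕ} (hj : j < ds.length) :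
    ds.take (j + 1) = ds.take j ++ [ds.getD j 0] := by
  rw [List.take_succ_eq_append_getElem hj, List.getD_eq_getElem _ _ hj]

theorem two_pow_length_le {ds : List ℕ} (hds : ∀ d ∈ ds, 2 ≤ d) : 2 ^ ds.length ≤ ds.prod := by
  induction ds with
  | nil => simp
  | cons d ds ih =>
    rw [List.length_cons, List.prod_cons, pow_succ, mul_comm]
    exact Nat.mul_le_mul (hds d (by simp)) (ih fun e he => hds e (by simp [he]))

/-- Hence passes over the list of orders cost O(|𝒢|). -/
theorem length_lt_prod {ds : List ℕ} (hds : ∀ d ∈ ds, 2 ≤ d) : ds.length < ds.prod :=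
  lt_of_lt_of_le Nat.lt_two_pow_self (two_pow_length_le hds)

theorem evens_length_le (ds : List ℕ) (j : ℕ) : (evens ds j).length ≤ j := by
  induction j with
  | zero => simp [evens]
  | succ j ih =>
    rw [evens]; split
    · rw [List.length_cons]; omega
    · omega

/-- The invariant J must not depend on registers `3`, `4` and `19`, which the loop itself uses for
the prefix product, the index and the current order. -/
theorem overOrders_does {W : ℕ} {ds : List ℕ} (hds : ∀ d ∈ ds, 2 ≤ d)
    (hW : ds.prod * ds.prod + 2 * ds.prod + 4 < W) {s : Store} (hs : s.Bounded W)
    (hk : s.reg 2 = ds.length) (hd : ∀ i, s.arr 2 i = ds.getD i 0) {p : Prog}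
    (hp : ∀ x ∈ [2, 3, 4, 19], x ∉ p.wregs) (hpa : 2 ∉ p.warrs) (J : ℕ → Store → Prop) {c : ℕ}
    (hJ : ∀ j s x z, x ∈ [3, 4, 19] → J j s → J j (s.setReg x z)) (h0 : J 0 s)
    (step : ∀ j s', j < ds.length → s'.Bounded W → s'.reg 3 = (ds.take j).prod →
      s'.reg 19 = ds.getD j 0 → (ds.take j).prod * ds.getD j 0 ≤ ds.prod → j < ds.prod →
      2 ≤ ds.getD j 0 → J j s' → Does W p c s' (J (j + 1))) :
    Does W (overOrders p) (ds.length * (c + 15) + 8) s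
      (fun s' => s'.reg 3 = ds.prod ∧ J ds.length s') := by
  have hW1 : 1 < W := by omega
  have key : Does W (overOrders p) (2 + (ds.length * ((3 + (c + 4)) + 8) + 6)) s
      (fun s' => s'.reg 3 = (ds.take ds.length).prod ∧ J ds.length s') := by
    refine Does.seq (Does.exec (p := .assign 3 1) hW1 hs hW1) fun s1 hs1 ha1 e1 => ?_
    have hp' : 2 ∉ p.wregs ∧ 3 ∉ p.wregs ∧ 4 ∉ p.wregs ∧ 19 ∉ p.wregs := by simpa using hp
    refine Does.forUp (fun j s' => s'.reg 3 = (ds.take j).prod ∧ J j s') hW1 hs1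
      (by rw [ha1.reg 2 (by decide), hk]) (by decide) (by simp [Prog.wregs, hp'])
      (by simp [Prog.wregs, hp']) ?_ ?_
    · refine ⟨by simp [e1, Prog.exec], hJ _ _ _ _ (by simp) ?_⟩
      rw [e1]
      exact hJ _ _ _ _ (by simp) h0
    · intro j s' hj hs' ha hi ⟨hP, hJj⟩
      have hdj : s'.arr 2 j = ds.getD j 0 := by
        rw [ha.arr 2 (by simpa [forUp, Prog.warrs] using hpa), ha1.arr 2 (by decide), hd]
      have hle := take_prod_le hds (j + 1)
      rw [take_succ_eq hj, List.prod_append, List.prod_singleton] at hle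
      have hd2 : 2 ≤ ds.getD j 0 := by
        rw [List.getD_eq_getElem _ _ hj]; exact hds _ (List.getElem_mem hj)
      have hk' := length_lt_prod hds
      refine Does.seq (Does.exec (p := .assign 19 (.cell 2 #4)) hW1 hs' (by simp [Prog.Ok]))
        fun s2 hs2 ha2 e2 => ?_
      have h19 : s2.reg 19 = ds.getD j 0 := by simp [e2, Prog.exec, hi, hdj]
      have h3 : s2.reg 3 = (ds.take j).prod := by rw [ha2.reg 3 (by decide), hP]
      refine Does.seq (step j s2 hj hs2 h3 h19 hle (by omega) hd2 ?_) fun s3 hs3 ha3 hJ3 => ?_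
      · rw [e2]; exact hJ _ _ _ _ (by simp) hJj
      · have h19' := (ha3.reg 19 hp'.2.2.2).trans h19
        have h3' := (ha3.reg 3 hp'.2.1).trans h3
        refine Does.of_exec hW1 (p := .assign 3 (#3 * #19)) hs3 ?_ ⟨?_, ?_⟩
        · simp [-List.getD_eq_getElem?_getD, Prog.Ok, h19', h3']; omega
        · simp [Prog.exec, h19', h3', take_succ_eq hj]
        · exact hJ _ _ _ _ (by simp) (hJ _ _ _ _ (by simp) hJ3)
  refine key.mono (by ring_nf; omega) fun s' _ _ h => ?_
  rwa [List.take_length] at h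

/-- The numbers of even orders, of orders `2`, and of orders `3`. -/
structure Counted (ds : List ℕ) (j : ℕ) (s : Store) : Prop where
  even : s.reg 5 = (evens ds j).length
  two : s.reg 6 = (ds.take j).count 2
  three : s.reg 7 = (ds.take j).count 3

/-- Registers `10` to `13` form a queue of the latest four involutions; no initial choice needs more
than four independent ones. The quarter is only needed when a single order is even, so the latest
suffices. -/
structure Halved (ds : List ℕ) (j : ℕ) (s : Store) : Prop where
  half : ∀ t < 4, s.reg (10 + t) =
    ((evens ds j).map fun i => unitCode ds i (ds.getD i 0 / 2)).getD t 0
  quarter : s.reg 14 =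
    ((evens ds j).map fun i => unitCode ds i (ds.getD i 0 / 4)).getD 0 0

/-- Register `8` holds the code of an element of order not `3`, if there is one. -/
def NotThree (ds : List ℕ) (j : ℕ) (s : Store) : Prop :=
  (s.reg 8 = 0 ∧ ∀ i < j, ds.getD i 0 = 3) ∨
    ∃ i < j, ds.getD i 0 ≠ 3 ∧ s.reg 8 = unitCode ds i 1

/-- A factor of order at least 2 other than 2 and 4 contains an element x with 4x ≠ 0, which
`Sel.single_triple` needs. -/
def NotTwoFour (ds : List ℕ) (j : ℕ) (s : Store) : Prop :=
  (s.reg 9 = 0 ∧ ∀ i < j, ds.getD i 0 = 2 ∨ ds.getD i 0 = 4) ∨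
    ∃ i < j, ds.getD i 0 ≠ 2 ∧ ds.getD i 0 ≠ 4 ∧ s.reg 9 = unitCode ds i 1

theorem countOrders_does {W : ℕ} {ds : List ℕ} (hds : ∀ d ∈ ds, 2 ≤ d)
    (hW : ds.prod * ds.prod + 2 * ds.prod + 4 < W) {s : Store} (hs : s.Bounded W)
    (hk : s.reg 2 = ds.length) (hd : ∀ i, s.arr 2 i = ds.getD i 0)
    (h0 : ∀ x, 5 ≤ x → x ≤ 14 → s.reg x = 0) :
    Does W (overOrders countOrders) (ds.length * (countOrders.time + 15) + 8) s
      (fun s' => s'.reg 3 = ds.prod ∧ Counted ds ds.length s') := by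
  refine overOrders_does hds hW hs hk hd (by decide) (by decide) (Counted ds) ?_ ?_ ?_
  · intro j s x z hx ⟨h1, h2, h3⟩
    have : 5 ≠ x ∧ 6 ≠ x ∧ 7 ≠ x := by simp at hx; omega
    constructor <;> simp [this, h1, h2, h3]
  · constructor <;> simp [evens, h0]
  · intro j s' hj hs' h3 h19 hle hjN hd2 ⟨q1, q2, q3⟩
    have b1 : ∀ p : Prop, [Decidable p] → (if p then 1 else 0) ≤ 1 := by
      intro p _; split <;> simp
    have b2 := b1 (ds.getD j 0 % 2 = 0)
    have b3 := b1 (ds.getD j 0 = 2)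
    have b4 := b1 (ds.getD j 0 = 3)
    have hev := evens_length_le ds j
    have hc2 := List.count_le_length (a := 2) (l := ds.take j)
    have hc3 := List.count_le_length (a := 3) (l := ds.take j)
    have hlen : (ds.take j).length ≤ j := by simp
    refine Does.of_exec (by omega) hs' ?_ ?_
    · simp [-List.getD_eq_getElem?_getD, countOrders, Prog.Ok, Prog.exec, h19, q1, q2, q3]; omega
    · constructor
      · simp [-List.getD_eq_getElem?_getD, countOrders, Prog.exec, h19, q1, evens]; split <;> simp
      · simp [-List.getD_eq_getElem?_getD, countOrders, Prog.exec, h19, q2, take_succ_eq hj, List.count_singleton]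
      · simp [-List.getD_eq_getElem?_getD, countOrders, Prog.exec, h19, q3, take_succ_eq hj, List.count_singleton]

theorem recordHalves_does {W : ℕ} {ds : List ℕ} (hds : ∀ d ∈ ds, 2 ≤ d)
    (hW : ds.prod * ds.prod + 2 * ds.prod + 4 < W) {s : Store} (hs : s.Bounded W)
    (hk : s.reg 2 = ds.length) (hd : ∀ i, s.arr 2 i = ds.getD i 0)
    (h0 : ∀ x, 10 ≤ x → x ≤ 14 → s.reg x = 0) :
    Does W (overOrders recordHalves) (ds.length * (recordHalves.time + 15) + 8) s
      (fun s' => s'.reg 3 = ds.prod ∧ Halved ds ds.length s') := by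
  refine overOrders_does hds hW hs hk hd (by decide) (by decide) (Halved ds) ?_ ?_ ?_
  · intro j s x z hx ⟨h1, h2⟩
    have : 14 ≠ x ∧ ∀ t < 4, 10 + t ≠ x := by
      simp at hx
      rcases hx with rfl | rfl | rfl <;> exact ⟨by decide, by omega⟩
    refine ⟨fun t ht => ?_, ?_⟩
    · rw [Store.setReg_reg, if_neg (this.2 t ht), h1 t ht]
    · rw [Store.setReg_reg, if_neg this.1, h2]
  · refine ⟨fun t ht => ?_, ?_⟩
    · rw [h0 _ (by omega) (by omega)]; simp [evens]
    · rw [h0 _ (by omega) (by omega)]; simp [evens]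
  · intro j s' hj hs' h3 h19 hle hjN hd2 ⟨q1, q2⟩
    have hdiv : ∀ c, (ds.take j).prod * (ds.getD j 0 / c) ≤ ds.prod :=
      fun c => le_trans (Nat.mul_le_mul_left _ (Nat.div_le_self _ _)) hle
    have d2 := hdiv 2
    have d4 := hdiv 4
    by_cases he : ds.getD j 0 % 2 = 0
    · refine Does.of_exec (by omega) hs' ?_ ?_
      · simp [-List.getD_eq_getElem?_getD, recordHalves, Prog.Ok, Prog.exec, h19, he, h3]; omega
      · have r10 := q1 0 (by omega)
        have r11 := q1 1 (by omega)
        have r12 := q1 2 (by omega)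
        simp only [Nat.add_zero, Nat.reduceAdd] at r10 r11 r12
        refine ⟨fun t ht => ?_, ?_⟩
        · interval_cases t
          all_goals
            simp [-List.getD_eq_getElem?_getD, List.getD_cons_zero, List.getD_cons_succ,
              recordHalves, Prog.exec, h19, he, h3, evens, r10, r11, r12, unitCode]
        · simp [-List.getD_eq_getElem?_getD, List.getD_cons_zero, List.getD_cons_succ,
              recordHalves, Prog.exec, h19, he, h3, evens, unitCode]
    · refine Does.of_exec (by omega) hs' ?_ ?_
      · simp [-List.getD_eq_getElem?_getD, recordHalves, Prog.Ok, h19, he]; omega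
      · refine ⟨fun t ht => ?_, ?_⟩
        · simp [-List.getD_eq_getElem?_getD, List.getD_cons_zero, List.getD_cons_succ,
              recordHalves, Prog.exec, h19, he, evens, q1 t ht]
        · simp [-List.getD_eq_getElem?_getD, List.getD_cons_zero, List.getD_cons_succ,
              recordHalves, Prog.exec, h19, he, evens, q2]

theorem recordNotThree_does {W : ℕ} {ds : List ℕ} (hds : ∀ d ∈ ds, 2 ≤ d)
    (hW : ds.prod * ds.prod + 2 * ds.prod + 4 < W) {s : Store} (hs : s.Bounded W)
    (hk : s.reg 2 = ds.length) (hd : ∀ i, s.arr 2 i = ds.getD i 0)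
    (h0 : s.reg 8 = 0) :
    Does W (overOrders recordNotThree) (ds.length * (recordNotThree.time + 15) + 8) s
      (fun s' => s'.reg 3 = ds.prod ∧ NotThree ds ds.length s') := by
  refine overOrders_does hds hW hs hk hd (by decide) (by decide) (NotThree ds) ?_ ?_ ?_
  · intro j s x z hx h
    have : 8 ≠ x := by simp at hx; omega
    simpa [NotThree, this] using h
  · simp [NotThree, h0]
  · intro j s' hj hs' h3 h19 hle hjN hd2 h
    refine Does.of_exec (by omega) hs' ?_ ?_
    · simp [-List.getD_eq_getElem?_getD, recordNotThree, Prog.Ok]; omega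
    · by_cases he : ds.getD j 0 = 3
      · have hex : recordNotThree.exec s' = s' := by
          simp [-List.getD_eq_getElem?_getD, recordNotThree, Prog.exec, h19, he]
        rw [hex]
        rcases h with ⟨h1, h2⟩ | ⟨i, h1, h2⟩
        · refine Or.inl ⟨h1, fun i hi => ?_⟩
          rcases Nat.lt_succ_iff_lt_or_eq.1 hi with h | rfl
          · exact h2 i h
          · exact he
        · exact Or.inr ⟨i, by omega, h2⟩
      · refine Or.inr ⟨j, by omega, he, ?_⟩
        simp [-List.getD_eq_getElem?_getD, recordNotThree, Prog.exec, h19, he, h3, unitCode]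

theorem recordNotTwoFour_does {W : ℕ} {ds : List ℕ} (hds : ∀ d ∈ ds, 2 ≤ d)
    (hW : ds.prod * ds.prod + 2 * ds.prod + 4 < W) {s : Store} (hs : s.Bounded W)
    (hk : s.reg 2 = ds.length) (hd : ∀ i, s.arr 2 i = ds.getD i 0)
    (h0 : s.reg 9 = 0) :
    Does W (overOrders recordNotTwoFour) (ds.length * (recordNotTwoFour.time + 15) + 8) s
      (fun s' => s'.reg 3 = ds.prod ∧ NotTwoFour ds ds.length s') := by
  refine overOrders_does hds hW hs hk hd (by decide) (by decide) (NotTwoFour ds) ?_ ?_ ?_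
  · intro j s x z hx h
    have : 9 ≠ x := by simp at hx; omega
    simpa [NotTwoFour, this] using h
  · simp [NotTwoFour, h0]
  · intro j s' hj hs' h3 h19 hle hjN hd2 h
    refine Does.of_exec (by omega) hs' ?_ ?_
    · simp [-List.getD_eq_getElem?_getD, recordNotTwoFour, Prog.Ok]; split_ifs <;> omega
    · by_cases he : ds.getD j 0 = 2 ∨ ds.getD j 0 = 4
      · have hex : recordNotTwoFour.exec s' = s' := by
          rcases he with he | he <;> simp [-List.getD_eq_getElem?_getD, recordNotTwoFour, Prog.exec, h19, he]
        rw [hex]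
        rcases h with ⟨h1, h2⟩ | ⟨i, h1, h2⟩
        · refine Or.inl ⟨h1, fun i hi => ?_⟩
          rcases Nat.lt_succ_iff_lt_or_eq.1 hi with h | rfl
          · exact h2 i h
          · exact he
        · exact Or.inr ⟨i, by omega, h2⟩
      · push Not at he
        refine Or.inr ⟨j, by omega, he.1, he.2, ?_⟩
        simp [-List.getD_eq_getElem?_getD, recordNotTwoFour, Prog.exec, h19, he, h3, unitCode]

/-- What `scan` computes. -/
structure Scanned (ds : List ℕ) (s : Store) : Prop where
  prod : s.reg 3 = ds.prod
  counted : Counted ds ds.length s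
  halved : Halved ds ds.length s
  notThree : NotThree ds ds.length s
  notTwoFour : NotTwoFour ds ds.length s

theorem scan_does {W : ℕ} {ds : List ℕ} (hds : ∀ d ∈ ds, 2 ≤ d)
    (hW : ds.prod * ds.prod + 2 * ds.prod + 4 < W) {s : Store} (hs : s.Bounded W)
    (hk : s.reg 2 = ds.length) (hd : ∀ i, s.arr 2 i = ds.getD i 0)
    (h0 : ∀ x, 5 ≤ x → x ≤ 14 → s.reg x = 0) :
    Does W scan (ds.length * 200 + 40) s (Scanned ds) := by
  have key : Does W scan (ds.length * (countOrders.time + 15) + 8 +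
      (ds.length * (recordHalves.time + 15) + 8 + (ds.length * (recordNotThree.time + 15) + 8 +
      (ds.length * (recordNotTwoFour.time + 15) + 8)))) s (Scanned ds) := by
    refine Does.seq (countOrders_does hds hW hs hk hd h0) fun s1 hs1 ha1 ⟨p1, h1⟩ => ?_
    have hk1 := (ha1.reg 2 (by decide)).trans hk
    have hd1 := fun i => (congrFun (ha1.arr 2 (by decide)) i).trans (hd i)
    refine Does.seq (recordHalves_does hds hW hs1 hk1 hd1 ?_) fun s2 hs2 ha2 ⟨p2, h2⟩ => ?_
    · intro x hx hx'
      rw [ha1.reg x, h0 x (by omega) hx']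
      have : x ∉ [3, 4, 19, 5, 6, 7, 3, 4] := by simp; omega
      exact this
    have hk2 := (ha2.reg 2 (by decide)).trans hk1
    have hd2 := fun i => (congrFun (ha2.arr 2 (by decide)) i).trans (hd1 i)
    refine Does.seq (recordNotThree_does hds hW hs2 hk2 hd2 ?_) fun s3 hs3 ha3 ⟨p3, h3⟩ => ?_
    · rw [ha2.reg 8 (by decide), ha1.reg 8 (by decide), h0 8 (by omega) (by omega)]
    have hk3 := (ha3.reg 2 (by decide)).trans hk2
    have hd3 := fun i => (congrFun (ha3.arr 2 (by decide)) i).trans (hd2 i)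
    refine (recordNotTwoFour_does hds hW hs3 hk3 hd3 ?_).mono le_rfl fun s4 _ ha4 ⟨p4, h4⟩ => ?_
    · rw [ha3.reg 9 (by decide), ha2.reg 9 (by decide), ha1.reg 9 (by decide),
        h0 9 (by omega) (by omega)]
    refine ⟨p4, ?_, ?_, ?_, h4⟩
    · obtain ⟨q1, q2, q3⟩ := h1
      constructor
      · rw [ha4.reg 5 (by decide), ha3.reg 5 (by decide), ha2.reg 5 (by decide), q1]
      · rw [ha4.reg 6 (by decide), ha3.reg 6 (by decide), ha2.reg 6 (by decide), q2]
      · rw [ha4.reg 7 (by decide), ha3.reg 7 (by decide), ha2.reg 7 (by decide), q3]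
    · obtain ⟨q1, q2⟩ := h2
      constructor
      · intro t ht
        rw [ha4.reg _, ha3.reg _, q1 t ht]
        · have : 10 + t ∉ [3, 4, 19, 8, 3, 4] := by simp; omega
          exact this
        · have : 10 + t ∉ [3, 4, 19, 9, 3, 4] := by simp; omega
          exact this
      · rw [ha4.reg 14 (by decide), ha3.reg 14 (by decide), q2]
    · have : s4.reg 8 = s3.reg 8 := ha4.reg 8 (by decide)
      simpa [NotThree, this] using h3
  refine key.mono ?_ fun _ _ _ h => h
  have e1 : countOrders.time ≤ 30 := by decide
  have e2 : recordHalves.time ≤ 30 := by decide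
  have e3 : recordNotThree.time ≤ 30 := by decide
  have e4 : recordNotTwoFour.time ≤ 30 := by decide
  have f1 := Nat.mul_le_mul_left ds.length e1
  have f2 := Nat.mul_le_mul_left ds.length e2
  have f3 := Nat.mul_le_mul_left ds.length e3
  have f4 := Nat.mul_le_mul_left ds.length e4
  simp only [Nat.mul_add]
  omega

end IrregularLabeling

namespace IrregularLabeling

/-! ### Subtraction tables -/

/-- Array `a` tabulates subtraction for the orders `l`, with row length `N`. -/
def IsTable (s : Store) (a N : ℕ) (l : List ℕ) : Prop :=
  ∀ x < l.prod, ∀ y < l.prod, s.arr a (x * N + y) = subc l x y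

def extendCell (a rl : ℕ) : Prog :=
  .assign 24 (#20 / #23) ;; .assign 25 (#20 % #23) ;;
  .store a (#24 * #3 + #25) (.cell a (#24 % #rl * #3 + #25 % #rl) +
    #rl * ((#24 / #rl + (#22 - #25 / #rl)) % #22))

/-- Extend the table `a` by the factor in register `22`. -/
def extendTable (a rl : ℕ) : Prog :=
  .assign 22 (.cell 2 #18) ;; .assign 23 (#rl * #22) ;; .assign 21 (#23 * #23) ;;
  forUp 20 21 (extendCell a rl) ;;
  .assign rl #23 ;; .assign 18 (#18 + 1)

/-- Build the table `a` for as many factors as possible, from the one in register `18` on. -/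
def buildTable (a rl : ℕ) : Prog :=
  .assign rl 1 ;;
  .while ((#18 <ₑ #2) * (1 - (#3 <ₑ #rl * .cell 2 #18 * (#rl * .cell 2 #18)))) (extendTable a rl)

theorem subc_append_singleton (l : List ℕ) {d x y : ℕ} (hx : x < l.prod * d) (hy : y < l.prod * d) :
    subc (l ++ [d]) x y = subc l x y + l.prod * ((x / l.prod + (d - y / l.prod)) % d) := by
  rw [subc_append]
  simp only [subc, Nat.mul_zero, Nat.add_zero]
  rw [Nat.mod_eq_of_lt (Nat.div_lt_of_lt_mul hx), Nat.mod_eq_of_lt (Nat.div_lt_of_lt_mul hy)]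

/-- Old entries remain correct for the longer list of orders. As the row length is always N, they
also keep their places, so a table can be extended in place. -/
theorem subc_append_singleton_of_lt (l : List ℕ) {d x y : ℕ} (hx : x < l.prod) (hy : y < l.prod)
    (hd : 0 < d) : subc (l ++ [d]) x y = subc l x y := by
  rw [subc_append_singleton l (lt_of_lt_of_le hx (Nat.le_mul_of_pos_right _ hd))
    (lt_of_lt_of_le hy (Nat.le_mul_of_pos_right _ hd)), Nat.div_eq_of_lt hx, Nat.div_eq_of_lt hy]
  simp

theorem mul_add_inj {N x y x' y' : ℕ} (hy : y < N) (hy' : y' < N) (h : x * N + y = x' * N + y') :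
    x = x' ∧ y = y' := by
  have h1 := congrArg (· / N) h
  have h2 := congrArg (· % N) h
  simp only [mul_comm _ N, Nat.mul_add_mod, Nat.mod_eq_of_lt hy, Nat.mod_eq_of_lt hy'] at h2
  simp only [mul_comm _ N, Nat.mul_add_div (by omega : 0 < N), Nat.div_eq_of_lt hy,
    Nat.div_eq_of_lt hy', Nat.add_zero] at h1
  exact ⟨h1, h2⟩

theorem extendTable_does {W N : ℕ} {l : List ℕ} {d : ℕ} (hl : ∀ e ∈ l, 2 ≤ e) (hd : 2 ≤ d)
    (hlN : l.prod * d ≤ N) (hN : l.prod * d * (l.prod * d) ≤ N)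
    (hW : N * N + 2 * N + 4 < W) {a rl : ℕ}
    (hrl : rl ∉ [2, 3, 18, 20, 21, 22, 23, 24, 25]) {s : Store} (hs : s.Bounded W)
    (h3 : s.reg 3 = N) (hr : s.reg rl = l.prod) (hsd : s.arr 2 (s.reg 18) = d)
    (hk : s.reg 18 < s.reg 2) (ht : IsTable s a N l) :
    Does W (extendTable a rl) (l.prod * d * (l.prod * d) * 60 + 30) s (fun s' =>
      s'.reg rl = (l ++ [d]).prod ∧ s'.reg 18 = s.reg 18 + 1 ∧ IsTable s' a N (l ++ [d])) := by
  have hW1 : 1 < W := by omega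
  simp only [List.mem_cons, List.not_mem_nil, or_false, not_or] at hrl
  obtain ⟨n2, n3, n18, n20, n21, n22, n23, n24, n25⟩ := hrl
  set L := l.prod with hL
  have hLpos : 0 < L := list_prod_pos hl
  set L' := L * d with hL'
  have hL'pos : 0 < L' := Nat.mul_pos hLpos (by omega)
  have hLL' : L ≤ L' := Nat.le_mul_of_pos_right _ (by omega)
  have hdL' : d ≤ L' := Nat.le_mul_of_pos_left _ hLpos
  have hprod : (l ++ [d]).prod = L' := by simp [hL', hL]
  refine Does.mono (T := (3 + (4 + (4 + (L' * L' * (50 + 8) + 6 + (2 + 4)))))) ?_ (by omega)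
    fun _ _ _ h => h
  refine Does.seq (Does.exec (p := .assign 22 (.cell 2 #18)) hW1 hs (by simp [Prog.Ok]))
    fun s1 hs1 ha1 e1 => ?_
  refine Does.seq (Does.exec (p := .assign 23 (#rl * #22)) hW1 hs1 ?_) fun s2 hs2 ha2 e2 => ?_
  · simp [Prog.Ok, e1, Prog.exec, n22, hr, hsd]; omega
  refine Does.seq (Does.exec (p := .assign 21 (#23 * #23)) hW1 hs2 ?_) fun s3 hs3 ha3 e3 => ?_
  · have hLL : L * d * (L * d) < W := lt_of_le_of_lt hN (by omega)
    simp [Prog.Ok, e1, e2, Prog.exec, n22, hr, hsd]; exact hLL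
  have f21 : s3.reg 21 = L' * L' := by simp [Prog.exec, e1, e2, e3, n22, hr, hsd, hL']
  have f22 : s3.reg 22 = d := by simp [Prog.exec, e1, e2, e3, hsd]
  have f23 : s3.reg 23 = L' := by simp [Prog.exec, e1, e2, e3, n22, hr, hsd, hL']
  have f3 : s3.reg 3 = N := by simp [Prog.exec, e1, e2, e3, h3]
  have fr : s3.reg rl = L := by simp [Prog.exec, e1, e2, e3, n21, n22, n23, hr]
  have f18 : s3.reg 18 = s.reg 18 := by simp [Prog.exec, e1, e2, e3]
  have fa : s3.arr = s.arr := by simp [Prog.exec, e1, e2, e3]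
  have h2 : s3.reg 2 = s.reg 2 := by simp [Prog.exec, e1, e2, e3]
  -- Entries of the old table are correct throughout, even after being overwritten; the others are
  -- correct as soon as the loop has reached them. The new entries are computed from old ones only.
  refine Does.seq (Does.forUp (fun k s' => ∀ x < L', ∀ y < L', (x < L ∧ y < L) ∨ x * L' + y < k →
    s'.arr a (x * N + y) = subc (l ++ [d]) x y) (c := 50) hW1 hs3 f21 (by decide)
    (by decide : 20 ∉ [24, 25]) (by decide : 21 ∉ [24, 25]) ?_ ?_) fun s4 hs4 ha4 h4 => ?_
  · intro x hx y hy h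
    rcases h with ⟨h, h'⟩ | h
    · rw [subc_append_singleton_of_lt l h h' (by omega)]
      simp only [Store.setReg_arr, fa]
      exact ht x h y h'
    · omega
  · intro k s' hk' hs' ha' hi hJ
    have g22 := (ha'.reg 22 (by decide : 22 ∉ [20, 24, 25, 20])).trans f22
    have g23 := (ha'.reg 23 (by decide : 23 ∉ [20, 24, 25, 20])).trans f23
    have g3 := (ha'.reg 3 (by decide : 3 ∉ [20, 24, 25, 20])).trans f3
    have gr := (ha'.reg rl (by simp; omega : rl ∉ [20, 24, 25, 20])).trans fr
    have hx : k / L' < L' := Nat.div_lt_of_lt_mul hk'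
    have hy : k % L' < L' := Nat.mod_lt _ hL'pos
    set x := k / L' with hxd
    set y := k % L' with hyd
    have hk3 : x * L' + y = k := Nat.div_add_mod' k L'
    have hxl := Nat.mod_lt x hLpos
    have hyl := Nat.mod_lt y hLpos
    have hcell := hJ (x % L) (by omega) (y % L) (by omega) (Or.inl ⟨hxl, hyl⟩)
    rw [subc_append_singleton_of_lt l hxl hyl (by omega), hL, subc_mod, ← hL] at hcell
    have hnew := subc_append_singleton l hx hy
    have hlt := subc_lt (l := l ++ [d]) (by intro e he; simp at he; rcases he with h | rfl; exacts [hl e h, hd]) x y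
    rw [hprod, hnew, ← hL] at hlt
    have hxd2 : x / L < d := Nat.div_lt_of_lt_mul hx
    have hmd := Nat.mod_lt (x / L + (d - y / L)) (by omega : 0 < d)
    have b1 := mul_add_lt_mul (b := N) (lt_of_lt_of_le hx hlN) (lt_of_lt_of_le hy hlN)
    have b2 := mul_add_lt_mul (b := N) (lt_of_lt_of_le (lt_of_lt_of_le hxl hLL') hlN)
      (lt_of_lt_of_le (lt_of_lt_of_le hyl hLL') hlN)
    have z2 := Nat.zero_le (y / L)
    refine Does.mono (T := (extendCell a rl).time) ?_ (Nat.le_of_ble_eq_true rfl) fun _ _ _ h => h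
    refine Does.of_exec hW1 hs' ?_ ?_
    · simp [extendCell, Prog.Ok, Prog.exec, hi, g22, g23, g3, gr, n24, n25, ← hxd, ← hyd, hcell]
      refine ⟨⟨?_, ?_⟩, ⟨?_, ?_⟩, ⟨?_, ?_⟩, ?_⟩ <;> omega
    · intro x' hx' y' hy' h
      simp [extendCell, Prog.exec, hi, g22, g23, g3, gr, n24, n25, ← hxd, ← hyd, hcell,
        Function.update_apply]
      split_ifs with heq
      · obtain ⟨rfl, rfl⟩ := mul_add_inj (lt_of_lt_of_le hy' hlN) (lt_of_lt_of_le hy hlN) heq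
        rw [hnew]
      · refine hJ x' hx' y' hy' ?_
        rcases h with h | h
        · exact Or.inl h
        · right
          rcases Nat.lt_succ_iff_lt_or_eq.1 h with h | h
          · exact h
          · rw [← hk3] at h
            obtain ⟨rfl, rfl⟩ := mul_add_inj hy' hy h
            exact (heq rfl).elim
  · have g23 := (ha4.reg 23 (by decide : 23 ∉ [20, 24, 25, 20])).trans f23
    have g18 := (ha4.reg 18 (by decide : 18 ∉ [20, 24, 25, 20])).trans f18
    have b18 := hs.reg 2
    refine Does.of_exec (p := .assign rl #23 ;; .assign 18 (#18 + 1)) hW1 hs4 ?_ ⟨?_, ?_, ?_⟩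
    · simp [Prog.Ok, Prog.exec, g18, Ne.symm n18]; omega
    · simp [Prog.exec, g23, n18]; rfl
    · simp [Prog.exec, g18, Ne.symm n18]
    · intro x hx y hy
      rw [hprod] at hx hy
      simp only [Prog.exec, Store.setReg_arr]
      exact h4 x hx y hy (Or.inr (mul_add_lt_mul hx hy))

/-- The loop of `buildTable` has treated the factors from `j₀` up to the one in register `18`. -/
structure Building (ds : List ℕ) (a rl j₀ : ℕ) (s : Store) : Prop where
  ge : j₀ ≤ s.reg 18
  le : s.reg 18 ≤ ds.length
  prod : s.reg rl = ((ds.drop j₀).take (s.reg 18 - j₀)).prod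
  sq : s.reg rl * s.reg rl ≤ ds.prod
  table : IsTable s a ds.prod ((ds.drop j₀).take (s.reg 18 - j₀))

theorem segment_prod_le {ds : List ℕ} (hds : ∀ d ∈ ds, 2 ≤ d) (i j : ℕ) :
    ((ds.drop i).take j).prod ≤ ds.prod := by
  have h1 := take_prod_le (ds := ds.drop i) (fun d hd => hds d (List.mem_of_mem_drop hd)) j
  refine h1.trans ?_
  conv_rhs => rw [← List.take_append_drop i ds, List.prod_append]
  exact Nat.le_mul_of_pos_left _ (list_prod_pos fun d hd => hds d (List.mem_of_mem_take hd))

theorem segment_succ {ds : List ℕ} {i j : ℕ} (hij : i ≤ j) (hj : j < ds.length) :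
    (ds.drop i).take (j + 1 - i) = (ds.drop i).take (j - i) ++ [ds.getD j 0] := by
  have : j + 1 - i = (j - i) + 1 := by omega
  rw [this, take_succ_eq (by rw [List.length_drop]; omega)]
  congr 2
  rw [List.getD_eq_getElem?_getD, List.getElem?_drop, List.getD_eq_getElem?_getD]
  congr 2; omega

/-- Each extension multiplies the size of the table by at least 4, so the cost of all extensions is
a geometric sum dominated by the final size, which is at most N. If factors are left, the next one
would have made the table larger than N. -/
theorem buildTable_does {W : ℕ} {ds : List ℕ} (hds : ∀ d ∈ ds, 2 ≤ d)
    (hW : ds.prod * ds.prod + 2 * ds.prod + 4 < W) {a rl : ℕ} (ha : a ≠ 2)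
    (hrl : rl ∉ [2, 3, 18, 20, 21, 22, 23, 24, 25]) {s : Store} (hs : s.Bounded W)
    (hk : s.reg 2 = ds.length) (h3 : s.reg 3 = ds.prod) (hd : ∀ i, s.arr 2 i = ds.getD i 0)
    (hj : s.reg 18 ≤ ds.length) (hz : s.arr a 0 = 0) :
    Does W (buildTable a rl) (400 * ds.prod + 30) s (fun s' => Building ds a rl (s.reg 18) s' ∧
      (s'.reg 18 < ds.length → ds.prod <
        s'.reg rl * ds.getD (s'.reg 18) 0 * (s'.reg rl * ds.getD (s'.reg 18) 0))) := by
  have hW1 : 1 < W := by omega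
  have hrl' := hrl
  simp only [List.mem_cons, List.not_mem_nil, or_false, not_or] at hrl'
  obtain ⟨n2, n3, n18, n20, n21, n22, n23, n24, n25⟩ := hrl'
  set N := ds.prod with hN
  have hNpos : 0 < N := list_prod_pos hds
  refine Does.mono (T := 2 + (200 * (2 * (N - 1)) + 25)) ?_ (by omega) fun _ _ _ h => h
  refine Does.seq (Does.exec (p := .assign rl 1) hW1 hs (by simpa [Prog.Ok] using hW1))
    fun s1 hs1 ha1 e1 => ?_
  have g18 : s1.reg 18 = s.reg 18 := by simp [e1, Prog.exec, Ne.symm n18]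
  have g3 : s1.reg 3 = N := by simp [e1, Prog.exec, Ne.symm n3, h3]
  have g2 : s1.reg 2 = ds.length := by simp [e1, Prog.exec, Ne.symm n2, hk]
  have gr : s1.reg rl = 1 := by simp [e1, Prog.exec]
  have ga : s1.arr = s.arr := by simp [e1, Prog.exec]
  set e : Expr := (#18 <ₑ #2) * (1 - (#3 <ₑ #rl * .cell 2 #18 * (#rl * .cell 2 #18))) with he
  have hcost : e.cost ≤ 20 := Nat.le_of_ble_eq_true rfl
  -- The potential is proportional to N minus the present number of table entries.
  refine Does.mono (Does.while hW1 (e := e) (p := extendTable a rl) (Building ds a rl (s.reg 18))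
    (fun s' => 200 * (2 * (N - s'.reg rl * s'.reg rl))) hs1 ?_ ?_) ?_ ?_
  · refine ⟨g18.ge, g18.trans_le hj, ?_, ?_, ?_⟩
    · simp [gr, g18]
    · rw [gr]; exact hNpos
    · simp only [g18, Nat.sub_self, List.take_zero]
      intro x hx y hy
      have : x = 0 ∧ y = 0 := by simp at hx hy; exact ⟨hx, hy⟩
      simp [this.1, this.2, ga, hz, subc]
  · intro s' hs' hag hB
    have e2 := (hag.reg 2 (by simp [extendTable, extendCell, forUp, Prog.wregs]; omega)).trans g2
    have e3 := (hag.reg 3 (by simp [extendTable, extendCell, forUp, Prog.wregs]; omega)).trans g3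
    have ea : s'.arr 2 = s.arr 2 := by
      rw [hag.arr 2 (by simp [extendTable, extendCell, forUp, Prog.warrs]; omega), ga]
    have hbound : s'.reg rl * ds.getD (s'.reg 18) 0 ≤ N := by
      rcases hB.le.lt_or_eq with h | h
      · have := segment_prod_le hds (s.reg 18) (s'.reg 18 + 1 - s.reg 18)
        rw [segment_succ hB.ge h, List.prod_append, List.prod_singleton, ← hB.prod] at this
        exact this
      -- Behind the last order the array holds 0, so the test of the loop is harmless there.
      · rw [h, List.getD_eq_default _ _ le_rfl]; omega
    have hsq := Nat.mul_le_mul hbound hbound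
    refine ⟨?_, fun hv => ?_⟩
    · simp [he, e2, e3, ea, hd, -List.getD_eq_getElem?_getD]
      repeat' apply And.intro
      all_goals first | omega | (split_ifs <;> omega)
    · have hcond : s'.reg 18 < ds.length ∧
          s'.reg rl * ds.getD (s'.reg 18) 0 * (s'.reg rl * ds.getD (s'.reg 18) 0) ≤ N := by
        simp [he, e2, e3, ea, hd, -List.getD_eq_getElem?_getD] at hv
        by_contra hcon
        rcases not_and_or.1 hcon with h | h
        · exact h hv.1
        · rw [if_pos (by omega)] at hv; omega
      obtain ⟨hlt, hle⟩ := hcond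
      set d := ds.getD (s'.reg 18) 0 with hdd
      have hd2 : 2 ≤ d := by
        rw [hdd, List.getD_eq_getElem _ _ hlt]; exact hds _ (List.getElem_mem hlt)
      set l := (ds.drop (s.reg 18)).take (s'.reg 18 - s.reg 18) with hl
      have hprod := hB.prod
      rw [← hl] at hprod
      refine ⟨l.prod * d * (l.prod * d) * 60 + 30, ?_⟩
      refine (extendTable_does (l := l) (d := d) (N := N)
        (fun x hx => hds x (List.mem_of_mem_drop (List.mem_of_mem_take hx))) hd2
        (by rw [← hprod]; exact hbound) (by rw [← hprod]; exact hle) hW hrl hs' e3 hprod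
        (by rw [ea, hd]) (by rw [e2]; exact hlt) hB.table).mono le_rfl ?_
      rintro s2 hs2 ha2 ⟨q1, q2, q3⟩
      have hseg : (ds.drop (s.reg 18)).take (s2.reg 18 - s.reg 18) = l ++ [d] := by
        rw [q2, segment_succ hB.ge hlt]
      have q1' : s2.reg rl = l.prod * d := by rw [q1]; simp
      refine ⟨⟨?_, ?_, ?_, ?_, ?_⟩, ?_⟩
      · have := hB.ge; omega
      · omega
      · rw [hseg, q1]
      · rw [q1', ← hprod]; exact hle
      · rw [hseg]; exact q3
      · rw [q1', hprod]
        rw [hprod] at hle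
        have hlp : 0 < l.prod := list_prod_pos
          fun x hx => hds x (List.mem_of_mem_drop (List.mem_of_mem_take hx))
        -- At least three quarters of the new entries are really new; the decrease of the potential
        -- therefore pays for rewriting all of them.
        have h4 : 4 * (l.prod * l.prod) ≤ l.prod * d * (l.prod * d) := by
          calc 4 * (l.prod * l.prod) = l.prod * 2 * (l.prod * 2) := by ring
            _ ≤ _ := Nat.mul_le_mul (Nat.mul_le_mul_left _ hd2) (Nat.mul_le_mul_left _ hd2)
        have h5 : 0 < l.prod * l.prod := Nat.mul_pos hlp hlp
        omega
  · simp only [gr]; omega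
  · rintro s' hs' hag ⟨hB, hv⟩
    refine ⟨hB, fun hlt => ?_⟩
    have e2 := (hag.reg 2 (by simp [extendTable, extendCell, forUp, Prog.wregs]; omega)).trans g2
    have e3 := (hag.reg 3 (by simp [extendTable, extendCell, forUp, Prog.wregs]; omega)).trans g3
    have ea : s'.arr 2 = s.arr 2 := by
      rw [hag.arr 2 (by simp [extendTable, extendCell, forUp, Prog.warrs]; omega), ga]
    simp [he, e2, e3, ea, hd, hlt, -List.getD_eq_getElem?_getD] at hv
    by_contra hcon
    rw [if_neg hcon] at hv
    omega

/-- Build the two tables. -/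
def tables : Prog :=
  .assign 18 0 ;; buildTable 17 15 ;;
  .assign 16 (.cell 2 #18) ;; .assign 18 (#18 + 1) ;; .assign 17 (#15 * #16) ;;
  buildTable 18 26

/-- The first table stops at a factor d with (L * d)² > N, where L is the product before d. So the
product of the factors after d is less than √N, and the second table covers all of them. -/
theorem tables_does {W : ℕ} {ds : List ℕ} (hds : ∀ d ∈ ds, 2 ≤ d) (hds1 : ds ≠ [])
    (hW : ds.prod * ds.prod + 2 * ds.prod + 4 < W) {s : Store} (hs : s.Bounded W)
    (hk : s.reg 2 = ds.length) (h3 : s.reg 3 = ds.prod) (hd : ∀ i, s.arr 2 i = ds.getD i 0)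
    (hz : s.arr 17 0 = 0) (hz' : s.arr 18 0 = 0) :
    Does W tables (800 * ds.prod + 100) s (Tab ds) := by
  have hW1 : 1 < W := by omega
  have hNpos := list_prod_pos hds
  have hkN := length_lt_prod hds
  set N := ds.prod with hN
  refine Does.mono (T := 2 + (400 * N + 30 + (3 + (4 + (4 + (400 * N + 30)))))) ?_ (by omega)
    fun _ _ _ h => h
  refine Does.seq (Does.exec (p := .assign 18 0) hW1 hs (by simp [Prog.Ok]; omega))
    fun s1 hs1 ha1 e1 => ?_
  have g18 : s1.reg 18 = 0 := by simp [e1, Prog.exec]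
  have ga : s1.arr = s.arr := by simp [e1, Prog.exec]
  refine Does.seq (buildTable_does hds hW (by decide) (by decide) hs1
    ((ha1.reg 2 (by decide)).trans hk) ((ha1.reg 3 (by decide)).trans h3)
    (fun i => by rw [ga, hd]) (by omega) (by rw [ga, hz])) fun s2 hs2 ha2 ⟨hB, hlast⟩ => ?_
  rw [g18] at hB
  -- The first table cannot take all factors, as N * N ≤ N would force N ≤ 1. So a single factor is
  -- left to be the middle one.
  have hlt : s2.reg 18 < ds.length := by
    rcases hB.le.lt_or_eq with h | h
    · exact h
    · exfalso
      have h1 := hB.prod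
      have h2 := hB.sq
      rw [h] at h1
      simp only [List.drop_zero, Nat.sub_zero, List.take_length] at h1
      rw [h1, ← hN] at h2
      have : N ≤ 1 := by
        by_contra hc
        have := Nat.mul_lt_mul_of_lt_of_le (by omega : 1 < N) (le_refl N) (by omega)
        omega
      have hpos : 0 < ds.length := List.length_pos_iff.2 hds1
      omega
  have hlast := hlast hlt
  set j := s2.reg 18 with hj
  set d := ds.getD j 0 with hdd
  have hdm : d ∈ ds := by rw [hdd, List.getD_eq_getElem _ _ hlt]; exact List.getElem_mem hlt
  have hd2 := hds d hdm
  have hprod : s2.reg 15 = (ds.take j).prod := by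
    have := hB.prod; simpa [← hj] using this
  have hle1 : (ds.take j).prod * d ≤ N := by
    have := take_prod_le hds (j + 1)
    rwa [take_succ_eq hlt, List.prod_append, List.prod_singleton] at this
  have ga2 : s2.arr 2 = s.arr 2 := (ha2.arr 2 (by decide)).trans (by rw [ga])
  refine Does.seq (Does.exec (p := .assign 16 (.cell 2 #18)) hW1 hs2 (by simp [Prog.Ok]))
    fun s3 hs3 ha3 e3 => ?_
  refine Does.seq (Does.exec (p := .assign 18 (#18 + 1)) hW1 hs3 ?_) fun s4 hs4 ha4 e4 => ?_
  · simp [Prog.Ok, e3, Prog.exec]; omega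
  refine Does.seq (Does.exec (p := .assign 17 (#15 * #16)) hW1 hs4 ?_) fun s5 hs5 ha5 e5 => ?_
  · simp [Prog.Ok, e4, e3, Prog.exec, ga2, hd, hprod, -List.getD_eq_getElem?_getD]
    rw [← hj, ← hdd]; omega
  have k18 : s5.reg 18 = j + 1 := by simp [e5, e4, e3, Prog.exec, hj]
  have k16 : s5.reg 16 = d := by
    simp [e5, e4, e3, Prog.exec, ga2, hd, ← hj, hdd]
  have k15 : s5.reg 15 = (ds.take j).prod := by simp [e5, e4, e3, Prog.exec, hprod]
  have k17 : s5.reg 17 = (ds.take j).prod * d := by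
    simp [e5, e4, e3, Prog.exec, ga2, hd, ← hj, hdd, hprod]
  have k2 : s5.reg 2 = ds.length := by
    rw [ha5.reg 2 (by decide), ha4.reg 2 (by decide), ha3.reg 2 (by decide),
      ha2.reg 2 (by decide), ha1.reg 2 (by decide), hk]
  have k3 : s5.reg 3 = N := by
    rw [ha5.reg 3 (by decide), ha4.reg 3 (by decide), ha3.reg 3 (by decide),
      ha2.reg 3 (by decide), ha1.reg 3 (by decide), h3]
  have kar : s5.arr = s2.arr := by simp [e5, e4, e3, Prog.exec]
  refine (buildTable_does hds hW (by decide) (by decide) hs5 k2 k3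
    (fun i => by rw [kar, ga2, hd]) (by omega)
    (by rw [kar, ha2.arr 18 (by decide), ga, hz'])).mono le_rfl ?_
  rintro s6 hs6 ha6 ⟨hB2, hlast2⟩
  rw [k18] at hB2
  have hsplit : ds = ds.take j ++ d :: ds.drop (j + 1) := by
    conv_lhs => rw [← List.take_append_drop j ds]
    congr 1
    rw [hdd, List.getD_eq_getElem _ _ hlt]
    exact List.drop_eq_getElem_cons hlt
  have hNe : N = (ds.take j).prod * d * (ds.drop (j + 1)).prod := by
    rw [hN]; conv_lhs => rw [hsplit]
    simp [mul_assoc]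
  -- If the second table stopped too early, both stopping conditions together would give N * N < N *
  -- N.
  have hend : s6.reg 18 = ds.length := by
    by_contra hcon
    have hlt2 : s6.reg 18 < ds.length := lt_of_le_of_ne hB2.le hcon
    have h1 := hlast2 hlt2
    have h2 : s6.reg 26 * ds.getD (s6.reg 18) 0 ≤ (ds.drop (j + 1)).prod := by
      rw [hB2.prod, ← List.prod_singleton (x := ds.getD (s6.reg 18) 0), ← List.prod_append,
        ← segment_succ hB2.ge hlt2]
      exact take_prod_le (fun x hx => hds x (List.mem_of_mem_drop hx)) _
    rw [hprod] at hlast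
    have h3 := lt_of_lt_of_le h1 (Nat.mul_le_mul h2 h2)
    have h4 := Nat.mul_lt_mul'' hlast h3
    have h5 : N * N = (ds.take j).prod * d * ((ds.take j).prod * d) *
        ((ds.drop (j + 1)).prod * (ds.drop (j + 1)).prod) := by
      conv_lhs => rw [hNe]
      ring
    exact h4.ne h5
  refine ⟨ds.take j, d, ds.drop (j + 1), hsplit, ?_, ?_, ?_, ?_, ?_, ?_⟩
  · rw [ha6.reg 3 (by decide), k3]
  · rw [ha6.reg 15 (by decide), k15]
  · rw [ha6.reg 16 (by decide), k16]
  · rw [ha6.reg 17 (by decide), k17]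
  · rw [ha6.arr 17 (by decide), kar]
    have := hB.table
    simpa [IsTable, ← hj] using this
  · have := hB2.table
    rw [hend, List.take_of_length_le (by simp)] at this
    exact this

end IrregularLabeling

namespace IrregularLabeling

/-! ### Choosing the weights -/

section selection

variable {A : Type*} [AddCommGroup A] [DecidableEq A]

/-- The elements chosen for the two colour classes. -/
abbrev Sel (A : Type*) := List A × List A

namespace Sel

/-- Put `x` and `y` into the first class if two more elements fit there, else into the second. -/
def put2 (a : ℕ) (x y : A) (σ : Sel A) : Sel A :=
  if 1 < a - σ.1.length then (y :: x :: σ.1, σ.2) else (σ.1, y :: x :: σ.2)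

/-- The number of elements that are still missing. -/
def rem (a b : ℕ) (σ : Sel A) : ℕ := (a - σ.1.length) + (b - σ.2.length)

def used (σ : Sel A) : Finset A := (σ.1 ++ σ.2).toFinset

/-- An even number of elements is missing in both classes. -/
structure Shape (a b : ℕ) (σ : Sel A) : Prop where
  nodup : (σ.1 ++ σ.2).Nodup
  le₁ : σ.1.length ≤ a
  le₂ : σ.2.length ≤ b
  even₁ : Even (a - σ.1.length)
  even₂ : Even (b - σ.2.length)

def Balanced (σ : Sel A) : Prop := σ.1.sum = σ.2.sum

theorem mem_used {σ : Sel A} {x : A} : x ∈ σ.used ↔ x ∈ σ.1 ∨ x ∈ σ.2 := by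
  simp [used]

theorem Shape.card_used {a b : ℕ} {σ : Sel A} (h : σ.Shape a b) :
    σ.used.card + σ.rem a b = a + b := by
  rw [used, List.toFinset_card_of_nodup h.nodup, List.length_append, rem]
  have := h.le₁; have := h.le₂; omega

theorem Shape.even_rem {a b : ℕ} {σ : Sel A} (h : σ.Shape a b) : Even (σ.rem a b) :=
  h.even₁.add h.even₂

theorem put2_perm (a : ℕ) (x y : A) (σ : Sel A) :
    ((σ.put2 a x y).1 ++ (σ.put2 a x y).2).Perm (x :: y :: (σ.1 ++ σ.2)) := by
  unfold put2; split
  · exact List.Perm.swap _ _ _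
  · refine (List.perm_append_comm).trans ?_
    refine (List.Perm.swap _ _ _).trans ?_
    exact (List.perm_append_comm.cons _).cons _

/-- Both deficits are even and not both are 0, so one class has room for two more elements. Keeping
the deficits even is why elements are always added in pairs. -/
theorem Shape.put2 {a b : ℕ} {σ : Sel A} (h : σ.Shape a b) (hr : 2 ≤ σ.rem a b) {x y : A}
    (hxy : x ≠ y) (hx : x ∉ σ.used) (hy : y ∉ σ.used) : (σ.put2 a x y).Shape a b := by
  have hnd : ((σ.put2 a x y).1 ++ (σ.put2 a x y).2).Nodup := by
    rw [(put2_perm a x y σ).nodup_iff]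
    have hx' : x ∉ σ.1 ++ σ.2 := by simpa [used] using hx
    have hy' : y ∉ σ.1 ++ σ.2 := by simpa [used] using hy
    exact List.nodup_cons.2 ⟨by simp [hxy] at hx' ⊢; exact hx', List.nodup_cons.2 ⟨hy', h.nodup⟩⟩
  obtain ⟨h1, h2, h3, h4, h5⟩ := h
  refine ⟨hnd, ?_, ?_, ?_, ?_⟩ <;> unfold Sel.put2 <;> unfold Sel.rem at hr <;>
    rw [Nat.even_iff] at * <;> split <;> simp <;> omega

theorem used_put2 (a : ℕ) (x y : A) (σ : Sel A) :
    (σ.put2 a x y).used = σ.used ∪ {x, y} := by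
  ext z
  have := (put2_perm a x y σ).mem_iff (a := z)
  simp only [used, List.mem_toFinset, this, Finset.mem_union, List.mem_cons, Finset.mem_insert,
    Finset.mem_singleton]
  tauto

/-- The class that receives the pair is not controlled, so the change of the difference of the sums
is known only up to sign. This is enough if x + y is 0, or if two such changes by an involution
follow each other. -/
theorem put2_sum (a : ℕ) (x y : A) (σ : Sel A) :
    (σ.put2 a x y).1.sum - (σ.put2 a x y).2.sum = σ.1.sum - σ.2.sum + (x + y) ∨
    (σ.put2 a x y).1.sum - (σ.put2 a x y).2.sum = σ.1.sum - σ.2.sum - (x + y) := by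
  unfold put2; split
  · left; simp; abel
  · right; simp; abel

/-- Choose the pair `x, -x` if possible and necessary. -/
def pairStep (a b : ℕ) (σ : Sel A) (x : A) : Sel A :=
  if 1 < σ.rem a b ∧ x ≠ -x ∧ x ∉ σ.used ∧ -x ∉ σ.used then σ.put2 a x (-x) else σ

/-- P is the set of the elements added, closed under negation. If the choice stays incomplete, every
element is unsuitable at the end: the set of used elements only grows, so an element rejected once
remains unsuitable. -/
theorem foldl_pairStep {a b : ℕ} (xs : List A) {σ : Sel A} (h : σ.Shape a b) (hb : σ.Balanced) :
    (xs.foldl (pairStep a b) σ).Shape a b ∧ (xs.foldl (pairStep a b) σ).Balanced ∧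
      ∃ P : Finset A, (xs.foldl (pairStep a b) σ).used = σ.used ∪ P ∧ Disjoint σ.used P ∧
        (∀ x ∈ P, x ≠ -x ∧ -x ∈ P) ∧ ((xs.foldl (pairStep a b) σ).rem a b = 0 ∨
          ∀ x ∈ xs, x = -x ∨ x ∈ (xs.foldl (pairStep a b) σ).used ∨
            -x ∈ (xs.foldl (pairStep a b) σ).used) := by
  induction xs generalizing σ with
  | nil => exact ⟨h, hb, ∅, by simp, by simp, by simp, Or.inr (by simp)⟩
  | cons x xs ih =>
    rw [List.foldl_cons]
    by_cases hc : 1 < σ.rem a b ∧ x ≠ -x ∧ x ∉ σ.used ∧ -x ∉ σ.used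
    · have hstep : pairStep a b σ x = σ.put2 a x (-x) := if_pos hc
      rw [hstep]
      obtain ⟨c1, c2, c3, c4⟩ := hc
      have hb' : (σ.put2 a x (-x)).Balanced := by
        unfold Balanced at hb ⊢
        rcases put2_sum a x (-x) σ with e | e <;> rw [hb] at e <;> simp at e <;>
          exact sub_eq_zero.1 e
      obtain ⟨q1, q2, P, q3, q4, q5, q6⟩ := ih (h.put2 c1 c2 c3 c4) hb'
      rw [used_put2] at q3 q4
      refine ⟨q1, q2, {x, -x} ∪ P, ?_, ?_, ?_, ?_⟩
      · rw [q3, Finset.union_assoc]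
      · rw [Finset.disjoint_union_left] at q4
        rw [Finset.disjoint_union_right]
        refine ⟨?_, q4.1⟩
        rw [Finset.disjoint_right]
        simp only [Finset.mem_insert, Finset.mem_singleton]
        rintro z (rfl | rfl) <;> assumption
      · intro z hz
        simp only [Finset.mem_union, Finset.mem_insert, Finset.mem_singleton] at hz ⊢
        rcases hz with (rfl | rfl) | hz
        · exact ⟨c2, Or.inl (Or.inr rfl)⟩
        · exact ⟨by rw [neg_neg]; exact c2.symm, Or.inl (Or.inl (neg_neg x))⟩
        · exact ⟨(q5 z hz).1, Or.inr (q5 z hz).2⟩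
      · rcases q6 with q6 | q6
        · exact Or.inl q6
        · right
          intro z hz
          rcases List.mem_cons.1 hz with rfl | hz
          · right; left; rw [q3]; simp
          · exact q6 z hz
    · have hstep : pairStep a b σ x = σ := if_neg hc
      rw [hstep]
      obtain ⟨q1, q2, P, q3, q4, q5, q6⟩ := ih h hb
      refine ⟨q1, q2, P, q3, q4, q5, ?_⟩
      rcases q6 with q6 | q6
      · exact Or.inl q6
      · by_cases hr : 1 < σ.rem a b
        · right
          intro z hz
          rcases List.mem_cons.1 hz with rfl | hz
          · rw [q3]
            simp only [Finset.mem_union]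
            tauto
          · exact q6 z hz
        -- The deficit never grows, and it is even, so a deficit of at most 1 ends as 0.
        · left
          have e1 := h.card_used
          have e2 := q1.card_used
          have e3 : σ.used.card ≤ (List.foldl (pairStep a b) σ xs).used.card :=
            Finset.card_le_card (by rw [q3]; exact Finset.subset_union_left)
          have e4 := q1.even_rem
          rw [Nat.even_iff] at e4
          omega

/-- Choose a coset of `{0, α, β, α + β}` if possible and necessary. -/
def cosetStep (a b : ℕ) (α β : A) (σ : Sel A) (x : A) : Sel A :=
  if 3 < σ.rem a b ∧ x = -x ∧ x ∉ σ.used ∧ x - α ∉ σ.used ∧ x - β ∉ σ.used ∧ x - α - β ∉ σ.used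
  then (σ.put2 a x (x - α)).put2 a (x - β) (x - α - β) else σ

/-- `α` and `β` generate a Klein four-group. -/
structure Klein (α β : A) : Prop where
  two_left : α + α = 0
  two_right : β + β = 0
  left_ne : α ≠ 0
  right_ne : β ≠ 0
  ne : α ≠ β

/-- The coset steps are written with subtraction, the only group operation that the machine
tabulates; for involutions it agrees with addition. -/
theorem sub_eq_add_of_two {α : A} (h : α + α = 0) (x : A) : x - α = x + α := by
  rw [sub_eq_add_neg, neg_eq_of_add_eq_zero_left h]

set_option maxHeartbeats 1000000 in
-- C is the union of the added cosets; it consists of self-inverse elements and is closed under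
-- translation by α and β. Four elements are added at a time, so the deficit keeps its residue mod
-- 4. As for pairs, if four or more elements are still missing, no free coset of self-inverse
-- elements remains.
theorem foldl_cosetStep {a b : ℕ} {α β : A} (hK : Klein α β) (xs : List A) {σ : Sel A}
    (h : σ.Shape a b) (hb : σ.Balanced) :
    (xs.foldl (cosetStep a b α β) σ).Shape a b ∧ (xs.foldl (cosetStep a b α β) σ).Balanced ∧
      (xs.foldl (cosetStep a b α β) σ).rem a b % 4 = σ.rem a b % 4 ∧
      ∃ C : Finset A, (xs.foldl (cosetStep a b α β) σ).used = σ.used ∪ C ∧ Disjoint σ.used C ∧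
        (∀ x ∈ C, x = -x ∧ x + α ∈ C ∧ x + β ∈ C) ∧
        ((xs.foldl (cosetStep a b α β) σ).rem a b < 4 ∨
          ∀ x ∈ xs, x = -x → x ∈ (xs.foldl (cosetStep a b α β) σ).used ∨
            x + α ∈ (xs.foldl (cosetStep a b α β) σ).used ∨
            x + β ∈ (xs.foldl (cosetStep a b α β) σ).used ∨
            x + α + β ∈ (xs.foldl (cosetStep a b α β) σ).used) := by
  induction xs generalizing σ with
  | nil => exact ⟨h, hb, rfl, ∅, by simp, by simp, by simp, Or.inr (by simp)⟩
  | cons x xs ih =>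
    rw [List.foldl_cons]
    by_cases hc : 3 < σ.rem a b ∧ x = -x ∧ x ∉ σ.used ∧ x - α ∉ σ.used ∧ x - β ∉ σ.used ∧
        x - α - β ∉ σ.used
    · have hstep : cosetStep a b α β σ x =
          (σ.put2 a x (x - α)).put2 a (x - β) (x - α - β) := if_pos hc
      rw [hstep]
      obtain ⟨c1, c2, c3, c4, c5, c6⟩ := hc
      simp only [sub_eq_add_of_two hK.two_left, sub_eq_add_of_two hK.two_right] at c4 c5 c6 ⊢
      have hxx : x + x = 0 := by
        nth_rewrite 2 [c2]; exact add_neg_cancel x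
      have hαβ : α + β ≠ 0 := by
        intro e
        exact hK.ne (add_right_cancel (e.trans hK.two_right.symm))
      have n1 : x ≠ x + α := by simpa using hK.left_ne
      have n2 : x ≠ x + β := by simpa using hK.right_ne
      have n3 : x ≠ x + α + β := by simpa [add_assoc] using hαβ
      have n4 : x + α ≠ x + β := by simpa using hK.ne
      have n5 : x + α ≠ x + α + β := by simpa using hK.right_ne
      have n6 : x + β ≠ x + α + β := by
        rw [add_right_comm]; simpa using hK.left_ne
      have h1 := h.put2 (x := x) (y := x + α) (by omega) n1 c3 c4
      have hr1 : (σ.put2 a x (x + α)).rem a b + 2 = σ.rem a b := by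
        have e1 := h.card_used
        have e2 := h1.card_used
        rw [used_put2, Finset.card_union_of_disjoint, Finset.card_pair n1] at e2
        · omega
        · rw [Finset.disjoint_right]
          simp only [Finset.mem_insert, Finset.mem_singleton]
          rintro z (rfl | rfl) <;> assumption
      have h2 := h1.put2 (x := x + β) (y := x + α + β) (by omega) n6
        (by
          rw [used_put2, Finset.notMem_union, Finset.mem_insert, Finset.mem_singleton, not_or]
          exact ⟨c5, n2.symm, n4.symm⟩)
        (by
          rw [used_put2, Finset.notMem_union, Finset.mem_insert, Finset.mem_singleton, not_or]
          exact ⟨c6, n3.symm, n5.symm⟩)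
      have hb1 : ((σ.put2 a x (x + α)).put2 a (x + β) (x + α + β)).Balanced := by
        unfold Balanced at hb ⊢
        -- Both halves of the coset have sum α, and α + α = 0 = α - α. So the four possible
        -- distributions over the classes all leave the sums equal.
        have e0 : x + (x + α) = α := by rw [← add_assoc, hxx, zero_add]
        have e0' : x + β + (x + α + β) = α := by
          calc x + β + (x + α + β) = (x + x) + (β + β) + α := by abel
            _ = α := by rw [hxx, hK.two_right]; simp
        have e1 := put2_sum a x (x + α) σ
        have e2 := put2_sum a (x + β) (x + α + β) (σ.put2 a x (x + α))
        rw [hb, e0, sub_self] at e1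
        rw [e0'] at e2
        refine sub_eq_zero.1 ?_
        have hα := hK.two_left
        have hα' : -α = α := neg_eq_of_add_eq_zero_left hα
        rcases e1 with e1 | e1 <;> rw [e1] at e2 <;> rcases e2 with e2 | e2 <;>
          simp [hα, hα', sub_eq_add_neg] at e2 <;> rw [sub_eq_add_neg, e2]
      have hU : ((σ.put2 a x (x + α)).put2 a (x + β) (x + α + β)).used =
          σ.used ∪ {x, x + α, x + β, x + α + β} := by
        rw [used_put2, used_put2, Finset.union_assoc, Finset.insert_union, Finset.singleton_union]
      have hdisj : Disjoint σ.used {x, x + α, x + β, x + α + β} := by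
        rw [Finset.disjoint_right]
        simp only [Finset.mem_insert, Finset.mem_singleton]
        rintro z (rfl | rfl | rfl | rfl) <;> assumption
      have hr2 : ((σ.put2 a x (x + α)).put2 a (x + β) (x + α + β)).rem a b + 4 =
          σ.rem a b := by
        have e1 := h.card_used
        have e2 := h2.card_used
        have e4 : ({x, x + α, x + β, x + α + β} : Finset A).card = 4 := by
          rw [Finset.card_insert_of_notMem (by simp [n1, n2, n3, -left_eq_add]),
            Finset.card_insert_of_notMem (by simp [n4, n5, -left_eq_add]), Finset.card_pair n6]
        rw [hU, Finset.card_union_of_disjoint hdisj, e4] at e2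
        omega
      obtain ⟨q1, q2, q0, C, q3, q4, q5, q6⟩ := ih h2 hb1
      rw [hU] at q3 q4
      refine ⟨q1, q2, by omega, {x, x + α, x + β, x + α + β} ∪ C, ?_, ?_, ?_, ?_⟩
      · rw [q3, Finset.union_assoc]
      · rw [Finset.disjoint_union_left] at q4
        rw [Finset.disjoint_union_right]
        exact ⟨hdisj, q4.1⟩
      · have hα0 := hK.two_left
        have hβ0 := hK.two_right
        have neg_of : ∀ z : A, z + z = 0 → z = -z := fun z hz => eq_neg_of_add_eq_zero_left hz
        have t1 : (x + α) + (x + α) = 0 := by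
          calc _ = (x + x) + (α + α) := by abel
            _ = 0 := by rw [hxx, hα0, add_zero]
        have t2 : (x + β) + (x + β) = 0 := by
          calc _ = (x + x) + (β + β) := by abel
            _ = 0 := by rw [hxx, hβ0, add_zero]
        have t3 : (x + α + β) + (x + α + β) = 0 := by
          calc _ = (x + x) + (α + α) + (β + β) := by abel
            _ = 0 := by rw [hxx, hα0, hβ0]; simp
        have u1 : x + α + α = x := by rw [add_assoc, hα0, add_zero]
        have u2 : x + β + β = x := by rw [add_assoc, hβ0, add_zero]
        have u3 : x + α + β + α = x + β := by
          calc _ = x + β + (α + α) := by abel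
            _ = _ := by rw [hα0, add_zero]
        have u4 : x + α + β + β = x + α := by rw [add_assoc, hβ0, add_zero]
        have u5 : x + β + α = x + α + β := by abel
        intro z hz
        have m : ∀ w ∈ ({x, x + α, x + β, x + α + β} : Finset A),
            w ∈ ({x, x + α, x + β, x + α + β} : Finset A) ∪ C :=
          fun w hw => Finset.mem_union_left _ hw
        rcases Finset.mem_union.1 hz with hz | hz
        · simp only [Finset.mem_insert, Finset.mem_singleton] at hz
          rcases hz with rfl | rfl | rfl | rfl
          · exact ⟨c2, m _ (by simp), m _ (by simp)⟩
          · rw [u1]; exact ⟨neg_of _ t1, m _ (by simp), m _ (by simp)⟩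
          · rw [u2, u5]; exact ⟨neg_of _ t2, m _ (by simp), m _ (by simp)⟩
          · rw [u3, u4]; exact ⟨neg_of _ t3, m _ (by simp), m _ (by simp)⟩
        · obtain ⟨w1, w2, w3⟩ := q5 z hz
          exact ⟨w1, Finset.mem_union_right _ w2, Finset.mem_union_right _ w3⟩
      · rcases q6 with q6 | q6
        · exact Or.inl q6
        · right
          intro z hz hzz
          rcases List.mem_cons.1 hz with rfl | hz
          · left; rw [q3]; simp
          · exact q6 z hz hzz
    · have hstep : cosetStep a b α β σ x = σ := if_neg hc
      rw [hstep]
      obtain ⟨q1, q2, q0, C, q3, q4, q5, q6⟩ := ih h hb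
      refine ⟨q1, q2, q0, C, q3, q4, q5, ?_⟩
      rcases q6 with q6 | q6
      · exact Or.inl q6
      · by_cases hr : 3 < σ.rem a b
        · right
          intro z hz hzz
          rcases List.mem_cons.1 hz with rfl | hz
          · simp only [sub_eq_add_of_two hK.two_left, sub_eq_add_of_two hK.two_right] at hc
            rw [q3]
            simp only [Finset.mem_union]
            tauto
          · exact q6 z hz hzz
        · left
          have e1 := h.card_used
          have e2 := q1.card_used
          have e3 : σ.used.card ≤ (List.foldl (cosetStep a b α β) σ xs).used.card :=
            Finset.card_le_card (by rw [q3]; exact Finset.subset_union_left)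
          omega

variable [Fintype A]

/-- Pairs suffice to complete the choice if few elements are unsuitable. -/
theorem complete_pairs {a b : ℕ} {xs : List A} (hxs : ∀ x, x ∈ xs) {σ : Sel A}
    (h : σ.Shape a b) (hb : σ.Balanced) (B : Finset A)
    (hB : ∀ x, x = -x ∨ x ∈ σ.used ∨ -x ∈ σ.used → x ∈ B)
    (hcard : B.card + (a + b) ≤ Fintype.card A + σ.used.card) :
    (xs.foldl (pairStep a b) σ).rem a b = 0 := by
  obtain ⟨q1, q2, P, q3, q4, q5, q6⟩ := foldl_pairStep xs h hb
  rcases q6 with q6 | q6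
  · exact q6
  -- If the choice is incomplete, each element is unsuitable from the start or has been used in a
  -- pair. Counting then contradicts the bound on B.
  · have huniv : Finset.univ ⊆ B ∪ P := by
      intro x _
      have h1 := q6 x (hxs x)
      rw [q3] at h1
      simp only [Finset.mem_union] at h1 ⊢
      rcases h1 with h1 | (h1 | h1) | (h1 | h1)
      · exact Or.inl (hB x (by tauto))
      · exact Or.inl (hB x (by tauto))
      · exact Or.inr h1
      · exact Or.inl (hB x (by tauto))
      · have := (q5 _ h1).2
        rw [neg_neg] at this
        exact Or.inr this
    have h1 := (Finset.card_le_card huniv).trans (Finset.card_union_le _ _)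
    rw [Finset.card_univ] at h1
    have h2 := q1.card_used
    rw [q3, Finset.card_union_of_disjoint q4] at h2
    omega

/-- Cosets and pairs suffice to complete the choice if few elements are unsuitable. -/
theorem complete_cosets {a b : ℕ} {α β : A} (hK : Klein α β) {xs : List A} (hxs : ∀ x, x ∈ xs)
    {σ : Sel A} (h : σ.Shape a b) (hb : σ.Balanced) (h2 : ∀ x ∈ σ.used, x = -x) (B : Finset A)
    (hB : ∀ x ∈ σ.used, x ∈ B ∧ x + α ∈ B ∧ x + β ∈ B ∧ x + α + β ∈ B)
    (hcard : B.card + (a + b) ≤ Fintype.card A + σ.used.card)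
    (hr : σ.rem a b % 4 = 0 ∨ ∃ x : A, x ≠ -x) :
    (xs.foldl (pairStep a b) (xs.foldl (cosetStep a b α β) σ)).rem a b = 0 := by
  obtain ⟨p1, p2, p0, C, p3, p4, p5, p6⟩ := foldl_cosetStep hK xs h hb
  set σ' := xs.foldl (cosetStep a b α β) σ with hσ'
  obtain ⟨q1, q2, P, q3, q4, q5, q6⟩ := foldl_pairStep xs p1 p2
  set σ'' := xs.foldl (pairStep a b) σ' with hσ''
  by_contra hne
  have q6 := q6.resolve_left hne
  have hT : ∀ x ∈ σ'.used, x = -x := by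
    intro x hx
    rw [p3, Finset.mem_union] at hx
    rcases hx with hx | hx
    · exact h2 x hx
    · exact (p5 x hx).1
  have hP : ∀ x, x = -x ∨ x ∈ P := by
    intro x
    have h1 := q6 x (hxs x)
    rw [q3] at h1
    simp only [Finset.mem_union] at h1
    rcases h1 with h1 | (h1 | h1) | (h1 | h1)
    · exact Or.inl h1
    · exact Or.inl (hT x h1)
    · exact Or.inr h1
    · have := hT _ h1
      rw [neg_neg] at this
      exact Or.inl this.symm
    · have := (q5 _ h1).2
      rw [neg_neg] at this
      exact Or.inr this
  have e1 := p1.card_used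
  have e2 := q1.card_used
  have e3 := h.card_used
  rw [q3, Finset.card_union_of_disjoint q4] at e2
  have ev := q1.even_rem
  have ev' := p1.even_rem
  rw [Nat.even_iff] at ev ev'
  rcases p6 with p6 | p6
  -- After the cosets the deficit is 0 or 2. If it is still positive at the end, no pair was added,
  -- although nothing except self-inverse elements had been used; so there is no x ≠ -x, and the
  -- residue mod 4 excludes a deficit of 2.
  · have : P.card = 0 := by omega
    rw [Finset.card_eq_zero] at this
    rcases hr with hr | ⟨x, hx⟩
    · omega
    · rcases hP x with h | h
      · exact hx h
      · rw [this] at h; simp at h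
  -- Otherwise the cosets were exhausted: self-inverse elements lie in C or in a coset touched by
  -- the initial choice, hence in B, and all others were used in pairs.
  · have huniv : Finset.univ ⊆ (C ∪ B) ∪ P := by
      intro x _
      rcases hP x with hx | hx
      · refine Finset.mem_union_left _ ?_
        have h1 := p6 x (hxs x) hx
        have hback : ∀ y ∈ σ'.used, y ∈ C ∪ B ∧ y + α ∈ C ∪ B ∧ y + β ∈ C ∪ B ∧
            y + α + β ∈ C ∪ B := by
          intro y hy
          rw [p3, Finset.mem_union] at hy
          simp only [Finset.mem_union]
          rcases hy with hy | hy
          · obtain ⟨w1, w2, w3, w4⟩ := hB y hy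
            exact ⟨Or.inr w1, Or.inr w2, Or.inr w3, Or.inr w4⟩
          · obtain ⟨w1, w2, w3⟩ := p5 y hy
            exact ⟨Or.inl hy, Or.inl w2, Or.inl w3, Or.inl (p5 _ w2).2.2⟩
        have hα0 := hK.two_left
        have hβ0 := hK.two_right
        rcases h1 with h1 | h1 | h1 | h1
        · exact (hback _ h1).1
        · have := (hback _ h1).2.1
          rwa [add_assoc, hα0, add_zero] at this
        · have := (hback _ h1).2.2.1
          rwa [add_assoc, hβ0, add_zero] at this
        · have := (hback _ h1).2.2.2
          have e : x + α + β + α + β = x := by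
            calc _ = x + (α + α) + (β + β) := by abel
              _ = x := by rw [hα0, hβ0]; simp
          rwa [e] at this
      · exact Finset.mem_union_right _ hx
    have h1 := (Finset.card_le_card huniv).trans ((Finset.card_union_le _ _).trans
      (Nat.add_le_add_right (Finset.card_union_le _ _) _))
    rw [Finset.card_univ] at h1
    rw [p3, Finset.card_union_of_disjoint p4] at e2
    omega

end Sel

end selection

end IrregularLabeling

namespace IrregularLabeling

/-! ### Programs that choose the weights -/

theorem Sel.rem_put2 {A : Type*} {a b : ℕ} {σ : Sel A} (x y : A) (h1 : σ.1.length ≤ a)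
    (h2 : σ.2.length ≤ b) (h3 : Even (a - σ.1.length)) (h4 : Even (b - σ.2.length))
    (hr : 2 ≤ σ.rem a b) :
    (σ.put2 a x y).1.length ≤ a ∧ (σ.put2 a x y).2.length ≤ b ∧
      Even (a - (σ.put2 a x y).1.length) ∧ Even (b - (σ.put2 a x y).2.length) ∧
      (σ.put2 a x y).rem a b + 2 = σ.rem a b := by
  unfold Sel.put2; unfold Sel.rem at *
  rw [Nat.even_iff] at *
  rw [Nat.even_iff]
  split <;> simp <;> omega

variable {W : ℕ} {ds : List ℕ}

/-- The cells of colour `c`, of which there are `cnt`, are filled from the end with `l`. -/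
structure ColRep (ds : List ℕ) (s : Store) (c cnt : ℕ) (l : List (CyclicProduct ds)) : Prop where
  need : s.arr 14 c = cnt - l.length
  cell : ∀ i g, l[i]? = some g → s.arr 15 (2 * (cnt - l.length + i) + c) = code ds g

/-- The store represents the choice `σ`, the first class having colour `z`. -/
structure Rep (ds : List ℕ) (a b z : ℕ) (s : Store) (σ : Sel (CyclicProduct ds)) : Prop where
  le : z ≤ 1
  rA : s.reg 27 = z
  rB : s.reg 28 = 1 - z
  fst : ColRep ds s z a σ.1
  snd : ColRep ds s (1 - z) b σ.2
  used : ∀ g, s.arr 16 (code ds g) ≠ 0 ↔ g ∈ σ.used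

theorem ColRep.congr {s s' : Store} {c cnt : ℕ} {l : List (CyclicProduct ds)}
    (h : ColRep ds s c cnt l) (h14 : s'.arr 14 = s.arr 14) (h15 : s'.arr 15 = s.arr 15) :
    ColRep ds s' c cnt l :=
  ⟨by rw [h14, h.need], fun i g hg => by rw [h15, h.cell i g hg]⟩

theorem Rep.congr {a b z : ℕ} {s s' : Store} {σ : Sel (CyclicProduct ds)}
    (h : Rep ds a b z s σ) (hr : ∀ x ∈ [27, 28], s'.reg x = s.reg x)
    (ha : ∀ x ∈ [14, 15, 16], s'.arr x = s.arr x) : Rep ds a b z s' σ :=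
  ⟨h.le, by rw [hr 27 (by simp), h.rA], by rw [hr 28 (by simp), h.rB],
    h.fst.congr (ha 14 (by simp)) (ha 15 (by simp)), h.snd.congr (ha 14 (by simp)) (ha 15 (by simp)),
    fun g => by rw [ha 16 (by simp), h.used g]⟩

/-- Put the value of register `v` into the class whose colour is in register `c`. -/
def put (c v : ℕ) : Prog :=
  .store 14 #c (.cell 14 #c - 1) ;; .store 15 (2 * .cell 14 #c + #c) #v ;; .store 16 #v 1

/-- Filling each class from its end lets the number of missing elements serve as the index of the
next cell. -/
theorem put_does (hds : ∀ d ∈ ds, 2 ≤ d) {c v k k' cnt cnt' : ℕ} {l l' : List (CyclicProduct ds)}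
    {s : Store}
    (hs : s.Bounded W) (hW : 2 * cnt + 4 < W) (hc : s.reg c = k) (hk : k ≤ 1) (hk' : k' ≤ 1)
    (hkk : k ≠ k') (h : ColRep ds s k cnt l) (h' : ColRep ds s k' cnt' l')
    (hl : l.length < cnt) {g : CyclicProduct ds} (hv : s.reg v = code ds g)
    {U : Finset (CyclicProduct ds)} (hU : ∀ g, s.arr 16 (code ds g) ≠ 0 ↔ g ∈ U) :
    Does W (put c v) 17 s (fun s' => ColRep ds s' k cnt (g :: l) ∧ ColRep ds s' k' cnt' l' ∧
      ∀ h, s'.arr 16 (code ds h) ≠ 0 ↔ h ∈ insert g U) := by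
  have hn := h.need
  refine Does.mono (T := (put c v).time) (Does.of_exec (by omega) hs ?_ ?_)
    (Nat.le_of_ble_eq_true rfl) fun _ _ _ h => h
  · simp [put, Prog.Ok, Prog.exec, hc, hn]; omega
  · refine ⟨⟨?_, ?_⟩, ⟨?_, ?_⟩, ?_⟩
    · simp [put, Prog.exec, hc, hn]; omega
    · intro i x hx
      simp only [put, Prog.exec, Expr.val_reg, Expr.val_cell, Expr.val_sub,
        Store.setCell_reg, Store.setCell_arr, hc, hn, hv, Expr.val_add, Expr.val_mul, if_true,
        if_neg (by decide : ¬ (15 = 14)), if_neg (by decide : ¬ (15 = 16)), Function.update_self,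
        Expr.val_ofNat, List.length_cons]
      rw [Function.update_apply]
      cases i with
      | zero =>
        rw [if_pos (by omega)]
        simp at hx; rw [hx]
      | succ i =>
        rw [if_neg (by omega)]
        rw [List.getElem?_cons_succ] at hx
        rw [← h.cell i x hx]
        congr 1; omega
    · simp [put, Prog.exec, hc, hn, h'.need, hkk.symm]
    · intro i x hx
      simp only [put, Prog.exec, Expr.val_reg, Expr.val_cell, Expr.val_sub,
        Store.setCell_reg, Store.setCell_arr, hc, hn, hv, Expr.val_add, Expr.val_mul, if_true,
        if_neg (by decide : ¬ (15 = 14)), if_neg (by decide : ¬ (15 = 16)), Function.update_self,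
        Expr.val_ofNat]
      -- Cells of different colours have indices of different parity.
      rw [Function.update_apply, if_neg (by omega), h'.cell i x hx]
    · intro x
      simp only [put, Prog.exec, Expr.val_reg, Store.setCell_reg, Store.setCell_arr, hv, if_true,
        Expr.val_one, if_neg (by decide : ¬ (16 = 15)), if_neg (by decide : ¬ (16 = 14))]
      rw [Function.update_apply, Finset.mem_insert]
      by_cases hx : x = g
      · simp [hx]
      · have : code ds x ≠ code ds g := fun e => hx (code_injective hds e)
        rw [if_neg this, hU]; simp [hx]

section
variable {a b z : ℕ} {s : Store} {σ : Sel (CyclicProduct ds)}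

theorem putA_does (hds : ∀ d ∈ ds, 2 ≤ d) {v : ℕ} (hs : s.Bounded W) (hW : 2 * a + 4 < W)
    (h : Rep ds a b z s σ)
    (hl : σ.1.length < a) {g : CyclicProduct ds} (hv : s.reg v = code ds g) :
    Does W (put 27 v) 17 s (fun s' => Rep ds a b z s' (g :: σ.1, σ.2)) := by
  have hz := h.le
  refine (put_does hds hs hW h.rA h.le (by omega : 1 - z ≤ 1) (by omega) h.fst h.snd hl hv
    h.used).mono le_rfl ?_
  rintro s' hs' ha ⟨h1, h2, h3⟩
  refine ⟨h.le, (ha.reg 27 (by simp [put, Prog.wregs])).trans h.rA,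
    (ha.reg 28 (by simp [put, Prog.wregs])).trans h.rB, h1, h2, fun x => ?_⟩
  rw [h3]; simp [Sel.mem_used]; tauto

theorem putB_does (hds : ∀ d ∈ ds, 2 ≤ d) {v : ℕ} (hs : s.Bounded W) (hW : 2 * b + 4 < W)
    (h : Rep ds a b z s σ)
    (hl : σ.2.length < b) {g : CyclicProduct ds} (hv : s.reg v = code ds g) :
    Does W (put 28 v) 17 s (fun s' => Rep ds a b z s' (σ.1, g :: σ.2)) := by
  have hz := h.le
  refine (put_does hds hs hW h.rB (by omega : 1 - z ≤ 1) h.le (by omega) h.snd h.fst hl hv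
    h.used).mono le_rfl ?_
  rintro s' hs' ha ⟨h1, h2, h3⟩
  refine ⟨h.le, (ha.reg 27 (by simp [put, Prog.wregs])).trans h.rA,
    (ha.reg 28 (by simp [put, Prog.wregs])).trans h.rB, h2, h1, fun x => ?_⟩
  rw [h3]; simp [Sel.mem_used]; tauto

end

/-- Put the values of registers `29` and `30` into the same class. -/
def putTwo : Prog :=
  .ite (1 <ₑ .cell 14 #27) (put 27 29 ;; put 27 30) (put 28 29 ;; put 28 30)

theorem putTwo_does (hds : ∀ d ∈ ds, 2 ≤ d) {a b z : ℕ} {s : Store}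
    {σ : Sel (CyclicProduct ds)} (hs : s.Bounded W)
    (hW : 2 * (a + b) + 4 < W) (h : Rep ds a b z s σ) (h1 : σ.1.length ≤ a)
    (h2 : σ.2.length ≤ b) (h3 : Even (a - σ.1.length)) (h4 : Even (b - σ.2.length))
    (hr : 2 ≤ σ.rem a b) {x y : CyclicProduct ds} (hx : s.reg 29 = code ds x)
    (hy : s.reg 30 = code ds y) :
    Does W putTwo 50 s (fun s' => Rep ds a b z s' (σ.put2 a x y)) := by
  rw [Nat.even_iff] at h3 h4
  have hneed := h.fst.need
  have key : Does W putTwo (4 + 1 + (17 + 17)) s (fun s' => Rep ds a b z s' (σ.put2 a x y)) := by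
    refine Does.ite (e := 1 <ₑ .cell 14 #27) (by omega) hs (by simp; omega) ?_ ?_
    · intro hv
      simp [h.rA, hneed] at hv
      have e : σ.put2 a x y = (y :: x :: σ.1, σ.2) := if_pos (by omega)
      rw [e]
      refine Does.seq (putA_does hds hs (by omega) h (by omega) hx) fun s1 hs1 ha1 hr1 => ?_
      exact putA_does hds hs1 (by omega) hr1 (by simp; omega)
        ((ha1.reg 30 (by simp [put, Prog.wregs])).trans hy)
    · intro hv
      simp [h.rA, hneed] at hv
      have e : σ.put2 a x y = (σ.1, y :: x :: σ.2) := if_neg (by omega)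
      rw [e]
      unfold Sel.rem at hr
      refine Does.seq (putB_does hds hs (by omega) h (by omega) hx) fun s1 hs1 ha1 hr1 => ?_
      exact putB_does hds hs1 (by omega) hr1 (by simp; omega)
        ((ha1.reg 30 (by simp [put, Prog.wregs])).trans hy)
  exact key.mono (by norm_num) fun _ _ _ h => h

/-- The expression reads nothing that `putTwo` or its preparation changes. -/
def Expr.Stable (e : Expr) : Prop :=
  (∀ x ∈ e.rregs, x ≠ 29 ∧ x ≠ 30) ∧ ∀ x ∈ e.rarrs, x ≠ 14 ∧ x ≠ 15 ∧ x ≠ 16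

instance (e : Expr) : Decidable e.Stable := by unfold Expr.Stable; infer_instance

theorem EvalTo.agree {p : Prog} {s s' : Store} {e : Expr} {g : CyclicProduct ds}
    (h : EvalTo W ds s e g) (hst : e.Stable) (hag : Agree p s s')
    (hp : ∀ x ∈ p.wregs, x = 29 ∨ x = 30) (hp' : ∀ x ∈ p.warrs, x = 14 ∨ x = 15 ∨ x = 16) :
    EvalTo W ds s' e g := by
  obtain ⟨h1, h2⟩ := e.congr (W := W) (s := s) (s' := s')
    (fun x hx => hag.reg x fun hm => by have := hst.1 x hx; have := hp x hm; omega)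
    (fun x hx => hag.arr x fun hm => by have := hst.2 x hx; have := hp' x hm; omega)
  exact ⟨h1.trans h.1, h2 h.2⟩

/-- Put the values of the expressions into the class whose colour is in register `c`. -/
def putList (c : ℕ) (es : List Expr) : Prog :=
  es.foldr (fun e p => .assign 29 e ;; put c 29 ;; p) .skip

/-- Put the values of the expressions into the classes in pairs. -/
def putPairs (es : List (Expr × Expr)) : Prog :=
  es.foldr (fun e p => .assign 29 e.1 ;; .assign 30 e.2 ;; putTwo ;; p) .skip

theorem assign29_does {v : ℕ} (hv : v = 29 ∨ v = 30) {a b z : ℕ} {s : Store}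
    {σ : Sel (CyclicProduct ds)}
    (hW : 1 < W) (hs : s.Bounded W) (h : Rep ds a b z s σ) {e : Expr} {g : CyclicProduct ds}
    (he : EvalTo W ds s e g) :
    Does W (.assign v e) (e.cost + 1) s
      (fun s' => Rep ds a b z s' σ ∧ s'.reg v = code ds g) := by
  refine (Does.exec (p := .assign v e) hW hs he.2).mono le_rfl fun s' _ _ e' => ?_
  have e1 := he.1
  refine ⟨h.congr (fun x hx => ?_) (fun x hx => ?_), ?_⟩
  · have : x ≠ v := by simp at hx; omega
    simp [e', Prog.exec, this]
  · simp [e', Prog.exec]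
  · simp [e', Prog.exec, e1]

theorem putListA_does (hds : ∀ d ∈ ds, 2 ≤ d) {a b z : ℕ} (hW : 2 * a + 4 < W) (es : List Expr)
    (hst : ∀ e ∈ es, e.Stable) {gs : List (CyclicProduct ds)} {s : Store}
    {σ : Sel (CyclicProduct ds)} (hs : s.Bounded W) (hev : List.Forall₂ (EvalTo W ds s) es gs)
    (h : Rep ds a b z s σ) (hl : σ.1.length + gs.length ≤ a) :
    Does W (putList 27 es) (putList 27 es).time s
      (fun s' => Rep ds a b z s' (gs.reverse ++ σ.1, σ.2)) := by
  induction es generalizing gs s σ with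
  | nil =>
    cases hev
    exact (Does.exec (p := .skip) (by omega) hs trivial).mono le_rfl fun s' _ _ e => e ▸ h
  | cons e es ih =>
    obtain ⟨g, gs', hg, hgs, rfl⟩ := List.forall₂_cons_left_iff.1 hev
    simp only [List.length_cons] at hl
    refine Does.mono (T := (e.cost + 1) + (17 + (putList 27 es).time)) ?_ ?_ fun _ _ _ h => h
    · refine Does.seq (assign29_does (Or.inl rfl) (by omega) hs h hg)
        fun s1 hs1 ha1 ⟨hr1, hv1⟩ => ?_
      refine Does.seq (putA_does hds hs1 hW hr1 (by omega) hv1) fun s2 hs2 ha2 hr2 => ?_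
      refine (ih (fun e he => hst e (by simp [he])) hs2 (gs := gs') ?_ hr2
        (by simp; omega)).mono le_rfl fun s3 _ _ hr3 => by simpa using hr3
      rw [List.forall₂_iff_get] at hgs ⊢
      refine ⟨hgs.1, fun i h1 h2 => ?_⟩
      have hsti := hst _ (List.mem_cons_of_mem _ (List.get_mem es ⟨i, h1⟩))
      refine ((hgs.2 i h1 h2).agree hsti ha1 (by simp [Prog.wregs])
        (by simp [Prog.warrs])).agree hsti ha2 (by simp [put, Prog.wregs])
        (by simp [put, Prog.warrs])
    · have : (put 27 29).time = 17 := rfl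
      change _ ≤ (e.cost + 1) + ((put 27 29).time + (putList 27 es).time)
      omega

theorem putListB_does (hds : ∀ d ∈ ds, 2 ≤ d) {a b z : ℕ} (hW : 2 * b + 4 < W) (es : List Expr)
    (hst : ∀ e ∈ es, e.Stable) {gs : List (CyclicProduct ds)} {s : Store}
    {σ : Sel (CyclicProduct ds)} (hs : s.Bounded W) (hev : List.Forall₂ (EvalTo W ds s) es gs)
    (h : Rep ds a b z s σ) (hl : σ.2.length + gs.length ≤ b) :
    Does W (putList 28 es) (putList 28 es).time s
      (fun s' => Rep ds a b z s' (σ.1, gs.reverse ++ σ.2)) := by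
  induction es generalizing gs s σ with
  | nil =>
    cases hev
    exact (Does.exec (p := .skip) (by omega) hs trivial).mono le_rfl fun s' _ _ e => e ▸ h
  | cons e es ih =>
    obtain ⟨g, gs', hg, hgs, rfl⟩ := List.forall₂_cons_left_iff.1 hev
    simp only [List.length_cons] at hl
    refine Does.mono (T := (e.cost + 1) + (17 + (putList 28 es).time)) ?_ ?_ fun _ _ _ h => h
    · refine Does.seq (assign29_does (Or.inl rfl) (by omega) hs h hg)
        fun s1 hs1 ha1 ⟨hr1, hv1⟩ => ?_
      refine Does.seq (putB_does hds hs1 hW hr1 (by omega) hv1) fun s2 hs2 ha2 hr2 => ?_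
      refine (ih (fun e he => hst e (by simp [he])) hs2 (gs := gs') ?_ hr2
        (by simp; omega)).mono le_rfl fun s3 _ _ hr3 => by simpa using hr3
      rw [List.forall₂_iff_get] at hgs ⊢
      refine ⟨hgs.1, fun i h1 h2 => ?_⟩
      have hsti := hst _ (List.mem_cons_of_mem _ (List.get_mem es ⟨i, h1⟩))
      refine ((hgs.2 i h1 h2).agree hsti ha1 (by simp [Prog.wregs])
        (by simp [Prog.warrs])).agree hsti ha2 (by simp [put, Prog.wregs])
        (by simp [put, Prog.warrs])
    · have : (put 28 29).time = 17 := rfl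
      change _ ≤ (e.cost + 1) + ((put 28 29).time + (putList 28 es).time)
      omega

theorem putPairs_does (hds : ∀ d ∈ ds, 2 ≤ d) {a b z : ℕ} (hW : 2 * (a + b) + 4 < W)
    (es : List (Expr × Expr)) (hst : ∀ e ∈ es, e.1.Stable ∧ e.2.Stable ∧ 29 ∉ e.2.rregs)
    {gs : List (CyclicProduct ds × CyclicProduct ds)} {s : Store}
    {σ : Sel (CyclicProduct ds)} (hs : s.Bounded W)
    (hev : List.Forall₂ (fun e g => EvalTo W ds s e.1 g.1 ∧ EvalTo W ds s e.2 g.2) es gs)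
    (h : Rep ds a b z s σ) (h1 : σ.1.length ≤ a)
    (h2 : σ.2.length ≤ b) (h3 : Even (a - σ.1.length)) (h4 : Even (b - σ.2.length))
    (hl : 2 * gs.length ≤ σ.rem a b) :
    Does W (putPairs es) (putPairs es).time s
      (fun s' => Rep ds a b z s' (gs.foldl (fun σ g => σ.put2 a g.1 g.2) σ)) := by
  induction es generalizing gs s σ with
  | nil =>
    cases hev
    exact (Does.exec (p := .skip) (by omega) hs trivial).mono le_rfl fun s' _ _ e => e ▸ h
  | cons e es ih =>
    obtain ⟨g, gs', hg, hgs, rfl⟩ := List.forall₂_cons_left_iff.1 hev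
    simp only [List.length_cons] at hl
    refine Does.mono (T := (e.1.cost + 1) + ((e.2.cost + 1) + (50 + (putPairs es).time))) ?_ ?_
      fun _ _ _ h => h
    · have hste := hst e (by simp)
      refine Does.seq (assign29_does (Or.inl rfl) (by omega) hs h hg.1)
        fun s1 hs1 ha1 ⟨hr1, hv1⟩ => ?_
      refine Does.seq (assign29_does (Or.inr rfl) (by omega) hs1 hr1
        (hg.2.agree hste.2.1 ha1 (by simp [Prog.wregs]) (by simp [Prog.warrs])))
        fun s2 hs2 ha2 ⟨hr2, hv2⟩ => ?_
      have hrem := Sel.rem_put2 g.1 g.2 h1 h2 h3 h4 (by omega)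
      refine Does.seq (putTwo_does hds hs2 hW hr2 h1 h2 h3 h4 (by omega)
        ((ha2.reg 29 (by simp [Prog.wregs])).trans hv1) hv2) fun s3 hs3 ha3 hr3 => ?_
      refine ih (fun e he => hst e (by simp [he])) hs3 (gs := gs') ?_ hr3 hrem.1 hrem.2.1
        hrem.2.2.1 hrem.2.2.2.1
        (show 2 * gs'.length ≤ (σ.put2 a g.1 g.2).rem a b by omega)
      rw [List.forall₂_iff_get] at hgs ⊢
      refine ⟨hgs.1, fun i i1 i2 => ?_⟩
      have hsti := hst _ (List.mem_cons_of_mem _ (List.get_mem es ⟨i, i1⟩))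
      have key : ∀ e' g', e'.Stable → EvalTo W ds s e' g' → EvalTo W ds s3 e' g' := by
        intro e' g' h1 h2
        exact ((h2.agree h1 ha1 (by simp [Prog.wregs]) (by simp [Prog.warrs])).agree h1 ha2
          (by simp [Prog.wregs]) (by simp [Prog.warrs])).agree h1 ha3
          (by simp [putTwo, put, Prog.wregs]) (by simp [putTwo, put, Prog.warrs])
      exact ⟨key _ _ hsti.1 (hgs.2 i i1 i2).1, key _ _ hsti.2.1 (hgs.2 i i1 i2).2⟩
    -- `Prog.time` adds the times of both branches, so it exceeds the bound 50 that holds for each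
    -- run.
    · have : putTwo.time = 73 := rfl
      change _ ≤ (e.1.cost + 1) + ((e.2.cost + 1) + (putTwo.time + (putPairs es).time))
      omega

/-- Start with the given elements. -/
def start (esA esB : List Expr) (es : List (Expr × Expr)) : Prog :=
  putList 27 esA ;; putList 28 esB ;; putPairs es

/-- The choice made by `start`. -/
def Sel.start {A : Type*} (a : ℕ) (gsA gsB : List A) (gs : List (A × A)) : Sel A :=
  gs.foldl (fun σ g => σ.put2 a g.1 g.2) (gsA.reverse, gsB.reverse)

theorem putList_wregs (c : ℕ) (es : List Expr) : ∀ x ∈ (putList c es).wregs, x = 29 ∨ x = 30 := by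
  induction es with
  | nil => simp [putList, Prog.wregs]
  | cons e es ih =>
    intro x hx
    have : x ∈ 29 :: (putList c es).wregs := hx
    rcases List.mem_cons.1 this with h | h
    · exact Or.inl h
    · exact ih x h

theorem putList_warrs (c : ℕ) (es : List Expr) :
    ∀ x ∈ (putList c es).warrs, x = 14 ∨ x = 15 ∨ x = 16 := by
  induction es with
  | nil => simp [putList, Prog.warrs]
  | cons e es ih =>
    intro x hx
    have : x ∈ [14, 15, 16] ++ (putList c es).warrs := hx
    rcases List.mem_append.1 this with h | h
    · simpa using h
    · exact ih x h

theorem start_does (hds : ∀ d ∈ ds, 2 ≤ d) {a b z : ℕ} (hW : 2 * (a + b) + 4 < W)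
    {esA esB : List Expr} {es : List (Expr × Expr)} (hstA : ∀ e ∈ esA, e.Stable)
    (hstB : ∀ e ∈ esB, e.Stable) (hst : ∀ e ∈ es, e.1.Stable ∧ e.2.Stable ∧ 29 ∉ e.2.rregs)
    {gsA gsB : List (CyclicProduct ds)}
    {gs : List (CyclicProduct ds × CyclicProduct ds)} {s : Store} (hs : s.Bounded W)
    (hevA : List.Forall₂ (EvalTo W ds s) esA gsA) (hevB : List.Forall₂ (EvalTo W ds s) esB gsB)
    (hev : List.Forall₂ (fun e g => EvalTo W ds s e.1 g.1 ∧ EvalTo W ds s e.2 g.2) es gs)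
    (h : Rep ds a b z s ([], [])) (h1 : gsA.length ≤ a) (h2 : gsB.length ≤ b)
    (h3 : Even (a - gsA.length)) (h4 : Even (b - gsB.length))
    (hl : 2 * gs.length + gsA.length + gsB.length ≤ a + b) :
    Does W (start esA esB es) (start esA esB es).time s
      (fun s' => Rep ds a b z s' (Sel.start a gsA gsB gs)) := by
  have tr : ∀ {p : Prog} {s1 s2 : Store} {e g}, e.Stable → EvalTo W ds s1 e g → Agree p s1 s2 →
      (∀ x ∈ p.wregs, x = 29 ∨ x = 30) → (∀ x ∈ p.warrs, x = 14 ∨ x = 15 ∨ x = 16) →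
      EvalTo W ds s2 e g := fun h1 h2 h3 h4 h5 => h2.agree h1 h3 h4 h5
  have trl : ∀ {p : Prog} {s1 s2 : Store} (es : List Expr) (gs : List (CyclicProduct ds)),
      (∀ e ∈ es, e.Stable) → List.Forall₂ (EvalTo W ds s1) es gs → Agree p s1 s2 →
      (∀ x ∈ p.wregs, x = 29 ∨ x = 30) → (∀ x ∈ p.warrs, x = 14 ∨ x = 15 ∨ x = 16) →
      List.Forall₂ (EvalTo W ds s2) es gs := by
    intro p s1 s2 es gs h1 h2 h3 h4 h5
    rw [List.forall₂_iff_get] at h2 ⊢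
    exact ⟨h2.1, fun i i1 i2 => tr (h1 _ (List.get_mem es ⟨i, i1⟩)) (h2.2 i i1 i2) h3 h4 h5⟩
  refine Does.seq (putListA_does hds (by omega) esA hstA hs hevA h (by simpa using h1))
    fun s1 hs1 ha1 hr1 => ?_
  refine Does.seq (putListB_does hds (by omega) esB hstB hs1 (trl esB gsB hstB hevB ha1
    (putList_wregs _ _) (putList_warrs _ _)) hr1 (by simpa using h2)) fun s2 hs2 ha2 hr2 => ?_
  simp only [List.append_nil] at hr2
  refine putPairs_does hds hW es hst hs2 (gs := gs) ?_ hr2 (by simpa) (by simpa) (by simpa)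
    (by simpa) (by simp [Sel.rem]; omega)
  rw [List.forall₂_iff_get] at hev ⊢
  refine ⟨hev.1, fun i i1 i2 => ?_⟩
  have hsti := hst _ (List.get_mem es ⟨i, i1⟩)
  exact ⟨tr hsti.1 (tr hsti.1 (hev.2 i i1 i2).1 ha1 (putList_wregs _ _) (putList_warrs _ _)) ha2
      (putList_wregs _ _) (putList_warrs _ _),
    tr hsti.2.1 (tr hsti.2.1 (hev.2 i i1 i2).2 ha1 (putList_wregs _ _) (putList_warrs _ _)) ha2
      (putList_wregs _ _) (putList_warrs _ _)⟩

end IrregularLabeling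

/-! ### Running through all elements of the group -/

namespace IrregularLabeling

open Classical in
/-- The group element with a given code. -/
noncomputable def dec (ds : List ℕ) (x : ℕ) : CyclicProduct ds :=
  if h : ∃ g, code ds g = x then h.choose else 0

theorem code_dec {ds : List ℕ} (hds : ∀ d ∈ ds, 2 ≤ d) {x : ℕ} (hx : x < ds.prod) :
    code ds (dec ds x) = x := by
  have h := exists_code hds hx
  rw [dec, dif_pos h]; exact h.choose_spec

theorem dec_code {ds : List ℕ} (hds : ∀ d ∈ ds, 2 ≤ d) (g : CyclicProduct ds) :
    dec ds (code ds g) = g :=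
  code_injective hds (code_dec hds (code_lt hds g))

/-- The order is that of the codes, so that the loop counter in register `4` is the code of the
current element. -/
noncomputable def elems (ds : List ℕ) : List (CyclicProduct ds) :=
  (List.range ds.prod).map (dec ds)

theorem mem_elems {ds : List ℕ} (hds : ∀ d ∈ ds, 2 ≤ d) (g : CyclicProduct ds) : g ∈ elems ds :=
  List.mem_map.2 ⟨_, List.mem_range.2 (code_lt hds g), dec_code hds g⟩

variable {W : ℕ} {ds : List ℕ}

theorem Rep.needs {a b z : ℕ} {s : Store} {σ : Sel (CyclicProduct ds)} (h : Rep ds a b z s σ) :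
    s.arr 14 (s.reg 27) + s.arr 14 (s.reg 28) = σ.rem a b := by
  rw [h.rA, h.rB, h.fst.need, h.snd.need, Sel.rem]

/-- The nested tests follow the conditions of `Sel.pairStep`; array `16` marks the used elements. -/
def pairBody : Prog :=
  .assign 29 #4 ;; .assign 30 (subE 0 #4) ;;
  .ite (1 <ₑ .cell 14 #27 + .cell 14 #28)
    (.ite (#29 =ₑ #30) .skip (.ite (.cell 16 #29) .skip (.ite (.cell 16 #30) .skip putTwo)))
    .skip

/-- Registers `10` and `11` hold the codes of α and β, as left there by `scan`. Register `31` holds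
the code of -x for the test x = -x. -/
def cosetBody : Prog :=
  .assign 29 #4 ;; .assign 31 (subE 0 #4) ;; .assign 30 (subE #4 #10) ;;
  .assign 32 (subE #4 #11) ;; .assign 33 (subE #30 #11) ;;
  .ite (3 <ₑ .cell 14 #27 + .cell 14 #28)
    (.ite (#29 =ₑ #31)
      (.ite (.cell 16 #29) .skip (.ite (.cell 16 #30) .skip (.ite (.cell 16 #32) .skip
        (.ite (.cell 16 #33) .skip
          (putTwo ;; .assign 29 #32 ;; .assign 30 #33 ;; putTwo)))))
      .skip)
    .skip

theorem assign_does {a b z x : ℕ} {s : Store} {σ : Sel (CyclicProduct ds)} (hW : 1 < W)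
    (hs : s.Bounded W) (ht : Tab ds s) (h : Rep ds a b z s σ) (hx : x ∉ [3, 15, 16, 17, 27, 28])
    {e : Expr} {g : CyclicProduct ds} (he : EvalTo W ds s e g) :
    Does W (.assign x e) (e.cost + 1) s
      (fun s' => Tab ds s' ∧ Rep ds a b z s' σ ∧ s'.reg x = code ds g) := by
  refine (Does.exec (p := .assign x e) hW hs he.2).mono le_rfl fun s' _ ha e' => ?_
  have e1 := he.1
  simp only [List.mem_cons, List.not_mem_nil, or_false, not_or] at hx
  refine ⟨ht.congr (fun y hy => ha.reg y ?_) (fun y _ => ha.arr y (by simp [Prog.warrs])),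
    h.congr (fun y hy => ha.reg y ?_) (fun y _ => ha.arr y (by simp [Prog.warrs])), ?_⟩
  · simp at hy; simp [Prog.wregs]; omega
  · simp at hy; simp [Prog.wregs]; omega
  · simp [e', Prog.exec, e1]

theorem Does.skip {s : Store} {Q : Store → Prop} {T : ℕ} (hs : s.Bounded W) (hT : 1 ≤ T)
    (h : Q s) : Does W .skip T s Q :=
  ⟨1, s, .skip s, hT, hs, Agree.refl _ _, h⟩

theorem pairBody_does (hds : ∀ d ∈ ds, 2 ≤ d) {a b z : ℕ} {s : Store}
    {σ : Sel (CyclicProduct ds)} (hs : s.Bounded W) (hW : 2 * (a + b) + 4 < W)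
    (hNW : ds.prod * ds.prod + 2 * ds.prod < W) (ht : Tab ds s)
    (h : Rep ds a b z s σ) (hσ : σ.Shape a b) {x : CyclicProduct ds} (hx : s.reg 4 = code ds x) :
    Does W pairBody 200 s (fun s' => Rep ds a b z s' (σ.pairStep a b x)) := by
  have hW1 : 1 < W := by omega
  refine Does.mono (T := 2 + ((subE 0 #4).cost + 1 + (7 + 1 + (3 + 1 + (2 + 1 + (2 + 1 + 50))))))
    ?_ (Nat.le_of_ble_eq_true rfl) fun _ _ _ h => h
  refine Does.seq (assign_does hW1 hs ht h (by decide) (EvalTo.reg hx))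
    fun s1 hs1 ha1 ⟨ht1, hr1, h29⟩ => ?_
  have hx1 : s1.reg 4 = code ds x := (ha1.reg 4 (by decide)).trans hx
  refine Does.seq (assign_does hW1 hs1 ht1 hr1 (by decide)
    (EvalTo.subE hds hNW ht1 (EvalTo.zero (by omega)) (EvalTo.reg hx1)))
    fun s2 hs2 ha2 ⟨ht2, hr2, h30⟩ => ?_
  rw [zero_sub] at h30
  have h29 : s2.reg 29 = code ds x := (ha2.reg 29 (by decide)).trans h29
  have hn := hr2.needs
  have c1 := hσ.card_used
  have hrem : σ.rem a b ≤ a + b := by omega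
  have hu1 := hr2.used x
  have hu2 := hr2.used (-x)
  unfold Sel.pairStep
  refine Does.ite hW1 hs2 (by simp [hn]; omega) (fun hv => ?_) (fun hv => ?_)
  · simp [hn] at hv
    refine Does.ite hW1 hs2 (by simp) (fun hv2 => ?_) (fun hv2 => ?_)
    · simp [h29, h30] at hv2
      rw [if_neg (fun h => h.2.1 (code_injective hds hv2))]
      exact Does.skip hs2 (by omega) hr2
    · simp [h29, h30] at hv2
      have hne : x ≠ -x := fun h => hv2 (congrArg (code ds) h)
      refine Does.ite hW1 hs2 (by simp) (fun hv3 => ?_) (fun hv3 => ?_)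
      · simp [h29] at hv3
        rw [if_neg (fun h => h.2.2.1 (hu1.1 hv3))]
        exact Does.skip hs2 (by omega) hr2
      · simp [h29] at hv3
        refine Does.ite hW1 hs2 (by simp) (fun hv4 => ?_) (fun hv4 => ?_)
        · simp [h30] at hv4
          rw [if_neg (fun h => h.2.2.2 (hu2.1 hv4))]
          exact Does.skip hs2 (by omega) hr2
        · simp [h30] at hv4
          rw [if_pos ⟨hv, hne, fun h => hu1.2 h hv3, fun h => hu2.2 h hv4⟩]
          exact putTwo_does hds hs2 hW hr2 hσ.le₁ hσ.le₂ hσ.even₁ hσ.even₂ hv h29 h30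
  · simp [hn] at hv
    rw [if_neg (fun h => by omega)]
    exact Does.skip hs2 (by omega) hr2

set_option maxHeartbeats 1000000 in
theorem cosetBody_does (hds : ∀ d ∈ ds, 2 ≤ d) {a b z : ℕ} {s : Store}
    {σ : Sel (CyclicProduct ds)} (hs : s.Bounded W) (hW : 2 * (a + b) + 4 < W)
    (hNW : ds.prod * ds.prod + 2 * ds.prod < W) (ht : Tab ds s)
    (h : Rep ds a b z s σ) (hσ : σ.Shape a b) {x α β : CyclicProduct ds}
    (hx : s.reg 4 = code ds x) (hα : s.reg 10 = code ds α) (hβ : s.reg 11 = code ds β) :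
    Does W cosetBody 500 s (fun s' => Rep ds a b z s' (σ.cosetStep a b α β x)) := by
  have hW1 : 1 < W := by omega
  refine Does.mono (T := 2 + ((subE 0 #4).cost + 1 + ((subE #4 #10).cost + 1 +
    ((subE #4 #11).cost + 1 + ((subE #30 #11).cost + 1 + (7 + 1 + (3 + 1 + (2 + 1 + (2 + 1 +
      (2 + 1 + (2 + 1 + (50 + (2 + (2 + 50))))))))))))))
    ?_ (Nat.le_of_ble_eq_true rfl) fun _ _ _ h => h
  refine Does.seq (assign_does hW1 hs ht h (by decide) (EvalTo.reg hx))
    fun s1 hs1 ha1 ⟨ht1, hr1, h29⟩ => ?_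
  have x1 := (ha1.reg 4 (by decide)).trans hx
  have α1 := (ha1.reg 10 (by decide)).trans hα
  have β1 := (ha1.reg 11 (by decide)).trans hβ
  refine Does.seq (assign_does hW1 hs1 ht1 hr1 (by decide)
    (EvalTo.subE hds hNW ht1 (EvalTo.zero (by omega)) (EvalTo.reg x1)))
    fun s2 hs2 ha2 ⟨ht2, hr2, h31⟩ => ?_
  rw [zero_sub] at h31
  have x2 := (ha2.reg 4 (by decide)).trans x1
  have α2 := (ha2.reg 10 (by decide)).trans α1
  have β2 := (ha2.reg 11 (by decide)).trans β1
  refine Does.seq (assign_does hW1 hs2 ht2 hr2 (by decide)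
    (EvalTo.subE hds hNW ht2 (EvalTo.reg x2) (EvalTo.reg α2)))
    fun s3 hs3 ha3 ⟨ht3, hr3, h30⟩ => ?_
  have x3 := (ha3.reg 4 (by decide)).trans x2
  have β3 := (ha3.reg 11 (by decide)).trans β2
  refine Does.seq (assign_does hW1 hs3 ht3 hr3 (by decide)
    (EvalTo.subE hds hNW ht3 (EvalTo.reg x3) (EvalTo.reg β3)))
    fun s4 hs4 ha4 ⟨ht4, hr4, h32⟩ => ?_
  have h30 := (ha4.reg 30 (by decide)).trans h30
  have β4 := (ha4.reg 11 (by decide)).trans β3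
  refine Does.seq (assign_does hW1 hs4 ht4 hr4 (by decide)
    (EvalTo.subE hds hNW ht4 (EvalTo.reg h30) (EvalTo.reg β4)))
    fun s5 hs5 ha5 ⟨ht5, hr5, h33⟩ => ?_
  have h30 := (ha5.reg 30 (by decide)).trans h30
  have h32 := (ha5.reg 32 (by decide)).trans h32
  have h31 := (ha5.reg 31 (by decide)).trans
    ((ha4.reg 31 (by decide)).trans ((ha3.reg 31 (by decide)).trans h31))
  have h29 := (ha5.reg 29 (by decide)).trans ((ha4.reg 29 (by decide)).trans
    ((ha3.reg 29 (by decide)).trans ((ha2.reg 29 (by decide)).trans h29)))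
  have hn := hr5.needs
  have c1 := hσ.card_used
  have hrem : σ.rem a b ≤ a + b := by omega
  have hu1 := hr5.used x
  have hu2 := hr5.used (x - α)
  have hu3 := hr5.used (x - β)
  have hu4 := hr5.used (x - α - β)
  unfold Sel.cosetStep
  refine Does.ite hW1 hs5 (by simp [hn]; omega) (fun hv => ?_) (fun hv => ?_)
  · simp [hn] at hv
    refine Does.ite hW1 hs5 (by simp) (fun hv2 => ?_) (fun hv2 => ?_)
    · simp [h29, h31] at hv2
      have hne : x = -x := code_injective hds hv2
      refine Does.ite hW1 hs5 (by simp) (fun hv3 => ?_) (fun hv3 => ?_)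
      · simp [h29] at hv3
        rw [if_neg (fun h => h.2.2.1 (hu1.1 hv3))]
        exact Does.skip hs5 (by omega) hr5
      simp [h29] at hv3
      refine Does.ite hW1 hs5 (by simp) (fun hv4 => ?_) (fun hv4 => ?_)
      · simp [h30] at hv4
        rw [if_neg (fun h => h.2.2.2.1 (hu2.1 hv4))]
        exact Does.skip hs5 (by omega) hr5
      simp [h30] at hv4
      refine Does.ite hW1 hs5 (by simp) (fun hv5 => ?_) (fun hv5 => ?_)
      · simp [h32] at hv5
        rw [if_neg (fun h => h.2.2.2.2.1 (hu3.1 hv5))]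
        exact Does.skip hs5 (by omega) hr5
      simp [h32] at hv5
      refine Does.ite hW1 hs5 (by simp) (fun hv6 => ?_) (fun hv6 => ?_)
      · simp [h33] at hv6
        rw [if_neg (fun h => h.2.2.2.2.2 (hu4.1 hv6))]
        exact Does.skip hs5 (by omega) hr5
      simp [h33] at hv6
      rw [if_pos ⟨hv, hne, fun h => hu1.2 h hv3, fun h => hu2.2 h hv4, fun h => hu3.2 h hv5,
        fun h => hu4.2 h hv6⟩]
      have hp := Sel.rem_put2 x (x - α) hσ.le₁ hσ.le₂ hσ.even₁ hσ.even₂ (by omega)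
      refine Does.seq (putTwo_does hds hs5 hW hr5 hσ.le₁ hσ.le₂ hσ.even₁ hσ.even₂ (by omega)
        h29 h30) fun s6 hs6 ha6 hr6 => ?_
      have h32 := (ha6.reg 32 (by decide)).trans h32
      have h33 := (ha6.reg 33 (by decide)).trans h33
      refine Does.seq (assign29_does (Or.inl rfl) hW1 hs6 hr6 (EvalTo.reg h32))
        fun s7 hs7 ha7 ⟨hr7, k29⟩ => ?_
      have h33 := (ha7.reg 33 (by decide)).trans h33
      refine Does.seq (assign29_does (Or.inr rfl) hW1 hs7 hr7 (EvalTo.reg h33))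
        fun s8 hs8 ha8 ⟨hr8, k30⟩ => ?_
      have k29 := (ha8.reg 29 (by decide)).trans k29
      exact putTwo_does hds hs8 hW hr8 hp.1 hp.2.1 hp.2.2.1 hp.2.2.2.1 (by omega) k29 k30
    · simp [h29, h31] at hv2
      rw [if_neg (fun h => hv2 (congrArg (code ds) h.2.1))]
      exact Does.skip hs5 (by omega) hr5
  · simp [hn] at hv
    rw [if_neg (fun h => by omega)]
    exact Does.skip hs5 (by omega) hr5

theorem range_foldl_succ {A : Type*} (f : A → CyclicProduct ds → A) (x : A) (k : ℕ) :
    ((List.range (k + 1)).map (dec ds)).foldl f x =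
      f (((List.range k).map (dec ds)).foldl f x) (dec ds k) := by
  rw [List.range_succ, List.map_append, List.foldl_append]; rfl

theorem pairLoop_does (hds : ∀ d ∈ ds, 2 ≤ d) {a b z : ℕ} {s : Store}
    {σ : Sel (CyclicProduct ds)} (hs : s.Bounded W) (hW : 2 * (a + b) + 4 < W)
    (hNW : ds.prod * ds.prod + 2 * ds.prod < W) (h3 : s.reg 3 = ds.prod) (ht : Tab ds s)
    (h : Rep ds a b z s σ) (hσ : σ.Shape a b) (hb : σ.Balanced) :
    Does W (forUp 4 3 pairBody) (ds.prod * 208 + 6) s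
      (fun s' => Rep ds a b z s' ((elems ds).foldl (Sel.pairStep a b) σ)) := by
  refine Does.forUp (c := 200) (fun k s' => Rep ds a b z s'
    (((List.range k).map (dec ds)).foldl (Sel.pairStep a b) σ)) (by omega) hs h3 (by decide)
    (by decide) (by decide) ?_ ?_
  · exact h.congr (by intro x hx; simp at hx; simp; omega) (by simp)
  · intro k s' hk hs' ha hi hJ
    have ht' := ht.congr (s' := s')
      (fun x hx => ha.reg x ((by decide : ∀ x ∈ [3, 15, 16, 17], x ∉ (forUp 4 3 pairBody).wregs) x hx))
      (fun x hx => ha.arr x ((by decide : ∀ x ∈ [17, 18], x ∉ (forUp 4 3 pairBody).warrs) x hx))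
    refine (pairBody_does hds hs' hW hNW ht' hJ (Sel.foldl_pairStep _ hσ hb).1
      (hi.trans (code_dec hds hk).symm)).mono le_rfl fun s'' _ _ hr => ?_
    rw [range_foldl_succ]
    exact hr.congr (by intro x hx; simp at hx; simp; omega) (by simp)

theorem cosetLoop_does (hds : ∀ d ∈ ds, 2 ≤ d) {a b z : ℕ} {s : Store}
    {σ : Sel (CyclicProduct ds)} (hs : s.Bounded W) (hW : 2 * (a + b) + 4 < W)
    (hNW : ds.prod * ds.prod + 2 * ds.prod < W) (h3 : s.reg 3 = ds.prod) (ht : Tab ds s)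
    (h : Rep ds a b z s σ) (hσ : σ.Shape a b) (hb : σ.Balanced) {α β : CyclicProduct ds}
    (hα : s.reg 10 = code ds α) (hβ : s.reg 11 = code ds β) (hK : Sel.Klein α β) :
    Does W (forUp 4 3 cosetBody) (ds.prod * 508 + 6) s
      (fun s' => Rep ds a b z s' ((elems ds).foldl (Sel.cosetStep a b α β) σ)) := by
  refine Does.forUp (c := 500) (fun k s' => Rep ds a b z s'
    (((List.range k).map (dec ds)).foldl (Sel.cosetStep a b α β) σ)) (by omega) hs h3 (by decide)
    (by decide) (by decide) ?_ ?_
  · exact h.congr (by intro x hx; simp at hx; simp; omega) (by simp)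
  · intro k s' hk hs' ha hi hJ
    have ht' := ht.congr (s' := s')
      (fun x hx => ha.reg x ((by decide : ∀ x ∈ [3, 15, 16, 17], x ∉ (forUp 4 3 cosetBody).wregs) x hx))
      (fun x hx => ha.arr x ((by decide : ∀ x ∈ [17, 18], x ∉ (forUp 4 3 cosetBody).warrs) x hx))
    refine (cosetBody_does hds hs' hW hNW ht' hJ (Sel.foldl_cosetStep hK _ hσ hb).1
      (hi.trans (code_dec hds hk).symm) ((ha.reg 10 (by decide)).trans hα)
      ((ha.reg 11 (by decide)).trans hβ)).mono le_rfl fun s'' _ _ hr => ?_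
    rw [range_foldl_succ]
    exact hr.congr (by intro x hx; simp at hx; simp; omega) (by simp)

end IrregularLabeling

namespace IrregularLabeling
namespace Sel

/-! ### Initial choices that can be completed -/

section
variable {A : Type*} [AddCommGroup A] [DecidableEq A]

/-- The elements used by `start`. -/
def startList (gsA gsB : List A) (gs : List (A × A)) : List A :=
  gs.flatMap (fun g => [g.1, g.2]) ++ (gsA ++ gsB)

theorem start_perm (a : ℕ) (gsA gsB : List A) (gs : List (A × A)) :
    ((start a gsA gsB gs).1 ++ (start a gsA gsB gs).2).Perm (startList gsA gsB gs) := by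
  have key : ∀ σ : Sel A, let σ' := gs.foldl (fun σ g => σ.put2 a g.1 g.2) σ
      (σ'.1 ++ σ'.2).Perm (gs.flatMap (fun g => [g.1, g.2]) ++ (σ.1 ++ σ.2)) := by
    induction gs with
    | nil => intro σ; exact List.Perm.refl _
    | cons g gs ih =>
      intro σ
      refine (ih (σ.put2 a g.1 g.2)).trans ?_
      refine ((put2_perm a g.1 g.2 σ).append_left _).trans ?_
      simp only [List.flatMap_cons, List.cons_append, List.nil_append]
      exact List.perm_middle.trans (List.perm_middle.cons _)
  refine (key (gsA.reverse, gsB.reverse)).trans (List.Perm.append_left _ ?_)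
  exact (List.reverse_perm gsA).append (List.reverse_perm gsB)

/-- The sizes fit, and an even number of elements is missing in both classes. -/
structure Fits (a b : ℕ) (gsA gsB : List A) (gs : List (A × A)) : Prop where
  le₁ : gsA.length ≤ a
  le₂ : gsB.length ≤ b
  even₁ : Even (a - gsA.length)
  even₂ : Even (b - gsB.length)
  le : 2 * gs.length + gsA.length + gsB.length ≤ a + b

theorem Fits.shape {a b : ℕ} {gsA gsB : List A} {gs : List (A × A)} (h : Fits a b gsA gsB gs)
    (hnd : (startList gsA gsB gs).Nodup) : (start a gsA gsB gs).Shape a b := by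
  have hnd' := (start_perm a gsA gsB gs).nodup_iff.2 hnd
  have key : ∀ σ : Sel A, σ.1.length ≤ a → σ.2.length ≤ b → Even (a - σ.1.length) →
      Even (b - σ.2.length) → 2 * gs.length ≤ σ.rem a b →
      let σ' := gs.foldl (fun σ g => σ.put2 a g.1 g.2) σ
      σ'.1.length ≤ a ∧ σ'.2.length ≤ b ∧ Even (a - σ'.1.length) ∧ Even (b - σ'.2.length) := by
    clear h hnd hnd'
    induction gs with
    | nil => intro σ h1 h2 h3 h4 _; exact ⟨h1, h2, h3, h4⟩
    | cons g gs ih =>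
      intro σ h1 h2 h3 h4 hl
      simp only [List.length_cons] at hl
      have hp := rem_put2 g.1 g.2 h1 h2 h3 h4 (by omega)
      exact ih (σ.put2 a g.1 g.2) hp.1 hp.2.1 hp.2.2.1 hp.2.2.2.1 (by omega)
  have h' := key (gsA.reverse, gsB.reverse) (by simpa using h.le₁) (by simpa using h.le₂)
    (by simpa using h.even₁) (by simpa using h.even₂)
    (by have := h.le; have := h.le₁; have := h.le₂; simp [rem]; omega)
  exact ⟨hnd', h'.1, h'.2.1, h'.2.2.1, h'.2.2.2⟩

theorem mem_used_start {a : ℕ} {gsA gsB : List A} {gs : List (A × A)} {x : A} :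
    x ∈ (start a gsA gsB gs).used ↔ x ∈ startList gsA gsB gs := by
  rw [used, List.mem_toFinset, (start_perm a gsA gsB gs).mem_iff]

theorem card_used_start {a b : ℕ} {gsA gsB : List A} {gs : List (A × A)}
    (hnd : (startList gsA gsB gs).Nodup) :
    (start a gsA gsB gs).used.card = (startList gsA gsB gs).length := by
  rw [used, List.toFinset_card_of_nodup ((start_perm a gsA gsB gs).nodup_iff.2 hnd),
    (start_perm a gsA gsB gs).length_eq]

/-- The initial choice can be completed by pairs. -/
def PairsComplete (xs : List A) (a b : ℕ) (σ : Sel A) : Prop :=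
  σ.Shape a b ∧ σ.Balanced ∧ (xs.foldl (pairStep a b) σ).rem a b = 0

/-- The initial choice can be completed by cosets and pairs. -/
def CosetsComplete (xs : List A) (a b : ℕ) (α β : A) (σ : Sel A) : Prop :=
  σ.Shape a b ∧ σ.Balanced ∧
    (xs.foldl (pairStep a b) (xs.foldl (cosetStep a b α β) σ)).rem a b = 0

variable [Fintype A]

/-- The list B consists of the self-inverse elements and of the chosen elements with their
negatives. What it contains beyond the chosen elements is wasted, and `hcard` says that the group
can spare it. -/
theorem pairsComplete_start {xs : List A} (hxs : ∀ x, x ∈ xs) {a b : ℕ} {gsA gsB : List A}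
    (h : Fits a b gsA gsB []) (hnd : (gsA ++ gsB).Nodup) (hsum : gsA.sum = gsB.sum)
    (B : List A) (hT : ∀ x : A, x = -x → x ∈ B) (hB : ∀ x ∈ gsA ++ gsB, x ∈ B ∧ -x ∈ B)
    (hcard : B.length + (a + b) ≤ Fintype.card A + (gsA.length + gsB.length)) :
    PairsComplete xs a b (start a gsA gsB []) := by
  have hnd' : (startList gsA gsB []).Nodup := by simpa [startList] using hnd
  have hs := h.shape hnd'
  have hb : (start a gsA gsB []).Balanced := by
    simpa [Balanced, start, List.sum_reverse] using hsum
  have hu : ∀ x, x ∈ (start a gsA gsB []).used ↔ x ∈ gsA ++ gsB := by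
    intro x; rw [mem_used_start]; simp [startList]
  refine ⟨hs, hb, complete_pairs hxs hs hb B.toFinset ?_ ?_⟩
  · intro x hx
    rw [List.mem_toFinset]
    rcases hx with hx | hx | hx
    · exact hT x hx
    · exact (hB x ((hu x).1 hx)).1
    · have := (hB (-x) ((hu _).1 hx)).2
      rwa [neg_neg] at this
  · rw [card_used_start (b := b) hnd']
    have := List.toFinset_card_le B
    simp [startList]; omega

def coset4 (α β c : A) : List A := [c, c + α, c + β, c + α + β]

omit [Fintype A] in
theorem coset4_closed {α β : A} (hK : Klein α β) {c x : A} (hx : x ∈ coset4 α β c) :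
    x ∈ coset4 α β c ∧ x + α ∈ coset4 α β c ∧ x + β ∈ coset4 α β c ∧
      x + α + β ∈ coset4 α β c := by
  have hα := hK.two_left
  have hβ := hK.two_right
  have u1 : c + α + α = c := by rw [add_assoc, hα, add_zero]
  have u2 : c + β + β = c := by rw [add_assoc, hβ, add_zero]
  have u3 : c + α + β + α = c + β := by
    calc _ = c + β + (α + α) := by abel
      _ = _ := by rw [hα, add_zero]
  have u4 : c + α + β + β = c + α := by rw [add_assoc, hβ, add_zero]
  have u5 : c + β + α = c + α + β := by abel
  refine ⟨hx, ?_⟩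
  simp only [coset4, List.mem_cons, List.not_mem_nil, or_false] at hx ⊢
  rcases hx with rfl | rfl | rfl | rfl
  · exact ⟨by simp, by simp, by simp⟩
  · rw [u1]; exact ⟨by simp, by simp, by simp⟩
  · rw [u2, u5, u4]; exact ⟨by simp, by simp, by simp⟩
  · rw [u3, u4, u2]; exact ⟨by simp, by simp, by simp⟩

/-- If all chosen elements are self-inverse, signs do not matter, so the two sums agree as soon as
the sum of all chosen elements is 0, however they are distributed. The wasted elements are the rest
of the cosets that meet the initial choice. -/
theorem cosetsComplete_start {xs : List A} (hxs : ∀ x, x ∈ xs) {a b : ℕ} {α β : A}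
    (hK : Klein α β) {gsA gsB : List A} {gs : List (A × A)} (h : Fits a b gsA gsB gs)
    (hnd : (startList gsA gsB gs).Nodup) (h2 : ∀ x ∈ startList gsA gsB gs, x = -x)
    (hsum : (startList gsA gsB gs).sum = 0) (cs : List A)
    (hB : ∀ x ∈ startList gsA gsB gs, ∃ c ∈ cs, x ∈ coset4 α β c)
    (hcard : 4 * cs.length + (a + b) ≤ Fintype.card A + (startList gsA gsB gs).length)
    (hr : (a + b - (startList gsA gsB gs).length) % 4 = 0 ∨ ∃ x : A, x ≠ -x) :
    CosetsComplete xs a b α β (start a gsA gsB gs) := by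
  have hs := h.shape hnd
  have hp := start_perm a gsA gsB gs
  have hneg : ∀ l : List A, (∀ x ∈ l, x = -x) → l.sum = -l.sum := by
    intro l hl
    induction l with
    | nil => simp
    | cons x l ih =>
      have h1 := hl x (by simp)
      have h2 := ih fun y hy => hl y (by simp [hy])
      rw [List.sum_cons, neg_add, ← h1, ← h2]
  have hb : (start a gsA gsB gs).Balanced := by
    have e1 := hp.sum_eq
    rw [hsum, List.sum_append] at e1
    have e2 := hneg (start a gsA gsB gs).2 fun x hx =>
      h2 x (hp.mem_iff.1 (List.mem_append_right _ hx))
    unfold Balanced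
    rw [e2]; exact eq_neg_of_add_eq_zero_left e1
  have hc := card_used_start (a := a) (b := b) hnd
  have hc2 := hs.card_used
  refine ⟨hs, hb, complete_cosets hK hxs hs hb (fun x hx => h2 x (mem_used_start.1 hx))
    (cs.flatMap (coset4 α β)).toFinset ?_ ?_ ?_⟩
  · intro x hx
    obtain ⟨c, hc, hx⟩ := hB x (mem_used_start.1 hx)
    obtain ⟨q1, q2, q3, q4⟩ := coset4_closed hK hx
    simp only [List.mem_toFinset, List.mem_flatMap]
    exact ⟨⟨c, hc, q1⟩, ⟨c, hc, q2⟩, ⟨c, hc, q3⟩, ⟨c, hc, q4⟩⟩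
  · have h1 := List.toFinset_card_le (cs.flatMap (coset4 α β))
    have h2 : (cs.flatMap (coset4 α β)).length = 4 * cs.length := by
      clear hB hcard h1
      induction cs with
      | nil => rfl
      | cons c cs ih => rw [List.flatMap_cons, List.length_append, ih]; simp [coset4]; omega
    omega
  · rcases hr with hr | hr
    · left; omega
    · exact Or.inr hr

/-! #### No involutions -/

section odd
variable {xs : List A} (hxs : ∀ x, x ∈ xs) {a b : ℕ} (hT : ∀ x : A, x = -x → x = 0)
include hxs hT

/-- Without involutions the nonzero elements split completely into pairs, so nothing is wasted once
0 is used. -/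
theorem odd_one (h : Fits a b ([0] : List A) [] []) (hc : a + b ≤ Fintype.card A) :
    PairsComplete xs a b (start a [0] [] []) :=
  pairsComplete_start hxs h (by simp) (by simp) [0] (fun x hx => by simp [hT x hx]) (by simp)
    (by simp; omega)

theorem odd_none (h : Fits a b ([] : List A) [] []) (hc : a + b < Fintype.card A) :
    PairsComplete xs a b (start a [] [] []) :=
  pairsComplete_start hxs h (by simp) (by simp) [0] (fun x hx => by simp [hT x hx]) (by simp)
    (by simp; omega)

/-- Here x = 0 + (-x) + (x + x), and only -(x + x) is wasted. -/
theorem odd_double {x : A} (h : Fits a b [x] [0, -x, x + x] []) (h3 : x + x + x ≠ 0)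
    (hc : a + b < Fintype.card A) : PairsComplete xs a b (start a [x] [0, -x, x + x] []) := by
  have hx0 : x ≠ 0 := by rintro rfl; simp at h3
  have hxn : x ≠ -x := fun e => hx0 (hT x e)
  have h2 : x + x ≠ 0 := fun e => hxn (eq_neg_of_add_eq_zero_left e)
  have h4 : -x ≠ x + x := fun e => h3 (by rw [← e]; simp)
  refine pairsComplete_start hxs h ?_ (by simp) [0, x, -x, x + x, -(x + x)]
    (fun x hx => by simp [hT x hx]) ?_ (by simp; omega)
  · simp [hx0, hxn, h2.symm, h4]
  · simp

/-- Both triples have sum 0, and only 0 is wasted. The price is that both classes must have at least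
three elements; this is the tight case of elementary 3-groups, where x + x = -x rules out
`odd_double`. -/
theorem odd_triples {x u : A} (h : Fits a b [x, u, -(x + u)] [-x, -u, x + u] [])
    (hx3 : x + x + x = 0) (hu3 : u + u + u = 0) (hx : x ≠ 0) (hu : u ≠ 0) (hxu : x ≠ u)
    (hxu' : x + u ≠ 0) (hc : a + b < Fintype.card A) :
    PairsComplete xs a b (start a [x, u, -(x + u)] [-x, -u, x + u] []) := by
  have hxn : x ≠ -x := fun e => hx (hT x e)
  have hun : u ≠ -u := fun e => hu (hT u e)
  have hxun : x + u ≠ -(x + u) := fun e => hxu' (hT _ e)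
  have hx2 : x + x = -x := eq_neg_of_add_eq_zero_left hx3
  have hu2 : u + u = -u := eq_neg_of_add_eq_zero_left hu3
  have n1 : x ≠ -(x + u) := by
    intro e
    have : x + x = -u := by
      calc x + x = x + (-(x + u)) := by rw [← e]
        _ = -u := by abel
    rw [hx2] at this; exact hxu (neg_injective this)
  have n2 : u ≠ -(x + u) := by
    intro e
    have : u + u = -x := by
      calc u + u = u + (-(x + u)) := by rw [← e]
        _ = -x := by abel
    rw [hu2] at this; exact hxu (neg_injective this).symm
  have n3 : x ≠ -u := fun e => hxu' (by rw [e]; simp)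
  have n4 : u ≠ -x := fun e => hxu' (by rw [e]; simp)
  refine pairsComplete_start hxs h ?_ ?_ [0, x, -x, u, -u, x + u, -(x + u)]
    (fun x hx => by simp [hT x hx]) ?_ (by simp; omega)
  · have m1 : -x ≠ x + u := fun e => n1 (by rw [← e, neg_neg])
    have m2 : -u ≠ x + u := fun e => n2 (by rw [← e, neg_neg])
    have m3 : -(x + u) ≠ -x := fun e => hu (by simpa using neg_injective e)
    have m4 : -(x + u) ≠ -u := fun e => hx (by simpa using neg_injective e)
    simp only [List.cons_append, List.nil_append, List.nodup_cons, List.mem_cons,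
      List.not_mem_nil, or_false, not_or, List.nodup_nil, and_true, not_false_eq_true]
    refine ⟨⟨hxu, n1, hxn, n3, ?_⟩, ⟨n2, n4, hun, ?_⟩, ⟨m3, m4, hxun.symm⟩, ⟨?_, m1⟩, m2⟩
    · simpa using hu
    · simpa using hx
    · exact fun e => hxu (neg_injective e)
  · simp
  · simp

/-- The negatives of x, u and x + u are wasted, but the first class may consist of one element. -/
theorem odd_sum {x u : A} (h : Fits a b [x + u] [0, x, u] []) (hx : x ≠ 0) (hu : u ≠ 0)
    (hxu : x ≠ u) (hxu' : x + u ≠ 0) (hc : a + b + 3 ≤ Fintype.card A) :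
    PairsComplete xs a b (start a [x + u] [0, x, u] []) := by
  refine pairsComplete_start hxs h ?_ (by simp) [0, x, -x, u, -u, x + u, -(x + u)]
    (fun x hx => by simp [hT x hx]) ?_ (by simp; omega)
  · simp [hx, hu, hxu, hxu', hx.symm, hu.symm]
  · simp

end odd

/-! #### One involution -/

section single
variable {xs : List A} (hxs : ∀ x, x ∈ xs) {a b : ℕ} {ι : A} (hT : ∀ x : A, x = -x → x = 0 ∨ x = ι)
include hxs hT

theorem single_one (h : Fits a b ([0] : List A) [] []) (hc : a + b < Fintype.card A) :
    PairsComplete xs a b (start a [0] [] []) :=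
  pairsComplete_start hxs h (by simp) (by simp) [0, ι] (fun x hx => by simpa using hT x hx)
    (by simp) (by simp; omega)

theorem single_none (h : Fits a b ([] : List A) [] []) (hc : a + b + 2 ≤ Fintype.card A) :
    PairsComplete xs a b (start a [] [] []) :=
  pairsComplete_start hxs h (by simp) (by simp) [0, ι] (fun x hx => by simpa using hT x hx)
    (by simp) (by simp; omega)

/-- With i + i = ι both pairs have sum i = ι - i. The four elements are closed under negation and
contain all self-inverse ones, so nothing is wasted. -/
theorem single_full_even {i : A} (hι : ι ≠ 0) (hi : i + i = ι) (hιι : ι + ι = 0)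
    (h : Fits a b [0, i] [ι, -i] []) (hc : a + b ≤ Fintype.card A) :
    PairsComplete xs a b (start a [0, i] [ι, -i] []) := by
  have hi0 : i ≠ 0 := by rintro rfl; simp at hi; exact hι hi.symm
  have hiι : i ≠ ι := by rintro rfl; exact hι (hi ▸ hιι)
  have hin : i ≠ -i := fun e => hι (by rw [← hi]; nth_rewrite 2 [e]; simp)
  have hιn : -ι = ι := neg_eq_of_add_eq_zero_left hιι
  have hιi : ι ≠ -i := fun e => hiι (by rw [← hιn, e, neg_neg])
  refine pairsComplete_start hxs h ?_ ?_ [0, ι, i, -i] (fun x hx => ?_) ?_ (by simp; omega)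
  · simp [hi0.symm, hι.symm, hi0, hiι, hin, hιi]
  · simp [← hi]
  · rcases hT x hx with rfl | rfl <;> simp
  · simp [hιn]

/-- The same four elements distributed as 1 + 3, by -i = i + ι. -/
theorem single_full_odd {i : A} (hι : ι ≠ 0) (hi : i + i = ι) (hιι : ι + ι = 0)
    (h : Fits a b [-i] [0, i, ι] []) (hc : a + b ≤ Fintype.card A) :
    PairsComplete xs a b (start a [-i] [0, i, ι] []) := by
  have hi0 : i ≠ 0 := by rintro rfl; simp at hi; exact hι hi.symm
  have hiι : i ≠ ι := by rintro rfl; exact hι (hi ▸ hιι)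
  have hin : i ≠ -i := fun e => hι (by rw [← hi]; nth_rewrite 2 [e]; simp)
  have hιn : -ι = ι := neg_eq_of_add_eq_zero_left hιι
  have hιi : ι ≠ -i := fun e => hiι (by rw [← hιn, e, neg_neg])
  refine pairsComplete_start hxs h ?_ ?_ [0, ι, i, -i] (fun x hx => ?_) ?_ (by simp; omega)
  · simp [hi0.symm, hι.symm, hi0, hiι, hin.symm, hιi.symm]
  · simp only [List.sum_cons, List.sum_nil, add_zero, zero_add]
    refine neg_eq_of_add_eq_zero_right ?_
    rw [← add_assoc, hi, hιι]
  · rcases hT x hx with rfl | rfl <;> simp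
  · simp [hιn]

/-- The triple has sum ι + ι = 0, and x is distinct from ι - x because 4x ≠ 0. The elements -x and x
- ι are wasted. -/
theorem single_triple {x : A} (hι : ι ≠ 0) (hιι : ι + ι = 0) (hx : x + x + (x + x) ≠ 0)
    (h : Fits a b [0] [ι, x, ι - x] []) (hc : a + b + 2 ≤ Fintype.card A) :
    PairsComplete xs a b (start a [0] [ι, x, ι - x] []) := by
  have hιn : -ι = ι := neg_eq_of_add_eq_zero_left hιι
  have h0 : x ≠ 0 := by rintro rfl; simp at hx
  have h1 : x ≠ ι := by rintro rfl; exact hx (by rw [hιι, add_zero])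
  have h2 : x ≠ ι - x := fun e => by
    have : x + x = ι := by nth_rewrite 2 [e]; abel
    exact hx (by rw [this, hιι])
  have h3 : ι - x ≠ 0 := fun e => h1 (sub_eq_zero.1 e).symm
  have h4 : ι ≠ ι - x := fun e => h0 (sub_eq_self.1 e.symm)
  refine pairsComplete_start hxs h ?_ ?_ [0, ι, x, -x, ι - x, x - ι] (fun x hx => ?_) ?_
    (by simp; omega)
  · simp [hι.symm, h0.symm, h1.symm, h2, h3.symm, h4]
  · simp [hιι]
  · rcases hT x hx with rfl | rfl <;> simp
  · simp [hιn]

end single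

/-! #### More than one involution -/

section many
variable {xs : List A} (hxs : ∀ x, x ∈ xs) {a b : ℕ} {α β : A} (hK : Klein α β)
include hxs hK

/-- The three involutions in the Klein group of α and β are wasted; the residue mod 4 lets cosets
complete the choice. -/
theorem many_one (h : Fits a b ([0] : List A) [] []) (hc : a + b + 3 ≤ Fintype.card A)
    (h1 : (a + b) % 4 = 1) : CosetsComplete xs a b α β (start a [0] [] []) :=
  cosetsComplete_start hxs hK h (by simp [startList]) (by simp [startList]) (by simp [startList])
    [0] (by simp [startList, coset4]) (by simp [startList]; omega) (by simp [startList]; omega)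

theorem many_none (h : Fits a b ([] : List A) [] []) (hc : a + b ≤ Fintype.card A)
    (h1 : (a + b) % 4 = 0 ∨ ∃ x : A, x ≠ -x) : CosetsComplete xs a b α β (start a [] [] []) :=
  cosetsComplete_start hxs hK h (by simp [startList]) (by simp [startList]) (by simp [startList])
    [] (by simp [startList]) (by simp [startList]; omega) (by simpa [startList] using h1)

omit [DecidableEq A] [Fintype A] hxs in
theorem _root_.IrregularLabeling.Sel.Klein.facts : α = -α ∧ β = -β ∧ α + β = -(α + β) ∧ α + β ≠ 0 ∧ α + (β + (α + β)) = 0 := by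
  have hα := hK.two_left
  have hβ := hK.two_right
  refine ⟨eq_neg_of_add_eq_zero_left hα, eq_neg_of_add_eq_zero_left hβ,
    eq_neg_of_add_eq_zero_left ?_, fun e => hK.ne (add_right_cancel (e.trans hβ.symm)), ?_⟩
  · calc α + β + (α + β) = (α + α) + (β + β) := by abel
      _ = 0 := by rw [hα, hβ, add_zero]
  · calc α + (β + (α + β)) = (α + α) + (β + β) := by abel
      _ = 0 := by rw [hα, hβ, add_zero]

/-- The three involutions α, β, α + β have sum 0, and only 0 is wasted. -/
theorem many_three (h : Fits a b [α] [] [(β, α + β)]) (hc : a + b + 1 ≤ Fintype.card A)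
    (h1 : (a + b) % 4 = 3) : CosetsComplete xs a b α β (start a [α] [] [(β, α + β)]) := by
  obtain ⟨f1, f2, f3, f4, f5⟩ := hK.facts
  refine cosetsComplete_start hxs hK h ?_ ?_ ?_ [0] ?_ ?_ ?_
  · simp [startList, hK.left_ne, hK.right_ne, hK.ne.symm]
  · intro x hx
    simp only [startList, List.flatMap_cons, List.flatMap_nil, List.append_nil, List.cons_append,
      List.nil_append, List.mem_cons, List.not_mem_nil, or_false] at hx
    rcases hx with rfl | rfl | rfl <;> assumption
  · simp only [startList, List.flatMap_cons, List.flatMap_nil, List.append_nil, List.cons_append,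
      List.nil_append, List.sum_cons, List.sum_nil, add_zero]
    rw [← f5]; abel
  · intro x hx
    refine ⟨0, by simp, ?_⟩
    simp [startList, coset4] at hx ⊢; tauto
  · simp [startList]; omega
  · left; simp [startList]; omega

/-- The full Klein four-group is used, so nothing is wasted; placing 0 and α in different classes
makes both deficits even when both class sizes are odd. -/
theorem many_four (h : Fits a b [0] [α] [(β, α + β)]) (hc : a + b ≤ Fintype.card A)
    (h1 : (a + b) % 4 = 0 ∨ ∃ x : A, x ≠ -x) :
    CosetsComplete xs a b α β (start a [0] [α] [(β, α + β)]) := by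
  obtain ⟨f1, f2, f3, f4, f5⟩ := hK.facts
  refine cosetsComplete_start hxs hK h ?_ ?_ ?_ [0] ?_ ?_ ?_
  · simp [startList, hK.left_ne, hK.right_ne, hK.ne.symm, hK.left_ne.symm, f4]
  · intro x hx
    simp only [startList, List.flatMap_cons, List.flatMap_nil, List.append_nil, List.cons_append,
      List.nil_append, List.mem_cons, List.not_mem_nil, or_false] at hx
    rcases hx with rfl | rfl | rfl | rfl <;> first | assumption | simp
  · simp only [startList, List.flatMap_cons, List.flatMap_nil, List.append_nil, List.cons_append,
      List.nil_append, List.sum_cons, List.sum_nil, add_zero, zero_add]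
    rw [← f5]; abel
  · intro x hx
    refine ⟨0, by simp, ?_⟩
    simp [startList, coset4] at hx ⊢; tauto
  · simp [startList]; omega
  · rcases h1 with h1 | h1
    · left
      have := h.le
      simp [startList] at this ⊢; omega
    · exact Or.inr h1

section independent
variable {B C : Type*} [AddCommGroup B] [AddCommGroup C] {γ δ : A}

/-- The elements `γ`, `δ` are independent modulo the elements `α`, `β`. -/
structure Independent (α β γ δ : A) (φ : A →+ B) (ψ : A →+ C) : Prop where
  neg₁ : γ = -γ
  neg₂ : δ = -δ
  φα : φ α = 0
  φβ : φ β = 0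
  φγ : φ γ ≠ 0
  φδ : φ δ = 0
  ψα : ψ α = 0
  ψβ : ψ β = 0
  ψγ : ψ γ = 0
  ψδ : ψ δ ≠ 0

omit hxs [Fintype A] [DecidableEq A] in
-- In an elementary 2-group with n ≡ 2 mod 4, cosets alone leave two elements missing, and two
-- distinct elements have nonzero sum. So six elements with sum 0 are used instead, two from each of
-- three cosets; the other six elements of these cosets are wasted.
theorem six_elements {φ : A →+ B} {ψ : A →+ C} (hI : Independent α β γ δ φ ψ) {l : List A}
    (hl : l.Perm [0, α, γ, γ + β, δ, δ + α + β]) :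
    l.Nodup ∧ (∀ x ∈ l, x = -x) ∧ l.sum = 0 ∧ (∀ x ∈ l, ∃ c ∈ [0, γ, δ], x ∈ coset4 α β c) := by
  obtain ⟨f1, f2, f3, f4, f5⟩ := hK.facts
  obtain ⟨g1, g2, p1, p2, p3, p4, q1, q2, q3, q4⟩ := hI
  have d1 : γ + γ = 0 := by nth_rewrite 2 [g1]; simp
  have d2 : δ + δ = 0 := by nth_rewrite 2 [g2]; simp
  have hne : ∀ x y : A, φ x ≠ φ y ∨ ψ x ≠ ψ y → x ≠ y := by
    rintro x y h rfl; simp at h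
  refine ⟨?_, ?_, ?_, ?_⟩
  · rw [hl.nodup_iff]
    simp only [List.nodup_cons, List.mem_cons, List.not_mem_nil, or_false, not_or, List.nodup_nil,
      and_true, not_false_eq_true]
    refine ⟨⟨hK.left_ne.symm, ?_, ?_, ?_, ?_⟩, ⟨?_, ?_, ?_, ?_⟩, ⟨?_, ?_, ?_⟩, ⟨?_, ?_⟩, ?_⟩
    -- The maps φ and ψ distinguish elements of different cosets only; γ, γ + β and likewise δ, δ +
    -- α + β are compared directly.
    on_goal 14 => simpa [add_assoc] using f4
    on_goal 9 => simpa using hK.right_ne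
    all_goals
      apply hne
      simp [p1, p2, p3, p4, q1, q2, q3, p3.symm, q4.symm]
  · intro x hx
    have hx := hl.mem_iff.1 hx
    simp only [List.mem_cons, List.not_mem_nil, or_false] at hx
    rcases hx with rfl | rfl | rfl | rfl | rfl | rfl
    · simp
    · exact f1
    · exact g1
    · rw [neg_add, ← g1, ← f2]
    · exact g2
    · rw [neg_add, neg_add, ← g2, ← f1, ← f2]
  · rw [hl.sum_eq]
    simp only [List.sum_cons, List.sum_nil, add_zero, zero_add]
    calc _ = (α + α) + (β + β) + (γ + γ) + (δ + δ) := by abel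
      _ = 0 := by rw [hK.two_left, hK.two_right, d1, d2]; simp
  · intro x hx
    have hx := hl.mem_iff.1 hx
    simp only [List.mem_cons, List.not_mem_nil, or_false] at hx
    rcases hx with rfl | rfl | rfl | rfl | rfl | rfl <;> simp [coset4]

theorem many_six_even {φ : A →+ B} {ψ : A →+ C} (hI : Independent α β γ δ φ ψ)
    (h : Fits a b ([] : List A) [] [(0, α), (γ, γ + β), (δ, δ + α + β)])
    (hc : a + b + 6 ≤ Fintype.card A) (h1 : (a + b) % 4 = 2) :
    CosetsComplete xs a b α β (start a [] [] [(0, α), (γ, γ + β), (δ, δ + α + β)]) := by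
  obtain ⟨e1, e2, e3, e4⟩ := six_elements hK hI
    (l := startList [] [] [(0, α), (γ, γ + β), (δ, δ + α + β)]) (by simp [startList])
  have hl := h.le
  refine cosetsComplete_start hxs hK h e1 e2 e3 [0, γ, δ] e4 ?_ ?_
  · simp [startList]; omega
  · left; simp [startList] at hl ⊢; omega

theorem many_six_odd {φ : A →+ B} {ψ : A →+ C} (hI : Independent α β γ δ φ ψ)
    (h : Fits a b [0] [α] [(γ, γ + β), (δ, δ + α + β)])
    (hc : a + b + 6 ≤ Fintype.card A) (h1 : (a + b) % 4 = 2) :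
    CosetsComplete xs a b α β (start a [0] [α] [(γ, γ + β), (δ, δ + α + β)]) := by
  obtain ⟨e1, e2, e3, e4⟩ := six_elements hK hI
    (l := startList [0] [α] [(γ, γ + β), (δ, δ + α + β)]) (by
      simpa [startList] using List.perm_append_comm (l₁ := [γ, γ + β, δ, δ + α + β]) (l₂ := [0, α]))
  have hl := h.le
  refine cosetsComplete_start hxs hK h e1 e2 e3 [0, γ, δ] e4 ?_ ?_
  · simp [startList]; omega
  · left; simp [startList] at hl ⊢; omega

end independent

end many

end
end Sel
end IrregularLabeling

namespace IrregularLabeling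

/-! ### Special elements -/

variable {ds : List ℕ}

/-- The element `c` of the `i`-th factor. -/
def unitE (ds : List ℕ) (i c : ℕ) : CyclicProduct ds :=
  if h : i < ds.length then Pi.single ⟨i, h⟩ (c : ZMod (ds.get ⟨i, h⟩)) else 0

theorem unitE_eq {i : ℕ} (h : i < ds.length) (c : ℕ) :
    unitE ds i c = Pi.single ⟨i, h⟩ (c : ZMod (ds.get ⟨i, h⟩)) := dif_pos h

theorem code_unitE {i c : ℕ} (h : i < ds.length) (hc : c < ds.getD i 0) :
    code ds (unitE ds i c) = unitCode ds i c := by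
  rw [unitE_eq h, code_single ⟨i, h⟩ (by simpa [h] using hc), unitCode]

theorem unitE_add (i c c' : ℕ) : unitE ds i c + unitE ds i c' = unitE ds i (c + c') := by
  unfold unitE; split
  · rw [← Pi.single_add, Nat.cast_add]
  · simp

theorem unitE_eq_zero {i c : ℕ} (h : i < ds.length) : unitE ds i c = 0 ↔ ds.getD i 0 ∣ c := by
  rw [unitE_eq h, Pi.single_eq_zero_iff, ZMod.natCast_eq_zero_iff]; simp [h]

theorem unitE_apply_ne {i c : ℕ} {j : Fin ds.length} (h : (j : ℕ) ≠ i) : unitE ds i c j = 0 := by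
  unfold unitE; split
  · rw [Pi.single_eq_of_ne]; intro e; exact h (by rw [e])
  · rfl

theorem unitE_apply_ne_zero {i c : ℕ} (h : i < ds.length) (hc : ¬ ds.getD i 0 ∣ c) :
    unitE ds i c ⟨i, h⟩ ≠ 0 := by
  rw [unitE_eq h, Pi.single_eq_same, Ne, ZMod.natCast_eq_zero_iff]; simpa [h] using hc

theorem mem_evens {i j : ℕ} : i ∈ evens ds j ↔ i < j ∧ ds.getD i 0 % 2 = 0 := by
  induction j with
  | zero => simp [evens]
  | succ j ih =>
    rw [evens]
    split
    · rename_i h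
      rw [List.mem_cons, ih]
      constructor
      · rintro (rfl | h')
        · exact ⟨by omega, h⟩
        · exact ⟨by omega, h'.2⟩
      · rintro ⟨h1, h2⟩
        rcases Nat.lt_succ_iff_lt_or_eq.1 h1 with h1 | h1
        · exact Or.inr ⟨h1, h2⟩
        · exact Or.inl h1
    · rename_i h
      rw [ih]
      constructor
      · rintro ⟨h1, h2⟩; exact ⟨by omega, h2⟩
      · rintro ⟨h1, h2⟩
        refine ⟨?_, h2⟩
        rcases Nat.lt_succ_iff_lt_or_eq.1 h1 with h1 | rfl
        · exact h1
        · exact absurd h2 h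

theorem nodup_evens (j : ℕ) : (evens ds j).Nodup := by
  induction j with
  | zero => simp [evens]
  | succ j ih =>
    rw [evens]; split
    · exact List.nodup_cons.2 ⟨fun h => by have := (mem_evens.1 h).1; omega, ih⟩
    · exact ih

theorem take_prod_evens {j : ℕ} (hj : j ≤ ds.length) :
    ∃ m, m % 2 = 1 ∧ (ds.take j).prod = ((evens ds j).map fun i => ds.getD i 0).prod * m := by
  induction j with
  | zero => exact ⟨1, rfl, by simp [evens]⟩
  | succ j ih =>
    obtain ⟨m, h1, h2⟩ := ih (by omega)
    rw [take_succ_eq (by omega), List.prod_append, h2, List.prod_singleton, evens]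
    split
    · exact ⟨m, h1, by rw [List.map_cons, List.prod_cons]; ring⟩
    · rename_i h
      exact ⟨m * ds.getD j 0, by rw [Nat.mul_mod, h1]; omega, by ring⟩

/-- The residues of the group order mod 2 and mod 4 can be read off from the even orders, since m is
odd. -/
theorem prod_evens (ds : List ℕ) :
    ∃ m, m % 2 = 1 ∧ ds.prod = ((evens ds ds.length).map fun i => ds.getD i 0).prod * m := by
  have := take_prod_evens (ds := ds) le_rfl
  rwa [List.take_length] at this

/-- The involution of the `i`-th factor. -/
def halfE (ds : List ℕ) (i : ℕ) : CyclicProduct ds := unitE ds i (ds.getD i 0 / 2)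

section
variable (hds : ∀ d ∈ ds, 2 ≤ d)
include hds

theorem two_le_getD {i : ℕ} (h : i < ds.length) : 2 ≤ ds.getD i 0 := by
  rw [List.getD_eq_getElem _ _ h]; exact hds _ (List.getElem_mem h)

theorem code_halfE {i : ℕ} (h : i < ds.length) :
    code ds (halfE ds i) = unitCode ds i (ds.getD i 0 / 2) :=
  code_unitE h (by have := two_le_getD hds h; omega)

theorem halfE_ne_zero {i : ℕ} (h : i < ds.length) : halfE ds i ≠ 0 := by
  rw [halfE, Ne, unitE_eq_zero h]
  have := two_le_getD hds h
  exact fun hd => by have := Nat.le_of_dvd (by omega) hd; omega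

omit hds in
theorem halfE_add {i : ℕ} (h : i < ds.length) (he : ds.getD i 0 % 2 = 0) :
    halfE ds i + halfE ds i = 0 := by
  rw [halfE, unitE_add, unitE_eq_zero h]
  exact ⟨1, by omega⟩

omit hds in
theorem halfE_apply_ne {i : ℕ} {j : Fin ds.length} (h : (j : ℕ) ≠ i) : halfE ds i j = 0 :=
  unitE_apply_ne h

theorem halfE_apply_ne_zero {i : ℕ} (h : i < ds.length) : halfE ds i ⟨i, h⟩ ≠ 0 := by
  refine unitE_apply_ne_zero h fun hd => ?_
  have := two_le_getD hds h
  have := Nat.le_of_dvd (by omega) hd; omega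

theorem klein_halfE {i j : ℕ} (hi : i ∈ evens ds ds.length) (hj : j ∈ evens ds ds.length)
    (h : i ≠ j) : Sel.Klein (halfE ds i) (halfE ds j) := by
  obtain ⟨i1, i2⟩ := mem_evens.1 hi
  obtain ⟨j1, j2⟩ := mem_evens.1 hj
  refine ⟨halfE_add i1 i2, halfE_add j1 j2, halfE_ne_zero hds i1, halfE_ne_zero hds j1, ?_⟩
  intro e
  have := congrFun e ⟨i, i1⟩
  rw [halfE_apply_ne (i := j) (by simpa using h)] at this
  exact halfE_apply_ne_zero hds i1 this

omit hds in
theorem independent_halfE (hds : ∀ d ∈ ds, 2 ≤ d) {i j k l : ℕ} (hk : k ∈ evens ds ds.length)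
    (hl : l ∈ evens ds ds.length) (h : [i, j, k, l].Nodup) :
    Sel.Independent (halfE ds i) (halfE ds j) (halfE ds k) (halfE ds l)
      (Pi.evalAddMonoidHom _ ⟨k, (mem_evens.1 hk).1⟩)
      (Pi.evalAddMonoidHom _ ⟨l, (mem_evens.1 hl).1⟩) := by
  obtain ⟨k1, k2⟩ := mem_evens.1 hk
  obtain ⟨l1, l2⟩ := mem_evens.1 hl
  simp only [List.nodup_cons, List.mem_cons, List.not_mem_nil, or_false, not_or] at h
  obtain ⟨⟨h1, h2, h3⟩, ⟨h4, h5⟩, h6, -⟩ := h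
  exact ⟨eq_neg_of_add_eq_zero_left (halfE_add k1 k2), eq_neg_of_add_eq_zero_left (halfE_add l1 l2),
    halfE_apply_ne (by simpa using Ne.symm h2), halfE_apply_ne (by simpa using Ne.symm h4),
    halfE_apply_ne_zero hds k1, halfE_apply_ne (by simpa using h6),
    halfE_apply_ne (by simpa using Ne.symm h3), halfE_apply_ne (by simpa using Ne.symm h5),
    halfE_apply_ne (by simpa using Ne.symm h6), halfE_apply_ne_zero hds l1⟩

omit hds in
theorem apply_of_eq_neg {x : CyclicProduct ds} (hx : x = -x) (i : Fin ds.length) :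
    x i = 0 ∨ 2 * (x i).val = ds.get i := by
  have := congrFun hx i
  exact (ZMod.neg_eq_self_iff (x i)).1 this.symm

omit hds in
theorem eq_zero_of_eq_neg (h : evens ds ds.length = []) {x : CyclicProduct ds} (hx : x = -x) :
    x = 0 := by
  funext i
  rcases apply_of_eq_neg hx i with h' | h'
  · exact h'
  · have : (i : ℕ) ∈ evens ds ds.length := mem_evens.2 ⟨i.2, by
      rw [List.getD_eq_getElem _ _ i.2]; simp at h'; omega⟩
    simp [h] at this

/-- In each coordinate a self-inverse element is 0 or half the order, and the second is possible
only for an even order. -/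
theorem eq_zero_or_of_eq_neg {k : ℕ} (h : evens ds ds.length = [k]) {x : CyclicProduct ds}
    (hx : x = -x) : x = 0 ∨ x = halfE ds k := by
  have hk : k < ds.length := (mem_evens.1 (h ▸ List.mem_singleton_self k)).1
  have hne : ∀ i : Fin ds.length, (i : ℕ) ≠ k → x i = 0 := by
    intro i hi
    rcases apply_of_eq_neg hx i with h' | h'
    · exact h'
    · have : (i : ℕ) ∈ evens ds ds.length := mem_evens.2 ⟨i.2, by
        rw [List.getD_eq_getElem _ _ i.2]; simp at h'; omega⟩
      simp [h] at this; exact absurd this hi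
  rcases apply_of_eq_neg hx ⟨k, hk⟩ with h' | h'
  · left
    funext i
    by_cases hi : (i : ℕ) = k
    · have : i = ⟨k, hk⟩ := Fin.ext hi
      rw [this, h']; rfl
    · exact hne i hi
  · right
    funext i
    by_cases hi : (i : ℕ) = k
    · have : i = ⟨k, hk⟩ := Fin.ext hi
      have h2 : 2 ≤ ds.get ⟨k, hk⟩ := hds _ (List.get_mem _ _)
      have : NeZero (ds.get ⟨k, hk⟩) := ⟨by omega⟩
      subst i
      rw [halfE, unitE_eq hk, Pi.single_eq_same, ← ZMod.natCast_zmod_val (x ⟨k, hk⟩)]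
      congr 1
      rw [List.getD_eq_getElem _ _ hk]
      simp only [List.get_eq_getElem] at h'
      omega
    · rw [hne i hi, halfE_apply_ne hi]

theorem quarter_add {k : ℕ} (hk : k < ds.length) (h4 : ds.getD k 0 % 4 = 0) :
    code ds (unitE ds k (ds.getD k 0 / 4)) = unitCode ds k (ds.getD k 0 / 4) ∧
      unitE ds k (ds.getD k 0 / 4) + unitE ds k (ds.getD k 0 / 4) = halfE ds k := by
  have := two_le_getD hds hk
  refine ⟨code_unitE hk (by omega), ?_⟩
  rw [unitE_add, halfE]; congr 1; omega

theorem code_unitE_one {i : ℕ} (hi : i < ds.length) :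
    code ds (unitE ds i 1) = unitCode ds i 1 :=
  code_unitE hi (by have := two_le_getD hds hi; omega)

theorem triple_ne_zero {i : ℕ} (hi : i < ds.length) (h3 : ds.getD i 0 ≠ 3) :
    unitE ds i 1 + unitE ds i 1 + unitE ds i 1 ≠ 0 := by
  have := two_le_getD hds hi
  rw [unitE_add, unitE_add, Ne, unitE_eq_zero hi]
  intro h
  rcases (Nat.dvd_prime Nat.prime_three).1 h with h | h
  · omega
  · exact h3 h

theorem quadruple_ne_zero {i : ℕ} (hi : i < ds.length) (h2 : ds.getD i 0 ≠ 2)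
    (h4 : ds.getD i 0 ≠ 4) :
    unitE ds i 1 + unitE ds i 1 + (unitE ds i 1 + unitE ds i 1) ≠ 0 := by
  have := two_le_getD hds hi
  rw [unitE_add, unitE_add, Ne, unitE_eq_zero hi]
  intro h
  have hle := Nat.le_of_dvd (by omega) h
  generalize ds.getD i 0 = d at *
  interval_cases d <;> omega

theorem exists_ne_neg (h : ds.count 2 ≠ ds.length) : ∃ x : CyclicProduct ds, x ≠ -x := by
  rw [Ne, List.count_eq_length] at h
  push Not at h
  obtain ⟨d, hd, hd2⟩ := h
  obtain ⟨i, hi, rfl⟩ := List.getElem_of_mem hd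
  refine ⟨unitE ds i 1, fun e => ?_⟩
  have e' : unitE ds i 1 + unitE ds i 1 = 0 := by nth_rewrite 2 [e]; simp
  rw [unitE_add, unitE_eq_zero hi, List.getD_eq_getElem _ _ hi] at e'
  have := Nat.le_of_dvd (by omega) e'
  have := hds _ hd
  omega

end

theorem prod_eq_pow {c : ℕ} (h : ∀ d ∈ ds, d = c) : ds.prod = c ^ ds.length := by
  rw [List.eq_replicate_of_mem h, List.prod_replicate, List.length_replicate]

/-- The unit vectors of the first two factors: their codes are the prefix products 1 and 3, so the
program may use these constants. -/
theorem three_elements (h : ∀ d ∈ ds, d = 3) (hl : 2 ≤ ds.length) :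
    ∃ x u : CyclicProduct ds, code ds x = 1 ∧ code ds u = 3 ∧ x + x + x = 0 ∧ u + u + u = 0 ∧
      x ≠ 0 ∧ u ≠ 0 ∧ x ≠ u ∧ x + u ≠ 0 := by
  have hg : ∀ i < ds.length, ds.getD i 0 = 3 := fun i hi => by
    rw [List.getD_eq_getElem _ _ hi]; exact h _ (List.getElem_mem hi)
  have h0 : 0 < ds.length := by omega
  have h1 : 1 < ds.length := by omega
  have a1 : unitE ds 0 1 ⟨1, h1⟩ = 0 := unitE_apply_ne (by simp)
  have a2 : unitE ds 1 1 ⟨1, h1⟩ ≠ 0 := unitE_apply_ne_zero h1 (by rw [hg 1 h1]; omega)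
  refine ⟨unitE ds 0 1, unitE ds 1 1, ?_, ?_, ?_, ?_, ?_, ?_, ?_, ?_⟩
  · rw [code_unitE h0 (by rw [hg 0 h0]; omega)]; simp [unitCode]
  · rw [code_unitE h1 (by rw [hg 1 h1]; omega), unitCode, take_succ_eq h0, hg 0 h0]; simp
  · rw [unitE_add, unitE_add, unitE_eq_zero h0, hg 0 h0]
  · rw [unitE_add, unitE_add, unitE_eq_zero h1, hg 1 h1]
  · rw [Ne, unitE_eq_zero h0, hg 0 h0]; omega
  · rw [Ne, unitE_eq_zero h1, hg 1 h1]; omega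
  · intro e
    rw [← congrFun e ⟨1, h1⟩, a1] at a2; exact a2 rfl
  · intro e
    have := congrFun e ⟨1, h1⟩
    rw [Pi.add_apply, a1, zero_add] at this; exact a2 this

end IrregularLabeling

namespace IrregularLabeling

/-! ### Choosing the weights -/

variable {W : ℕ} {ds : List ℕ}

def negE (e : Expr) : Expr := subE 0 e
def addE (e₁ e₂ : Expr) : Expr := subE e₁ (subE 0 e₂)

/-- The expression computes the code of `g`, also after further elements are put. -/
def Ev (W : ℕ) (ds : List ℕ) (s : Store) (e : Expr) (g : CyclicProduct ds) : Prop :=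
  EvalTo W ds s e g ∧ e.Stable

theorem Expr.Stable.subE {e₁ e₂ : Expr} (h₁ : e₁.Stable) (h₂ : e₂.Stable) :
    (subE e₁ e₂).Stable := by
  constructor
  · intro x hx
    simp only [IrregularLabeling.subE, Expr.rregs, HAdd.hAdd, Add.add, HMul.hMul, Mul.mul,
      HSub.hSub, Sub.sub, HMod.hMod, Mod.mod, HDiv.hDiv, Div.div, List.mem_append,
      List.mem_singleton] at hx
    by_cases q1 : x ∈ e₁.rregs
    · exact h₁.1 x q1
    · by_cases q2 : x ∈ e₂.rregs
      · exact h₂.1 x q2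
      · simp only [q1, q2, false_or, or_false] at hx; omega
  · intro x hx
    simp only [IrregularLabeling.subE, Expr.rarrs, HAdd.hAdd, Add.add, HMul.hMul, Mul.mul,
      HSub.hSub, Sub.sub, HMod.hMod, Mod.mod, HDiv.hDiv, Div.div, List.mem_append,
      List.mem_cons, List.not_mem_nil] at hx
    by_cases q1 : x ∈ e₁.rarrs
    · exact h₁.2 x q1
    · by_cases q2 : x ∈ e₂.rarrs
      · exact h₂.2 x q2
      · simp only [q1, q2, false_or, or_false] at hx; omega

section
variable {s : Store} {e e₁ e₂ : Expr} {g g₁ g₂ : CyclicProduct ds}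

theorem Ev.zero (hW : 0 < W) : Ev W ds s 0 0 := ⟨EvalTo.zero hW, by decide⟩

theorem Ev.reg {x : ℕ} (h : s.reg x = code ds g) (hx : x ≠ 29 ∧ x ≠ 30) : Ev W ds s #x g :=
  ⟨EvalTo.reg h, fun y hy => by simp [Expr.rregs] at hy; omega, fun y hy => by simp [Expr.rarrs] at hy⟩

theorem Ev.sub (hds : ∀ d ∈ ds, 2 ≤ d) (hW : ds.prod * ds.prod + 2 * ds.prod < W) (ht : Tab ds s)
    (h₁ : Ev W ds s e₁ g₁) (h₂ : Ev W ds s e₂ g₂) : Ev W ds s (subE e₁ e₂) (g₁ - g₂) :=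
  ⟨h₁.1.subE hds hW ht h₂.1, h₁.2.subE h₂.2⟩

theorem Ev.neg (hds : ∀ d ∈ ds, 2 ≤ d) (hW : ds.prod * ds.prod + 2 * ds.prod < W) (ht : Tab ds s)
    (h : Ev W ds s e g) : Ev W ds s (negE e) (-g) := by
  rw [← zero_sub]; exact (Ev.zero (by omega)).sub hds hW ht h

theorem Ev.add (hds : ∀ d ∈ ds, 2 ≤ d) (hW : ds.prod * ds.prod + 2 * ds.prod < W) (ht : Tab ds s)
    (h₁ : Ev W ds s e₁ g₁) (h₂ : Ev W ds s e₂ g₂) : Ev W ds s (addE e₁ e₂) (g₁ + g₂) := by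
  rw [← sub_neg_eq_add]; exact h₁.sub hds hW ht (h₂.neg hds hW ht)

/-- The programs that make initial choices are closed terms, so their time bound is independent of
the instance and is checked by evaluation. -/
theorem startEv_does (hds : ∀ d ∈ ds, 2 ≤ d) {a b z T : ℕ} (hW : 2 * (a + b) + 4 < W)
    (hs : s.Bounded W) (h : Rep ds a b z s ([], []))
    {esA esB : List Expr} {es : List (Expr × Expr)} {gsA gsB : List (CyclicProduct ds)}
    {gs : List (CyclicProduct ds × CyclicProduct ds)}
    (hA : List.Forall₂ (Ev W ds s) esA gsA) (hB : List.Forall₂ (Ev W ds s) esB gsB)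
    (hev : List.Forall₂ (fun e g => Ev W ds s e.1 g.1 ∧ Ev W ds s e.2 g.2) es gs)
    (hf : Sel.Fits a b gsA gsB gs) (hT : (start esA esB es).time ≤ T)
    {P : Sel (CyclicProduct ds) → Prop} (hP : P (Sel.start a gsA gsB gs)) :
    Does W (start esA esB es) T s (fun s' => ∃ σ, Rep ds a b z s' σ ∧ P σ) := by
  have key : ∀ {es : List Expr} {gs : List (CyclicProduct ds)}, List.Forall₂ (Ev W ds s) es gs →
      ∀ e ∈ es, e.Stable := by
    intro es gs h
    induction h with
    | nil => simp
    | cons h _ ih => intro e he; rcases List.mem_cons.1 he with rfl | he; exacts [h.2, ih _ he]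
  refine (start_does hds hW (key hA) (key hB) ?_ hs (hA.imp fun _ _ h => h.1)
    (hB.imp fun _ _ h => h.1) (hev.imp fun _ _ h => ⟨h.1.1, h.2.1⟩) h hf.le₁ hf.le₂ hf.even₁
    hf.even₂ hf.le).mono hT fun s' _ _ hr => ⟨_, hr, hP⟩
  clear hf hP hT
  induction hev with
  | nil => simp
  | cons h _ ih =>
    intro e he
    rcases List.mem_cons.1 he with rfl | he
    · exact ⟨h.1.2, h.2.2, fun hm => (h.2.2.1 _ hm).1 rfl⟩
    · exact ih _ he

end

theorem Sel.Fits.of {A : Type*} {a b : ℕ} {gsA gsB : List A} {gs : List (A × A)} (p q r : ℕ)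
    (hp : gsA.length = p) (hq : gsB.length = q) (hr : gs.length = r) (h1 : p ≤ a) (h2 : q ≤ b)
    (h3 : (a - p) % 2 = 0) (h4 : (b - q) % 2 = 0) (h5 : 2 * r + p + q ≤ a + b) :
    Fits a b gsA gsB gs := by
  subst hp hq hr; exact ⟨h1, h2, Nat.even_iff.2 h3, Nat.even_iff.2 h4, h5⟩

/-- The initial choice in a group of odd order. -/
def startOdd : Prog :=
  .ite (#0 % 2 =ₑ 1) (start [0] [] [])
    (.ite (.cell 14 #27 % 2 =ₑ 0) (start [] [] [])
      (.ite #8 (start [#8] [0, negE #8, addE #8 #8] [])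
        (.ite (#0 + 1 =ₑ #3)
          (start [1, 3, negE (addE 1 3)] [negE 1, negE 3, addE 1 3] [])
          (start [addE 1 3] [0, 1, 3] []))))

/-- The initial choice in a group with one involution. -/
def startSingle : Prog :=
  .ite (#0 % 2 =ₑ 1) (start [0] [] [])
    (.ite (#0 =ₑ #3)
      (.ite (.cell 14 #27 % 2 =ₑ 0) (start [0, #14] [#10, negE #14] [])
        (start [negE #14] [0, #14, #10] []))
      (.ite (.cell 14 #27 % 2 =ₑ 0) (start [] [] [])
        (start [0] [#10, #9, subE #10 #9] [])))

/-- The initial choice in a group with more than one involution. -/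
def startMany : Prog :=
  .ite (#0 % 4 =ₑ 1) (start [0] [] [])
    (.ite (#0 % 4 =ₑ 3) (start [#10] [] [(#11, addE #10 #11)])
      (.ite ((#0 % 4 =ₑ 2) * (#6 =ₑ #2))
        (.ite (.cell 14 #27 % 2 =ₑ 0)
          (start [] [] [(0, #10), (#12, addE #12 #11), (#13, addE (addE #13 #10) #11)])
          (start [0] [#10] [(#12, addE #12 #11), (#13, addE (addE #13 #10) #11)]))
        (.ite (.cell 14 #27 % 2 =ₑ 0) (start [] [] [])
          (start [0] [#10] [(#11, addE #10 #11)]))))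

/-- The sizes of the two classes admit a choice of weights with equal sums. -/
structure Feasible (ds : List ℕ) (a b : ℕ) : Prop where
  pos₁ : 1 ≤ a
  pos₂ : 1 ≤ b
  three : 3 ≤ a + b
  le : a + b ≤ ds.prod
  odd : (a + b) % 2 = 1 → a % 2 = 1
  smaller : a % 2 = 1 → b % 2 = 1 → a ≤ b
  full : ds.prod % 4 = 2 → a + b ≠ ds.prod
  twos : ds.count 2 = ds.length → a + b + 2 ≠ ds.prod
  threes : ds.count 3 = ds.length → a + b + 1 = ds.prod → 2 ≤ a ∧ 2 ≤ b

section
variable (hds : ∀ d ∈ ds, 2 ≤ d) {a b z : ℕ} {s : Store} (hs : s.Bounded W)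
  (hW : 2 * (a + b) + 4 < W) (hNW : ds.prod * ds.prod + 2 * ds.prod < W)
  (h0 : s.reg 0 = a + b) (h2 : s.reg 2 = ds.length) (hsc : Scanned ds s) (ht : Tab ds s)
  (hr : Rep ds a b z s ([], [])) (hf : Feasible ds a b)
include hds hs hW hNW h0 hsc ht hr hf

/-- A branch on the parity of the size of the first class. -/
theorem parity_ite_does {p q : Prog} {T : ℕ} {Q : Store → Prop}
    (hp : a % 2 = 0 → Does W p T s Q) (hq : a % 2 = 1 → Does W q T s Q) :
    Does W (.ite (.cell 14 #27 % 2 =ₑ 0) p q) (7 + T) s Q := by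
  have hv : s.arr 14 z = a := by simpa using hr.fst.need
  refine Does.ite (by omega) hs (by simp; omega) (fun h => hp ?_) (fun h => hq ?_)
  · simp [hr.rA, hv] at h; exact h
  · simp [hr.rA, hv] at h; omega

theorem startOdd_does (hE : evens ds ds.length = []) :
    Does W startOdd 6000 s
      (fun s' => ∃ σ, Rep ds a b z s' σ ∧ Sel.PairsComplete (elems ds) a b σ) := by
  obtain ⟨f1, f2, f3, f4, f5, f6, f7, f8, f9⟩ := hf
  have hxs := mem_elems hds
  have hT : ∀ x : CyclicProduct ds, x = -x → x = 0 := fun x => eq_zero_of_eq_neg hE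
  have : ∀ i : Fin ds.length, NeZero (ds.get i) := fun i =>
    ⟨by have := hds _ (List.get_mem ds i); omega⟩
  have hcard : Fintype.card (CyclicProduct ds) = ds.prod := by
    rw [← Nat.card_eq_fintype_card, card_cyclicProduct]
  have hodd : ds.prod % 2 = 1 := by
    obtain ⟨m, hm, he⟩ := prod_evens ds
    rw [hE] at he; simp at he; omega
  have e0 := Ev.zero (W := W) (ds := ds) (s := s) (by omega)
  refine Does.mono (T := 6 + (7 + (2 + (6 + 5000)))) ?_ (by omega) fun _ _ _ h => h
  refine Does.ite (by omega) hs (by simp; omega) (fun h => ?_) (fun h => ?_)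
  · simp [h0] at h
    have hF : Sel.Fits a b ([0] : List (CyclicProduct ds)) [] [] :=
      .of 1 0 0 rfl rfl rfl (by omega) (by omega) (by omega) (by omega) (by omega)
    exact startEv_does hds hW hs hr (.cons e0 .nil) .nil .nil hF (by decide +kernel)
      (Sel.odd_one hxs hT hF (by omega))
  simp [h0] at h
  refine parity_ite_does hds hs hW hNW h0 hsc ht hr ⟨f1, f2, f3, f4, f5, f6, f7, f8, f9⟩
    (fun ha => ?_) fun ha => ?_
  · have hF : Sel.Fits a b ([] : List (CyclicProduct ds)) [] [] :=
      .of 0 0 0 rfl rfl rfl (by omega) (by omega) (by omega) (by omega) (by omega)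
    exact startEv_does hds hW hs hr .nil .nil .nil hF (by decide +kernel)
      (Sel.odd_none hxs hT hF (by omega))
  have hab := f6 ha (by omega)
  -- Both class sizes are odd, the first is the smaller one, and their sum is at least 3.
  have hb3 : 3 ≤ b := by omega
  refine Does.ite (by omega) hs (by simp) (fun h8 => ?_) (fun h8 => ?_)
  · simp at h8
    rcases hsc.notThree with ⟨q, _⟩ | ⟨i, hi, hi3, h8'⟩
    · exact absurd q h8
    · rw [← code_unitE_one hds hi] at h8'
      have ex := Ev.reg (W := W) h8' (by omega)
      have hF : Sel.Fits a b [unitE ds i 1] [0, -unitE ds i 1, unitE ds i 1 + unitE ds i 1] [] :=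
        .of 1 3 0 rfl rfl rfl (by omega) (by omega) (by omega) (by omega) (by omega)
      exact startEv_does hds hW hs hr (.cons ex .nil)
        (.cons e0 (.cons (ex.neg hds hNW ht) (.cons (ex.add hds hNW ht ex) .nil))) .nil hF
        (by decide +kernel) (Sel.odd_double hxs hT hF (triple_ne_zero hds hi hi3) (by omega))
  simp at h8
  -- A zero in register `8` is unambiguous: the code of a unit vector of order other than 3 is not
  -- 0.
  have h3 : ∀ d ∈ ds, d = 3 := by
    rcases hsc.notThree with ⟨_, q⟩ | ⟨i, hi, hi3, h8'⟩
    · intro d hd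
      obtain ⟨i, hi, rfl⟩ := List.getElem_of_mem hd
      rw [← q i hi, List.getD_eq_getElem _ _ hi]
    · rw [h8, ← code_unitE_one hds hi] at h8'
      have e := code_injective hds (a₁ := 0) (a₂ := unitE ds i 1) (by rw [← h8']; simp)
      exact absurd (by rw [← e]; simp) (triple_ne_zero hds hi hi3)
  have hc3 : ds.count 3 = ds.length := List.count_eq_length.2 fun d hd => (h3 d hd).symm
  have hl : 2 ≤ ds.length := by
    by_contra hlt
    have e := prod_eq_pow h3
    have : ds.length = 0 ∨ ds.length = 1 := by omega
    rcases this with h | h <;> rw [h] at e <;> simp at e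
    · omega
    · have := f9 hc3 (by omega); omega
  obtain ⟨x, u, c1, c2, x3, u3, x0, u0, xu, xu'⟩ := three_elements h3 hl
  have ex : Ev W ds s 1 x := ⟨⟨by simp [c1], by simp; omega⟩, by decide⟩
  have eu : Ev W ds s 3 u := ⟨⟨by simp [c2], by simp; omega⟩, by decide⟩
  have exu := ex.add hds hNW ht eu
  -- As n is even and N is odd, either n + 1 = N or n + 3 ≤ N. In the first case feasibility makes
  -- both odd class sizes at least 3.
  refine Does.ite (by omega) hs (by simp; rw [h0]; omega) (fun h => ?_) (fun h => ?_)
  · simp [h0, hsc.prod] at h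
    have := f9 hc3 h
    have hF : Sel.Fits a b [x, u, -(x + u)] [-x, -u, x + u] [] :=
      .of 3 3 0 rfl rfl rfl (by omega) (by omega) (by omega) (by omega) (by omega)
    exact startEv_does hds hW hs hr (.cons ex (.cons eu (.cons (exu.neg hds hNW ht) .nil)))
      (.cons (ex.neg hds hNW ht) (.cons (eu.neg hds hNW ht) (.cons exu .nil))) .nil hF
      (by decide +kernel) (Sel.odd_triples hxs hT hF x3 u3 x0 u0 xu xu' (by omega))
  · simp [h0, hsc.prod] at h
    have hF : Sel.Fits a b [x + u] [0, x, u] [] :=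
      .of 1 3 0 rfl rfl rfl (by omega) (by omega) (by omega) (by omega) (by omega)
    exact startEv_does hds hW hs hr (.cons exu .nil) (.cons e0 (.cons ex (.cons eu .nil))) .nil hF
      (by decide +kernel) (Sel.odd_sum hxs hT hF x0 u0 xu xu' (by omega))

theorem startSingle_does {k : ℕ} (hE : evens ds ds.length = [k]) :
    Does W startSingle 6000 s
      (fun s' => ∃ σ, Rep ds a b z s' σ ∧ Sel.PairsComplete (elems ds) a b σ) := by
  obtain ⟨f1, f2, f3, f4, f5, f6, f7, f8, f9⟩ := hf
  have hxs := mem_elems hds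
  have hk := mem_evens.1 (hE ▸ List.mem_singleton_self k)
  have hT : ∀ x : CyclicProduct ds, x = -x → x = 0 ∨ x = halfE ds k := fun x =>
    eq_zero_or_of_eq_neg hds hE
  have : ∀ i : Fin ds.length, NeZero (ds.get i) := fun i =>
    ⟨by have := hds _ (List.get_mem ds i); omega⟩
  have hcard : Fintype.card (CyclicProduct ds) = ds.prod := by
    rw [← Nat.card_eq_fintype_card, card_cyclicProduct]
  obtain ⟨m, hm, he⟩ := prod_evens ds
  rw [hE] at he; simp only [List.map_cons, List.map_nil, List.prod_cons, List.prod_nil, mul_one] at he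
  have heven : ds.prod % 2 = 0 := by rw [he, Nat.mul_mod, hk.2]; simp
  have e0 := Ev.zero (W := W) (ds := ds) (s := s) (by omega)
  have i1 := halfE_ne_zero hds hk.1
  have i2 := halfE_add hk.1 hk.2
  have eι : Ev W ds s #10 (halfE ds k) := by
    refine Ev.reg ?_ (by omega)
    have := hsc.halved.half 0 (by omega)
    rw [hE] at this
    rw [code_halfE hds hk.1]; simpa using this
  refine Does.mono (T := 6 + (4 + (7 + 5000))) ?_ (by omega) fun _ _ _ h => h
  refine Does.ite (by omega) hs (by simp; omega) (fun h => ?_) (fun h => ?_)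
  · simp [h0] at h
    have hF : Sel.Fits a b ([0] : List (CyclicProduct ds)) [] [] :=
      .of 1 0 0 rfl rfl rfl (by omega) (by omega) (by omega) (by omega) (by omega)
    exact startEv_does hds hW hs hr (.cons e0 .nil) .nil .nil hF (by decide +kernel)
      (Sel.single_one hxs hT hF (by omega))
  simp [h0] at h
  refine Does.ite (by omega) hs (by simp) (fun hn => ?_) (fun hn => ?_)
  · simp [h0, hsc.prod] at hn
    -- The other orders are odd, so if this one were 2 mod 4, then N would be 2 mod 4, which is
    -- excluded for n = N. Hence the involution is a double.
    have h4 : ds.getD k 0 % 4 = 0 := by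
      have h42 : ds.prod % 4 ≠ 2 := fun h => f7 h hn
      by_contra h4
      have : ds.getD k 0 % 4 = 2 := by omega
      apply h42
      rw [he, Nat.mul_mod, this]
      have : m % 4 = 1 ∨ m % 4 = 3 := by omega
      rcases this with h | h <;> rw [h]
    obtain ⟨j1, j2⟩ := quarter_add hds hk.1 h4
    have ei : Ev W ds s #14 (unitE ds k (ds.getD k 0 / 4)) := by
      refine Ev.reg ?_ (by omega)
      have := hsc.halved.quarter
      rw [hE] at this
      rw [j1]; simpa using this
    refine parity_ite_does hds hs hW hNW h0 hsc ht hr ⟨f1, f2, f3, f4, f5, f6, f7, f8, f9⟩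
      (fun ha => ?_) fun ha => ?_
    · have hF : Sel.Fits a b [0, unitE ds k (ds.getD k 0 / 4)]
          [halfE ds k, -unitE ds k (ds.getD k 0 / 4)] [] :=
        .of 2 2 0 rfl rfl rfl (by omega) (by omega) (by omega) (by omega) (by omega)
      exact startEv_does hds hW hs hr (.cons e0 (.cons ei .nil))
        (.cons eι (.cons (ei.neg hds hNW ht) .nil)) .nil hF (by decide +kernel)
        (Sel.single_full_even hxs hT i1 j2 i2 hF (by omega))
    · have := f6 ha (by omega)
      have hF : Sel.Fits a b [-unitE ds k (ds.getD k 0 / 4)]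
          [0, unitE ds k (ds.getD k 0 / 4), halfE ds k] [] :=
        .of 1 3 0 rfl rfl rfl (by omega) (by omega) (by omega) (by omega) (by omega)
      exact startEv_does hds hW hs hr (.cons (ei.neg hds hNW ht) .nil)
        (.cons e0 (.cons ei (.cons eι .nil))) .nil hF (by decide +kernel)
        (Sel.single_full_odd hxs hT i1 j2 i2 hF (by omega))
  simp [h0, hsc.prod] at hn
  refine parity_ite_does hds hs hW hNW h0 hsc ht hr ⟨f1, f2, f3, f4, f5, f6, f7, f8, f9⟩
    (fun ha => ?_) fun ha => ?_
  · have hF : Sel.Fits a b ([] : List (CyclicProduct ds)) [] [] :=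
      .of 0 0 0 rfl rfl rfl (by omega) (by omega) (by omega) (by omega) (by omega)
    exact startEv_does hds hW hs hr .nil .nil .nil hF (by decide +kernel)
      (Sel.single_none hxs hT hF (by omega))
  have hab := f6 ha (by omega)
  -- Otherwise all orders are 2 or 4, hence even, and as only one order is even the group is cyclic
  -- of order 2 or 4. But n is even, at least 4, and less than N.
  obtain ⟨i, hi, hi2, hi4, h9⟩ : ∃ i < ds.length, ds.getD i 0 ≠ 2 ∧ ds.getD i 0 ≠ 4 ∧
      s.reg 9 = unitCode ds i 1 := by
    rcases hsc.notTwoFour with ⟨_, q⟩ | q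
    · exfalso
      have hall : ∀ i < ds.length, i = k := by
        intro i hi
        have : i ∈ evens ds ds.length := mem_evens.2 ⟨hi, by rcases q i hi with h | h <;> rw [h]⟩
        rw [hE] at this; simpa using this
      have hlen : ds.length = 1 := by
        have := hall 0 (by omega)
        have := hall (ds.length - 1) (by omega)
        omega
      have hq := q k hk.1
      obtain ⟨d, rfl⟩ := List.length_eq_one_iff.1 hlen
      have : k = 0 := by simpa using hk.1
      subst this
      simp at hq f4 hn heven
      omega
    · exact q
  rw [← code_unitE_one hds hi] at h9
  have ex := Ev.reg (W := W) h9 (by omega)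
  have hF : Sel.Fits a b [0] [halfE ds k, unitE ds i 1, halfE ds k - unitE ds i 1] [] :=
    .of 1 3 0 rfl rfl rfl (by omega) (by omega) (by omega) (by omega) (by omega)
  exact startEv_does hds hW hs hr (.cons e0 .nil)
    (.cons eι (.cons ex (.cons (eι.sub hds hNW ht ex) .nil))) .nil hF (by decide +kernel)
    (Sel.single_triple hxs hT i1 i2 (quadruple_ne_zero hds hi hi2 hi4) hF (by omega))

set_option maxHeartbeats 1000000 in
include h2 in
theorem startMany_does {i j : ℕ} {l : List ℕ} (hE : evens ds ds.length = i :: j :: l) :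
    Does W startMany 6000 s
      (fun s' => ∃ σ, Rep ds a b z s' σ ∧
        Sel.CosetsComplete (elems ds) a b (halfE ds i) (halfE ds j) σ) := by
  obtain ⟨f1, f2, f3, f4, f5, f6, f7, f8, f9⟩ := hf
  have hxs := mem_elems hds
  have hi : i ∈ evens ds ds.length := by simp [hE]
  have hj : j ∈ evens ds ds.length := by simp [hE]
  have hnd := nodup_evens (ds := ds) ds.length
  have hij : i ≠ j := by rw [hE] at hnd; simp at hnd; tauto
  have hK := klein_halfE hds hi hj hij
  have : ∀ i : Fin ds.length, NeZero (ds.get i) := fun i =>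
    ⟨by have := hds _ (List.get_mem ds i); omega⟩
  have hcard : Fintype.card (CyclicProduct ds) = ds.prod := by
    rw [← Nat.card_eq_fintype_card, card_cyclicProduct]
  -- With 4 dividing N, the residue of n mod 4 bounds N - n from below: by 3 for n ≡ 1 and by 1 for
  -- n ≡ 3.
  have h4 : ds.prod % 4 = 0 := by
    obtain ⟨m, hm, he⟩ := prod_evens ds
    rw [hE] at he; simp only [List.map_cons, List.prod_cons] at he
    have hi2 := (mem_evens.1 hi).2
    have hj2 := (mem_evens.1 hj).2
    obtain ⟨u, hu⟩ := Nat.dvd_of_mod_eq_zero hi2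
    obtain ⟨v, hv⟩ := Nat.dvd_of_mod_eq_zero hj2
    rw [he, hu, hv]
    refine Nat.mod_eq_zero_of_dvd ⟨u * v * (l.map fun i => ds.getD i 0).prod * m, by ring⟩
  have e0 := Ev.zero (W := W) (ds := ds) (s := s) (by omega)
  have half : ∀ t < 4, ∀ k, (evens ds ds.length)[t]? = some k → Ev W ds s #(10 + t) (halfE ds k) := by
    intro t ht k hk
    refine Ev.reg ?_ (by omega)
    have hm : k ∈ evens ds ds.length := List.mem_of_getElem? hk
    rw [hsc.halved.half t ht, code_halfE hds (mem_evens.1 hm).1]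
    simp [hk]
  have eα := half 0 (by omega) i (by simp [hE])
  have eβ := half 1 (by omega) j (by simp [hE])
  have eαβ := eα.add hds hNW ht eβ
  refine Does.mono (T := 6 + (6 + (10 + (7 + 5000)))) ?_ (by omega) fun _ _ _ h => h
  refine Does.ite (by omega) hs (by simp; omega) (fun h => ?_) (fun h => ?_)
  · simp [h0] at h
    have hF : Sel.Fits a b ([0] : List (CyclicProduct ds)) [] [] :=
      .of 1 0 0 rfl rfl rfl (by omega) (by omega) (by omega) (by omega) (by omega)
    exact startEv_does hds hW hs hr (.cons e0 .nil) .nil .nil hF (by decide +kernel)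
      (Sel.many_one hxs hK hF (by omega) (by omega))
  simp [h0] at h
  refine Does.ite (by omega) hs (by simp; omega) (fun h' => ?_) (fun h' => ?_)
  · simp [h0] at h'
    have hF : Sel.Fits a b [halfE ds i] [] [(halfE ds j, halfE ds i + halfE ds j)] :=
      .of 1 0 1 rfl rfl rfl (by omega) (by omega) (by omega) (by omega) (by omega)
    exact startEv_does hds hW hs hr (.cons eα .nil) .nil (.cons ⟨eβ, eαβ⟩ .nil) hF
      (by decide +kernel) (Sel.many_three hxs hK hF (by omega) (by omega))
  simp [h0] at h'
  refine Does.ite (by omega) hs ?_ (fun h'' => ?_) (fun h'' => ?_)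
  · simp only [Expr.safe_mul, Expr.safe_eq, Expr.safe_mod, Expr.safe_reg, Expr.safe_ofNat,
      Expr.val_eq, true_and, and_true]
    refine ⟨⟨by omega, by omega⟩, ?_⟩
    split <;> split <;> omega
  · simp [h0, h2, hsc.counted.two] at h''
    obtain ⟨hc2, hn2⟩ := h''
    have hc2' := List.count_eq_length.1 hc2
    have hN : ds.prod = 2 ^ ds.length := prod_eq_pow fun d hd => (hc2' d hd).symm
    -- Here n is 2 mod 4, at least 6, and n + 2 ≠ N, so n + 6 ≤ N. The power N of 2 is therefore at
    -- least 16, which provides four independent involutions.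
    have hlen : 4 ≤ ds.length := by
      by_contra hlt
      have : ds.prod ≠ a + b + 2 := fun e => f8 hc2 e.symm
      have h3 : ds.length ≤ 3 := by omega
      have hpow : 2 ^ ds.length ≤ 2 ^ 3 := Nat.pow_le_pow_right (by norm_num) h3
      norm_num at hpow
      omega
    have hev : ∀ t < ds.length, t ∈ evens ds ds.length := fun t ht => mem_evens.2 ⟨ht, by
      rw [List.getD_eq_getElem _ _ ht, ← hc2' _ (List.getElem_mem ht)]⟩
    have hle : 4 ≤ (evens ds ds.length).length := by
      have : List.range ds.length ⊆ evens ds ds.length := fun t ht => hev t (List.mem_range.1 ht)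
      have := (List.subperm_of_subset List.nodup_range this).length_le
      simp at this; omega
    obtain ⟨k, l', l'', hE'⟩ : ∃ k l' l'', evens ds ds.length = i :: j :: k :: l' :: l'' := by
      rw [hE] at hle ⊢
      match l, hle with
      | k :: l' :: l'', _ => exact ⟨k, l', l'', rfl⟩
    have hk : k ∈ evens ds ds.length := by simp [hE']
    have hl' : l' ∈ evens ds ds.length := by simp [hE']
    have hI := independent_halfE hds (i := i) (j := j) hk hl' (by
      rw [hE'] at hnd; exact hnd.sublist (by simp))
    have eγ := half 2 (by omega) k (by simp [hE'])
    have eδ := half 3 (by omega) l' (by simp [hE'])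
    have hN6 : a + b + 6 ≤ ds.prod := by have := f8 hc2; omega
    refine parity_ite_does hds hs hW hNW h0 hsc ht hr ⟨f1, f2, f3, f4, f5, f6, f7, f8, f9⟩
      (fun ha => ?_) fun ha => ?_
    · have hF : Sel.Fits a b ([] : List (CyclicProduct ds)) [] [(0, halfE ds i),
          (halfE ds k, halfE ds k + halfE ds j),
          (halfE ds l', halfE ds l' + halfE ds i + halfE ds j)] :=
        .of 0 0 3 rfl rfl rfl (by omega) (by omega) (by omega) (by omega) (by omega)
      exact startEv_does hds hW hs hr .nil .nil (.cons ⟨e0, eα⟩ (.cons ⟨eγ, eγ.add hds hNW ht eβ⟩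
        (.cons ⟨eδ, (eδ.add hds hNW ht eα).add hds hNW ht eβ⟩ .nil))) hF
        (by decide +kernel) (Sel.many_six_even hxs hK hI hF (by omega) (by omega))
    · have hF : Sel.Fits a b [0] [halfE ds i] [
          (halfE ds k, halfE ds k + halfE ds j),
          (halfE ds l', halfE ds l' + halfE ds i + halfE ds j)] :=
        .of 1 1 2 rfl rfl rfl (by omega) (by omega) (by omega) (by omega) (by omega)
      exact startEv_does hds hW hs hr (.cons e0 .nil) (.cons eα .nil) (.cons
        ⟨eγ, eγ.add hds hNW ht eβ⟩ (.cons ⟨eδ, (eδ.add hds hNW ht eα).add hds hNW ht eβ⟩ .nil)) hF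
        (by decide +kernel) (Sel.many_six_odd hxs hK hI hF (by omega) (by omega))
  simp [h0, h2, hsc.counted.two] at h''
  -- An elementary 2-group with n ≡ 2 mod 4 was treated before, and n is even.
  have hr' : (a + b) % 4 = 0 ∨ ∃ x : CyclicProduct ds, x ≠ -x := by
    by_cases hc : ds.count 2 = ds.length
    · left
      have : (a + b) % 4 ≠ 2 := fun e => h'' hc e
      omega
    · exact Or.inr (exists_ne_neg hds hc)
  refine parity_ite_does hds hs hW hNW h0 hsc ht hr ⟨f1, f2, f3, f4, f5, f6, f7, f8, f9⟩
    (fun ha => ?_) fun ha => ?_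
  · have hF : Sel.Fits a b ([] : List (CyclicProduct ds)) [] [] :=
      .of 0 0 0 rfl rfl rfl (by omega) (by omega) (by omega) (by omega) (by omega)
    exact startEv_does hds hW hs hr .nil .nil .nil hF (by decide +kernel)
      (Sel.many_none hxs hK hF (by omega) hr')
  · have hF : Sel.Fits a b [0] [halfE ds i] [(halfE ds j, halfE ds i + halfE ds j)] :=
      .of 1 1 1 rfl rfl rfl (by omega) (by omega) (by omega) (by omega) (by omega)
    exact startEv_does hds hW hs hr (.cons e0 .nil) (.cons eα .nil) (.cons ⟨eβ, eαβ⟩ .nil) hF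
      (by decide +kernel) (Sel.many_four hxs hK hF (by omega) hr')

end

/-- Choose the weights of the vertices. -/
def select : Prog :=
  .ite (#5 =ₑ 0) startOdd (.ite (#5 =ₑ 1) startSingle (startMany ;; forUp 4 3 cosetBody)) ;;
    forUp 4 3 pairBody

theorem select_does (hds : ∀ d ∈ ds, 2 ≤ d) {a b z : ℕ} {s : Store} (hs : s.Bounded W)
    (hW : 2 * (a + b) + 4 < W) (hNW : ds.prod * ds.prod + 2 * ds.prod < W)
    (h0 : s.reg 0 = a + b) (h2 : s.reg 2 = ds.length) (hsc : Scanned ds s) (ht : Tab ds s)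
    (hr : Rep ds a b z s ([], [])) (hf : Feasible ds a b) :
    Does W select (ds.prod * 800 + 8000) s (fun s' => ∃ σ, Rep ds a b z s' σ ∧ σ.Shape a b ∧
      σ.Balanced ∧ σ.rem a b = 0) := by
  have h5 := hsc.counted.even
  have agr : ∀ {p : Prog} {s' : Store}, Agree p s s' → 3 ∉ p.wregs → 10 ∉ p.wregs → 11 ∉ p.wregs →
      (∀ x ∈ [3, 15, 16, 17], x ∉ p.wregs) → (∀ x ∈ [17, 18], x ∉ p.warrs) →
      s'.reg 3 = ds.prod ∧ s'.reg 10 = s.reg 10 ∧ s'.reg 11 = s.reg 11 ∧ Tab ds s' := by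
    intro p s' ha q1 q2 q3 q4 q5
    exact ⟨(ha.reg 3 q1).trans hsc.prod, ha.reg 10 q2, ha.reg 11 q3,
      ht.congr (fun x hx => ha.reg x (q4 x hx)) (fun x hx => ha.arr x (q5 x hx))⟩
  have key : Does W (.ite (#5 =ₑ 0) startOdd (.ite (#5 =ₑ 1) startSingle
      (startMany ;; forUp 4 3 cosetBody))) (4 + (4 + (6000 + (ds.prod * 508 + 6)))) s
      (fun s' => ∃ σ, Rep ds a b z s' σ ∧ Sel.PairsComplete (elems ds) a b σ) := by
    refine Does.ite (by omega) hs (by simp; omega) (fun h => ?_) (fun h => ?_)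
    · simp [h5] at h
      exact (startOdd_does hds hs hW hNW h0 hsc ht hr hf h).mono (by omega) fun _ _ _ h => h
    simp [h5] at h
    refine Does.ite (by omega) hs (by simp; omega) (fun h' => ?_) (fun h' => ?_)
    · simp [h5] at h'
      obtain ⟨k, hk⟩ := List.length_eq_one_iff.1 h'
      exact (startSingle_does hds hs hW hNW h0 hsc ht hr hf hk).mono (by omega) fun _ _ _ h => h
    simp [h5] at h'
    obtain ⟨i, j, l, hE⟩ : ∃ i j l, evens ds ds.length = i :: j :: l := by
      match evens ds ds.length, h, h' with
      | [], h, _ => exact absurd rfl h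
      | [_], _, h' => exact absurd rfl h'
      | i :: j :: l, _, _ => exact ⟨i, j, l, rfl⟩
    refine Does.seq (startMany_does hds hs hW hNW h0 h2 hsc ht hr hf hE)
      fun s1 hs1 ha1 ⟨σ, hr1, c1, c2, c3⟩ => ?_
    obtain ⟨q1, q2, q3, q4⟩ := agr ha1 (by decide) (by decide) (by decide) (by decide) (by decide)
    have hi : i ∈ evens ds ds.length := by simp [hE]
    have hj : j ∈ evens ds ds.length := by simp [hE]
    have hij : i ≠ j := by
      have hnd := nodup_evens (ds := ds) ds.length
      rw [hE] at hnd; simp at hnd; tauto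
    have hK := klein_halfE hds hi hj hij
    refine (cosetLoop_does hds hs1 hW hNW q1 q4 hr1 c1 c2 (α := halfE ds i) (β := halfE ds j)
      ?_ ?_ hK).mono le_rfl fun s2 _ _ hr2 => ⟨_, hr2, ?_⟩
    · have := hsc.halved.half 0 (by omega)
      rw [q2, code_halfE hds (mem_evens.1 hi).1]; simpa [hE] using this
    · have := hsc.halved.half 1 (by omega)
      rw [q3, code_halfE hds (mem_evens.1 hj).1]; simpa [hE] using this
    · have := Sel.foldl_cosetStep hK (elems ds) c1 c2
      exact ⟨this.1, this.2.1, c3⟩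
  refine Does.mono (key.seq (T' := ds.prod * 208 + 6) fun s1 hs1 ha1 ⟨σ, hr1, c1, c2, c3⟩ => ?_)
    (by omega) fun _ _ _ h => h
  obtain ⟨q1, q2, q3, q4⟩ := agr ha1 (by decide) (by decide) (by decide) (by decide) (by decide)
  refine (pairLoop_does hds hs1 hW hNW q1 q4 hr1 c1 c2).mono le_rfl fun s2 _ _ hr2 =>
    ⟨_, hr2, ?_⟩
  have := Sel.foldl_pairStep (elems ds) c1 c2
  exact ⟨this.1, this.2.1, c3⟩

end IrregularLabeling

namespace IrregularLabeling

/-! ### Truth values of comparisons -/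

theorem Expr.lt_ne_zero {e₁ e₂ : Expr} {s : Store} :
    (e₁ <ₑ e₂).val s ≠ 0 ↔ e₁.val s < e₂.val s := by
  rw [Expr.val_lt]; split <;> simp_all

theorem Expr.lt_eq_zero {e₁ e₂ : Expr} {s : Store} :
    (e₁ <ₑ e₂).val s = 0 ↔ e₂.val s ≤ e₁.val s := by
  rw [Expr.val_lt]; split <;> simp_all

theorem Expr.eq_ne_zero {e₁ e₂ : Expr} {s : Store} :
    (e₁ =ₑ e₂).val s ≠ 0 ↔ e₁.val s = e₂.val s := by
  rw [Expr.val_eq]; split <;> simp_all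

theorem Expr.eq_eq_zero {e₁ e₂ : Expr} {s : Store} :
    (e₁ =ₑ e₂).val s = 0 ↔ e₁.val s ≠ e₂.val s := by
  rw [Expr.val_eq]; split <;> simp_all

/-! ### Adjacency lists -/

/-- The linked list with links `nxt` that starts at the pointer `x` has the entries `L`. -/
def Chain (nxt : ℕ → ℕ) : ℕ → List ℕ → Prop
  | x, [] => x = 0
  | x, k :: L => x = k + 1 ∧ Chain nxt (nxt k) L

theorem Chain.congr {nxt nxt' : ℕ → ℕ} {x : ℕ} {L : List ℕ} (h : Chain nxt x L)
    (hn : ∀ k ∈ L, nxt' k = nxt k) : Chain nxt' x L := by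
  induction L generalizing x with
  | nil => exact h
  | cons k L ih =>
    refine ⟨h.1, ?_⟩
    rw [hn k (by simp)]
    exact ih h.2 fun j hj => hn j (by simp [hj])

/-- Edge `i` with ends `U i`, `V i` gives the arcs `2 i` and `2 i + 1`. -/
def src (U V : ℕ → ℕ) (k : ℕ) : ℕ := if k % 2 = 0 then U (k / 2) else V (k / 2)

/-- The arcs of an edge are reverse to each other, so the target is the source with the roles of U
and V exchanged. -/
def tgt (U V : ℕ → ℕ) (k : ℕ) : ℕ := src V U k

/-- The list is reversed because new arcs are inserted at the head. Pointers are arc numbers plus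
one, and 0 ends a list. -/
def arcs (f : ℕ → ℕ) (K v : ℕ) : List ℕ := ((List.range K).filter fun k => f k = v).reverse

theorem mem_arcs {f : ℕ → ℕ} {K v k : ℕ} : k ∈ arcs f K v ↔ k < K ∧ f k = v := by
  simp [arcs]

theorem nodup_arcs (f : ℕ → ℕ) (K v : ℕ) : (arcs f K v).Nodup :=
  List.nodup_reverse.2 (List.nodup_range.filter _)

theorem arcs_succ (f : ℕ → ℕ) (K v : ℕ) :
    arcs f (K + 1) v = if f K = v then K :: arcs f K v else arcs f K v := by
  rw [arcs, List.range_succ, List.filter_append, List.reverse_append]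
  by_cases h : f K = v <;> simp [h, arcs]

/-- The adjacency lists of the first `K` arcs. -/
structure Adjacency (f g : ℕ → ℕ) (K : ℕ) (tg nxt hd : ℕ → ℕ) : Prop where
  target : ∀ k < K, tg k = g k
  chain : ∀ v, Chain nxt (hd v) (arcs f K v)

theorem Adjacency.step {f g : ℕ → ℕ} {K : ℕ} {tg nxt hd : ℕ → ℕ} (h : Adjacency f g K tg nxt hd)
    {y : ℕ} (hy : y = g K) {x : ℕ} (hx : x = f K) :
    Adjacency f g (K + 1) (Function.update tg K y) (Function.update nxt K (hd x))
      (Function.update hd x (K + 1)) := by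
  subst hy hx
  constructor
  · intro k hk
    by_cases e : k = K
    · simp [e]
    · rw [Function.update_of_ne e]; exact h.target k (by omega)
  · intro v
    have hc : Chain (Function.update nxt K (hd (f K))) (hd v) (arcs f K v) :=
      (h.chain v).congr fun k hk => by
        rw [Function.update_of_ne]; have := (mem_arcs.1 hk).1; omega
    rw [arcs_succ]
    by_cases e : f K = v
    · subst e
      rw [if_pos rfl]
      simp [Chain, hc]
    · rw [if_neg e, Function.update_of_ne (Ne.symm e)]; exact hc

/-- Array `5` holds the targets of the arcs, array `6` the links, and array `7` the heads of the
lists. -/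
def adjacencyBody : Prog :=
  .store 5 (2 * #4) (.cell 1 #4) ;; .store 6 (2 * #4) (.cell 7 (.cell 0 #4)) ;;
    .store 7 (.cell 0 #4) (2 * #4 + 1) ;;
  .store 5 (2 * #4 + 1) (.cell 0 #4) ;; .store 6 (2 * #4 + 1) (.cell 7 (.cell 1 #4)) ;;
    .store 7 (.cell 1 #4) (2 * #4 + 1 + 1)

/-- Build the adjacency lists. -/
def adjacency : Prog := forUp 4 1 adjacencyBody

theorem adjacency_does {W m : ℕ} {U V : ℕ → ℕ} {s : Store} (hs : s.Bounded W) (hW : 2 * m + 2 < W)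
    (h1 : s.reg 1 = m) (hU : s.arr 0 = U) (hV : s.arr 1 = V) (h7 : ∀ i, s.arr 7 i = 0) :
    Does W adjacency (m * 100 + 6) s
      (fun s' => Adjacency (src U V) (tgt U V) (2 * m) (s'.arr 5) (s'.arr 6) (s'.arr 7)) := by
  refine (Does.forUp (c := adjacencyBody.time) (fun k s' => Adjacency (src U V) (tgt U V) (2 * k)
    (s'.arr 5) (s'.arr 6) (s'.arr 7)) (by omega) hs h1 (by decide) (by decide) (by decide) ?_ ?_).mono
    ?_ fun _ _ _ h => h
  · exact ⟨fun k hk => by omega, fun v => by simp [Chain, arcs, h7]⟩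
  · intro k s' hk hs' ha hi hJ
    have hU' : s'.arr 0 = U := (ha.arr 0 (by decide)).trans hU
    have hV' : s'.arr 1 = V := (ha.arr 1 (by decide)).trans hV
    refine Does.of_exec (by omega) hs' ?_ ?_
    · simp [adjacencyBody, Prog.Ok, Prog.exec, hi]; omega
    · have e1 := hJ.step (y := V k) (by simp [tgt, src]) (x := U k) (by simp [src])
      have e2 := e1.step (y := U k)
        (by simp [tgt, src, Nat.add_mod, show (2 * k + 1) / 2 = k by omega]) (x := V k)
        (by simp [src, Nat.add_mod, show (2 * k + 1) / 2 = k by omega])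
      simpa [adjacencyBody, Prog.exec, hi, hU', hV', Nat.mul_add] using e2
  · have : adjacencyBody.time ≤ 90 := by decide
    exact Nat.add_le_add_right (Nat.mul_le_mul_left _ (by omega)) _

/-! ### Rooted trees by position -/

/-- A rooted tree with `q` vertices `ord 0, …, ord (q - 1)`; `pos` is the position plus one, `par`
the position of the parent, `pe` the edge to the parent, `col` the colour in the two-colouring. -/
structure Tree (U V : ℕ → ℕ) (n m q : ℕ) (ord pos par pe col : ℕ → ℕ) : Prop where
  ord_lt : ∀ p < q, ord p < n
  pos_ord : ∀ p < q, pos (ord p) = p + 1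
  ord_pos : ∀ v < n, pos v ≠ 0 → ∃ p < q, ord p = v
  col_zero : col 0 = 0
  par_lt : ∀ p < q, 0 < p → par p < p
  pe_lt : ∀ p < q, 0 < p → pe p < m
  ends : ∀ p < q, 0 < p → (U (pe p) = ord p ∧ V (pe p) = ord (par p)) ∨
    (V (pe p) = ord p ∧ U (pe p) = ord (par p))
  col_par : ∀ p < q, 0 < p → col p + col (par p) = 1

section
variable {U V : ℕ → ℕ} {n m q : ℕ} {ord pos par pe col : ℕ → ℕ}

theorem Tree.col_le (h : Tree U V n m q ord pos par pe col) {p : ℕ} (hp : p < q) : col p ≤ 1 := by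
  by_cases h0 : 0 < p
  · have := h.col_par p hp h0; omega
  · have : p = 0 := by omega
    rw [this, h.col_zero]; omega

theorem Tree.ord_inj (h : Tree U V n m q ord pos par pe col) {p p' : ℕ} (hp : p < q) (hp' : p' < q)
    (e : ord p = ord p') : p = p' := by
  have h1 := h.pos_ord p hp
  have h2 := h.pos_ord p' hp'
  rw [e] at h1; omega

theorem Tree.extend (h : Tree U V n m q ord pos par pe col) (hq : 0 < q) {u p e : ℕ} (hu : u < n)
    (hu0 : pos u = 0) (hp : p < q) (he : e < m)
    (hue : (U e = u ∧ V e = ord p) ∨ (V e = u ∧ U e = ord p)) :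
    Tree U V n m (q + 1) (Function.update ord q u) (Function.update pos u (q + 1))
      (Function.update par q p) (Function.update pe q e) (Function.update col q (1 - col p)) := by
  have hne : ∀ p' < q, ord p' ≠ u := by
    rintro p' hp' rfl
    rw [h.pos_ord p' hp'] at hu0; omega
  have hcol := h.col_le hp
  constructor
  · intro p' hp'
    by_cases e : p' = q
    · simp [e, hu]
    · rw [Function.update_of_ne e]; exact h.ord_lt p' (by omega)
  · intro p' hp'
    by_cases e : p' = q
    · simp [e]
    · rw [Function.update_of_ne e, Function.update_of_ne (hne p' (by omega))]
      exact h.pos_ord p' (by omega)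
  · intro v hv hv0
    by_cases e : v = u
    · exact ⟨q, by omega, by simp [e]⟩
    · rw [Function.update_of_ne e] at hv0
      obtain ⟨p', h1, h2⟩ := h.ord_pos v hv hv0
      exact ⟨p', by omega, by rw [Function.update_of_ne (by omega), h2]⟩
  · rw [Function.update_of_ne (by omega), h.col_zero]
  · intro p' hp' h0
    by_cases e : p' = q
    · simp [e, hp]
    · rw [Function.update_of_ne e]; exact h.par_lt p' (by omega) h0
  · intro p' hp' h0
    by_cases e : p' = q
    · simp [e, he]
    · rw [Function.update_of_ne e]; exact h.pe_lt p' (by omega) h0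
  · intro p' hp' h0
    by_cases e : p' = q
    · subst e
      simp [Function.update_of_ne (show p ≠ p' by omega), hue]
    · have := h.par_lt p' (by omega) h0
      simp only [Function.update_of_ne e, Function.update_of_ne (show par p' ≠ q by omega)]
      exact h.ends p' (by omega) h0
  · intro p' hp' h0
    by_cases e : p' = q
    · subst e
      simp [Function.update_of_ne (show p ≠ p' by omega)]; omega
    · have := h.par_lt p' (by omega) h0
      simp only [Function.update_of_ne e, Function.update_of_ne (show par p' ≠ q by omega)]
      exact h.col_par p' (by omega) h0

end

/-! ### Breadth-first search -/

/-- Arrays `8` to `12` hold the order of discovery, the positions plus one, the parents, the parent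
edges and the colours. Arc k belongs to edge k / 2. -/
def visitArc : Prog :=
  .assign 26 (#24 - 1) ;; .assign 20 (.cell 5 #26) ;; .assign 24 (.cell 6 #26) ;;
  .assign 25 (#25 + 1) ;;
  .ite (.cell 9 #20) .skip
    (.store 8 #23 #20 ;; .store 9 #20 (#23 + 1) ;; .store 10 #23 #22 ;; .store 11 #23 (#26 / 2) ;;
      .store 12 #23 (1 - .cell 12 #22) ;; .assign 23 (#23 + 1))

def searchBody : Prog :=
  .ite (#24 =ₑ 0) (.assign 22 (#22 + 1) ;; .assign 24 (.cell 7 (.cell 8 #22))) visitArc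

/-- Breadth-first search from the vertex `0`. Register `22` is the position of the current vertex,
`23` the number of vertices found, `24` the pointer to the next arc, `25` the number of arcs seen. -/
def search : Prog :=
  .store 9 0 1 ;; .assign 22 0 ;; .assign 23 1 ;; .assign 25 0 ;; .assign 24 (.cell 7 0) ;;
    .while (#22 <ₑ #23) searchBody

def TreeOf (U V : ℕ → ℕ) (n m q : ℕ) (s : Store) : Prop :=
  Tree U V n m q (s.arr 8) (s.arr 9) (s.arr 10) (s.arr 11) (s.arr 12)

/-- The invariant of the search; `D` is the set of arcs seen, `L` the list of arcs that remain at
the current vertex. -/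
structure Searching (U V : ℕ → ℕ) (n m : ℕ) (s : Store) (D : Finset ℕ) (L : List ℕ) : Prop where
  le : s.reg 22 ≤ s.reg 23
  pos : 0 < s.reg 23
  tree : TreeOf U V n m (s.reg 23) s
  done : ∀ k < 2 * m, ∀ p < s.reg 22, src U V k = s.arr 8 p → s.arr 9 (tgt U V k) ≠ 0
  seen : ∀ k ∈ D, k < 2 * m ∧ s.arr 9 (src U V k) ≠ 0 ∧ s.arr 9 (src U V k) ≤ s.reg 22 + 1
  card : D.card = s.reg 25
  chain : s.reg 22 < s.reg 23 → Chain (s.arr 6) (s.reg 24) L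
  nodup : L.Nodup
  list : s.reg 22 < s.reg 23 → ∀ k ∈ L, k < 2 * m ∧ src U V k = s.arr 8 (s.reg 22)
  disjoint : s.reg 22 < s.reg 23 → ∀ k ∈ L, k ∉ D
  rest : s.reg 22 < s.reg 23 → ∀ k < 2 * m, src U V k = s.arr 8 (s.reg 22) →
    k ∈ L ∨ s.arr 9 (tgt U V k) ≠ 0

section
variable {W : ℕ} {U V : ℕ → ℕ} {n m : ℕ}

theorem Tree.le {q : ℕ} {ord pos par pe col : ℕ → ℕ} (h : Tree U V n m q ord pos par pe col) :
    q ≤ n := by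
  have := Finset.card_le_card_of_injOn (s := Finset.range q) (t := Finset.range n) ord
    (fun p hp => by simpa using h.ord_lt p (by simpa using hp))
    (fun p hp p' hp' e => h.ord_inj (by simpa using hp) (by simpa using hp') e)
  simpa using this

/-- The set D is not stored; it serves only to show that no arc is seen twice, so that at most 2 m
arcs are seen. -/
theorem Searching.card_lt {s : Store} {D : Finset ℕ} {k : ℕ} {L : List ℕ}
    (h : Searching U V n m s D (k :: L)) (hlt : s.reg 22 < s.reg 23) : s.reg 25 < 2 * m := by
  have hk := h.disjoint hlt k (by simp)
  have h1 : insert k D ⊆ Finset.range (2 * m) := by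
    intro j hj
    rw [Finset.mem_range]
    rcases Finset.mem_insert.1 hj with rfl | hj
    · exact (h.list hlt j (by simp)).1
    · exact (h.seen j hj).1
  have := Finset.card_le_card h1
  rw [Finset.card_insert_of_notMem hk, h.card, Finset.card_range] at this
  omega

theorem advance_does {s : Store} (hs : s.Bounded W) (hW : 2 * m + 2 < W) (hW' : n + 2 < W)
    (hadj : Adjacency (src U V) (tgt U V) (2 * m) (s.arr 5) (s.arr 6) (s.arr 7))
    {D : Finset ℕ} {L : List ℕ} (h : Searching U V n m s D L) (hlt : s.reg 22 < s.reg 23)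
    (h24 : s.reg 24 = 0) :
    Does W (.assign 22 (#22 + 1) ;; .assign 24 (.cell 7 (.cell 8 #22))) 8 s
      (fun s' => (∃ D L, Searching U V n m s' D L) ∧ s'.reg 22 = s.reg 22 + 1 ∧
        s'.reg 25 = s.reg 25) := by
  have hqn := h.tree.le
  have hL : L = [] := by
    have := h.chain hlt
    rw [h24] at this
    match L, this with
    | [], _ => rfl
    | k :: L, h => exact absurd h.1 (by omega)
  subst hL
  refine Does.of_exec (p := (.assign 22 (#22 + 1) ;; .assign 24 (.cell 7 (.cell 8 #22))))
    (by omega) hs ?_ ?_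
  · simp [Prog.Ok, Prog.exec]; omega
  set s' := (Prog.exec (.assign 22 (#22 + 1) ;; .assign 24 (.cell 7 (.cell 8 #22))) s) with hs'
  have ha : s'.arr = s.arr := by simp [s', Prog.exec]
  have r22 : s'.reg 22 = s.reg 22 + 1 := by simp [s', Prog.exec]
  have r23 : s'.reg 23 = s.reg 23 := by simp [s', Prog.exec]
  have r25 : s'.reg 25 = s.reg 25 := by simp [s', Prog.exec]
  have r24 : s'.reg 24 = s.arr 7 (s.arr 8 (s.reg 22 + 1)) := by simp [s', Prog.exec]
  refine ⟨⟨D, arcs (src U V) (2 * m) (s.arr 8 (s.reg 22 + 1)), ?_⟩, r22, r25⟩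
  have ht := h.tree
  constructor
  · rw [r22, r23]; omega
  · rw [r23]; exact h.pos
  · rw [r23, TreeOf, ha]; exact ht
  · rw [ha, r22]
    intro k hk p hp hkp
    rcases Nat.lt_succ_iff_lt_or_eq.1 hp with hp | rfl
    · exact h.done k hk p hp hkp
    · simpa using h.rest hlt k hk hkp
  · rw [ha, r22]
    intro k hk
    obtain ⟨h1, h2, h3⟩ := h.seen k hk
    exact ⟨h1, h2, by omega⟩
  · rw [r25]; exact h.card
  · intro _
    rw [ha, r24]; exact hadj.chain _
  · exact nodup_arcs _ _ _
  · intro _ k hk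
    rw [r22, ha]; exact mem_arcs.1 hk
  · rw [r22, r23]
    intro hlt' k hk hkD
    -- Arcs seen so far start at positions up to the old one, so the arcs of the next position are
    -- new.
    have h3 := (h.seen k hkD).2.2
    rw [(mem_arcs.1 hk).2, ht.pos_ord _ hlt'] at h3
    omega
  · rw [r22, ha]
    intro _ k hk hk'
    exact Or.inl (mem_arcs.2 ⟨hk, hk'⟩)

theorem src_lt (hU : ∀ i < m, U i < n) (hV : ∀ i < m, V i < n) {k : ℕ} (hk : k < 2 * m) :
    src U V k < n := by
  unfold src; split
  · exact hU _ (by omega)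
  · exact hV _ (by omega)

theorem visitArc_does {s : Store} (hs : s.Bounded W) (hW : 2 * m + 2 < W) (hW' : n + 2 < W)
    (hU : ∀ i < m, U i < n) (hV : ∀ i < m, V i < n)
    (hadj : Adjacency (src U V) (tgt U V) (2 * m) (s.arr 5) (s.arr 6) (s.arr 7))
    {D : Finset ℕ} {L : List ℕ} (h : Searching U V n m s D L) (hlt : s.reg 22 < s.reg 23)
    (h24 : s.reg 24 ≠ 0) :
    Does W visitArc 60 s
      (fun s' => (∃ D L, Searching U V n m s' D L) ∧ s'.reg 22 = s.reg 22 ∧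
        s'.reg 25 = s.reg 25 + 1 ∧ s.reg 25 < 2 * m) := by
  obtain ⟨k, L, rfl⟩ : ∃ k L', L = k :: L' := by
    have := h.chain hlt
    match L, this with
    | [], h => exact absurd h h24
    | k :: L, _ => exact ⟨k, L, rfl⟩
  have hcard := h.card_lt hlt
  obtain ⟨c1, c2⟩ := h.chain hlt
  obtain ⟨l1, l2⟩ := h.list hlt k (by simp)
  have ht := h.tree
  have hqn := ht.le
  have htk : s.arr 5 k = tgt U V k := hadj.target k l1
  have htn : tgt U V k < n := src_lt hV hU l1
  have hnd := List.nodup_cons.1 h.nodup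
  have hkD := h.disjoint hlt k (by simp)
  have hpq := ht.pos_ord _ hlt
  refine Does.mono (T := visitArc.time) ?_ (by decide) fun _ _ _ h => h
  refine Does.of_exec (by omega) hs ?_ ?_
  · simp only [visitArc, Prog.Ok, Prog.exec]
    simp [c1, htk]
    constructor
    · omega
    · omega
  by_cases hv : s.arr 9 (tgt U V k) = 0
  · set s' := visitArc.exec s with hs'
    have r22 : s'.reg 22 = s.reg 22 := by simp [s', visitArc, Prog.exec, c1, htk, hv]
    have r23 : s'.reg 23 = s.reg 23 + 1 := by simp [s', visitArc, Prog.exec, c1, htk, hv]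
    have r25 : s'.reg 25 = s.reg 25 + 1 := by simp [s', visitArc, Prog.exec, c1, htk, hv]
    have r24 : s'.reg 24 = s.arr 6 k := by simp [s', visitArc, Prog.exec, c1, htk, hv]
    have a6 : s'.arr 6 = s.arr 6 := by simp [s', visitArc, Prog.exec, c1, htk, hv]
    have a8 : s'.arr 8 = Function.update (s.arr 8) (s.reg 23) (tgt U V k) := by
      simp [s', visitArc, Prog.exec, c1, htk, hv]
    have a9 : s'.arr 9 = Function.update (s.arr 9) (tgt U V k) (s.reg 23 + 1) := by
      simp [s', visitArc, Prog.exec, c1, htk, hv]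
    have a10 : s'.arr 10 = Function.update (s.arr 10) (s.reg 23) (s.reg 22) := by
      simp [s', visitArc, Prog.exec, c1, htk, hv]
    have a11 : s'.arr 11 = Function.update (s.arr 11) (s.reg 23) (k / 2) := by
      simp [s', visitArc, Prog.exec, c1, htk, hv]
    have a12 : s'.arr 12 = Function.update (s.arr 12) (s.reg 23) (1 - s.arr 12 (s.reg 22)) := by
      simp [s', visitArc, Prog.exec, c1, htk, hv]
    have mono : ∀ v, s.arr 9 v ≠ 0 → s'.arr 9 v = s.arr 9 v := by
      intro v h0
      rw [a9, Function.update_of_ne]; rintro rfl; exact h0 hv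
    have a8' : ∀ p < s.reg 23, s'.arr 8 p = s.arr 8 p := fun p hp => by
      rw [a8, Function.update_of_ne (by omega)]
    have new : s'.arr 9 (tgt U V k) ≠ 0 := by rw [a9]; simp
    refine ⟨⟨insert k D, L, ?_⟩, r22, r25, hcard⟩
    constructor
    · omega
    · omega
    · rw [TreeOf, r23, a8, a9, a10, a11, a12]
      refine ht.extend h.pos htn hv hlt (by omega) ?_
      rw [← l2, tgt, src, src]
      split
      · exact Or.inr ⟨rfl, rfl⟩
      · exact Or.inl ⟨rfl, rfl⟩
    · rw [r22]
      intro j hj p hp hjp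
      rw [a8' p (by omega)] at hjp
      have := h.done j hj p hp hjp
      rw [mono _ this]; exact this
    · rw [r22]
      intro j hj
      rcases Finset.mem_insert.1 hj with rfl | hj
      · have : s.arr 9 (src U V j) ≠ 0 := by rw [l2, hpq]; omega
        rw [mono _ this, l2, hpq]; exact ⟨l1, by omega, le_rfl⟩
      · obtain ⟨q1, q2, q3⟩ := h.seen j hj
        rw [mono _ q2]; exact ⟨q1, q2, q3⟩
    · rw [Finset.card_insert_of_notMem hkD, h.card, r25]
    · intro _; rw [a6, r24]; exact c2
    · exact hnd.2
    · rw [r22, a8' _ hlt]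
      intro _ j hj; exact h.list hlt j (by simp [hj])
    · intro _ j hj hjD
      rcases Finset.mem_insert.1 hjD with rfl | hjD
      · exact hnd.1 hj
      · exact h.disjoint hlt j (by simp [hj]) hjD
    · rw [r22, a8' _ hlt]
      intro _ j hj hj'
      rcases h.rest hlt j hj hj' with h' | h'
      · rcases List.mem_cons.1 h' with rfl | h'
        · exact Or.inr new
        · exact Or.inl h'
      · right; rw [mono _ h']; exact h'
  · set s' := visitArc.exec s with hs'
    have r22 : s'.reg 22 = s.reg 22 := by simp [s', visitArc, Prog.exec, c1, htk, hv]
    have r23 : s'.reg 23 = s.reg 23 := by simp [s', visitArc, Prog.exec, c1, htk, hv]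
    have r25 : s'.reg 25 = s.reg 25 + 1 := by simp [s', visitArc, Prog.exec, c1, htk, hv]
    have r24 : s'.reg 24 = s.arr 6 k := by simp [s', visitArc, Prog.exec, c1, htk, hv]
    have ha : s'.arr = s.arr := by simp [s', visitArc, Prog.exec, c1, htk, hv]
    refine ⟨⟨insert k D, L, ?_⟩, r22, r25, hcard⟩
    constructor
    · rw [r22, r23]; exact h.le
    · rw [r23]; exact h.pos
    · rw [TreeOf, r23, ha]; exact ht
    · rw [r22, ha]; exact h.done
    · rw [r22, ha]
      intro j hj
      rcases Finset.mem_insert.1 hj with rfl | hj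
      · rw [l2, hpq]; exact ⟨l1, by omega, le_rfl⟩
      · exact h.seen j hj
    · rw [Finset.card_insert_of_notMem hkD, h.card, r25]
    · intro _; rw [ha, r24]; exact c2
    · exact hnd.2
    · rw [r22, ha]
      intro _ j hj; exact h.list hlt j (by simp [hj])
    · intro _ j hj hjD
      rcases Finset.mem_insert.1 hjD with rfl | hjD
      · exact hnd.1 hj
      · exact h.disjoint hlt j (by simp [hj]) hjD
    · rw [r22, ha]
      intro _ j hj hj'
      rcases h.rest hlt j hj hj' with h' | h'
      · rcases List.mem_cons.1 h' with rfl | h'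
        · exact Or.inr hv
        · exact Or.inl h'
      · exact Or.inr h'

/-- Each round either sees a new arc or moves on to the next vertex, so there are at most 2 m + n
rounds. The hypothesis `hconn` expresses connectedness by sets closed under adjacency. -/
theorem search_does {s : Store} (hs : s.Bounded W) (hW : 2 * m + 2 < W) (hW' : n + 2 < W)
    (hn : 0 < n) (hU : ∀ i < m, U i < n) (hV : ∀ i < m, V i < n)
    (hadj : Adjacency (src U V) (tgt U V) (2 * m) (s.arr 5) (s.arr 6) (s.arr 7))
    (h8 : s.arr 8 0 = 0) (h9 : ∀ v, s.arr 9 v = 0) (h12 : s.arr 12 0 = 0)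
    (hconn : ∀ (S : Set ℕ), ∀ u < n, u ∈ S → (∀ i < m, U i ∈ S ↔ V i ∈ S) → ∀ v < n, v ∈ S) :
    Does W search (200 * m + 100 * n + 20) s (fun s' => TreeOf U V n m n s') := by
  refine Does.mono (T := 3 + (2 + (2 + (2 + (3 + (200 * m + 100 * n + 4)))))) ?_ (by omega)
    fun _ _ _ h => h
  obtain ⟨s0, hs0⟩ : ∃ s0, s0 = Prog.exec (.store 9 0 1 ;; .assign 22 0 ;; .assign 23 1 ;;
      .assign 25 0 ;; .assign 24 (.cell 7 0)) s := ⟨_, rfl⟩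
  refine Does.seq (Does.exec (by omega) (.store 9 0 1) hs (by simp [Prog.Ok]; omega))
    fun s1 hs1 ha1 e1 => ?_
  refine Does.seq (Does.exec (by omega) (.assign 22 0) hs1 (by simp [Prog.Ok]; omega))
    fun s2 hs2 ha2 e2 => ?_
  refine Does.seq (Does.exec (by omega) (.assign 23 1) hs2 (by simp [Prog.Ok]; omega))
    fun s3 hs3 ha3 e3 => ?_
  refine Does.seq (Does.exec (by omega) (.assign 25 0) hs3 (by simp [Prog.Ok]; omega))
    fun s4 hs4 ha4 e4 => ?_
  refine Does.seq (Does.exec (by omega) (.assign 24 (.cell 7 0)) hs4 (by simp [Prog.Ok]; omega))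
    fun s5 hs5 ha5 e5 => ?_
  have hfin : s5 = s0 := by rw [e5, e4, e3, e2, e1, hs0]; rfl
  have r22 : s5.reg 22 = 0 := by simp [hfin, hs0, Prog.exec]
  have r23 : s5.reg 23 = 1 := by simp [hfin, hs0, Prog.exec]
  have r25 : s5.reg 25 = 0 := by simp [hfin, hs0, Prog.exec]
  have r24 : s5.reg 24 = s.arr 7 0 := by simp [hfin, hs0, Prog.exec]
  have a9 : s5.arr 9 = Function.update (s.arr 9) 0 1 := by simp [hfin, hs0, Prog.exec]
  have ha : ∀ a, a ≠ 9 → s5.arr a = s.arr a := by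
    intro a h; simp [hfin, hs0, Prog.exec, h]
  have init : ∃ D L, Searching U V n m s5 D L := by
    refine ⟨∅, arcs (src U V) (2 * m) 0, ?_⟩
    constructor
    · omega
    · omega
    · rw [TreeOf, r23, a9, ha 8 (by omega), ha 10 (by omega), ha 11 (by omega), ha 12 (by omega)]
      constructor
      · intro p hp
        have : p = 0 := by omega
        rw [this, h8]; exact hn
      · intro p hp
        have : p = 0 := by omega
        rw [this, h8]; simp
      · intro v hv hv0
        refine ⟨0, by omega, ?_⟩
        by_contra e
        rw [Function.update_of_ne (by rw [h8] at e; exact Ne.symm e), h9] at hv0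
        exact hv0 rfl
      · exact h12
      all_goals intro p hp h0; omega
    · intro k _ p hp; omega
    · simp
    · simp [r25]
    · intro _; rw [ha 6 (by omega), r24]; exact hadj.chain 0
    · exact nodup_arcs _ _ _
    · intro _ k hk
      rw [r22, ha 8 (by omega), h8]; exact mem_arcs.1 hk
    · simp
    · intro _ k hk hk'
      rw [r22, ha 8 (by omega), h8] at hk'
      exact Or.inl (mem_arcs.2 ⟨hk, hk'⟩)
  have loop := Does.while (W := W) (by omega) (e := #22 <ₑ #23) (p := searchBody)
    (fun s' => ∃ D L, Searching U V n m s' D L)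
    (fun s' => 100 * (2 * m - s'.reg 25) + 100 * (n - s'.reg 22)) hs5 init ?_
  · refine loop.mono ?_ ?_
    · rw [r22, r25]
      have : (#22 <ₑ #23).cost = 3 := rfl
      omega
    · rintro s' _ _ ⟨⟨D, L, h⟩, hv⟩
      have heq : s'.reg 22 = s'.reg 23 :=
        le_antisymm h.le (Expr.lt_eq_zero.1 hv)
      have ht := h.tree
      -- When the search stops, every discovered vertex has been processed, so the set of discovered
      -- vertices is closed under adjacency.
      have hall : ∀ v < n, v ∈ {v | s'.arr 9 v ≠ 0} := by
        have hstep : ∀ k < 2 * m, s'.arr 9 (src U V k) ≠ 0 → s'.arr 9 (tgt U V k) ≠ 0 := by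
          intro k hk h0
          obtain ⟨p, hp, hp'⟩ := ht.ord_pos _ (src_lt hU hV hk) h0
          exact h.done k hk p (by omega) hp'.symm
        refine hconn _ _ (ht.ord_lt 0 h.pos) ?_ ?_
        · simp [ht.pos_ord 0 h.pos]
        · intro i hi
          have q1 := hstep (2 * i) (by omega)
          have q2 := hstep (2 * i + 1) (by omega)
          simp [tgt, src, Nat.add_mod, show (2 * i + 1) / 2 = i by omega] at q1 q2
          exact ⟨q1, q2⟩
      have hq : s'.reg 23 = n := by
        refine le_antisymm ht.le ?_
        have := Finset.card_le_card_of_surjOn (s := Finset.range (s'.reg 23)) (t := Finset.range n)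
          (s'.arr 8) (fun v hv => by
            obtain ⟨p, hp, hp'⟩ := ht.ord_pos v (by simpa using hv) (hall v (by simpa using hv))
            exact ⟨p, by simpa using hp, hp'⟩)
        simpa using this
      rw [hq] at ht; exact ht
  · rintro s' hs' ha' ⟨D, L, h⟩
    refine ⟨by simp, fun hv => ?_⟩
    replace hv : s'.reg 22 < s'.reg 23 := Expr.lt_ne_zero.1 hv
    have hadj' : Adjacency (src U V) (tgt U V) (2 * m) (s'.arr 5) (s'.arr 6) (s'.arr 7) := by
      rw [ha'.arr 5 (by decide), ha'.arr 6 (by decide), ha'.arr 7 (by decide), ha 5 (by omega),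
        ha 6 (by omega), ha 7 (by omega)]
      exact hadj
    have hqn := h.tree.le
    have hc : (#22 <ₑ #23).cost = 3 := rfl
    refine ⟨4 + 60, Does.ite (by omega) hs' (by simp; omega) (fun h24 => ?_) (fun h24 => ?_)⟩
    · replace h24 : s'.reg 24 = 0 := Expr.eq_ne_zero.1 h24
      refine (advance_does hs' hW hW' hadj' h hv h24).mono (by omega) ?_
      rintro s'' _ _ ⟨h', q1, q2⟩
      exact ⟨h', by rw [hc, q1, q2]; omega⟩
    · replace h24 : s'.reg 24 ≠ 0 := Expr.eq_eq_zero.1 h24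
      refine (visitArc_does hs' hW hW' hU hV hadj' h hv h24).mono (by omega) ?_
      rintro s'' _ _ ⟨h', q1, q2, q3⟩
      exact ⟨h', by rw [hc, q1, q2]; omega⟩

end

end IrregularLabeling

namespace IrregularLabeling

/-! ### Colour classes -/

/-- The number of positions below `q` of colour `c`. -/
def cnt (col : ℕ → ℕ) (c q : ℕ) : ℕ := ((Finset.range q).filter fun p => col p = c).card

section
variable {U V : ℕ → ℕ} {n m : ℕ} {ord pos par pe col : ℕ → ℕ}

theorem cnt_succ (col : ℕ → ℕ) (c q : ℕ) :
    cnt col c (q + 1) = cnt col c q + if col q = c then 1 else 0 := by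
  rw [cnt, Finset.range_add_one, Finset.filter_insert]
  split
  · rw [Finset.card_insert_of_notMem (by simp), cnt]
  · rw [cnt]; rfl

theorem cnt_mono (col : ℕ → ℕ) (c : ℕ) {p q : ℕ} (h : p ≤ q) : cnt col c p ≤ cnt col c q := by
  induction q, h using Nat.le_induction with
  | base => exact le_rfl
  | succ q _ ih => rw [cnt_succ]; omega

theorem cnt_lt {p q : ℕ} (h : p < q) : cnt col (col p) p < cnt col (col p) q := by
  have := cnt_mono col (col p) (show p + 1 ≤ q from h)
  rw [cnt_succ, if_pos rfl] at this; omega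

theorem cnt_le (col : ℕ → ℕ) (c q : ℕ) : cnt col c q ≤ q := by
  simpa [cnt] using Finset.card_filter_le (Finset.range q) fun p => col p = c

theorem cnt_inj {p q : ℕ} (h : col p = col q) (h' : cnt col (col p) p = cnt col (col q) q) :
    p = q := by
  rcases lt_trichotomy p q with hlt | rfl | hlt
  · have := cnt_lt (col := col) hlt; rw [h'] at this; rw [h] at this; omega
  · rfl
  · have := cnt_lt (col := col) hlt; rw [← h'] at this; rw [h] at this; omega

theorem cnt_add (hc : ∀ p < n, col p ≤ 1) : cnt col 0 n + cnt col 1 n = n := by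
  induction n with
  | zero => rfl
  | succ n ih =>
    have h1 := ih fun p hp => hc p (by omega)
    have h2 := hc n (by omega)
    rw [cnt_succ, cnt_succ]
    rcases Nat.le_one_iff_eq_zero_or_eq_one.1 h2 with h | h <;> simp [h] <;> omega

theorem two_le_cnt {c p q : ℕ} (hp : p < n) (hq : q < n) (hpq : p ≠ q) (h1 : col p = c)
    (h2 : col q = c) : 2 ≤ cnt col c n :=
  Finset.one_lt_card.2 ⟨p, by simp [hp, h1], q, by simp [hq, h2], hpq⟩

/-- Counting the earlier positions of the same colour numbers the positions of colour c
consecutively from 0. -/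
theorem sum_cnt {A : Type*} [AddCommMonoid A] (F : ℕ → A) (c q : ℕ) :
    (∑ p ∈ Finset.range q, if col p = c then F (cnt col c p) else 0) =
      ∑ i ∈ Finset.range (cnt col c q), F i := by
  induction q with
  | zero => simp [cnt]
  | succ q ih =>
    rw [Finset.sum_range_succ, ih, cnt_succ]
    split
    · rw [Finset.sum_range_succ]
    · simp

/-- Hang the position `v` below the position `u` by means of the edge `e`. -/
theorem Tree.reparent (h : Tree U V n m n ord pos par pe col) {u v c e : ℕ} (huv : u < v)
    (hv : v < n) (hcol : col u = col v) (hc : c < n) (hsing : ∀ p < n, col p = col c → p = c)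
    (he : e < m) (hue : (U e = ord v ∧ V e = ord u) ∨ (V e = ord v ∧ U e = ord u)) :
    Tree U V n m n ord pos (Function.update par v u) (Function.update pe v e)
      (Function.update col v (1 - col v)) := by
  have hvc : col v ≠ col c := fun e1 => by
    have h1 := hsing v hv e1
    have h2 := hsing u (by omega) (hcol.trans e1)
    omega
  have hcv := h.col_le hv
  -- The position v is a leaf: a child of v has the colour of the centre c, so it is c; but the
  -- parent of v is c as well, and it precedes v. So changing the colour of v affects no child.
  have hparc : ∀ p < n, 0 < p → par p ≠ v := by
    rintro p hp h0 rfl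
    have h1 := h.par_lt p hp h0
    have h2 := h.col_par p hp h0
    have h3 : p = c := hsing p hp (by have := h.col_le hc; omega)
    have h4 := h.col_par _ hv (by omega)
    have h5 := h.par_lt _ hv (by omega)
    have h6 : par (par p) = c := hsing _ (by omega) (by have := h.col_le hc; omega)
    omega
  constructor
  · exact h.ord_lt
  · exact h.pos_ord
  · exact h.ord_pos
  · rw [Function.update_of_ne (by omega)]; exact h.col_zero
  · intro p hp h0
    by_cases e1 : p = v
    · subst e1; simpa using huv
    · rw [Function.update_of_ne e1]; exact h.par_lt p hp h0
  · intro p hp h0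
    by_cases e1 : p = v
    · subst e1; simpa using he
    · rw [Function.update_of_ne e1]; exact h.pe_lt p hp h0
  · intro p hp h0
    by_cases e1 : p = v
    · subst e1; simpa using hue
    · rw [Function.update_of_ne e1, Function.update_of_ne e1]; exact h.ends p hp h0
  · intro p hp h0
    by_cases e1 : p = v
    · subst e1
      simp [Function.update_of_ne (show u ≠ p by omega)]; omega
    · rw [Function.update_of_ne e1, Function.update_of_ne e1, Function.update_of_ne (hparc p hp h0)]
      exact h.col_par p hp h0

/-- After the change c and v share one colour, while u and any fourth vertex share the other. -/
theorem two_le_cnt_reparent (h : Tree U V n m n ord pos par pe col) (hn : 4 ≤ n) {u v c : ℕ}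
    (huv : u < v) (hv : v < n) (hcol : col u = col v) (hc : c < n)
    (hsing : ∀ p < n, col p = col c → p = c) :
    2 ≤ cnt (Function.update col v (1 - col v)) 0 n ∧
      2 ≤ cnt (Function.update col v (1 - col v)) 1 n := by
  have hvc : col v ≠ col c := fun e1 => by
    have h1 := hsing v hv e1
    have h2 := hsing u (by omega) (hcol.trans e1)
    omega
  have hne1 : c ≠ v := by rintro rfl; exact hvc rfl
  have hne2 : u ≠ c := by rintro rfl; exact hvc hcol.symm
  have hcv := h.col_le hv
  have hcc := h.col_le hc
  obtain ⟨w, hw, hw'⟩ : ∃ w < n, w ∉ ({u, v, c} : Finset ℕ) := by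
    by_contra hno
    push Not at hno
    have := Finset.card_le_card (s := Finset.range n) (t := {u, v, c})
      fun w hw => hno w (by simpa using hw)
    have h3 := Finset.card_le_three (a := u) (b := v) (c := c)
    rw [Finset.card_range] at this; omega
  simp only [Finset.mem_insert, Finset.mem_singleton, not_or] at hw'
  have hcw : col w = col v := by
    have := h.col_le hw
    have : col w ≠ col c := fun e => hw'.2.2 (hsing w hw e)
    omega
  have k1 : 2 ≤ cnt (Function.update col v (1 - col v)) (col c) n :=
    two_le_cnt hc hv hne1 (by rw [Function.update_of_ne hne1]) (by simp; omega)
  have k2 : 2 ≤ cnt (Function.update col v (1 - col v)) (col v) n :=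
    two_le_cnt (show u < n by omega) hw (Ne.symm hw'.1)
      (by rw [Function.update_of_ne (by omega), hcol])
      (by rw [Function.update_of_ne hw'.2.1, hcw])
  rcases Nat.le_one_iff_eq_zero_or_eq_one.1 hcv with e1 | e1
  · have e2 : col c = 1 := by omega
    rw [e1] at k2; rw [e2] at k1
    rw [e1]; rw [e1] at k1; exact ⟨k2, k1⟩
  · have e2 : col c = 0 := by omega
    rw [e1] at k2; rw [e2] at k1
    rw [e1]; rw [e1] at k1; exact ⟨k1, k2⟩

end

/-! ### Avoiding a star -/

def colourSum : Prog := .assign 34 0 ;; forUp 4 0 (.assign 34 (#34 + .cell 12 #4))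

def endPos (a : ℕ) (e : Expr) : Expr := .cell 9 (.cell a e) - 1

def findEdge : Prog :=
  .assign 35 0 ;; forUp 4 1
    (.ite (.cell 12 (endPos 0 #4) =ₑ .cell 12 (endPos 1 #4)) (.assign 35 (#4 + 1)) .skip)

def reparent : Prog :=
  .assign 26 (#35 - 1) ;; .assign 20 (endPos 0 #26) ;; .assign 21 (endPos 1 #26) ;;
  .ite (#21 <ₑ #20) (.assign 22 #20 ;; .assign 20 #21 ;; .assign 21 #22) .skip ;;
  .store 10 #21 #20 ;; .store 11 #21 #26 ;; .store 12 #21 (1 - .cell 12 #21)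

/-- If all orders are `3`, the group has one more element than there are vertices, and the tree is
a star, then make it a tree that is not a star; if this is impossible, set register `36`. -/
def repair : Prog :=
  colourSum ;;
  .ite ((#7 =ₑ #2) * (#0 + 1 =ₑ #3) * ((#34 =ₑ 1) + (#34 + 1 =ₑ #0)))
    (findEdge ;; .ite #35 reparent (.assign 36 1)) .skip

/-- The edges form a star. -/
def IsStar (U V : ℕ → ℕ) (n m : ℕ) : Prop :=
  ∃ (χ : ℕ → ℕ) (c : ℕ), c < n ∧ (∀ v < n, χ v = χ c → v = c) ∧ (∀ v < n, χ v ≤ 1) ∧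
    ∀ i < m, χ (U i) ≠ χ (V i)

section
variable {W : ℕ} {U V : ℕ → ℕ} {n m : ℕ} {s : Store}

theorem colourSum_does (hs : s.Bounded W) (hW : n + 2 < W) (h0 : s.reg 0 = n)
    (hcol : ∀ p < n, s.arr 12 p ≤ 1) :
    Does W colourSum (n * 13 + 8) s (fun s' => s'.reg 34 = cnt (s.arr 12) 1 n) := by
  refine Does.mono (T := 2 + (n * (5 + 8) + 6)) ?_ (by omega) fun _ _ _ h => h
  refine Does.seq (Does.exec (by omega) (.assign 34 0) hs (by simp [Prog.Ok]; omega))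
    fun s1 hs1 ha1 e1 => ?_
  have h34 : s1.reg 34 = 0 := by simp [e1, Prog.exec]
  have h12 := ha1.arr 12 (by decide)
  refine Does.forUp (fun k s' => s'.reg 34 = cnt (s.arr 12) 1 k) (by omega) hs1
    ((ha1.reg 0 (by decide)).trans h0) (by decide) (by decide) (by decide) (by simp [h34, cnt]) ?_
  intro k s' hk hs' ha hi hJ
  have h12' := (ha.arr 12 (by decide)).trans h12
  have hc := hcol k hk
  have hle := cnt_le (s.arr 12) 1 k
  refine Does.of_exec (p := .assign 34 (#34 + .cell 12 #4)) (by omega) hs' ?_ ?_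
  · simp [Prog.Ok, hi, hJ, h12']; omega
  · simp [Prog.exec, hi, hJ, h12', cnt_succ]; split <;> omega

theorem findEdge_does (hs : s.Bounded W) (hW : m + 2 < W) (h1 : s.reg 1 = m)
    {χ : ℕ → ℕ} (hχ : ∀ i < m, s.arr 12 (s.arr 9 (s.arr 0 i) - 1) = χ (s.arr 0 i) ∧
      s.arr 12 (s.arr 9 (s.arr 1 i) - 1) = χ (s.arr 1 i)) :
    Does W findEdge (m * 40 + 8) s (fun s' =>
      (s'.reg 35 = 0 ∧ ∀ i < m, χ (s.arr 0 i) ≠ χ (s.arr 1 i)) ∨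
      ∃ i < m, s'.reg 35 = i + 1 ∧ χ (s.arr 0 i) = χ (s.arr 1 i)) := by
  refine Does.mono (T := 2 + (m * (32 + 8) + 6)) ?_ (by omega) fun _ _ _ h => h
  refine Does.seq (Does.exec (by omega) (.assign 35 0) hs (by simp [Prog.Ok]; omega))
    fun s1 hs1 ha1 e1 => ?_
  have h35 : s1.reg 35 = 0 := by simp [e1, Prog.exec]
  have harr : s1.arr = s.arr := by simp [e1, Prog.exec]
  refine (Does.forUp (fun k s' =>
    (s'.reg 35 = 0 ∧ ∀ i < k, χ (s.arr 0 i) ≠ χ (s.arr 1 i)) ∨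
      ∃ i < k, s'.reg 35 = i + 1 ∧ χ (s.arr 0 i) = χ (s.arr 1 i)) (by omega) hs1
    ((ha1.reg 1 (by decide)).trans h1) (by decide) (by decide) (by decide) (by simp [h35]) ?_)
  intro k s' hk hs' ha hi hJ
  have b0 : s'.arr 0 = s.arr 0 := (ha.arr 0 (by decide)).trans (by rw [harr])
  have b1 : s'.arr 1 = s.arr 1 := (ha.arr 1 (by decide)).trans (by rw [harr])
  have b9 : s'.arr 9 = s.arr 9 := (ha.arr 9 (by decide)).trans (by rw [harr])
  have b12 : s'.arr 12 = s.arr 12 := (ha.arr 12 (by decide)).trans (by rw [harr])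
  obtain ⟨c1, c2⟩ := hχ k hk
  refine (Does.ite (T := 4) (by omega) hs' (by simp [endPos]; omega) (fun hv => ?_)
    (fun hv => ?_)).mono (by decide) fun _ _ _ h => h
  · replace hv : χ (s.arr 0 k) = χ (s.arr 1 k) := by
      have := Expr.eq_ne_zero.1 hv
      simpa [endPos, hi, b0, b1, b9, b12, c1, c2] using this
    refine Does.of_exec (p := .assign 35 (#4 + 1)) (by omega) hs' (by simp [Prog.Ok, hi]; omega) ?_
    exact Or.inr ⟨k, by omega, by simp [Prog.exec, hi], hv⟩
  · replace hv : χ (s.arr 0 k) ≠ χ (s.arr 1 k) := by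
      have := Expr.eq_eq_zero.1 hv
      simpa [endPos, hi, b0, b1, b9, b12, c1, c2] using this
    refine Does.skip hs' (by omega) ?_
    rcases hJ with ⟨q1, q2⟩ | ⟨i, q1, q2, q3⟩
    · refine Or.inl ⟨by simpa using q1, fun i hi' => ?_⟩
      rcases Nat.lt_succ_iff_lt_or_eq.1 hi' with h | rfl
      · exact q2 i h
      · exact hv
    · exact Or.inr ⟨i, by omega, by simpa using q2, q3⟩

theorem reparent_does (hs : s.Bounded W) (hW : n + 4 < W) (hn : 4 ≤ n) (ht : TreeOf U V n m n s)
    (hU : s.arr 0 = U) (hV : s.arr 1 = V) {i p q c : ℕ} (hi : i < m) (h35 : s.reg 35 = i + 1)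
    (hp : p < n) (hq : q < n) (hpU : U i = s.arr 8 p) (hqV : V i = s.arr 8 q) (hpq : p ≠ q)
    (hcol : s.arr 12 p = s.arr 12 q) (hc : c < n)
    (hsing : ∀ p < n, s.arr 12 p = s.arr 12 c → p = c) :
    Does W reparent 60 s (fun s' => TreeOf U V n m n s' ∧
      2 ≤ cnt (s'.arr 12) 0 n ∧ 2 ≤ cnt (s'.arr 12) 1 n) := by
  refine Does.mono (T := reparent.time) ?_ (by decide) fun _ _ _ h => h
  have eU : s.arr 9 (s.arr 0 i) - 1 = p := by rw [hU, hpU, ht.pos_ord p hp]; rfl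
  have eV : s.arr 9 (s.arr 1 i) - 1 = q := by rw [hV, hqV, ht.pos_ord q hq]; rfl
  refine Does.of_exec (by omega) hs ?_ ?_
  · simp [reparent, Prog.Ok, Prog.exec, endPos, h35]
    omega
  rcases lt_or_gt_of_ne hpq with hlt | hlt
  · have hno : ¬ q < p := by omega
    have e8 : (reparent.exec s).arr 8 = s.arr 8 := by
      simp [reparent, Prog.exec, endPos, h35, eU, eV, hno]
    have e9 : (reparent.exec s).arr 9 = s.arr 9 := by
      simp [reparent, Prog.exec, endPos, h35, eU, eV, hno]
    have e10 : (reparent.exec s).arr 10 = Function.update (s.arr 10) q p := by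
      simp [reparent, Prog.exec, endPos, h35, eU, eV, hno]
    have e11 : (reparent.exec s).arr 11 = Function.update (s.arr 11) q i := by
      simp [reparent, Prog.exec, endPos, h35, eU, eV, hno]
    have e12 : (reparent.exec s).arr 12 = Function.update (s.arr 12) q (1 - s.arr 12 q) := by
      simp [reparent, Prog.exec, endPos, h35, eU, eV, hno]
    rw [TreeOf, e8, e9, e10, e11, e12]
    exact ⟨ht.reparent hlt hq hcol hc hsing hi (Or.inr ⟨hqV, hpU⟩),
      two_le_cnt_reparent ht hn hlt hq hcol hc hsing⟩
  · have e8 : (reparent.exec s).arr 8 = s.arr 8 := by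
      simp [reparent, Prog.exec, endPos, h35, eU, eV, hlt]
    have e9 : (reparent.exec s).arr 9 = s.arr 9 := by
      simp [reparent, Prog.exec, endPos, h35, eU, eV, hlt]
    have e10 : (reparent.exec s).arr 10 = Function.update (s.arr 10) p q := by
      simp [reparent, Prog.exec, endPos, h35, eU, eV, hlt]
    have e11 : (reparent.exec s).arr 11 = Function.update (s.arr 11) p i := by
      simp [reparent, Prog.exec, endPos, h35, eU, eV, hlt]
    have e12 : (reparent.exec s).arr 12 = Function.update (s.arr 12) p (1 - s.arr 12 p) := by
      simp [reparent, Prog.exec, endPos, h35, eU, eV, hlt]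
    rw [TreeOf, e8, e9, e10, e11, e12]
    exact ⟨ht.reparent hlt hp hcol.symm hc hsing hi (Or.inl ⟨hpU, hqV⟩),
      two_le_cnt_reparent ht hn hlt hp hcol.symm hc hsing⟩

/-- If one class of the tree is a singleton, an edge with equally coloured ends joins two leaves and
allows `Tree.reparent`. If there is no such edge, the two-colouring of the tree is proper for the
whole graph, which is therefore a star. -/
theorem repair_does {N k : ℕ} (hs : s.Bounded W) (hW : n + 4 < W) (hW' : m + 2 < W) (hn : 3 ≤ n)
    (h0 : s.reg 0 = n) (h1 : s.reg 1 = m) (h2 : s.reg 2 = k) (h3 : s.reg 3 = N)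
    (h36 : s.reg 36 = 0) (hN : s.reg 7 = k → n + 1 = N → 4 ≤ n)
    (hU : s.arr 0 = U) (hV : s.arr 1 = V) (hUn : ∀ i < m, U i < n) (hVn : ∀ i < m, V i < n)
    (hUV : ∀ i < m, U i ≠ V i) (ht : TreeOf U V n m n s) (hvis : ∀ v < n, s.arr 9 v ≠ 0) :
    Does W repair (n * 13 + m * 40 + 200) s (fun s' =>
      (s'.reg 36 = 0 ∧ TreeOf U V n m n s' ∧
        (s.reg 7 = k → n + 1 = N → 2 ≤ cnt (s'.arr 12) 0 n ∧ 2 ≤ cnt (s'.arr 12) 1 n)) ∨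
      (s'.reg 36 ≠ 0 ∧ s.reg 7 = k ∧ n + 1 = N ∧ IsStar U V n m)) := by
  have hcol : ∀ p < n, s.arr 12 p ≤ 1 := fun p hp => ht.col_le hp
  have hadd := cnt_add hcol
  refine Does.mono (T := n * 13 + 8 + (20 + (m * 40 + 8 + (2 + 60)))) ?_ (by omega)
    fun _ _ _ h => h
  refine Does.seq (colourSum_does hs (by omega) h0 hcol) fun s1 hs1 ha1 h34 => ?_
  have harr : s1.arr = s.arr := funext fun a => ha1.arr a (by simp [colourSum, forUp, Prog.warrs])
  have r : ∀ x, x ≠ 34 → x ≠ 4 → s1.reg x = s.reg x := fun x q1 q2 =>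
    ha1.reg x (by simp [colourSum, forUp, Prog.wregs, q1, q2])
  have hle := cnt_le (s.arr 12) 1 n
  have hpos0 : 1 ≤ cnt (s.arr 12) 0 n := Finset.card_pos.2 ⟨0, by simp [ht.col_zero]; omega⟩
  have hpos1 : 1 ≤ cnt (s.arr 12) 1 n := by
    have q1 := ht.par_lt 1 (by omega) (by omega)
    have q2 := ht.col_par 1 (by omega) (by omega)
    have q3 : s.arr 10 1 = 0 := by omega
    rw [q3, ht.col_zero] at q2
    exact Finset.card_pos.2 ⟨1, by simp; omega⟩
  have hval : ((#7 =ₑ #2) * (#0 + 1 =ₑ #3) * ((#34 =ₑ 1) + (#34 + 1 =ₑ #0))).val s1 ≠ 0 ↔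
      s.reg 7 = k ∧ n + 1 = N ∧ (cnt (s.arr 12) 1 n = 1 ∨ cnt (s.arr 12) 1 n + 1 = n) := by
    simp [r, h0, h2, h3, h34]
    tauto
  refine (Does.ite (T := m * 40 + 8 + (2 + 60)) (by omega) hs1 ?_ (fun hv => ?_) (fun hv => ?_)).mono
    ?_ fun _ _ _ h => h
  · simp [r, h0, h2, h3, h34]
    refine ⟨⟨⟨by omega, by omega⟩, ?_⟩, ⟨by omega, by omega, ?_⟩, ?_⟩
    all_goals repeat' split
    all_goals omega
  · obtain ⟨v1, v2, v3⟩ := hval.1 hv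
    have hn4 := hN v1 v2
    obtain ⟨c, hc, hsing⟩ : ∃ c < n, ∀ p < n, s.arr 12 p = s.arr 12 c → p = c := by
      have : ∃ k, cnt (s.arr 12) k n = 1 := by
        rcases v3 with h | h
        · exact ⟨1, h⟩
        · exact ⟨0, by omega⟩
      obtain ⟨k, hk⟩ := this
      obtain ⟨c, hc⟩ := Finset.card_eq_one.1 hk
      have hc' : c ∈ (Finset.range n).filter fun p => s.arr 12 p = k := by rw [hc]; simp
      simp at hc'
      refine ⟨c, hc'.1, fun p hp hpc => ?_⟩
      have : p ∈ (Finset.range n).filter fun p => s.arr 12 p = k := by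
        simp [hp, hpc, hc'.2]
      rw [hc] at this; simpa using this
    have hord : ∀ v < n, ∃ p < n, s.arr 8 p = v ∧ s.arr 9 v - 1 = p := by
      intro v hv'
      obtain ⟨p, hp, hp'⟩ := ht.ord_pos v hv' (hvis v hv')
      exact ⟨p, hp, hp', by rw [← hp', ht.pos_ord p hp]; rfl⟩
    refine Does.seq (findEdge_does hs1 hW' ((r 1 (by omega) (by omega)).trans h1)
      (χ := fun v => s.arr 12 (s.arr 9 v - 1)) (by rw [harr]; exact fun _ _ => ⟨rfl, rfl⟩))
      fun s2 hs2 ha2 hfe => ?_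
    have harr2 : s2.arr = s.arr := by
      rw [← harr]
      exact funext fun a => ha2.arr a (by simp [findEdge, forUp, Prog.warrs])
    have h36' : s2.reg 36 = 0 := by
      rw [ha2.reg 36 (by decide), r 36 (by omega) (by omega), h36]
    rw [harr, hU, hV] at hfe
    refine Does.ite (by omega) hs2 (by simp) (fun hv2 => ?_) (fun hv2 => ?_)
    · rcases hfe with ⟨q1, _⟩ | ⟨i, hi, q1, q2⟩
      · exact absurd q1 hv2
      obtain ⟨p, hp, hp1, hp2⟩ := hord _ (hUn i hi)
      obtain ⟨q, hq, hq1, hq2⟩ := hord _ (hVn i hi)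
      simp only [hp2, hq2] at q2
      refine (reparent_does (c := c) hs2 hW hn4 (by rw [TreeOf, harr2]; exact ht) (by rw [harr2, hU])
        (by rw [harr2, hV]) hi q1 hp hq (by rw [harr2, hp1]) (by rw [harr2, hq1]) ?_
        (by rw [harr2, q2]) hc (by rw [harr2]; exact hsing)).mono le_rfl fun s3 _ ha3 hq3 => ?_
      · rintro rfl; exact hUV i hi (hp1.symm.trans hq1)
      · exact Or.inl ⟨(ha3.reg 36 (by decide)).trans h36', hq3.1, fun _ _ => hq3.2⟩
    · rcases hfe with ⟨_, q2⟩ | ⟨i, hi, q1, q2⟩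
      · refine Does.mono (Does.of_exec (p := .assign 36 1) (by omega) hs2
          (by simp [Prog.Ok]; omega) (Q := fun s' => s'.reg 36 ≠ 0) (by simp [Prog.exec]))
          (show 2 ≤ 60 by omega) fun s3 _ _ h => Or.inr ⟨h, v1, v2, ?_⟩
        -- The colouring that witnesses the star is that of the tree, read through the positions;
        -- its centre is the vertex at position c.
        refine ⟨fun v => s.arr 12 (s.arr 9 v - 1), s.arr 8 c, ht.ord_lt c hc, ?_, ?_, q2⟩
        · intro v hv' e
          obtain ⟨p, hp, hp1, hp2⟩ := hord v hv'
          simp only [hp2, ht.pos_ord c hc] at e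
          rw [← hp1, hsing p hp e]
        · intro v hv'
          obtain ⟨p, hp, hp1, hp2⟩ := hord v hv'
          simp only [hp2]; exact hcol p hp
      · exact absurd hv2 (by simp [q1])
  · refine Does.skip hs1 (by omega) (Or.inl ⟨?_, ?_, ?_⟩)
    · rw [r 36 (by omega) (by omega), h36]
    · rw [TreeOf, harr]; exact ht
    · intro v1 v2
      have : ¬ (cnt (s.arr 12) 1 n = 1 ∨ cnt (s.arr 12) 1 n + 1 = n) :=
        fun v3 => hval.2 ⟨v1, v2, v3⟩ hv
      rw [harr]; omega
  · have : ((#7 =ₑ #2) * (#0 + 1 =ₑ #3) * ((#34 =ₑ 1) + (#34 + 1 =ₑ #0))).cost + 1 ≤ 20 := by decide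
    omega

end

end IrregularLabeling

namespace IrregularLabeling

/-! ### The cells of the weights -/

/-- The cell for the weight of the vertex at position `p`. -/
def slot (col : ℕ → ℕ) (p : ℕ) : ℕ := 2 * cnt col (col p) p + col p

def slotBody : Prog :=
  .store 13 #4 (2 * .cell 14 (.cell 12 #4) + .cell 12 #4) ;;
    .store 14 (.cell 12 #4) (.cell 14 (.cell 12 #4) + 1)

/-- Distribute cells to the vertices, and choose the order of the two colours. -/
def slots : Prog :=
  forUp 4 0 slotBody ;;
  .ite (.cell 14 0 % 2 =ₑ 0) (.assign 27 1)
    (.assign 27 (.cell 14 1 % 2 * (.cell 14 1 <ₑ .cell 14 0))) ;;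
  .assign 28 (1 - #27)

section
variable {W n : ℕ} {s : Store} {ds : List ℕ}

theorem slotLoop_does (hs : s.Bounded W) (hW : 2 * n + 4 < W) (h0 : s.reg 0 = n)
    (h14 : ∀ c, s.arr 14 c = 0) (hcol : ∀ p < n, s.arr 12 p ≤ 1) :
    Does W (forUp 4 0 slotBody) (n * 40 + 6) s (fun s' =>
      (∀ p < n, s'.arr 13 p = slot (s.arr 12) p) ∧ ∀ c, s'.arr 14 c = cnt (s.arr 12) c n) := by
  refine (Does.forUp (c := slotBody.time) (fun k s' =>
    (∀ p < k, s'.arr 13 p = slot (s.arr 12) p) ∧ ∀ c, s'.arr 14 c = cnt (s.arr 12) c k)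
    (by omega) hs h0 (by decide) (by decide) (by decide) (by simp [h14, cnt]) ?_).mono ?_
    fun _ _ _ h => h
  · rintro k s' hk hs' ha hi ⟨h1, h2⟩
    have h12 : s'.arr 12 = s.arr 12 := ha.arr 12 (by decide)
    have hc := hcol k hk
    have hle := cnt_le (s.arr 12) (s.arr 12 k) k
    refine Does.of_exec (by omega) hs' ?_ ⟨?_, ?_⟩
    · simp [slotBody, Prog.Ok, Prog.exec, hi, h12, h2]; omega
    · intro p hp
      by_cases e : p = k
      · simp [slotBody, Prog.exec, hi, h12, h2, e, slot]
      · simp [slotBody, Prog.exec, hi, h12, Function.update_of_ne e, h1 p (by omega)]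
    · intro c
      rw [cnt_succ]
      by_cases e : c = s.arr 12 k
      · simp [slotBody, Prog.exec, hi, h12, h2, e]
      · simp [slotBody, Prog.exec, hi, h12, h2, Function.update_of_ne e, Ne.symm e]
  · have : slotBody.time + 8 ≤ 40 := by decide
    exact Nat.add_le_add_right (Nat.mul_le_mul_left _ this) _

/-- The first class is chosen to be odd if n is odd, and the smaller one if both classes are odd.
This leaves the initial choices a single pattern for each parity. -/
theorem slots_does (hs : s.Bounded W) (hW : 2 * n + 4 < W) (h0 : s.reg 0 = n)
    (h14 : ∀ c, s.arr 14 c = 0) (h16 : ∀ c, s.arr 16 c = 0) (hcol : ∀ p < n, s.arr 12 p ≤ 1) :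
    Does W slots (n * 40 + 50) s (fun s' => (∀ p < n, s'.arr 13 p = slot (s.arr 12) p) ∧
      ∃ z ≤ 1, Rep ds (cnt (s.arr 12) z n) (cnt (s.arr 12) (1 - z) n) z s' ([], []) ∧
        (n % 2 = 1 → cnt (s.arr 12) z n % 2 = 1) ∧
        (cnt (s.arr 12) z n % 2 = 1 → cnt (s.arr 12) (1 - z) n % 2 = 1 →
          cnt (s.arr 12) z n ≤ cnt (s.arr 12) (1 - z) n)) := by
  have hadd := cnt_add hcol
  refine Does.mono (T := n * 40 + 6 + (40 + 4)) ?_ (by omega) fun _ _ _ h => h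
  refine Does.seq (slotLoop_does hs hW h0 h14 hcol) fun s1 hs1 ha1 ⟨q1, q2⟩ => ?_
  have hl0 := cnt_le (s.arr 12) 0 n
  have hl1 := cnt_le (s.arr 12) 1 n
  refine Does.seq (Q := fun s2 => s2.arr = s1.arr ∧ ∃ z ≤ 1, s2.reg 27 = z ∧
    (n % 2 = 1 → cnt (s.arr 12) z n % 2 = 1) ∧
        (cnt (s.arr 12) z n % 2 = 1 → cnt (s.arr 12) (1 - z) n % 2 = 1 →
          cnt (s.arr 12) z n ≤ cnt (s.arr 12) (1 - z) n)) ?_ fun s2 hs2 ha2 ⟨g1, z, g2, g3, g4⟩ => ?_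
  · refine (Does.ite (T := 20) (by omega) hs1 (by simp; omega) (fun hv => ?_) (fun hv => ?_)).mono
      (by decide) fun _ _ _ h => h
    · replace hv := Expr.eq_ne_zero.1 hv
      simp [q2] at hv
      refine Does.mono (Does.of_exec (p := .assign 27 1) (by omega) hs1 (by simp [Prog.Ok]; omega)
        (Q := fun s2 => s2.arr = s1.arr ∧ s2.reg 27 = 1) (by simp [Prog.exec])) (by decide)
        fun s2 _ _ ⟨g1, g2⟩ => ⟨g1, 1, le_rfl, g2, ?_⟩
      simp only [Nat.sub_self]
      omega
    · replace hv := Expr.eq_eq_zero.1 hv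
      simp [q2] at hv
      refine Does.mono (Does.of_exec (p := .assign 27 (.cell 14 1 % 2 * (.cell 14 1 <ₑ .cell 14 0)))
        (by omega) hs1 ?_ (Q := fun s2 => s2.arr = s1.arr ∧ s2.reg 27 = (cnt (s.arr 12) 1 n % 2) *
          if cnt (s.arr 12) 1 n < cnt (s.arr 12) 0 n then 1 else 0)
        (by simp [Prog.exec, q2])) (by decide)
        fun s2 _ _ ⟨g1, g2⟩ => ⟨g1, ?_⟩
      · simp only [Prog.Ok, Expr.safe_mul, Expr.safe_mod, Expr.safe_cell, Expr.safe_lt,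
          Expr.safe_ofNat, Expr.val_lt, Expr.val_mod]
        refine ⟨by omega, by omega, ?_⟩
        have := Nat.mod_lt (Expr.val s1 (.cell 14 1)) (show 0 < 2 by omega)
        simp only [Expr.val_ofNat]
        split <;> omega
      · by_cases hlt : cnt (s.arr 12) 1 n < cnt (s.arr 12) 0 n
        · rw [if_pos hlt, mul_one] at g2
          refine ⟨_, by omega, g2, ?_⟩
          rcases Nat.mod_two_eq_zero_or_one (cnt (s.arr 12) 1 n) with h | h <;> rw [h]
          · simp only [Nat.sub_zero]; omega
          · simp only [Nat.sub_self]; omega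
        · rw [if_neg hlt, mul_zero] at g2
          refine ⟨0, by omega, g2, ?_⟩
          simp only [Nat.sub_zero]; omega
  · refine Does.of_exec (p := .assign 28 (1 - #27)) (by omega) hs2 (by simp [Prog.Ok]; omega) ?_
    have e14 : ∀ c, ((Prog.assign 28 (1 - #27)).exec s2).arr 14 c = cnt (s.arr 12) c n := by
      intro c; simp [Prog.exec, g1, q2]
    refine ⟨?_, z, g2, ⟨g2, ?_, ?_, ?_, ?_, ?_⟩, g4⟩
    · simpa [Prog.exec, g1] using q1
    · simp [Prog.exec, g3]
    · simp [Prog.exec, g3]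
    · exact ⟨by rw [e14]; rfl, by simp⟩
    · exact ⟨by rw [e14]; rfl, by simp⟩
    · intro g
      have : s1.arr 16 = s.arr 16 := ha1.arr 16 (by decide)
      simp [Prog.exec, g1, this, h16, Sel.used]

theorem slot_inj {col : ℕ → ℕ} (hcol : ∀ p < n, col p ≤ 1) {p q : ℕ} (hp : p < n) (hq : q < n)
    (h : slot col p = slot col q) : p = q := by
  have h1 := hcol p hp
  have h2 := hcol q hq
  unfold slot at h
  exact cnt_inj (col := col) (by omega) (by omega)

/-- The sign of a colour. -/
def sign (col : ℕ → ℕ) (p : ℕ) : ℤ := if col p = 0 then 1 else -1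

theorem sum_range_getD {A : Type*} [AddCommMonoid A] (l : List A) :
    ∑ i ∈ Finset.range l.length, l.getD i 0 = l.sum := by
  rw [Finset.sum_range, ← Fin.sum_univ_getElem]
  exact Finset.sum_congr rfl fun i _ => by simp

/-- The chosen weights. -/
theorem Rep.weights {col : ℕ → ℕ} (hcol : ∀ p < n, col p ≤ 1) {z : ℕ}
    {σ : Sel (CyclicProduct ds)} (h : Rep ds (cnt col z n) (cnt col (1 - z) n) z s σ)
    (hσ : σ.Shape (cnt col z n) (cnt col (1 - z) n)) (hb : σ.Balanced)
    (hr : σ.rem (cnt col z n) (cnt col (1 - z) n) = 0) :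
    ∃ wt : ℕ → CyclicProduct ds, (∀ p < n, s.arr 15 (slot col p) = code ds (wt p)) ∧
      (∀ p < n, ∀ q < n, wt p = wt q → p = q) ∧ ∑ p ∈ Finset.range n, sign col p • wt p = 0 := by
  have hz := h.le
  have l1 : σ.1.length = cnt col z n := by have := hσ.le₁; unfold Sel.rem at hr; omega
  have l2 : σ.2.length = cnt col (1 - z) n := by have := hσ.le₂; unfold Sel.rem at hr; omega
  have hnd := List.nodup_append.1 hσ.nodup
  have hF : ∀ p < n, (col p = z ∧ cnt col (col p) p < σ.1.length) ∨
      (col p = 1 - z ∧ col p ≠ z ∧ cnt col (col p) p < σ.2.length) := by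
    intro p hp
    have := cnt_lt (col := col) hp
    by_cases e : col p = z
    · left; rw [e] at this ⊢; exact ⟨rfl, by omega⟩
    · right
      have e2 : col p = 1 - z := by have := hcol p hp; omega
      refine ⟨e2, e, ?_⟩
      rw [e2] at this ⊢; omega
  obtain ⟨wt, hwt⟩ : ∃ wt : ℕ → CyclicProduct ds, wt = fun p =>
    (if col p = z then σ.1 else σ.2).getD (cnt col (col p) p) 0 := ⟨_, rfl⟩
  have w1 : ∀ p, col p = z → wt p = σ.1.getD (cnt col z p) 0 := by
    intro p e; rw [hwt]; simp only [e, if_true]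
  have w2 : ∀ p < n, col p ≠ z → wt p = σ.2.getD (cnt col (1 - z) p) 0 := by
    intro p hp e
    have e2 : col p = 1 - z := by have := hcol p hp; omega
    rw [hwt]; simp only [e2]
    rw [if_neg (by omega)]
  refine ⟨wt, ?_, ?_, ?_⟩
  · intro p hp
    rcases hF p hp with ⟨e, hlt⟩ | ⟨e, e', hlt⟩
    · have := h.fst.cell (cnt col (col p) p) _ (List.getElem?_eq_getElem hlt)
      rw [l1, Nat.sub_self, zero_add] at this
      rw [w1 p e]
      simp only [e] at this hlt ⊢
      rw [slot, e, this, List.getD_eq_getElem _ _ hlt]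
    · have := h.snd.cell (cnt col (col p) p) _ (List.getElem?_eq_getElem hlt)
      rw [l2, Nat.sub_self, zero_add] at this
      rw [w2 p hp e']
      simp only [e] at this hlt ⊢
      rw [slot, e, this, List.getD_eq_getElem _ _ hlt]
  · intro p hp q hq e
    rcases hF p hp with ⟨p1, p3⟩ | ⟨p1, p2, p3⟩ <;> rcases hF q hq with ⟨q1, q3⟩ | ⟨q1, q2, q3⟩
    · rw [w1 p p1, w1 q q1] at e
      rw [p1] at p3; rw [q1] at q3
      rw [List.getD_eq_getElem _ _ p3, List.getD_eq_getElem _ _ q3] at e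
      refine cnt_inj (col := col) (p1.trans q1.symm) ?_
      rw [p1, q1]; exact (hnd.1.getElem_inj_iff).1 e
    · rw [w1 p p1, w2 q hq q2] at e
      rw [p1] at p3; rw [q1] at q3
      rw [List.getD_eq_getElem _ _ p3, List.getD_eq_getElem _ _ q3] at e
      exact absurd e (hnd.2.2 _ (List.getElem_mem _) _ (List.getElem_mem _))
    · rw [w2 p hp p2, w1 q q1] at e
      rw [p1] at p3; rw [q1] at q3
      rw [List.getD_eq_getElem _ _ p3, List.getD_eq_getElem _ _ q3] at e
      exact absurd e.symm (hnd.2.2 _ (List.getElem_mem _) _ (List.getElem_mem _))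
    · rw [w2 p hp p2, w2 q hq q2] at e
      rw [p1] at p3; rw [q1] at q3
      rw [List.getD_eq_getElem _ _ p3, List.getD_eq_getElem _ _ q3] at e
      refine cnt_inj (col := col) (p1.trans q1.symm) ?_
      rw [p1, q1]; exact (hnd.2.1.getElem_inj_iff).1 e
  -- Summing over the positions of a colour amounts to summing the list of elements chosen for it,
  -- and the two lists have equal sums.
  · have s1 : ∑ p ∈ Finset.range n, (if col p = z then wt p else 0) = σ.1.sum := by
      rw [← sum_range_getD, l1, ← sum_cnt]
      exact Finset.sum_congr rfl fun p _ => by split <;> simp_all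
    have s2 : ∑ p ∈ Finset.range n, (if col p = 1 - z then wt p else 0) = σ.2.sum := by
      rw [← sum_range_getD, l2, ← sum_cnt]
      refine Finset.sum_congr rfl fun p hp => ?_
      split
      · rename_i e; rw [w2 p (by simpa using hp) (by omega)]
      · rfl
    have hsum : ∑ p ∈ Finset.range n, (if col p = 0 then wt p else 0) =
        ∑ p ∈ Finset.range n, (if col p = 1 then wt p else 0) := by
      have hbb : σ.1.sum = σ.2.sum := hb
      rw [← s1, ← s2] at hbb
      rcases Nat.le_one_iff_eq_zero_or_eq_one.1 hz with rfl | rfl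
      · simpa using hbb
      · simpa using hbb.symm
    rw [← sub_eq_zero, ← Finset.sum_sub_distrib] at hsum
    rw [← hsum]
    refine Finset.sum_congr rfl fun p hp => ?_
    have := hcol p (by simpa using hp)
    unfold sign
    rcases Nat.le_one_iff_eq_zero_or_eq_one.1 this with e | e <;> simp [e]

end

/-! ### From the leaves to the root -/

section
variable {A : Type*} [AddCommGroup A]

/-- The weights that remain after the last `t` positions have been handled. -/
def resid (n : ℕ) (par : ℕ → ℕ) (wt : ℕ → A) : ℕ → ℕ → A
  | 0 => wt
  | t + 1 => Function.update (resid n par wt t) (par (n - 1 - t))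
      (resid n par wt t (par (n - 1 - t)) - resid n par wt t (n - 1 - t))

/-- The label of the edge from the position `p` to its parent. -/
def label (n : ℕ) (par : ℕ → ℕ) (wt : ℕ → A) (p : ℕ) : A := resid n par wt (n - 1 - p) p

variable {n : ℕ} {par : ℕ → ℕ} {wt : ℕ → A}

/-- Invariant of the pass from the leaves to the root: the labels already placed at q, together with
what remains if q is not yet handled, make up the prescribed weight. -/
theorem sum_label_add (hpar : ∀ p < n, 0 < p → par p < p) {t : ℕ} (ht : t + 1 ≤ n) {q : ℕ}
    (hq : q < n) :
    (∑ p ∈ Finset.Ioo (n - 1 - t) n, if p = q ∨ par p = q then label n par wt p else 0) +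
      (if q ≤ n - 1 - t then resid n par wt t q else 0) = wt q := by
  induction t with
  | zero =>
    have : Finset.Ioo (n - 1 - 0) n = ∅ := by
      ext p; simp; omega
    rw [this]
    simp [resid]; omega
  | succ t ih =>
    have ih := ih (by omega)
    set j := n - 1 - t with hj
    have hj0 : n - 1 - (t + 1) = j - 1 := by omega
    have hins : Finset.Ioo (j - 1) n = insert j (Finset.Ioo j n) := by
      ext p; simp; omega
    have hpj := hpar j (by omega) (by omega)
    have hlab : label n par wt j = resid n par wt t j := by
      rw [label]; congr 1; omega
    rw [hj0, hins, Finset.sum_insert (by simp), ← ih, hlab, resid, ← hj]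
    by_cases e : q = j
    · subst e
      rw [if_pos (Or.inl rfl), if_pos le_rfl, if_neg (by omega)]
      abel
    · by_cases e' : par j = q
      · subst e'
        rw [if_pos (Or.inr rfl), if_pos (by omega), if_pos (by omega), Function.update_self]
        abel
      · rw [if_neg (by tauto), Function.update_of_ne (Ne.symm e'), zero_add]
        congr 1
        by_cases h : q ≤ j - 1
        · rw [if_pos h, if_pos (by omega)]
        · rw [if_neg h, if_neg (by omega)]

/-- Handling a position takes the same amount from it and from its parent. These have opposite
signs, so the signed sum is unchanged. -/
theorem sum_sign_resid {col : ℕ → ℕ} (hpar : ∀ p < n, 0 < p → par p < p)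
    (hcol : ∀ p < n, 0 < p → col p + col (par p) = 1) {t : ℕ} (ht : t + 1 ≤ n) :
    ∑ q ∈ Finset.range (n - t), sign col q • resid n par wt t q =
      ∑ q ∈ Finset.range n, sign col q • wt q := by
  induction t with
  | zero => rfl
  | succ t ih =>
    have ih := ih (by omega)
    have hj : n - t = (n - (t + 1)) + 1 := by omega
    rw [← ih, hj, Finset.sum_range_succ]
    have hj' : n - 1 - t = n - (t + 1) := by omega
    rw [resid, hj']
    set j := n - (t + 1)
    have hpj := hpar j (by omega) (by omega)
    have hcj := hcol j (by omega) (by omega)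
    have hsgn : sign col j = - sign col (par j) := by
      unfold sign
      have : col j = 0 ∨ col j = 1 := by omega
      rcases this with e | e
      · have : col (par j) = 1 := by omega
        simp [e, this]
      · have : col (par j) = 0 := by omega
        simp [e, this]
    have hupd : ∀ q, Function.update (resid n par wt t) (par j)
        (resid n par wt t (par j) - resid n par wt t j) q =
        resid n par wt t q - if q = par j then resid n par wt t j else 0 := by
      intro q
      by_cases e : q = par j
      · subst e; simp
      · rw [Function.update_of_ne e, if_neg e, sub_zero]
    simp only [hupd, smul_sub, Finset.sum_sub_distrib, smul_ite, smul_zero,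
      Finset.sum_ite_eq', Finset.mem_range, hpj, if_true]
    rw [hsgn, neg_smul, sub_eq_add_neg]

theorem sum_label {col : ℕ → ℕ} (hn : 0 < n) (hpar : ∀ p < n, 0 < p → par p < p)
    (h0 : col 0 = 0) (hcol : ∀ p < n, 0 < p → col p + col (par p) = 1)
    (hwt : ∑ q ∈ Finset.range n, sign col q • wt q = 0) {q : ℕ} (hq : q < n) :
    (∑ p ∈ Finset.Ioo 0 n, if p = q ∨ par p = q then label n par wt p else 0) = wt q := by
  have h1 := sum_label_add (wt := wt) hpar (t := n - 1) (by omega) hq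
  have h2 := sum_sign_resid (wt := wt) hpar hcol (t := n - 1) (by omega)
  have e1 : n - 1 - (n - 1) = 0 := by omega
  have e2 : n - (n - 1) = 1 := by omega
  -- Only the root is left, so the signed sum is what remains there; hence nothing remains.
  rw [e2, hwt, Finset.sum_range_one, sign, if_pos h0, one_smul] at h2
  rw [e1] at h1
  rw [← h1]
  by_cases e : q = 0
  · subst e; simp [h2]
  · rw [if_neg (by omega), add_zero]

end

/-- Positions are handled in decreasing order, children before parents. Array `15` holds the
remaining weights and is addressed through the cells in array `13`. -/
def labelBody : Prog :=
  .assign 20 (#0 - 1 - #4) ;; .assign 21 (.cell 13 #20) ;; .assign 22 (.cell 13 (.cell 10 #20)) ;;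
  .store 3 (.cell 11 #20) (.cell 15 #21) ;;
  .store 15 #22 (subE (.cell 15 #22) (.cell 15 #21))

/-- Label the tree edges. -/
def labels : Prog := .assign 37 (#0 - 1) ;; forUp 4 37 labelBody

/-- Two positions sharing a parent edge would be parents of each other, but parents come strictly
earlier. -/
theorem Tree.pe_inj {U V : ℕ → ℕ} {n m q : ℕ} {ord pos par pe col : ℕ → ℕ}
    (h : Tree U V n m q ord pos par pe col) {p p' : ℕ} (hp : p < q) (h0 : 0 < p) (hp' : p' < q)
    (h0' : 0 < p') (e : pe p = pe p') : p = p' := by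
  have q1 := h.ends p hp h0
  have q2 := h.ends p' hp' h0'
  have r1 := h.par_lt p hp h0
  have r2 := h.par_lt p' hp' h0'
  rw [e] at q1
  by_contra hne
  have k1 : ord p = ord (par p') ∧ ord p' = ord (par p) := by
    rcases q1 with ⟨a1, a2⟩ | ⟨a1, a2⟩ <;> rcases q2 with ⟨b1, b2⟩ | ⟨b1, b2⟩
    · exact absurd (h.ord_inj hp hp' (a1.symm.trans b1)) hne
    · exact ⟨a1.symm.trans b2, b1.symm.trans a2⟩
    · exact ⟨a1.symm.trans b2, b1.symm.trans a2⟩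
    · exact absurd (h.ord_inj hp hp' (a1.symm.trans b1)) hne
  have s1 := h.ord_inj hp (by omega) k1.1
  have s2 := h.ord_inj hp' (by omega) k1.2
  omega

theorem labels_does {W n m : ℕ} {U V : ℕ → ℕ} {s : Store} {ds : List ℕ} (hds : ∀ d ∈ ds, 2 ≤ d)
    (hs : s.Bounded W) (hW : n + 4 < W) (hNW : ds.prod * ds.prod + 2 * ds.prod < W)
    (hn : 0 < n) (h0 : s.reg 0 = n) (ht : TreeOf U V n m n s) (htab : Tab ds s)
    (h13 : ∀ p < n, s.arr 13 p = slot (s.arr 12) p) (h3 : ∀ i, s.arr 3 i = 0)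
    {wt : ℕ → CyclicProduct ds} (h15 : ∀ p < n, s.arr 15 (slot (s.arr 12) p) = code ds (wt p)) :
    Does W labels (n * 200 + 20) s (fun s' =>
      (∀ p < n, 0 < p → s'.arr 3 (s.arr 11 p) = code ds (label n (s.arr 10) wt p)) ∧
      ∀ i, (∀ p < n, 0 < p → s.arr 11 p ≠ i) → s'.arr 3 i = 0) := by
  have hcol : ∀ p < n, s.arr 12 p ≤ 1 := fun p hp => ht.col_le hp
  refine Does.mono (T := 4 + ((n - 1) * (192 + 8) + 6)) ?_ (by omega) fun _ _ _ h => h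
  refine Does.seq (Does.exec (by omega) (.assign 37 (#0 - 1)) hs (by simp [Prog.Ok]; omega))
    fun s1 hs1 ha1 e1 => ?_
  have h37 : s1.reg 37 = n - 1 := by simp [e1, Prog.exec, h0]
  have harr : s1.arr = s.arr := by simp [e1, Prog.exec]
  refine (Does.forUp (fun k s' =>
    (∀ p < n, n - 1 - k < p → s'.arr 3 (s.arr 11 p) = code ds (label n (s.arr 10) wt p)) ∧
    (∀ i, (∀ p < n, n - 1 - k < p → s.arr 11 p ≠ i) → s'.arr 3 i = 0) ∧
    ∀ q < n, s'.arr 15 (slot (s.arr 12) q) = code ds (resid n (s.arr 10) wt k q))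
    (by omega) hs1 h37 (by decide) (by decide) (by decide) ?_ ?_).mono le_rfl ?_
  · refine ⟨fun p hp hp' => by omega, fun i _ => ?_, fun q hq => ?_⟩
    · simp [harr, h3]
    · simp [harr, h15 q hq, resid]
  · rintro k s' hk hs' ha hi ⟨J1, J2, J3⟩
    set j := n - 1 - k with hj
    have hj0 : 0 < j := by omega
    have hjn : j < n := by omega
    have hpj := ht.par_lt j hjn hj0
    have b : ∀ a, a ≠ 3 → a ≠ 15 → s'.arr a = s.arr a := fun a q1 q2 => by
      rw [ha.arr a (by simp [labelBody, forUp, Prog.warrs, q1, q2]), harr]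
    have b0 : s'.reg 0 = n := by rw [ha.reg 0 (by decide), ha1.reg 0 (by decide), h0]
    have htab' : Tab ds s' := htab.congr
      (fun x hx => by
        rw [ha.reg x ((by decide : ∀ x ∈ [3, 15, 16, 17], x ∉ (forUp 4 37 labelBody).wregs) x hx),
          ha1.reg x ((by decide : ∀ x ∈ [3, 15, 16, 17], x ∉ (Prog.assign 37 (#0 - 1)).wregs) x hx)])
      (fun x hx => b x (by rintro rfl; simp at hx) (by rintro rfl; simp at hx))
    refine Does.mono (T := 6 + (3 + (4 + (5 + 150)))) ?_ (by omega) fun _ _ _ h => h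
    have hj' : s'.reg 0 - 1 - s'.reg 4 = j := by rw [b0, hi]
    refine Does.seq (Does.exec (by omega) (.assign 20 (#0 - 1 - #4)) hs' (by simp [Prog.Ok]; omega))
      fun s2 hs2 ha2 e2 => ?_
    refine Does.seq (Does.exec (by omega) (.assign 21 (.cell 13 #20)) hs2 (by simp [Prog.Ok]))
      fun s3 hs3 ha3 e3 => ?_
    refine Does.seq (Does.exec (by omega) (.assign 22 (.cell 13 (.cell 10 #20))) hs3
      (by simp [Prog.Ok])) fun s4 hs4 ha4 e4 => ?_
    refine Does.seq (Does.exec (by omega) (.store 3 (.cell 11 #20) (.cell 15 #21)) hs4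
      (by simp [Prog.Ok])) fun s5 hs5 ha5 e5 => ?_
    have r20 : s2.reg 20 = j := by simp [e2, Prog.exec, hj']
    have a2 : s2.arr = s'.arr := by simp [e2, Prog.exec]
    have r21 : s3.reg 21 = slot (s.arr 12) j := by
      simp [e3, Prog.exec, r20, a2, b 13, h13 j hjn]
    have a3 : s3.arr = s'.arr := by simp [e3, Prog.exec, a2]
    have r20' : s3.reg 20 = j := by simp [e3, Prog.exec, r20]
    have r22 : s4.reg 22 = slot (s.arr 12) (s.arr 10 j) := by
      simp [e4, Prog.exec, r20', a3, b 13, b 10, h13 _ (show s.arr 10 j < n by omega)]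
    have a4 : s4.arr = s'.arr := by simp [e4, Prog.exec, a3]
    have r20'' : s4.reg 20 = j := by simp [e4, Prog.exec, r20']
    have r21' : s4.reg 21 = slot (s.arr 12) j := by simp [e4, Prog.exec, r21]
    have r21'' : s5.reg 21 = slot (s.arr 12) j := by simp [e5, Prog.exec, r21']
    have r22' : s5.reg 22 = slot (s.arr 12) (s.arr 10 j) := by simp [e5, Prog.exec, r22]
    have v15 : s'.arr 15 (slot (s.arr 12) j) = code ds (resid n (s.arr 10) wt k j) := J3 j hjn
    have a53 : s5.arr 3 = Function.update (s'.arr 3) (s.arr 11 j)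
        (code ds (resid n (s.arr 10) wt k j)) := by
      simp [e5, Prog.exec, r20'', r21', a4, b 11, v15]
    have a5 : ∀ a, a ≠ 3 → s5.arr a = s'.arr a := by
      intro a h; simp [e5, Prog.exec, a4, h]
    have htab5 : Tab ds s5 := by
      refine htab'.congr (fun x hx => ?_) (fun x hx => a5 x (by rintro rfl; simp at hx))
      have : x ≠ 20 ∧ x ≠ 21 ∧ x ≠ 22 := by simp at hx; omega
      rw [ha5.reg x (by simp [Prog.wregs]), ha4.reg x (by simp [Prog.wregs, this]),
        ha3.reg x (by simp [Prog.wregs, this]), ha2.reg x (by simp [Prog.wregs, this])]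
    have ev := EvalTo.subE (W := W) hds hNW htab5 (e₁ := .cell 15 #22) (e₂ := .cell 15 #21)
      (g := resid n (s.arr 10) wt k (s.arr 10 j)) (h := resid n (s.arr 10) wt k j)
      ⟨by simp [r22', a5 15, J3 _ (show s.arr 10 j < n by omega)], by simp⟩
      ⟨by simp [r21'', a5 15, v15], by simp⟩
    refine (Does.exec (by omega) (.store 15 #22 (subE (.cell 15 #22) (.cell 15 #21))) hs5
      ⟨trivial, ev.2⟩).mono (by decide) fun s6 hs6 ha6 e6 => ?_
    have a63 : s6.arr 3 = s5.arr 3 := by simp [e6, Prog.exec]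
    have a615 : s6.arr 15 = Function.update (s'.arr 15) (slot (s.arr 12) (s.arr 10 j))
        (code ds (resid n (s.arr 10) wt k (s.arr 10 j) - resid n (s.arr 10) wt k j)) := by
      have := ev.1
      simp [e6, Prog.exec, r22', this, a5 15]
    have hlab : label n (s.arr 10) wt j = resid n (s.arr 10) wt k j := by
      rw [label]; congr 1; omega
    simp only [Store.setReg_arr, a63, a53, a615]
    refine ⟨?_, ?_, ?_⟩
    · intro p hp hp'
      by_cases e : p = j
      · subst e; rw [Function.update_self, hlab]
      · rw [Function.update_of_ne, J1 p hp (by omega)]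
        exact fun h => e (ht.pe_inj hp (by omega) hjn hj0 h)
    · intro i hi'
      rw [Function.update_of_ne (fun h => hi' j hjn (by omega) h.symm),
        J2 i fun p hp hp' => hi' p hp (by omega)]
    · intro q hq
      rw [resid, ← hj]
      by_cases e : q = s.arr 10 j
      · subst e; rw [Function.update_self, Function.update_self]
      · rw [Function.update_of_ne e, Function.update_of_ne, J3 q hq]
        exact fun h => e (slot_inj hcol hq (by omega) h)
  · rintro s' _ _ ⟨J1, J2, -⟩
    exact ⟨fun p hp hp' => J1 p hp (by omega), fun i hi => J2 i fun p hp hp' => hi p hp (by omega)⟩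

end IrregularLabeling

namespace IrregularLabeling

/-! ### Edge lists -/

section
variable {n : ℕ} {G : SimpleGraph (Fin n)} {edges : List (Fin n × Fin n)}

/-- The `i`-th edge. -/
def edgeAt (hE : IsEdgeList G edges) (i : Fin edges.length) : G.edgeSet :=
  ⟨s((edges.get i).1, (edges.get i).2), (hE.2 _).1 (List.mem_map.2 ⟨_, List.get_mem _ _, rfl⟩)⟩

theorem edgeAt_bijective (hE : IsEdgeList G edges) : Function.Bijective (edgeAt hE) := by
  constructor
  · intro i j h
    have h1 : s((edges.get i).1, (edges.get i).2) = s((edges.get j).1, (edges.get j).2) :=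
      congrArg Subtype.val h
    have := (List.Nodup.getElem_inj_iff hE.1 (i := i) (j := j) (hi := by simp) (hj := by simp)).1
      (by simpa using h1)
    exact Fin.ext this
  · rintro ⟨e, he⟩
    obtain ⟨p, hp, rfl⟩ := List.mem_map.1 ((hE.2 e).2 he)
    obtain ⟨i, rfl⟩ := List.get_of_mem hp
    exact ⟨i, rfl⟩

theorem edge_ne (hE : IsEdgeList G edges) (i : Fin edges.length) :
    (edges.get i).1 ≠ (edges.get i).2 := by
  have := (edgeAt hE i).2
  exact G.ne_of_adj ((G.mem_edgeSet).1 this)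

theorem ncard_edgeSet (hE : IsEdgeList G edges) : G.edgeSet.ncard = edges.length := by
  rw [← Nat.card_coe_set_eq, ← Nat.card_congr (Equiv.ofBijective _ (edgeAt_bijective hE)),
    Nat.card_eq_fintype_card, Fintype.card_fin]

theorem weight_eq {A : Type*} [AddCommGroup A] (hE : IsEdgeList G edges) (f : G.edgeSet → A)
    (v : Fin n) : weight G f v = ∑ i : Fin edges.length,
      if v = (edges.get i).1 ∨ v = (edges.get i).2 then f (edgeAt hE i) else 0 := by
  classical
  rw [weight, ← (edgeAt_bijective hE).sum_comp]
  refine Finset.sum_congr rfl fun i _ => ?_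
  simp [edgeAt, Sym2.mem_iff]

/-- Double counting over the edges. With constant weight 1 each label counts twice; with opposite
signs at the two ends of each edge everything cancels. -/
theorem sum_smul_weight {A : Type*} [AddCommGroup A] (hE : IsEdgeList G edges)
    (f : G.edgeSet → A) (χ : Fin n → ℤ) : ∑ v, χ v • weight G f v =
      ∑ i : Fin edges.length, (χ (edges.get i).1 + χ (edges.get i).2) • f (edgeAt hE i) := by
  simp only [weight_eq hE, Finset.smul_sum]
  rw [Finset.sum_comm]
  refine Finset.sum_congr rfl fun i _ => ?_
  have hne := edge_ne hE i
  have : ∀ v, (χ v • if v = (edges.get i).1 ∨ v = (edges.get i).2 then f (edgeAt hE i) else 0) =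
      (if v = (edges.get i).1 then χ v • f (edgeAt hE i) else 0) +
        if v = (edges.get i).2 then χ v • f (edgeAt hE i) else 0 := by
    intro v
    by_cases h1 : v = (edges.get i).1
    · have h2 : v ≠ (edges.get i).2 := h1 ▸ hne
      rw [if_pos (Or.inl h1), if_pos h1, if_neg h2, add_zero]
    · by_cases h2 : v = (edges.get i).2
      · rw [if_pos (Or.inr h2), if_neg h1, if_pos h2, zero_add]
      · rw [if_neg (by tauto), if_neg h1, if_neg h2, smul_zero, add_zero]
  simp only [this, Finset.sum_add_distrib, Finset.sum_ite_eq', Finset.mem_univ, if_true, add_smul]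

theorem exists_edge (hE : IsEdgeList G edges) {u v : Fin n} (h : G.Adj u v) :
    ∃ i : Fin edges.length, ((edges.get i).1 = u ∧ (edges.get i).2 = v) ∨
      ((edges.get i).1 = v ∧ (edges.get i).2 = u) := by
  obtain ⟨i, hi⟩ := (edgeAt_bijective hE).2 ⟨s(u, v), h⟩
  have := congrArg Subtype.val hi
  simp only [edgeAt, Sym2.eq_iff] at this
  exact ⟨i, this⟩

/-- The array of the first ends. -/
def endsU (edges : List (Fin n × Fin n)) (i : ℕ) : ℕ := (edges.map fun p => (p.1 : ℕ)).getD i 0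

/-- The array of the second ends. -/
def endsV (edges : List (Fin n × Fin n)) (i : ℕ) : ℕ := (edges.map fun p => (p.2 : ℕ)).getD i 0

theorem endsU_eq (i : Fin edges.length) : endsU edges i = (edges.get i).1 := by
  simp [endsU]

theorem endsV_eq (i : Fin edges.length) : endsV edges i = (edges.get i).2 := by
  simp [endsV]

theorem ends_facts (hE : IsEdgeList G edges) {i : ℕ} (hi : i < edges.length) :
    endsU edges i < n ∧ endsV edges i < n ∧ endsU edges i ≠ endsV edges i := by
  have h1 := endsU_eq (edges := edges) ⟨i, hi⟩
  have h2 := endsV_eq (edges := edges) ⟨i, hi⟩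
  have h3 := edge_ne hE ⟨i, hi⟩
  simp only at h1 h2
  rw [h1, h2]
  exact ⟨Fin.is_lt _, Fin.is_lt _, fun h => h3 (Fin.ext h)⟩

theorem connected_ends (hG : G.Connected) (hE : IsEdgeList G edges) (S : Set ℕ) :
    ∀ u < n, u ∈ S → (∀ i < edges.length, endsU edges i ∈ S ↔ endsV edges i ∈ S) →
      ∀ v < n, v ∈ S := by
  intro u hu huS hS v hv
  have key : ∀ a b : Fin n, G.Walk a b → (a : ℕ) ∈ S → (b : ℕ) ∈ S := by
    intro a b w
    induction w with
    | nil => exact id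
    | cons h _ ih =>
      intro ha
      apply ih
      obtain ⟨i, hi⟩ := exists_edge hE h
      have := hS i i.2
      rw [endsU_eq, endsV_eq] at this
      rcases hi with ⟨h1, h2⟩ | ⟨h1, h2⟩
      · rw [h1, h2] at this; exact this.1 ha
      · rw [h1, h2] at this; exact this.2 ha
  obtain ⟨w⟩ := hG.preconnected ⟨u, hu⟩ ⟨v, hv⟩
  exact key _ _ w huS

theorem Tree.exists_ord {U V : ℕ → ℕ} {m : ℕ} {ord pos par pe col : ℕ → ℕ}
    (h : Tree U V n m n ord pos par pe col) {v : ℕ} (hv : v < n) : ∃ p < n, ord p = v := by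
  have := Finset.surjOn_of_injOn_of_card_le (s := Finset.range n) (t := Finset.range n) ord
    (fun p hp => by simpa using h.ord_lt p (by simpa using hp))
    (fun p hp p' hp' e => h.ord_inj (by simpa using hp) (by simpa using hp') e) le_rfl
  obtain ⟨p, hp, hp'⟩ := this (by simpa using hv)
  exact ⟨p, by simpa using hp, hp'⟩

/-- The labels of the tree edges make an irregular labelling. -/
theorem exists_irregular {ds : List ℕ} (hds : ∀ d ∈ ds, 2 ≤ d) (hE : IsEdgeList G edges)
    {ord pos par pe col a : ℕ → ℕ} (hn : 0 < n)
    (ht : Tree (endsU edges) (endsV edges) n edges.length n ord pos par pe col)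
    {wt : ℕ → CyclicProduct ds} (hinj : ∀ p < n, ∀ q < n, wt p = wt q → p = q)
    (hsum : ∑ p ∈ Finset.range n, sign col p • wt p = 0)
    (h1 : ∀ p < n, 0 < p → a (pe p) = code ds (label n par wt p))
    (h2 : ∀ i, (∀ p < n, 0 < p → pe p ≠ i) → a i = 0) :
    ∃ f : G.edgeSet → CyclicProduct ds, IsIrregular G f ∧
      ∀ (i : Fin edges.length) (e : G.edgeSet),
        (e : Sym2 (Fin n)) = s((edges.get i).1, (edges.get i).2) → a i = code ds (f e) := by
  have hcode : ∀ i, code ds (dec ds (a i)) = a i := by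
    intro i
    by_cases h : ∃ p < n, 0 < p ∧ pe p = i
    · obtain ⟨p, hp, h0, rfl⟩ := h
      rw [h1 p hp h0, dec_code hds]
    · rw [h2 i fun p hp h0 e => h ⟨p, hp, h0, e⟩, ← code_zero ds, dec_code hds]
  let E := Equiv.ofBijective _ (edgeAt_bijective hE)
  have hf : ∀ i, E.symm (edgeAt hE i) = i := fun i => E.symm_apply_apply i
  refine ⟨fun e => dec ds (a (E.symm e)), ?_, ?_⟩
  · have hw : ∀ q < n, ∀ v : Fin n, ord q = v →
        weight G (fun e => dec ds (a (E.symm e))) v = wt q := by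
      intro q hq v hv
      rw [weight_eq hE, ← sum_label hn ht.par_lt ht.col_zero ht.col_par hsum hq]
      have e1 : ∀ i : Fin edges.length,
          (if v = (edges.get i).1 ∨ v = (edges.get i).2 then dec ds (a (E.symm (edgeAt hE i)))
            else 0) = (fun j => if (v : ℕ) = endsU edges j ∨ (v : ℕ) = endsV edges j then
              dec ds (a j) else 0) (i : ℕ) := by
        intro i
        simp only [hf, endsU_eq, endsV_eq, Fin.ext_iff]
      rw [Finset.sum_congr rfl fun i _ => e1 i]
      refine Eq.trans (Finset.sum_range (n := edges.length) fun j : ℕ =>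
        if (v : ℕ) = endsU edges j ∨ (v : ℕ) = endsV edges j then dec ds (a j) else 0).symm ?_
      symm
      -- The sum over all edges reduces to the tree edges, indexed by their lower ends, since all
      -- other labels are 0.
      refine Finset.sum_of_injOn pe ?_ ?_ ?_ ?_
      · intro p hp p' hp' e
        simp only [Finset.coe_Ioo, Set.mem_Ioo] at hp hp'
        exact ht.pe_inj hp.2 hp.1 hp'.2 hp'.1 e
      · intro p hp
        simp only [Finset.coe_Ioo, Set.mem_Ioo] at hp
        simpa using ht.pe_lt p hp.2 hp.1
      · intro i _ hi
        have : a i = 0 := h2 i fun p hp h0 e => hi ⟨p, by simp [hp, h0], e⟩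
        rw [this, ← code_zero ds, dec_code hds, ite_self]
      · intro p hp
        simp only [Finset.mem_Ioo] at hp
        have hpp := ht.par_lt p hp.2 hp.1
        simp only [h1 p hp.2 hp.1, dec_code hds]
        refine if_congr ?_ rfl rfl
        rw [← hv]
        have i1 : ord q = ord p ↔ p = q :=
          ⟨fun e => ht.ord_inj hp.2 hq e.symm, fun e => by rw [e]⟩
        have i2 : ord q = ord (par p) ↔ par p = q :=
          ⟨fun e => ht.ord_inj (by omega) hq e.symm, fun e => by rw [e]⟩
        rcases ht.ends p hp.2 hp.1 with ⟨q1, q2⟩ | ⟨q1, q2⟩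
        · rw [q1, q2, i1, i2]
        · rw [q1, q2, i1, i2, or_comm]
    intro v v' e
    obtain ⟨p, hp, hp'⟩ := ht.exists_ord v.2
    obtain ⟨q, hq, hq'⟩ := ht.exists_ord v'.2
    rw [hw p hp v hp', hw q hq v' hq'] at e
    have := hinj p hp q hq e
    subst this
    exact Fin.ext (hp'.symm.trans hq')
  · intro i e he
    have : e = edgeAt hE i := Subtype.ext he
    rw [this]
    simp only [hf, hcode]

/-! ### Instances without an irregular labelling -/

variable {ds : List ℕ}

theorem finite_cyclicProduct (hds : ∀ d ∈ ds, 2 ≤ d) :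
    ∃ _ : Fintype (CyclicProduct ds), Fintype.card (CyclicProduct ds) = ds.prod := by
  have : ∀ i : Fin ds.length, NeZero (ds.get i) := fun i =>
    ⟨by have := hds _ (List.get_mem ds i); omega⟩
  exact ⟨inferInstance, by rw [← Nat.card_eq_fintype_card, card_cyclicProduct]⟩

theorem not_irregular_of_lt (hds : ∀ d ∈ ds, 2 ≤ d) (h : ds.prod < n)
    (f : G.edgeSet → CyclicProduct ds) : ¬ IsIrregular G f := by
  obtain ⟨_, hc⟩ := finite_cyclicProduct hds
  intro hf
  have := Fintype.card_le_of_injective _ hf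
  rw [Fintype.card_fin, hc] at this; omega

/-- Every edge contains both vertices, so their weights agree. -/
theorem not_irregular_two {A : Type*} [AddCommGroup A] (hE : IsEdgeList G edges) (h : n = 2)
    (f : G.edgeSet → A) : ¬ IsIrregular G f := by
  subst h
  intro hf
  have := sum_smul_weight hE f (fun v => if v = 0 then 1 else -1)
  rw [Finset.sum_eq_zero (s := Finset.univ) (f := fun i : Fin edges.length => _)] at this
  · rw [Fin.sum_univ_two] at this
    simp at this
    have := hf (add_neg_eq_zero.1 this)
    simp at this
  · intro i _
    have := edge_ne hE i
    have h0 : ((if (edges.get i).1 = 0 then 1 else -1) +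
      if (edges.get i).2 = 0 then 1 else -1 : ℤ) = 0 := by
      generalize (edges.get i).1 = x at *
      generalize (edges.get i).2 = y at *
      fin_cases x <;> fin_cases y <;> simp_all
    rw [h0, zero_smul]

/-- X is the set of unused elements. -/
theorem sum_weight_add {A : Type*} [AddCommGroup A] [Fintype A] [DecidableEq A] {w : Fin n → A}
    (hw : Function.Injective w) {k : ℕ} (hc : Fintype.card A = n + k) :
    ∃ X : Finset A, X.card = k ∧ (∀ v, w v ∉ X) ∧ ∑ v, w v + ∑ x ∈ X, x = ∑ x : A, x := by
  refine ⟨(Finset.univ.image w)ᶜ, ?_, ?_, ?_⟩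
  · rw [Finset.card_compl, Finset.card_image_of_injective _ hw, hc]; simp
  · simp
  · rw [← Finset.sum_add_sum_compl (Finset.univ.image w), Finset.sum_image fun _ _ _ _ h => hw h]

theorem sum_weight (hE : IsEdgeList G edges) {A : Type*} [AddCommGroup A] (f : G.edgeSet → A) :
    ∃ F : A, ∑ v, weight G f v = F + F := by
  have := sum_smul_weight hE f fun _ => 1
  simp only [one_smul] at this
  refine ⟨∑ i, f (edgeAt hE i), ?_⟩
  rw [this, ← Finset.sum_add_distrib]
  exact Finset.sum_congr rfl fun i _ => by rw [add_smul, one_smul]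

/-- Apart from ι the elements cancel against their negatives. The choice ι = 0 covers groups without
involutions. -/
theorem sum_univ_of_involution {A : Type*} [AddCommGroup A] [Fintype A] [DecidableEq A] {ι : A}
    (h : ∀ x : A, x = -x → x = 0 ∨ x = ι) (hι : ι = -ι) : ∑ x : A, x = ι := by
  rw [← Finset.sum_erase_add _ _ (Finset.mem_univ ι)]
  rw [Finset.sum_involution (fun a _ => -a), zero_add]
  · intro a _; exact add_neg_cancel a
  · intro a ha h0 e
    rcases h a e.symm with h | h
    · exact h0 h
    · exact (Finset.ne_of_mem_erase ha) h
  · intro a ha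
    refine Finset.mem_erase.2 ⟨fun e => Finset.ne_of_mem_erase ha ?_, Finset.mem_univ _⟩
    rw [hι, ← e, neg_neg]
  · intro a _; exact neg_neg a

/-- Exactly one order is even, and it is 2 mod 4. The sum of all elements is the involution, which
is odd in that coordinate, while the sum of the weights is a double. -/
theorem not_irregular_full (hds : ∀ d ∈ ds, 2 ≤ d) (hE : IsEdgeList G edges) (h : ds.prod % 4 = 2)
    (hn : n = ds.prod) (f : G.edgeSet → CyclicProduct ds) : ¬ IsIrregular G f := by
  intro hf
  obtain ⟨_, hc⟩ := finite_cyclicProduct hds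
  obtain ⟨k, hk⟩ : ∃ k, evens ds ds.length = [k] := by
    obtain ⟨m, hm, he⟩ := prod_evens ds
    rcases hev : evens ds ds.length with _ | ⟨i, _ | ⟨j, l⟩⟩
    · rw [hev] at he; simp at he; omega
    · exact ⟨i, rfl⟩
    · exfalso
      have hi := (mem_evens.1 (show i ∈ evens ds ds.length by simp [hev])).2
      have hj := (mem_evens.1 (show j ∈ evens ds ds.length by simp [hev])).2
      obtain ⟨u, hu⟩ := Nat.dvd_of_mod_eq_zero hi
      obtain ⟨v, hv⟩ := Nat.dvd_of_mod_eq_zero hj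
      rw [hev] at he; simp only [List.map_cons, List.prod_cons] at he
      rw [hu, hv] at he
      have : ds.prod % 4 = 0 := Nat.mod_eq_zero_of_dvd
        ⟨u * v * (l.map fun i => ds.getD i 0).prod * m, by rw [he]; ring⟩
      omega
  have hk' := mem_evens.1 (hk ▸ List.mem_singleton_self k)
  have hd4 : ds.getD k 0 % 4 = 2 := by
    obtain ⟨m, hm, he⟩ := prod_evens ds
    rw [hk] at he
    simp only [List.map_cons, List.map_nil, List.prod_cons, List.prod_nil, mul_one] at he
    by_contra h4
    obtain ⟨u, hu⟩ : 4 ∣ ds.getD k 0 := by omega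
    have : ds.prod % 4 = 0 := Nat.mod_eq_zero_of_dvd ⟨u * m, by rw [he, hu]; ring⟩
    omega
  obtain ⟨X, hX, -, hsum⟩ := sum_weight_add hf (k := 0) (by omega)
  obtain ⟨F, hF⟩ := sum_weight hE f
  rw [Finset.card_eq_zero] at hX
  rw [hX, Finset.sum_empty, add_zero, hF, sum_univ_of_involution (ι := halfE ds k)
    (fun x => eq_zero_or_of_eq_neg hds hk)
    (eq_neg_of_add_eq_zero_left (halfE_add hk'.1 hk'.2))] at hsum
  have hcoord := congrFun hsum ⟨k, hk'.1⟩
  have hget : ds.get ⟨k, hk'.1⟩ = ds.getD k 0 := by simp [hk'.1]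
  rw [halfE, unitE_eq hk'.1, Pi.single_eq_same, Pi.add_apply] at hcoord
  have h2 : 2 ∣ ds.get ⟨k, hk'.1⟩ := by omega
  -- Reducing mod 2 sends the double to 0 and the odd number d / 2 to 1.
  have := congrArg (ZMod.castHom h2 (ZMod 2)) hcoord
  rw [map_add, map_natCast, CharTwo.add_self_eq_zero, eq_comm, ZMod.natCast_eq_zero_iff] at this
  omega

theorem nsmul_eq_zero {c : ℕ} (h : ∀ d ∈ ds, d = c) (x : CyclicProduct ds) : c • x = 0 := by
  funext i
  have : ds.get i = c := h _ (List.get_mem ds i)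
  rw [Pi.smul_apply, nsmul_eq_mul, ← this]; simp

theorem not_irregular_twos (hds : ∀ d ∈ ds, 2 ≤ d) (hE : IsEdgeList G edges)
    (h : ∀ d ∈ ds, d = 2) (hn : n + 2 = ds.prod) (hn3 : 3 ≤ n)
    (f : G.edgeSet → CyclicProduct ds) : ¬ IsIrregular G f := by
  intro hf
  obtain ⟨_, hc⟩ := finite_cyclicProduct hds
  have h2 : ∀ x : CyclicProduct ds, x + x = 0 := fun x => by
    rw [← two_nsmul]; exact nsmul_eq_zero h x
  have hlen : 2 ≤ ds.length := by
    by_contra hlt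
    have e := prod_eq_pow h
    have : ds.length = 0 ∨ ds.length = 1 := by omega
    rcases this with h | h <;> rw [h] at e <;> simp at e <;> omega
  have hS : ∑ x : CyclicProduct ds, x = 0 := by
    funext i
    rw [Finset.sum_apply]
    obtain ⟨j, hj, hji⟩ : ∃ j < ds.length, (i : ℕ) ≠ j := by
      by_cases h0 : (i : ℕ) = 0
      · exact ⟨1, by omega, by omega⟩
      · exact ⟨0, by omega, h0⟩
    have hu : unitE ds j 1 ≠ 0 := by
      rw [Ne, unitE_eq_zero hj, List.getD_eq_getElem _ _ hj, h _ (List.getElem_mem hj)]; omega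
    -- Translation by a unit vector of another factor pairs the elements without changing coordinate
    -- i, and equal coordinates cancel in pairs.
    refine Finset.sum_involution (fun a _ => a + unitE ds j 1) ?_ ?_ ?_ ?_
    · intro a _
      rw [Pi.add_apply, unitE_apply_ne hji, add_zero]
      exact congrFun (h2 a) i
    · intro a _ _ e; exact hu (by simpa using e)
    · intro a _; exact Finset.mem_univ _
    · intro a _; rw [add_assoc, h2, add_zero]
  obtain ⟨X, hX, -, hsum⟩ := sum_weight_add hf (k := 2) (by omega)
  obtain ⟨F, hF⟩ := sum_weight hE f
  obtain ⟨x, y, hxy, rfl⟩ := Finset.card_eq_two.1 hX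
  rw [hF, h2, zero_add, Finset.sum_pair hxy, hS] at hsum
  apply hxy
  rw [eq_neg_of_add_eq_zero_left hsum]
  exact (eq_neg_of_add_eq_zero_left (h2 y)).symm

/-- In a star the weight of the centre is the sum of all other weights. With x the unused element,
the total 0 gives 2 w(c) + x = 0. -/
theorem not_irregular_star (hds : ∀ d ∈ ds, 2 ≤ d) (hE : IsEdgeList G edges)
    (h : ∀ d ∈ ds, d = 3) (hn : n + 1 = ds.prod)
    (hstar : IsStar (endsU edges) (endsV edges) n edges.length)
    (f : G.edgeSet → CyclicProduct ds) : ¬ IsIrregular G f := by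
  intro hf
  obtain ⟨_, hc⟩ := finite_cyclicProduct hds
  obtain ⟨χ, c, hcn, hχ, hχ1, hχe⟩ := hstar
  have hev : evens ds ds.length = [] := by
    rw [List.eq_nil_iff_forall_not_mem]
    intro i hi
    obtain ⟨h1, h2⟩ := mem_evens.1 hi
    rw [List.getD_eq_getElem _ _ h1, h _ (List.getElem_mem h1)] at h2
    omega
  have hT : ∀ x : CyclicProduct ds, x = -x → x = 0 := fun x => eq_zero_of_eq_neg hev
  have hS : ∑ x : CyclicProduct ds, x = 0 :=
    sum_univ_of_involution (fun x hx => Or.inl (hT x hx)) (by simp)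
  obtain ⟨X, hX, hXw, hsum⟩ := sum_weight_add hf (k := 1) (by omega)
  obtain ⟨x, rfl⟩ := Finset.card_eq_one.1 hX
  rw [Finset.sum_singleton, hS] at hsum
  have hbip := sum_smul_weight hE f (fun v => if v = ⟨c, hcn⟩ then 1 else -1)
  rw [Finset.sum_eq_zero (s := Finset.univ) (f := fun i : Fin edges.length => _)] at hbip
  · have h2 : weight G f ⟨c, hcn⟩ + weight G f ⟨c, hcn⟩ + x = 0 := by
      rw [← hsum, ← add_zero (∑ v, weight G f v), ← hbip, ← Finset.sum_add_distrib]
      congr 1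
      have : ∀ v, weight G f v + (if v = ⟨c, hcn⟩ then (1 : ℤ) else -1) • weight G f v =
          if v = ⟨c, hcn⟩ then weight G f v + weight G f v else 0 := by
        intro v
        split
        · rw [one_smul]
        · rw [neg_smul, one_smul, add_neg_cancel]
      rw [Finset.sum_congr rfl fun v _ => this v, Finset.sum_ite_eq']
      simp
    have h3 : x + x + x = 0 := by
      have := nsmul_eq_zero h x
      rwa [show (3 : ℕ) = 1 + 1 + 1 from rfl, add_smul, add_smul, one_smul] at this
    -- As 3x = 0, the relation 2 w(c) = -x becomes 2 (w(c) - x) = 0. In odd order this yields w(c) =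
    -- x, but x is not a weight.
    have h4 : weight G f ⟨c, hcn⟩ - x = -(weight G f ⟨c, hcn⟩ - x) := by
      refine eq_neg_of_add_eq_zero_left ?_
      calc _ = (weight G f ⟨c, hcn⟩ + weight G f ⟨c, hcn⟩ + x) - (x + x + x) := by abel
        _ = 0 := by rw [h2, h3, sub_zero]
    exact hXw ⟨c, hcn⟩ (by simpa using sub_eq_zero.1 (hT _ h4))
  · intro i _
    have hne := edge_ne hE i
    have h1 := hχe i i.2
    rw [endsU_eq, endsV_eq] at h1
    have c1 := hχ1 c hcn
    have a1 := hχ1 _ (edges.get i).1.2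
    have b1 := hχ1 _ (edges.get i).2.2
    have a2 := hχ _ (edges.get i).1.2
    have b2 := hχ _ (edges.get i).2.2
    have : (edges.get i).1 = ⟨c, hcn⟩ ∨ (edges.get i).2 = ⟨c, hcn⟩ := by
      by_cases e : χ (edges.get i).1 = χ c
      · exact Or.inl (Fin.ext (a2 e))
      · exact Or.inr (Fin.ext (b2 (by omega)))
    rcases this with e | e
    · have e' : (edges.get i).2 ≠ ⟨c, hcn⟩ := fun h => hne (e.trans h.symm)
      rw [if_pos e, if_neg e']; simp
    · have e' : (edges.get i).1 ≠ ⟨c, hcn⟩ := fun h => hne (h.trans e.symm)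
      rw [if_pos e, if_neg e']; simp

end

end IrregularLabeling

namespace IrregularLabeling

/-! ### The algorithm -/

/-- Label the graph after the first tests. -/
def build : Prog :=
  tables ;; adjacency ;; search ;; repair ;;
    .ite #36 (.assign 0 0) (slots ;; select ;; labels ;; .assign 0 1)

/-- The program for Irregular Labeling. -/
def main : Prog :=
  .ite (#0 =ₑ 1) .skip
    (.ite (#0 =ₑ 2) (.assign 0 0)
      (scan ;;
        .ite (#3 <ₑ #0) (.assign 0 0)
          (.ite ((#0 =ₑ #3) * (#3 % 4 =ₑ 2)) (.assign 0 0)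
            (.ite ((#0 + 2 =ₑ #3) * (#6 =ₑ #2)) (.assign 0 0) build))))

theorem Scanned.congr {ds : List ℕ} {s s' : Store} (h : Scanned ds s)
    (hr : ∀ x ∈ [3, 5, 6, 7, 8, 9, 10, 11, 12, 13, 14], s'.reg x = s.reg x) : Scanned ds s' := by
  obtain ⟨h1, ⟨c1, c2, c3⟩, ⟨d1, d2⟩, h4, h5⟩ := h
  refine ⟨?_, ⟨?_, ?_, ?_⟩, ⟨fun t ht => ?_, ?_⟩, ?_, ?_⟩
  · rw [hr 3 (by simp), h1]
  · rw [hr 5 (by simp), c1]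
  · rw [hr 6 (by simp), c2]
  · rw [hr 7 (by simp), c3]
  · rw [hr (10 + t) (by simp; omega), d1 t ht]
  · rw [hr 14 (by simp), d2]
  · rw [NotThree, hr 8 (by simp)]; exact h4
  · rw [NotTwoFour, hr 9 (by simp)]; exact h5

section
variable {W n : ℕ} {G : SimpleGraph (Fin n)} {edges : List (Fin n × Fin n)} {ds : List ℕ}

theorem reject_does {s : Store} {T : ℕ} (hW : 1 < W) (hs : s.Bounded W) (hT : 2 ≤ T)
    (h : ∀ f : G.edgeSet → CyclicProduct ds, ¬ IsIrregular G f) :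
    Does W (.assign 0 0) T s (IsAnswer G edges ds) :=
  (Does.of_exec (p := .assign 0 0) hW hs (by simp [Prog.Ok]; omega)
    (Q := fun s' => s'.reg 0 = 0) (by simp [Prog.exec])).mono hT
    fun _ _ _ h0 => Or.inr ⟨h0, fun ⟨f, hf⟩ => h f hf⟩

theorem cnt_pos {U V : ℕ → ℕ} {m : ℕ} {ord pos par pe col : ℕ → ℕ}
    (ht : Tree U V n m n ord pos par pe col) (hn : 2 ≤ n) :
    1 ≤ cnt col 0 n ∧ 1 ≤ cnt col 1 n := by
  constructor
  · exact Finset.card_pos.2 ⟨0, by simp [ht.col_zero]; omega⟩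
  · have q1 := ht.par_lt 1 (by omega) (by omega)
    have q2 := ht.col_par 1 (by omega) (by omega)
    have q3 : par 1 = 0 := by omega
    rw [q3, ht.col_zero] at q2
    exact Finset.card_pos.2 ⟨1, by simp; omega⟩

/-- The weights are chosen and the labels computed once a suitable tree is found. -/
theorem finish_does (hds : ∀ d ∈ ds, 2 ≤ d) (hE : IsEdgeList G edges) {s : Store}
    (hs : s.Bounded W) (hW : 2 * n + 4 < W) (hNW : ds.prod * ds.prod + 2 * ds.prod < W)
    (hn : 3 ≤ n) (hnN : n ≤ ds.prod) (hfull : ds.prod % 4 = 2 → n ≠ ds.prod)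
    (htwos : ds.count 2 = ds.length → n + 2 ≠ ds.prod) (h0 : s.reg 0 = n)
    (h2 : s.reg 2 = ds.length) (hsc : Scanned ds s) (htab : Tab ds s)
    (ht : TreeOf (endsU edges) (endsV edges) n edges.length n s)
    (hthree : ds.count 3 = ds.length → n + 1 = ds.prod →
      2 ≤ cnt (s.arr 12) 0 n ∧ 2 ≤ cnt (s.arr 12) 1 n)
    (h3 : ∀ i, s.arr 3 i = 0) (h14 : ∀ i, s.arr 14 i = 0) (h16 : ∀ i, s.arr 16 i = 0) :
    Does W (slots ;; select ;; labels ;; .assign 0 1) (ds.prod * 800 + n * 240 + 8200) s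
      (IsAnswer G edges ds) := by
  have hcol : ∀ p < n, s.arr 12 p ≤ 1 := fun p hp => ht.col_le hp
  have hadd := cnt_add hcol
  obtain ⟨p0, p1⟩ := cnt_pos ht (by omega)
  refine Does.mono (T := n * 40 + 50 + (ds.prod * 800 + 8000 + (n * 200 + 20 + 2))) ?_ (by omega)
    fun _ _ _ h => h
  refine Does.seq (slots_does (ds := ds) hs hW h0 h14 h16 hcol)
    fun s1 hs1 ha1 ⟨h13, z, hz, hrep, hodd, hsm⟩ => ?_
  have hab : cnt (s.arr 12) z n + cnt (s.arr 12) (1 - z) n = n := by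
    rcases Nat.le_one_iff_eq_zero_or_eq_one.1 hz with rfl | rfl
    · exact hadd
    · rw [add_comm]; exact hadd
  have hfeas : Feasible ds (cnt (s.arr 12) z n) (cnt (s.arr 12) (1 - z) n) := by
    refine ⟨?_, ?_, by omega, by omega, by rw [hab]; exact hodd, hsm, by rw [hab]; exact hfull,
      by rw [hab]; exact htwos, fun q1 q2 => ?_⟩
    · rcases Nat.le_one_iff_eq_zero_or_eq_one.1 hz with rfl | rfl <;> assumption
    · rcases Nat.le_one_iff_eq_zero_or_eq_one.1 hz with rfl | rfl <;> assumption
    · have := hthree q1 (by omega)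
      rcases Nat.le_one_iff_eq_zero_or_eq_one.1 hz with rfl | rfl
      · exact this
      · exact this.symm
  have hsc1 : Scanned ds s1 := hsc.congr fun x hx => ha1.reg x
    ((by decide : ∀ x ∈ [3, 5, 6, 7, 8, 9, 10, 11, 12, 13, 14], x ∉ slots.wregs) x hx)
  have htab1 : Tab ds s1 := htab.congr
    (fun x hx => ha1.reg x ((by decide : ∀ x ∈ [3, 15, 16, 17], x ∉ slots.wregs) x hx))
    (fun x hx => ha1.arr x ((by decide : ∀ x ∈ [17, 18], x ∉ slots.warrs) x hx))
  refine Does.seq (select_does hds hs1 (by omega) hNW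
    (by rw [ha1.reg 0 (by decide), h0, hab]) ((ha1.reg 2 (by decide)).trans h2) hsc1 htab1 hrep hfeas)
    fun s2 hs2 ha2 ⟨σ, hrep2, hshape, hbal, hrem⟩ => ?_
  have g : ∀ a ∈ [3, 8, 9, 10, 11, 12], s2.arr a = s.arr a := fun a h => by
    rw [ha2.arr a ((by decide : ∀ x ∈ [3, 8, 9, 10, 11, 12], x ∉ select.warrs) a h),
      ha1.arr a ((by decide : ∀ x ∈ [3, 8, 9, 10, 11, 12], x ∉ slots.warrs) a h)]
  have g13 : s2.arr 13 = s1.arr 13 := ha2.arr 13 (by decide)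
  have htab2 : Tab ds s2 := htab1.congr
    (fun x hx => ha2.reg x ((by decide : ∀ x ∈ [3, 15, 16, 17], x ∉ select.wregs) x hx))
    (fun x hx => ha2.arr x ((by decide : ∀ x ∈ [17, 18], x ∉ select.warrs) x hx))
  obtain ⟨wt, w1, w2, w3⟩ := hrep2.weights hcol hshape hbal hrem
  have ht2 : TreeOf (endsU edges) (endsV edges) n edges.length n s2 := by
    rw [TreeOf, g 8 (by simp), g 9 (by simp), g 10 (by simp), g 11 (by simp), g 12 (by simp)]
    exact ht
  have hlab := labels_does (W := W) hds hs2 (by omega) (by omega) (by omega)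
    (by rw [ha2.reg 0 (by decide), ha1.reg 0 (by decide), h0]) ht2 htab2
    (by rw [g13, g 12 (by simp)]; exact h13) (by rw [g 3 (by simp)]; exact h3)
    (wt := wt) (by rw [g 12 (by simp)]; exact w1)
  refine Does.seq hlab fun s3 hs3 ha3 ⟨l1, l2⟩ => ?_
  rw [g 10 (by simp), g 11 (by simp)] at l1
  rw [g 11 (by simp)] at l2
  refine Does.of_exec (p := .assign 0 1) (by omega) hs3 (by simp [Prog.Ok]; omega)
    (Or.inl ⟨by simp [Prog.exec], ?_⟩)
  exact exists_irregular hds hE (by omega) ht w2 w3 l1 l2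

theorem build_does (hds : ∀ d ∈ ds, 2 ≤ d) (hG : G.Connected) (hE : IsEdgeList G edges) {s : Store}
    (hs : s.Bounded W) (hW : 2 * n + 4 < W) (hmW : 2 * edges.length + 2 < W)
    (hNW : ds.prod * ds.prod + 2 * ds.prod + 4 < W)
    (hn : 3 ≤ n) (hnN : n ≤ ds.prod) (hfull : ds.prod % 4 = 2 → n ≠ ds.prod)
    (htwos : ds.count 2 = ds.length → n + 2 ≠ ds.prod) (h0 : s.reg 0 = n)
    (h1 : s.reg 1 = edges.length) (h2 : s.reg 2 = ds.length) (h36 : s.reg 36 = 0)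
    (hsc : Scanned ds s) (ha : s.arr = (input n edges ds).arr) :
    Does W build (ds.prod * 1600 + edges.length * 340 + n * 353 + 9000) s
      (IsAnswer G edges ds) := by
  have hds1 : ds ≠ [] := by rintro rfl; simp at hnN; omega
  have hUn : ∀ i < edges.length, endsU edges i < n := fun i hi => (ends_facts hE hi).1
  have hVn : ∀ i < edges.length, endsV edges i < n := fun i hi => (ends_facts hE hi).2.1
  have hUV : ∀ i < edges.length, endsU edges i ≠ endsV edges i := fun i hi => (ends_facts hE hi).2.2
  have hc3 : ds.count 3 = ds.length → ∀ d ∈ ds, d = 3 := fun h d hd =>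
    (List.count_eq_length.1 h d hd).symm
  refine Does.mono (T := (800 * ds.prod + 100) + (edges.length * 100 + 6 + (200 * edges.length +
    100 * n + 20 + (n * 13 + edges.length * 40 + 200 + (2 + (ds.prod * 800 + n * 240 + 8200))))))
    ?_ (by omega) fun _ _ _ h => h
  refine Does.seq (tables_does hds hds1 hNW hs h2 hsc.prod (fun i => by rw [ha]; rfl)
    (by rw [ha]; rfl) (by rw [ha]; rfl)) fun s1 hs1 ha1 htab1 => ?_
  have hsc1 : Scanned ds s1 := hsc.congr fun x hx => ha1.reg x
    ((by decide : ∀ x ∈ [3, 5, 6, 7, 8, 9, 10, 11, 12, 13, 14], x ∉ tables.wregs) x hx)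
  have r1 : ∀ x ∈ [0, 1, 2, 36], s1.reg x = s.reg x := fun x hx => ha1.reg x
    ((by decide : ∀ x ∈ [0, 1, 2, 36], x ∉ tables.wregs) x hx)
  have b1 : ∀ a ∈ [0, 1, 3, 7, 8, 9, 12, 14, 16], s1.arr a = (input n edges ds).arr a := fun a h => by
    rw [ha1.arr a ((by decide : ∀ x ∈ [0, 1, 3, 7, 8, 9, 12, 14, 16], x ∉ tables.warrs) a h), ha]
  refine Does.seq (adjacency_does (m := edges.length) (U := endsU edges) (V := endsV edges) hs1 hmW
    ((r1 1 (by simp)).trans h1) (b1 0 (by simp)) (b1 1 (by simp))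
    (fun i => by rw [b1 7 (by simp)]; rfl)) fun s2 hs2 ha2 hadj => ?_
  have hsc2 : Scanned ds s2 := hsc1.congr fun x hx => ha2.reg x
    ((by decide : ∀ x ∈ [3, 5, 6, 7, 8, 9, 10, 11, 12, 13, 14], x ∉ adjacency.wregs) x hx)
  have htab2 : Tab ds s2 := htab1.congr
    (fun x hx => ha2.reg x ((by decide : ∀ x ∈ [3, 15, 16, 17], x ∉ adjacency.wregs) x hx))
    (fun x hx => ha2.arr x ((by decide : ∀ x ∈ [17, 18], x ∉ adjacency.warrs) x hx))
  have r2 : ∀ x ∈ [0, 1, 2, 36], s2.reg x = s.reg x := fun x hx => (ha2.reg x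
    ((by decide : ∀ x ∈ [0, 1, 2, 36], x ∉ adjacency.wregs) x hx)).trans (r1 x hx)
  have b2 : ∀ a ∈ [0, 1, 3, 8, 9, 12, 14, 16], s2.arr a = (input n edges ds).arr a := fun a h => by
    rw [ha2.arr a ((by decide : ∀ x ∈ [0, 1, 3, 8, 9, 12, 14, 16], x ∉ adjacency.warrs) a h),
      b1 a ((by decide : ∀ x ∈ [0, 1, 3, 8, 9, 12, 14, 16], x ∈ [0, 1, 3, 7, 8, 9, 12, 14, 16]) a h)]
  refine Does.seq (search_does hs2 hmW (by omega) (by omega) hUn hVn hadj (by rw [b2 8 (by simp)]; rfl)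
    (fun v => by rw [b2 9 (by simp)]; rfl) (by rw [b2 12 (by simp)]; rfl)
    (connected_ends hG hE)) fun s3 hs3 ha3 ht3 => ?_
  have hsc3 : Scanned ds s3 := hsc2.congr fun x hx => ha3.reg x
    ((by decide : ∀ x ∈ [3, 5, 6, 7, 8, 9, 10, 11, 12, 13, 14], x ∉ search.wregs) x hx)
  have htab3 : Tab ds s3 := htab2.congr
    (fun x hx => ha3.reg x ((by decide : ∀ x ∈ [3, 15, 16, 17], x ∉ search.wregs) x hx))
    (fun x hx => ha3.arr x ((by decide : ∀ x ∈ [17, 18], x ∉ search.warrs) x hx))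
  have r3 : ∀ x ∈ [0, 1, 2, 36], s3.reg x = s.reg x := fun x hx => (ha3.reg x
    ((by decide : ∀ x ∈ [0, 1, 2, 36], x ∉ search.wregs) x hx)).trans (r2 x hx)
  have b3 : ∀ a ∈ [0, 1, 3, 14, 16], s3.arr a = (input n edges ds).arr a := fun a h => by
    rw [ha3.arr a ((by decide : ∀ x ∈ [0, 1, 3, 14, 16], x ∉ search.warrs) a h),
      b2 a ((by decide : ∀ x ∈ [0, 1, 3, 14, 16], x ∈ [0, 1, 3, 8, 9, 12, 14, 16]) a h)]
  have hvis : ∀ v < n, s3.arr 9 v ≠ 0 := by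
    intro v hv
    obtain ⟨p, hp, rfl⟩ := ht3.exists_ord hv
    rw [ht3.pos_ord p hp]; omega
  have h7 := hsc3.counted.three
  rw [List.take_length] at h7
  refine Does.seq (repair_does hs3 (by omega) (by omega) hn ((r3 0 (by simp)).trans h0)
    ((r3 1 (by simp)).trans h1) ((r3 2 (by simp)).trans h2) hsc3.prod ((r3 36 (by simp)).trans h36)
    (fun q1 q2 => ?_) (b3 0 (by simp)) (b3 1 (by simp)) hUn hVn hUV ht3 hvis)
    fun s4 hs4 ha4 hq => ?_
  -- A value n = 3 would give N = 4, which is not a power of 3.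
  · have hN := prod_eq_pow (hc3 (h7.symm.trans q1))
    by_contra hlt
    have hNv : ds.prod = 4 := by omega
    rw [hNv] at hN
    have : ds.length = 0 ∨ ds.length = 1 ∨ 2 ≤ ds.length := by omega
    rcases this with h | h | h
    · rw [h] at hN; simp at hN
    · rw [h] at hN; simp at hN
    · have : 3 ^ 2 ≤ 3 ^ ds.length := Nat.pow_le_pow_right (by norm_num) h
      omega
  have hsc4 : Scanned ds s4 := hsc3.congr fun x hx => ha4.reg x
    ((by decide : ∀ x ∈ [3, 5, 6, 7, 8, 9, 10, 11, 12, 13, 14], x ∉ repair.wregs) x hx)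
  have htab4 : Tab ds s4 := htab3.congr
    (fun x hx => ha4.reg x ((by decide : ∀ x ∈ [3, 15, 16, 17], x ∉ repair.wregs) x hx))
    (fun x hx => ha4.arr x ((by decide : ∀ x ∈ [17, 18], x ∉ repair.warrs) x hx))
  have r4 : ∀ x ∈ [0, 2], s4.reg x = s.reg x := fun x hx => (ha4.reg x
    ((by decide : ∀ x ∈ [0, 2], x ∉ repair.wregs) x hx)).trans
      (r3 x ((by decide : ∀ x ∈ [0, 2], x ∈ [0, 1, 2, 36]) x hx))
  have b4 : ∀ a ∈ [3, 14, 16], s4.arr a = (input n edges ds).arr a := fun a h => by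
    rw [ha4.arr a ((by decide : ∀ x ∈ [3, 14, 16], x ∉ repair.warrs) a h),
      b3 a ((by decide : ∀ x ∈ [3, 14, 16], x ∈ [0, 1, 3, 14, 16]) a h)]
  rcases hq with ⟨q1, q2, q3⟩ | ⟨q1, q2, q3, q4⟩
  · refine Does.ite (by omega) hs4 (by simp) (fun h => absurd q1 h) fun _ => ?_
    exact finish_does hds hE hs4 hW (by omega) hn hnN hfull htwos ((r4 0 (by simp)).trans h0)
      ((r4 2 (by simp)).trans h2) hsc4 htab4 q2 (fun e1 e2 => q3 (h7.trans e1) e2)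
      (fun i => by rw [b4 3 (by simp)]; rfl) (fun i => by rw [b4 14 (by simp)]; rfl)
      (fun i => by rw [b4 16 (by simp)]; rfl)
  · refine Does.ite (by omega) hs4 (by simp) (fun _ => ?_) fun h => absurd h q1
    exact reject_does (by omega) hs4 (by omega)
      (not_irregular_star hds hE (hc3 (h7.symm.trans q2)) q3 q4)

theorem mul_ne_zero_val {e₁ e₂ : Expr} {s : Store} :
    (e₁ * e₂).val s ≠ 0 ↔ e₁.val s ≠ 0 ∧ e₂.val s ≠ 0 := by
  rw [Expr.val_mul, Nat.mul_ne_zero_iff]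

theorem safe_mul_eq {W : ℕ} (hW : 1 < W) {e₁ e₂ e₃ e₄ : Expr} {s : Store} (h1 : e₁.Safe W s)
    (h2 : e₂.Safe W s) (h3 : e₃.Safe W s) (h4 : e₄.Safe W s) :
    ((e₁ =ₑ e₂) * (e₃ =ₑ e₄)).Safe W s := by
  refine ⟨⟨h1, h2, trivial⟩, ⟨h3, h4, trivial⟩, ?_⟩
  change (e₁ =ₑ e₂).val s * (e₃ =ₑ e₄).val s < W
  rw [Expr.val_eq, Expr.val_eq]
  split <;> split <;> omega

theorem main_does (hds : ∀ d ∈ ds, 2 ≤ d) (hG : G.Connected) (hE : IsEdgeList G edges)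
    (hs : (input n edges ds).Bounded W) (hW : 2 * n + 4 < W) (hmW : 2 * edges.length + 2 < W)
    (hNW : ds.prod * ds.prod + 2 * ds.prod + 4 < W) :
    Does W main (ds.prod * 2200 + edges.length * 340 + 10000) (input n edges ds)
      (IsAnswer G edges ds) := by
  have hn0 : 0 < n := by
    obtain ⟨v⟩ := hG.nonempty
    exact v.pos
  have hlen := length_lt_prod hds
  refine Does.mono (T := 4 + (4 + (ds.length * 200 + 40 + (4 + (10 + (10 + (ds.prod * 1600 +
    edges.length * 340 + ds.prod * 353 + 9000))))))) ?_ (by omega) fun _ _ _ h => h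
  refine Does.ite (by omega) hs (by simp; omega) (fun h => ?_) (fun h => ?_)
  · replace h : n = 1 := Expr.eq_ne_zero.1 h
    -- For n = 1 register `0` already holds the answer 1, and array `3`, filled with zeros,
    -- describes the zero labelling.
    refine Does.skip hs (by omega) (Or.inl ⟨h, fun _ => 0, ?_, fun i e _ => ?_⟩)
    · subst h
      exact Function.injective_of_subsingleton _
    · simp [input]
  replace h : n ≠ 1 := Expr.eq_eq_zero.1 h
  refine Does.ite (by omega) hs (by simp; omega) (fun h' => ?_) (fun h' => ?_)
  · replace h' : n = 2 := Expr.eq_ne_zero.1 h'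
    exact reject_does (by omega) hs (by omega) (not_irregular_two hE h')
  replace h' : n ≠ 2 := Expr.eq_eq_zero.1 h'
  refine Does.seq (scan_does hds hNW hs rfl (fun _ => rfl) ?_) fun s1 hs1 ha1 hsc => ?_
  · intro x hx hx'
    interval_cases x <;> rfl
  have r0 : s1.reg 0 = n := ha1.reg 0 (by decide)
  have r1 : s1.reg 1 = edges.length := ha1.reg 1 (by decide)
  have r2 : s1.reg 2 = ds.length := ha1.reg 2 (by decide)
  have r36 : s1.reg 36 = 0 := ha1.reg 36 (by decide)
  have r6 := hsc.counted.two
  rw [List.take_length] at r6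
  have harr : s1.arr = (input n edges ds).arr := funext fun a => ha1.arr a (by
    have : scan.warrs = [] := by decide
    rw [this]; simp)
  refine Does.ite (by omega) hs1 (by simp) (fun h1 => ?_) (fun h1 => ?_)
  · replace h1 := Expr.lt_ne_zero.1 h1
    rw [Expr.val_reg, Expr.val_reg, hsc.prod, r0] at h1
    exact reject_does (by omega) hs1 (by omega) (not_irregular_of_lt hds h1)
  replace h1 := Expr.lt_eq_zero.1 h1
  rw [Expr.val_reg, Expr.val_reg, hsc.prod, r0] at h1
  refine Does.ite (by omega) hs1 (safe_mul_eq (by omega) (by simp) (by simp) (by simp; omega)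
    (by simp; omega)) (fun h2 => ?_) (fun h2 => ?_)
  · rw [mul_ne_zero_val, Expr.eq_ne_zero, Expr.eq_ne_zero] at h2
    simp [r0, hsc.prod] at h2
    exact reject_does (by omega) hs1 (by omega) (not_irregular_full hds hE h2.2 h2.1)
  rw [← not_not (a := _ = 0), ← ne_eq, mul_ne_zero_val, Expr.eq_ne_zero, Expr.eq_ne_zero] at h2
  simp [r0, hsc.prod] at h2
  refine Does.ite (T := ds.prod * 1600 + edges.length * 340 + ds.prod * 353 + 9000) (by omega) hs1
    (safe_mul_eq (by omega) (by simp [r0]; omega) (by simp) (by simp)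
    (by simp)) (fun h3 => ?_) (fun h3 => ?_)
  · rw [mul_ne_zero_val, Expr.eq_ne_zero, Expr.eq_ne_zero] at h3
    simp [r0, hsc.prod, r6, r2] at h3
    exact reject_does (by omega) hs1 (by omega) (not_irregular_twos hds hE
      (fun d hd => (List.count_eq_length.1 h3.2 d hd).symm) h3.1 (by omega))
  rw [← not_not (a := _ = 0), ← ne_eq, mul_ne_zero_val, Expr.eq_ne_zero, Expr.eq_ne_zero] at h3
  simp [r0, hsc.prod, r6, r2] at h3
  exact (build_does hds hG hE hs1 hW hmW hNW (by omega) h1 (fun e1 e2 => h2 e2 e1)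
    (fun e1 e2 => h3 e2 e1) r0 r1 r2 r36 hsc harr).mono (by omega) fun _ _ _ h => h

theorem input_bounded (hds : ∀ d ∈ ds, 2 ≤ d) (hn : n < W) (hm : edges.length < W)
    (hN : ds.prod < W) : (input n edges ds).Bounded W := by
  have hlen := length_lt_prod hds
  constructor
  · intro x
    match x with
    | 0 => exact hn
    | 1 => exact hm
    | 2 => exact hlen.trans hN
    | _ + 3 => exact lt_of_le_of_lt (Nat.zero_le _) hn
  · have getD_lt : ∀ (l : List ℕ) (i : ℕ), (∀ x ∈ l, x < W) → l.getD i 0 < W := by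
      intro l i hl
      by_cases hi : i < l.length
      · rw [List.getD_eq_getElem _ _ hi]; exact hl _ (List.getElem_mem hi)
      · rw [List.getD_eq_default _ _ (by omega)]; omega
    intro a i
    match a with
    | 0 =>
      refine getD_lt _ i fun x hx => ?_
      obtain ⟨p, -, rfl⟩ := List.mem_map.1 hx
      exact p.1.2.trans hn
    | 1 =>
      refine getD_lt _ i fun x hx => ?_
      obtain ⟨p, -, rfl⟩ := List.mem_map.1 hx
      exact p.2.2.trans hn
    | 2 =>
      exact getD_lt _ i fun x hx => lt_of_le_of_lt
        (Nat.le_of_dvd (list_prod_pos hds) (List.dvd_prod hx)) hN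
    | _ + 3 => exact lt_of_le_of_lt (Nat.zero_le _) hn

end

end IrregularLabeling

theorem corollary4p2 :
    ∃ (P : IrregularLabeling.Prog) (C c : ℕ),
      ∀ (n : ℕ) (G : SimpleGraph (Fin n)) (edges : List (Fin n × Fin n)) (orders : List ℕ),
        G.Connected → IrregularLabeling.IsEdgeList G edges → (∀ d ∈ orders, IsPrimePow d) →
        ∀ W : ℕ,
          C * (G.edgeSet.ncard + Nat.card (IrregularLabeling.CyclicProduct orders)) ^ c ≤ W →
          ∃ (t : ℕ) (s : IrregularLabeling.Store),
            IrregularLabeling.Run W P (IrregularLabeling.input n edges orders) t s ∧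
            t ≤ C * (G.edgeSet.ncard + Nat.card (IrregularLabeling.CyclicProduct orders)) ∧
            IrregularLabeling.IsAnswer G edges orders s := by
  -- The exponent 2 comes from the table indices, which are below N * N. The constant exceeds the
  -- time bound 2200 N + 340 m + 10000, as N ≥ 1.
  refine ⟨IrregularLabeling.main, 20000, 2, fun n G edges ds hG hE hpp W hW => ?_⟩
  have hds : ∀ d ∈ ds, 2 ≤ d := fun d hd => (hpp d hd).two_le
  rw [IrregularLabeling.card_cyclicProduct, IrregularLabeling.ncard_edgeSet hE] at *
  -- Connectedness bounds the number of vertices, so n does not appear in the time bound.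
  have hn : n ≤ edges.length + 1 := by
    have := hG.card_vert_le_card_edgeSet_add_one
    rwa [Nat.card_coe_set_eq, IrregularLabeling.ncard_edgeSet hE, Nat.card_eq_fintype_card,
      Fintype.card_fin] at this
  have hN := IrregularLabeling.list_prod_pos hds
  generalize hm : edges.length = m at *
  generalize hNN : ds.prod = N at *
  have h1 : (m + N) ≤ (m + N) ^ 2 := Nat.le_self_pow (by norm_num) _
  have h2 : N * N ≤ (m + N) ^ 2 := by rw [pow_two]; exact Nat.mul_le_mul (by omega) (by omega)
  obtain ⟨t, s, hr, ht, -, -, ha⟩ := IrregularLabeling.main_does (W := W) hds hG hE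
    (IrregularLabeling.input_bounded hds (by omega) (by omega) (by omega)) (by omega) (by omega)
    (by rw [hNN]; omega)
  exact ⟨t, s, hr, by omega, ha⟩
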